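/- Let $V_1,V_2$ be real-valued functions, real-analytic near $x=0$, with $V_1(0)=V_2(0)=0$, $V_1'(0)>0$, $V_2'(0)>0$, and let $n\ge 1$ be the contact order at $0$: $V_1^{(k)}(0)=V_2^{(k)}(0)$ for $0\le k\le n-1$ and $V_1^{(n)}(0)\ne V_2^{(n)}(0)$. Put $$v_0:=\sqrt{V_1'(0)V_2'(0)},\qquad q_n:=\frac{V_1^{(n)}(0)-V_2^{(n)}(0)}{n!\,(V_1'(0)V_2'(0))^{1/4}},$$ and $\epsilon:=0$ if $n=1$, $\epsilon:=\frac12$ if $n=2$, $\epsilon:=\frac{3}{4n+3}$ if $n\ge3$. For real $y$ let $$\mathrm{Ai}(y)=\frac1{2\pi}\int_{\mathbb R}e^{i(\eta^3/3+y\eta)}\,d\eta,\qquad A_n(y)=\frac1{2\pi}\int_{\mathbb R}\exp\Big(i\int_0^\eta(y+\tau^2)^n\,d\tau\Big)d\eta$$ (improper integrals), and extend both to entire functions of $y\in\mathbb C$. For $j=1,2$ there is a function $\xi_j(x,E)$, analytic in a complex neighborhood of $(x,E)=(0,0)$, which for real $(x,E)$ near $(0,0)$ is given by $$\xi_j(x,E)=-\Big(\tfrac32\int_x^{a_j(E)}\sqrt{E-V_j(t)}\,dt\Big)^{2/3}\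 (x\le a_j(E)),\qquad \xi_j(x,E)=\Big(\tfrac32\int_{a_j(E)}^x\sqrt{V_j(t)-E}\,dt\Big)^{2/3}\ (x>a_j(E)),$$ where $a_j(E)$ is the unique root of $V_j(x)=E$ near $0$. Write $\xi_j'=\partial_x\xi_j$. There is $\delta>0$ such that for every real-valued $r_0\in C_c^\infty((-\delta,\delta))$ and every $L>0$ the integral $$\mathcal I(E,h):=-\frac{2\pi}{h^{1/3}}\int_{\mathbb R}\frac{r_0(x)}{\sqrt{\xi_1'(x,E)\,\xi_2'(x,E)}}\,\mathrm{Ai}\big(h^{-2/3}\xi_1(x,E)\big)\,\mathrm{Ai}\big(h^{-2/3}\xi_2(x,E)\big)\,dx$$ satisfies $$\mathcal I(E,h)=-\frac{2\pi r_0(0)}{\sqrt{v_0}}\Big(\frac h{|q_n|}\Big)^{\frac1{2n+1}}A_n\Big(-\Big(\frac{|q_n|}h\Big)^{\frac2{2n+1}}\frac E{v_0}\Big)+\mathcal O\big(h^{\frac{2-\epsilon}{2n+1}}\big)\qquad(h\to0^+),$$ uniformly for complex $E$ with $|\mathrm{Re}\,E|\le Lh^{\frac2{2n+1}}$ and $|\mathrm{Im}\,E|\le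 Lh$. -/

import Mathlib

open Complex Filter Topology MeasureTheory

noncomputable section

/-! ### The Airy function and its generalizations, as entire functions -/

/-- The phase `∫₀^η (y + τ²)ⁿ dτ`, integrated along the segment from `0` to the complex
number `η` (the integrand is a polynomial, so the path is irrelevant). -/
def genAiryPhase (n : ℕ) (y η : ℂ) : ℂ :=
  ∫ s in (0 : ℝ)..1, η * (y + ((s : ℂ) * η) ^ 2) ^ n

/-- The generalized Airy function `A_n(y) = (2π)⁻¹ ∫ exp (i ∫₀^η (y + τ²)ⁿ dτ) dη`, `n ≥ 1`,
for complex `y`.  The integral is taken over the line `Im η = 1`, where it converges absolutely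
for every `y ∈ ℂ`.  `tendsto_genAiry` shows that for real `y` the value is the (conditionally
convergent) integral over the real line; `differentiable_genAiry` shows that `A_n` is entire.
So this is the analytic continuation of the integral over `ℝ`. -/
def genAiry (n : ℕ) (y : ℂ) : ℂ :=
  (1 / (2 * (Real.pi : ℂ))) * ∫ t : ℝ, exp (I * genAiryPhase n y (t + I))

/-- The Airy function `Ai(y) = (2π)⁻¹ ∫ exp (i (η³/3 + y η)) dη` for complex `y`, with the same
line of integration; see `tendsto_airyAi` and `differentiable_airyAi`. -/
def airyAi (y : ℂ) : ℂ :=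
  (1 / (2 * (Real.pi : ℂ))) * ∫ t : ℝ, exp (I * (((t : ℂ) + I) ^ 3 / 3 + y * (t + I)))

theorem genAiryPhase_eq_sum (n : ℕ) (y η : ℂ) :
    genAiryPhase n y η = ∑ k ∈ Finset.range (n + 1),
      (n.choose k : ℂ) * y ^ (n - k) * (η ^ (2 * k + 1) / (2 * k + 1 : ℕ)) := by
  unfold genAiryPhase
  have h1 : ∀ s : ℝ, η * (y + ((s : ℂ) * η) ^ 2) ^ n = ∑ k ∈ Finset.range (n + 1),
      ((n.choose k : ℂ) * y ^ (n - k) * η ^ (2 * k + 1)) * ((s ^ (2 * k) : ℝ) : ℂ) := by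
    intro s
    rw [add_comm y, add_pow, Finset.mul_sum]
    refine Finset.sum_congr rfl fun k _ => ?_
    push_cast
    ring
  simp_rw [h1]
  rw [intervalIntegral.integral_finsetSum]
  · refine Finset.sum_congr rfl fun k _ => ?_
    rw [intervalIntegral.integral_const_mul, intervalIntegral.integral_ofReal, integral_pow]
    push_cast
    simp
    ring
  · intro k _
    apply Continuous.intervalIntegrable
    fun_prop

theorem genAiryPhase_ofReal (n : ℕ) (y η : ℝ) :
    genAiryPhase n y η = ((∫ τ in (0 : ℝ)..η, (y + τ ^ 2) ^ n : ℝ) : ℂ) := by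
  have h2 : (∫ τ in (0 : ℝ)..η, (y + τ ^ 2) ^ n) = ∑ k ∈ Finset.range (n + 1),
      (n.choose k : ℝ) * y ^ (n - k) * (η ^ (2 * k + 1) / (2 * k + 1 : ℕ)) := by
    have h1 : ∀ s : ℝ, (y + s ^ 2) ^ n = ∑ k ∈ Finset.range (n + 1),
        ((n.choose k : ℝ) * y ^ (n - k)) * (s ^ (2 * k)) := by
      intro s
      rw [add_comm y, add_pow]
      refine Finset.sum_congr rfl fun k _ => ?_
      ring
    simp_rw [h1]
    rw [intervalIntegral.integral_finsetSum]
    · refine Finset.sum_congr rfl fun k _ => ?_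
      rw [intervalIntegral.integral_const_mul, integral_pow]
      push_cast
      simp
    · intro k _
      apply Continuous.intervalIntegrable
      fun_prop
  rw [genAiryPhase_eq_sum, h2]
  push_cast
  rfl

theorem airyAi_eq_genAiry (y : ℂ) : airyAi y = genAiry 1 y := by
  unfold airyAi genAiry
  congr 2
  funext t
  rw [genAiryPhase_eq_sum]
  simp [Finset.sum_range_succ]
  ring_nf

theorem airy_pow_expand (m : ℕ) (t s : ℝ) (hs : 0 ≤ s) (hs1 : s ≤ 1) :
    ‖((t : ℂ) + s * I) ^ (m + 2) - (t : ℂ) ^ (m + 2) - (m + 2) * (t : ℂ) ^ (m + 1) * (s * I)‖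
      ≤ s * ((m + 2) ^ 2 * (1 + |t|) ^ m) := by
  have hz : ‖(t : ℂ) + s * I‖ ≤ 1 + |t| := by
    refine (norm_add_le _ _).trans ?_
    simp [abs_of_nonneg hs]
    linarith
  induction m with
  | zero =>
    have : ((t : ℂ) + s * I) ^ (0 + 2) - (t : ℂ) ^ (0 + 2)
        - ((0 : ℕ) + 2) * (t : ℂ) ^ (0 + 1) * (s * I) = -((s : ℂ) ^ 2) := by
      have := I_sq
      push_cast
      linear_combination (s : ℂ) ^ 2 * this
    rw [this]
    simp [abs_of_nonneg hs]
    nlinarith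
  | succ m ih =>
    have : ((t : ℂ) + s * I) ^ (m + 1 + 2) - (t : ℂ) ^ (m + 1 + 2)
        - ((m + 1 : ℕ) + 2) * (t : ℂ) ^ (m + 1 + 1) * (s * I)
        = ((t : ℂ) + s * I) * (((t : ℂ) + s * I) ^ (m + 2) - (t : ℂ) ^ (m + 2)
          - (m + 2) * (t : ℂ) ^ (m + 1) * (s * I)) + -((m + 2) * (s : ℂ) ^ 2 * (t : ℂ) ^ (m + 1)) := by
      have := I_sq
      push_cast
      linear_combination ((m + 2) * (s : ℂ) ^ 2 * (t : ℂ) ^ (m + 1)) * this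
    rw [this]
    have hu : 0 ≤ 1 + |t| := by positivity
    have h3 : ‖-(((m : ℂ) + 2) * (s : ℂ) ^ 2 * (t : ℂ) ^ (m + 1))‖
        ≤ s * ((m + 2) * (1 + |t|) ^ (m + 1)) := by
      have e : ‖((m : ℂ) + 2)‖ = (m : ℝ) + 2 := by
        have : ((m : ℂ) + 2) = ((m + 2 : ℕ) : ℂ) := by push_cast; rfl
        rw [this, Complex.norm_natCast]; push_cast; rfl
      rw [norm_neg, norm_mul, norm_mul, e, norm_pow, norm_pow, norm_real, norm_real,
        Real.norm_eq_abs, Real.norm_eq_abs, abs_of_nonneg hs]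
      have a1 : |t| ^ (m + 1) ≤ (1 + |t|) ^ (m + 1) :=
        pow_le_pow_left₀ (abs_nonneg t) (by linarith) _
      have a2 : s ^ 2 ≤ s := by nlinarith
      calc ((m : ℝ) + 2) * s ^ 2 * |t| ^ (m + 1) ≤ (m + 2) * s * (1 + |t|) ^ (m + 1) := by gcongr
        _ = _ := by ring
    calc _ ≤ ‖(t : ℂ) + s * I‖ * ‖((t : ℂ) + s * I) ^ (m + 2) - (t : ℂ) ^ (m + 2)
          - (m + 2) * (t : ℂ) ^ (m + 1) * (s * I)‖ + s * ((m + 2) * (1 + |t|) ^ (m + 1)) := by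
            refine (norm_add_le _ _).trans ?_
            rw [norm_mul]
            gcongr
      _ ≤ (1 + |t|) * (s * ((m + 2) ^ 2 * (1 + |t|) ^ m)) + s * ((m + 2) * (1 + |t|) ^ (m + 1)) := by
            gcongr
      _ = s * (((m + 2) ^ 2 + (m + 2)) * (1 + |t|) ^ (m + 1)) := by ring
      _ ≤ _ := by
            push_cast
            gcongr
            nlinarith [(Nat.cast_nonneg m : (0 : ℝ) ≤ m)]

theorem airy_top_im (p : ℕ) (t s : ℝ) (hs : 0 ≤ s) (hs1 : s ≤ 1) :
    s * (t ^ (2 * p + 2) - (2 * p + 3) * (1 + |t|) ^ (2 * p + 1)) ≤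
      (((t : ℂ) + s * I) ^ (2 * p + 3) / (2 * p + 3 : ℕ)).im := by
  have h := airy_pow_expand (2 * p + 1) t s hs hs1
  have h2 := (abs_im_le_norm _).trans h
  have e1 : (((2 * p + 1 : ℕ) + 2 : ℂ) * (t : ℂ) ^ (2 * p + 1 + 1) * (s * I)).im
      = (2 * p + 3) * t ^ (2 * p + 2) * s := by
    have : (((2 * p + 1 : ℕ) + 2 : ℂ) * (t : ℂ) ^ (2 * p + 1 + 1) * (s * I))
      = (((2 * p + 3) * t ^ (2 * p + 2) * s : ℝ) : ℂ) * I := by push_cast; ring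
    rw [this]; simp only [mul_I_im, ofReal_re]
  have e2 : ((t : ℂ) ^ (2 * p + 1 + 2)).im = 0 := by rw [← ofReal_pow, ofReal_im]
  rw [sub_im, sub_im, e1, e2] at h2
  have h3 := (abs_le.1 h2).1
  rw [div_natCast_im, le_div_iff₀ (by positivity)]
  push_cast at h3 ⊢
  have : (2 * p + 1 + 2) = 2 * p + 3 := rfl
  rw [this] at h3
  nlinarith

theorem airy_im_pow_le (m : ℕ) (t s : ℝ) (hs : 0 ≤ s) (hs1 : s ≤ 1) :
    |(((t : ℂ) + s * I) ^ (m + 1)).im| ≤ s * ((m + 1) * (1 + |t|) ^ m) := by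
  have hz : ‖(t : ℂ) + s * I‖ ≤ 1 + |t| := by
    refine (norm_add_le _ _).trans ?_
    simp [abs_of_nonneg hs]
    linarith
  induction m with
  | zero => simp [abs_of_nonneg hs]
  | succ m ih =>
    have hre : |(((t : ℂ) + s * I) ^ (m + 1)).re| ≤ (1 + |t|) ^ (m + 1) := by
      refine (abs_re_le_norm _).trans ?_
      rw [norm_pow]
      gcongr
    rw [pow_succ, mul_im]
    have e1 : ((t : ℂ) + s * I).im = s := by simp
    have e2 : ((t : ℂ) + s * I).re = t := by simp
    rw [e1, e2]
    refine (abs_add_le _ _).trans ?_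
    rw [abs_mul, abs_mul, abs_of_nonneg hs]
    calc _ ≤ (1 + |t|) ^ (m + 1) * s + (s * ((m + 1) * (1 + |t|) ^ m)) * (1 + |t|) := by
            gcongr
            linarith
      _ = _ := by push_cast; ring

theorem airy_lower_real (p : ℕ) (y : ℝ) : ∃ C : ℝ, 0 ≤ C ∧ ∀ t s : ℝ, 0 ≤ s → s ≤ 1 →
    s * (t ^ (2 * p + 2) - C * (1 + |t|) ^ (2 * p + 1)) ≤
      (genAiryPhase (p + 1) y (t + s * I)).im := by
  refine ⟨(∑ k ∈ Finset.range (p + 1), ((p + 1).choose k : ℝ) * |y| ^ (p + 1 - k)) + (2 * p + 3),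
    by positivity, fun t s hs hs1 => ?_⟩
  rw [genAiryPhase_eq_sum, Finset.sum_range_succ _ (p + 1), add_im]
  have htop := airy_top_im p t s hs hs1
  have e : (((p + 1).choose (p + 1) : ℂ) * (y : ℂ) ^ (p + 1 - (p + 1)) *
      (((t : ℂ) + s * I) ^ (2 * (p + 1) + 1) / (2 * (p + 1) + 1 : ℕ)))
      = ((t : ℂ) + s * I) ^ (2 * p + 3) / (2 * p + 3 : ℕ) := by
    simp [show 2 * (p + 1) + 1 = 2 * p + 3 by ring]
  rw [e, im_sum]
  have hlow : -(s * ((∑ k ∈ Finset.range (p + 1), ((p + 1).choose k : ℝ) * |y| ^ (p + 1 - k)) *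
      (1 + |t|) ^ (2 * p + 1))) ≤ ∑ k ∈ Finset.range (p + 1),
      (((p + 1).choose k : ℂ) * (y : ℂ) ^ (p + 1 - k) *
      (((t : ℂ) + s * I) ^ (2 * k + 1) / (2 * k + 1 : ℕ))).im := by
    rw [Finset.sum_mul, Finset.mul_sum, ← Finset.sum_neg_distrib]
    refine Finset.sum_le_sum fun k hk => ?_
    have hk' : k ≤ p := by simpa [Nat.lt_succ_iff] using hk
    have e2 : (((p + 1).choose k : ℂ) * (y : ℂ) ^ (p + 1 - k) *
      (((t : ℂ) + s * I) ^ (2 * k + 1) / (2 * k + 1 : ℕ))).im =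
      (((p + 1).choose k : ℝ) * y ^ (p + 1 - k)) *
        ((((t : ℂ) + s * I) ^ (2 * k + 1)).im / (2 * k + 1 : ℕ)) := by
      rw [← div_natCast_im, ← im_ofReal_mul]
      push_cast
      rfl
    rw [e2]
    refine (abs_le.1 ?_).1
    rw [abs_mul, abs_mul, abs_pow, Nat.abs_cast, abs_div, Nat.abs_cast]
    have h1 := airy_im_pow_le (2 * k) t s hs hs1
    have h2 : |(((t : ℂ) + s * I) ^ (2 * k + 1)).im| / (2 * k + 1 : ℕ) ≤
        s * (1 + |t|) ^ (2 * p + 1) := by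
      rw [div_le_iff₀ (by positivity)]
      refine h1.trans ?_
      have : (1 + |t|) ^ (2 * k) ≤ (1 + |t|) ^ (2 * p + 1) :=
        pow_le_pow_right₀ (by linarith [abs_nonneg t]) (by omega)
      push_cast
      calc _ ≤ s * ((2 * k + 1) * (1 + |t|) ^ (2 * p + 1)) := by gcongr
        _ = _ := by ring
    calc _ ≤ (((p + 1).choose k : ℝ) * |y| ^ (p + 1 - k)) * (s * (1 + |t|) ^ (2 * p + 1)) := by
          gcongr
      _ = _ := by ring
  linarith

theorem airy_lower_complex (p : ℕ) (M : ℝ) (hM : 0 ≤ M) : ∃ C : ℝ, 0 ≤ C ∧ ∀ y : ℂ, ‖y‖ ≤ M →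
    ∀ t : ℝ, t ^ (2 * p + 2) - C * (1 + |t|) ^ (2 * p + 1) ≤
      (genAiryPhase (p + 1) y (t + I)).im := by
  refine ⟨(∑ k ∈ Finset.range (p + 1), ((p + 1).choose k : ℝ) * M ^ (p + 1 - k)) + (2 * p + 3),
    by positivity, fun y hy t => ?_⟩
  rw [genAiryPhase_eq_sum, Finset.sum_range_succ _ (p + 1), add_im]
  have htop := airy_top_im p t 1 zero_le_one le_rfl
  simp only [ofReal_one, one_mul] at htop
  have e : (((p + 1).choose (p + 1) : ℂ) * (y : ℂ) ^ (p + 1 - (p + 1)) *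
      (((t : ℂ) + I) ^ (2 * (p + 1) + 1) / (2 * (p + 1) + 1 : ℕ)))
      = ((t : ℂ) + I) ^ (2 * p + 3) / (2 * p + 3 : ℕ) := by
    simp [show 2 * (p + 1) + 1 = 2 * p + 3 by ring]
  have hz : ‖(t : ℂ) + I‖ ≤ 1 + |t| := by
    refine (norm_add_le _ _).trans ?_
    simp
    linarith
  rw [e]
  have hlow : ‖∑ k ∈ Finset.range (p + 1), ((p + 1).choose k : ℂ) * (y : ℂ) ^ (p + 1 - k) *
      (((t : ℂ) + I) ^ (2 * k + 1) / (2 * k + 1 : ℕ))‖ ≤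
      (∑ k ∈ Finset.range (p + 1), ((p + 1).choose k : ℝ) * M ^ (p + 1 - k)) *
      (1 + |t|) ^ (2 * p + 1) := by
    rw [Finset.sum_mul]
    refine norm_sum_le_of_le _ fun k hk => ?_
    have hk' : k ≤ p := by simpa [Nat.lt_succ_iff] using hk
    rw [norm_mul, norm_mul, norm_div, norm_pow, norm_pow, Complex.norm_natCast, Complex.norm_natCast]
    have h1 : ‖(t : ℂ) + I‖ ^ (2 * k + 1) / (2 * k + 1 : ℕ) ≤ (1 + |t|) ^ (2 * p + 1) := by
      refine (div_le_self (by positivity) (by push_cast; linarith [(Nat.cast_nonneg k : (0:ℝ) ≤ k)])).trans ?_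
      calc _ ≤ (1 + |t|) ^ (2 * k + 1) := by gcongr
        _ ≤ _ := pow_le_pow_right₀ (by linarith [abs_nonneg t]) (by omega)
    gcongr
  have := (abs_le.1 ((abs_im_le_norm _).trans hlow)).1
  linarith

theorem airy_poly_lower (p : ℕ) (C : ℝ) (hC : 0 ≤ C) : ∃ K : ℝ, ∀ t : ℝ,
    (1 + |t|) - K ≤ t ^ (2 * p + 2) - C * (1 + |t|) ^ (2 * p + 1) := by
  set D : ℝ := C + (2 * p + 2) with hD
  have hD0 : 0 ≤ D := by positivity
  refine ⟨D * (D + 1) ^ (2 * p + 1) + (D + 1), fun t => ?_⟩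
  set u : ℝ := 1 + |t| with hu
  have hu1 : 1 ≤ u := by simp [hu]
  have hb : u ^ (2 * p + 2) - (2 * p + 2) * u ^ (2 * p + 1) ≤ t ^ (2 * p + 2) := by
    have h0 : (-2 : ℝ) ≤ -1 / u := by
      rw [le_div_iff₀ (by linarith)]; linarith
    have h1 := one_add_mul_le_pow h0 (2 * p + 2)
    have h2 : (1 + -1 / u) = |t| / u := by
      field_simp
      rw [hu]; ring
    rw [h2, div_pow, le_div_iff₀ (by positivity), Even.pow_abs ⟨p + 1, by ring⟩] at h1
    refine le_trans (le_of_eq ?_) h1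
    push_cast
    field_simp
    ring
  have h2 : u ^ (2 * p + 1) * (u - D) ≤ t ^ (2 * p + 2) - C * u ^ (2 * p + 1) := by
    refine le_trans (le_of_eq ?_) (sub_le_sub_right hb _)
    rw [hD]; ring
  refine le_trans ?_ h2
  rcases le_total u (D + 1) with h | h
  · have h3 : u ^ (2 * p + 1) ≤ (D + 1) ^ (2 * p + 1) := by gcongr
    have h4 : 0 ≤ u ^ (2 * p + 1) := by positivity
    nlinarith
  · have h3 : u ≤ u ^ (2 * p + 1) := le_self_pow₀ hu1 (by omega)
    have h4 : 0 ≤ D * (D + 1) ^ (2 * p + 1) := by positivity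
    nlinarith

theorem airy_exp_bound (K t : ℝ) :
    Real.exp (-((1 + |t|) - K)) ≤ (2 * Real.exp K) * (1 + t ^ 2)⁻¹ := by
  have h := Real.quadratic_le_exp_of_nonneg (show 0 ≤ 1 + |t| by positivity)
  have h2 : (1 + t ^ 2) / 2 ≤ Real.exp (1 + |t|) := by
    refine le_trans ?_ h
    nlinarith [abs_nonneg t, sq_abs t]
  rw [neg_sub, Real.exp_sub, ← div_eq_mul_inv]
  rw [div_le_div_iff₀ (Real.exp_pos _) (by positivity)]
  nlinarith [Real.exp_pos K]

theorem continuous_genAiryPhase (n : ℕ) (y : ℂ) : Continuous (genAiryPhase n y) := by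
  have : genAiryPhase n y = fun η => ∑ k ∈ Finset.range (n + 1),
      (n.choose k : ℂ) * y ^ (n - k) * (η ^ (2 * k + 1) / (2 * k + 1 : ℕ)) :=
    funext fun η => genAiryPhase_eq_sum n y η
  rw [this]
  fun_prop

theorem differentiable_genAiryPhase (n : ℕ) (y : ℂ) : Differentiable ℂ (genAiryPhase n y) := by
  have : genAiryPhase n y = fun η => ∑ k ∈ Finset.range (n + 1),
      (n.choose k : ℂ) * y ^ (n - k) * (η ^ (2 * k + 1) / (2 * k + 1 : ℕ)) :=
    funext fun η => genAiryPhase_eq_sum n y η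
  rw [this]
  fun_prop

theorem integrable_genAiry (n : ℕ) (hn : 1 ≤ n) (y : ℂ) :
    Integrable fun t : ℝ => exp (I * genAiryPhase n y (t + I)) := by
  obtain ⟨p, rfl⟩ : ∃ p, n = p + 1 := ⟨n - 1, by omega⟩
  obtain ⟨C, hC, h⟩ := airy_lower_complex p ‖y‖ (norm_nonneg y)
  obtain ⟨K, hK⟩ := airy_poly_lower p C hC
  refine (integrable_inv_one_add_sq.const_mul (2 * Real.exp K)).mono' ?_ ?_
  · have := continuous_genAiryPhase (p + 1) y
    exact Continuous.aestronglyMeasurable (by fun_prop)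
  · refine Eventually.of_forall fun t => ?_
    rw [norm_exp]
    refine le_trans (Real.exp_le_exp.2 ?_) (airy_exp_bound K t)
    have := (hK t).trans (h y le_rfl t)
    simp only [mul_re, I_re, I_im]
    linarith

/-- For real `y`, the shifted line integral is the improper integral over the real line. -/
theorem tendsto_genAiry (n : ℕ) (hn : 1 ≤ n) (y : ℝ) :
    Tendsto (fun R : ℝ × ℝ => (1 / (2 * (Real.pi : ℂ))) * ∫ η in (-R.1)..R.2,
      exp (I * ((∫ τ in (0 : ℝ)..η, (y + τ ^ 2) ^ n : ℝ) : ℂ)))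
      (atTop ×ˢ atTop) (𝓝 (genAiry n y)) := by
  obtain ⟨p, rfl⟩ : ∃ p, n = p + 1 := ⟨n - 1, by omega⟩
  obtain ⟨C, hC, hlow⟩ := airy_lower_real p y
  obtain ⟨K, hK⟩ := airy_poly_lower p C hC
  set f : ℂ → ℂ := fun η => exp (I * genAiryPhase (p + 1) y η) with hf
  have hfd : Differentiable ℂ f := by
    have := differentiable_genAiryPhase (p + 1) y
    fun_prop
  have hvert : ∀ t : ℝ, K < 1 + |t| →
      ‖∫ s in (0 : ℝ)..1, f (t + s * I)‖ ≤ 1 / ((1 + |t|) - K) := by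
    intro t ht
    set c : ℝ := (1 + |t|) - K with hc
    have hc0 : 0 < c := by linarith
    have hb : ∀ s ∈ Set.Ioc (0 : ℝ) 1, ‖f (t + s * I)‖ ≤ Real.exp (-c * s) := by
      intro s hs
      rw [hf, norm_exp]
      apply Real.exp_le_exp.2
      have h1 := hlow t s hs.1.le hs.2
      have h2 := mul_le_mul_of_nonneg_left (hK t) hs.1.le
      simp only [mul_re, I_re, I_im]
      linarith
    refine (intervalIntegral.norm_integral_le_of_norm_le zero_le_one
      (Eventually.of_forall hb) (Continuous.intervalIntegrable (by fun_prop) _ _)).trans ?_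
    have hint : (∫ s in (0 : ℝ)..1, Real.exp (-c * s)) = (1 - Real.exp (-c)) / c := by
      rw [intervalIntegral.integral_comp_mul_left (fun x => Real.exp x) (neg_ne_zero.2 hc0.ne'),
        integral_exp]
      simp
      field_simp
      ring
    rw [hint]
    gcongr
    linarith [Real.exp_pos (-c)]
  have hv0 : Tendsto (fun t : ℝ => ∫ s in (0 : ℝ)..1, f (t + s * I)) (cocompact ℝ) (𝓝 0) := by
    have habs : Tendsto (fun t : ℝ => (1 + |t|) - K) (cocompact ℝ) atTop := by
      have : Tendsto (fun t : ℝ => |t|) (cocompact ℝ) atTop := tendsto_norm_cocompact_atTop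
      exact tendsto_atTop_add_const_right _ _ (tendsto_atTop_add_const_left _ _ this)
    refine squeeze_zero_norm' (a := fun t : ℝ => 1 / ((1 + |t|) - K)) ?_ ?_
    · filter_upwards [habs.eventually_gt_atTop 0] with t ht
      exact hvert t (by linarith)
    · simp only [one_div]
      exact habs.inv_tendsto_atTop
  have hrect : ∀ R : ℝ × ℝ, (∫ η in (-R.1)..R.2, f η) =
      (∫ η in (-R.1)..R.2, f (η + I)) - I * (∫ s in (0 : ℝ)..1, f ((R.2 : ℝ) + s * I))
        + I * (∫ s in (0 : ℝ)..1, f ((-R.1 : ℝ) + s * I)) := by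
    intro R
    have := integral_boundary_rect_eq_zero_of_differentiableOn f (-R.1 : ℝ) ((R.2 : ℝ) + I)
      hfd.differentiableOn
    simp at this
    push_cast
    linear_combination this
  have h1 : Tendsto (fun R : ℝ × ℝ => -R.1) (atTop ×ˢ atTop : Filter (ℝ × ℝ)) atBot :=
    tendsto_neg_atTop_atBot.comp tendsto_fst
  have h2 : Tendsto (fun R : ℝ × ℝ => R.2) (atTop ×ˢ atTop : Filter (ℝ × ℝ)) atTop := tendsto_snd
  have hmain := intervalIntegral_tendsto_integral (integrable_genAiry (p + 1) hn y) h1 h2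
  have hR := hv0.comp (h2.mono_right atTop_le_cocompact)
  have hL := hv0.comp (h1.mono_right atBot_le_cocompact)
  have hsum := ((hmain.sub (hR.const_mul I)).add (hL.const_mul I)).const_mul
    (1 / (2 * (Real.pi : ℂ)))
  simp only [mul_zero, sub_zero, add_zero] at hsum
  refine hsum.congr fun R => ?_
  simp only [Function.comp_apply]
  rw [← hrect R]
  congr 1
  refine intervalIntegral.integral_congr fun η _ => ?_
  simp only [hf, genAiryPhase_ofReal]

theorem differentiable_genAiry (n : ℕ) (hn : 1 ≤ n) : Differentiable ℂ (genAiry n) := by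
  obtain ⟨p, rfl⟩ : ∃ p, n = p + 1 := ⟨n - 1, by omega⟩
  intro y₀
  refine DifferentiableAt.const_mul ?_ _
  set M : ℝ := ‖y₀‖ + 1 with hM
  have hM0 : 0 ≤ M := by positivity
  obtain ⟨C, hC, hlow⟩ := airy_lower_complex p M hM0
  set B : ℝ := ∑ k ∈ Finset.range (p + 1),
    ((p + 1).choose k : ℝ) * ((p + 1 - k : ℕ) * M ^ (p + 1 - k - 1)) with hB
  have hB0 : 0 ≤ B := by positivity
  obtain ⟨K, hK⟩ := airy_poly_lower p (C + 1) (by linarith)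
  set G : ℂ → ℂ → ℂ := fun y η => ∑ k ∈ Finset.range (p + 1 + 1),
      ((p + 1).choose k : ℂ) * (((p + 1 - k : ℕ) : ℂ) * y ^ (p + 1 - k - 1)) *
        (η ^ (2 * k + 1) / (2 * k + 1 : ℕ)) with hG
  have hder : ∀ y η : ℂ, HasDerivAt (fun y => genAiryPhase (p + 1) y η) (G y η) y := by
    intro y η
    have : (fun y => genAiryPhase (p + 1) y η) = fun y => ∑ k ∈ Finset.range (p + 1 + 1),
      ((p + 1).choose k : ℂ) * y ^ (p + 1 - k) * (η ^ (2 * k + 1) / (2 * k + 1 : ℕ)) :=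
      funext fun y => genAiryPhase_eq_sum _ _ _
    rw [this]
    refine HasDerivAt.fun_sum fun k _ => ?_
    exact ((hasDerivAt_pow _ y).const_mul _).mul_const _
  have hGb : ∀ y : ℂ, ‖y‖ ≤ M → ∀ t : ℝ, ‖G y (t + I)‖ ≤ B * (1 + |t|) ^ (2 * p + 1) := by
    intro y hy t
    have hz : ‖(t : ℂ) + I‖ ≤ 1 + |t| := by
      refine (norm_add_le _ _).trans ?_
      simp
      linarith
    rw [hG, hB]
    simp only
    rw [Finset.sum_range_succ, Finset.sum_mul]
    simp only [Nat.sub_self, Nat.cast_zero, zero_mul, mul_zero, add_zero]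
    refine norm_sum_le_of_le _ fun k hk => ?_
    have hk' : k ≤ p := by simpa [Nat.lt_succ_iff] using hk
    rw [norm_mul, norm_mul, norm_mul, norm_div, norm_pow, norm_pow, Complex.norm_natCast, Complex.norm_natCast,
      Complex.norm_natCast]
    have h1 : ‖(t : ℂ) + I‖ ^ (2 * k + 1) / (2 * k + 1 : ℕ) ≤ (1 + |t|) ^ (2 * p + 1) := by
      refine (div_le_self (by positivity)
        (by push_cast; linarith [(Nat.cast_nonneg k : (0:ℝ) ≤ k)])).trans ?_
      calc _ ≤ (1 + |t|) ^ (2 * k + 1) := by gcongr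
        _ ≤ _ := pow_le_pow_right₀ (by linarith [abs_nonneg t]) (by omega)
    gcongr
  refine (hasDerivAt_integral_of_dominated_loc_of_deriv_le (μ := volume)
    (F := fun y (t : ℝ) => exp (I * genAiryPhase (p + 1) y (t + I)))
    (F' := fun y (t : ℝ) => exp (I * genAiryPhase (p + 1) y (t + I)) * (I * G y (t + I)))
    (bound := fun t => B * ((2 * Real.exp K) * (1 + t ^ 2)⁻¹)) (Metric.ball_mem_nhds y₀ one_pos)
    ?_ (integrable_genAiry (p + 1) hn y₀) ?_ ?_ ?_ ?_).2.differentiableAt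
  · exact Eventually.of_forall fun y => (integrable_genAiry (p + 1) hn y).aestronglyMeasurable
  · have h1 := continuous_genAiryPhase (p + 1) y₀
    have h2 : Continuous (G y₀) := by rw [hG]; fun_prop
    exact Continuous.aestronglyMeasurable (by fun_prop)
  · refine Eventually.of_forall fun t y hy => ?_
    have hyM : ‖y‖ ≤ M := by
      have : ‖y - y₀‖ < 1 := by simpa [dist_eq_norm] using hy
      have := norm_le_norm_add_norm_sub' y y₀
      linarith
    rw [norm_mul, norm_mul, norm_I, one_mul, norm_exp]
    have h1 := hlow y hyM t
    have h2 : (I * genAiryPhase (p + 1) y (t + I)).re = -(genAiryPhase (p + 1) y (t + I)).im := by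
      simp
    rw [h2]
    set u : ℝ := (1 + |t|) ^ (2 * p + 1) with hu
    have hu0 : 0 ≤ u := by positivity
    have h3 : u ≤ Real.exp u := by linarith [Real.add_one_le_exp u]
    calc _ ≤ Real.exp (-(t ^ (2 * p + 2) - C * u)) * (B * Real.exp u) := by
            refine mul_le_mul (Real.exp_le_exp.2 (by linarith))
              ((hGb y hyM t).trans (by gcongr)) (norm_nonneg _) (Real.exp_pos _).le
      _ = B * Real.exp (-(t ^ (2 * p + 2) - (C + 1) * u)) := by
            rw [mul_left_comm, ← Real.exp_add]
            ring_nf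
      _ ≤ B * Real.exp (-((1 + |t|) - K)) := by
            exact mul_le_mul_of_nonneg_left (Real.exp_le_exp.2 (neg_le_neg (hK t))) hB0
      _ ≤ _ := by
            gcongr
            exact airy_exp_bound K t
  · exact (integrable_inv_one_add_sq.const_mul _).const_mul _
  · exact Eventually.of_forall fun t y _ => ((hder y (t + I)).const_mul I).cexp

/-- For real `y`, `airyAi y` is the improper integral over the real line. -/
theorem tendsto_airyAi (y : ℝ) :
    Tendsto (fun R : ℝ × ℝ => (1 / (2 * (Real.pi : ℂ))) * ∫ η in (-R.1)..R.2,
      exp (I * ((η : ℂ) ^ 3 / 3 + y * η))) (atTop ×ˢ atTop) (𝓝 (airyAi y)) := by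
  rw [airyAi_eq_genAiry]
  refine (tendsto_genAiry 1 le_rfl y).congr fun R => ?_
  congr 1
  refine intervalIntegral.integral_congr fun η _ => ?_
  rw [← genAiryPhase_ofReal, genAiryPhase_eq_sum]
  simp [Finset.sum_range_succ]
  ring_nf

theorem differentiable_airyAi : Differentiable ℂ airyAi := by
  have : airyAi = genAiry 1 := funext airyAi_eq_genAiry
  rw [this]
  exact differentiable_genAiry 1 le_rfl

/-! ### The Langer variable `ξ(x, E)` at a simple turning point -/

/-- For real `x`, `E` and a root `a` of `V(a) = E`:
`ξ = -((3/2) ∫ₓᵃ √(E - V))^{2/3}` for `x ≤ a` and `ξ = ((3/2) ∫ₐˣ √(V - E))^{2/3}` for `x > a`. -/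
def xiReal (V : ℝ → ℝ) (E a x : ℝ) : ℝ :=
  if x ≤ a then -(((3 / 2) * ∫ t in x..a, √(E - V t)) ^ (2 / 3 : ℝ))
  else ((3 / 2) * ∫ t in a..x, √(V t - E)) ^ (2 / 3 : ℝ)

/-- `ξ`, a function of `(x, E) ∈ ℂ²`, is analytic near `(0, 0)` and extends the function `xiReal`
of real `(x, E)` near `(0, 0)`, where `a` is the root of `V(a) = E` near `0`.
When `V` is analytic at `0` with `V(0) = 0 < V'(0)`, this determines the germ of `ξ` at `(0, 0)`. -/
structure IsXi (V : ℝ → ℝ) (ξ : ℂ × ℂ → ℂ) : Prop where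
  analytic : AnalyticAt ℂ ξ (0, 0)
  eq_real : ∃ ρ > 0, ∀ x E a : ℝ, |x| < ρ → |E| < ρ → |a| < ρ → V a = E →
    ξ ((x : ℂ), (E : ℂ)) = (xiReal V E a x : ℂ)

/-- The derivative `ξ'(x) = ∂ξ/∂x` at energy `E`. -/
def xiDeriv (ξ : ℂ × ℂ → ℂ) (E : ℂ) (x : ℝ) : ℂ :=
  deriv (fun z : ℂ => ξ (z, E)) (x : ℂ)

/-- `𝓘(E, h) = -2π h^{-1/3} ∫ r₀ (ξ₁' ξ₂')^{-1/2} Ai(h^{-2/3} ξ₁) Ai(h^{-2/3} ξ₂) dx`. -/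
def keyIntegral (r₀ : ℝ → ℝ) (ξ₁ ξ₂ : ℂ × ℂ → ℂ) (E : ℂ) (h : ℝ) : ℂ :=
  -((2 * Real.pi / h ^ (1 / 3 : ℝ) : ℝ) : ℂ) * ∫ x : ℝ,
    (r₀ x : ℂ) / (xiDeriv ξ₁ E x * xiDeriv ξ₂ E x) ^ (1 / 2 : ℂ)
      * airyAi (((h ^ (-(2 / 3) : ℝ) : ℝ) : ℂ) * ξ₁ ((x : ℂ), E))
      * airyAi (((h ^ (-(2 / 3) : ℝ) : ℝ) : ℂ) * ξ₂ ((x : ℂ), E))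

/-! ### Constants -/

/-- `v₀ = √(V₁'(0) V₂'(0))`. -/
def crossingSlope (V₁ V₂ : ℝ → ℝ) : ℝ := √(deriv V₁ 0 * deriv V₂ 0)

/-- `q_n = (V₁⁽ⁿ⁾(0) - V₂⁽ⁿ⁾(0)) / (n! (V₁'(0) V₂'(0))^{1/4})`. -/
def crossingCoeff (V₁ V₂ : ℝ → ℝ) (n : ℕ) : ℝ :=
  (iteratedDeriv n V₁ 0 - iteratedDeriv n V₂ 0) /
    (n.factorial * (deriv V₁ 0 * deriv V₂ 0) ^ (1 / 4 : ℝ))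

/-- The loss `ε` in the remainder: `0` for `n = 1`, `1/2` for `n = 2`, `3/(4n+3)` for `n ≥ 3`. -/
def errorLoss (n : ℕ) : ℝ :=
  if n = 1 then 0 else if n = 2 then 1 / 2 else 3 / (4 * n + 3)

end

/-! The mechanism is a passage to momentum space: there each Airy factor is an oscillatory integral
whose phase is linear in x, and the contact order reappears as the order of vanishing of a
difference of inverse functions.

Let U_j be the local inverse of V_j and S_j(η) = ∫₀^η U_j(E - τ²) dτ (`action`). The phase xη -
S_j(η) has derivative x - U_j(E - η²), so its critical points are the roots of η² = t with t = E -
V_j(x); they coalesce at the turning point. Writing the derivative as (η² - t) k(η²), the cubic N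
(η³/3 - tη) with the same critical values has N = `langerCoeff U_j t E`. The Langer variable is ξ_j
= -t N^{2/3}, and ξ_j' = N^{-1/3}. A homotopy from the cubic to the true phase,
`exists_norm_homotopy_le`, costs only O(h^{4/3}), because multiplying the integral by the square
root of the intermediate k at t makes the first-order variation divisible by the derivative of the
phase: one integration by parts then gains h, and the van der Corput bound gains h^{1/3}. Combined
with a localisation of the Airy integral (`exists_norm_airy_sub_le`) this gives
`IsChart.exists_airy_approx`: up to O(h^{4/3}), 2π h^{1/3} (ξ_j')^{-1/2} Ai(h^{-2/3} ξ_j) is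
√(U_j'(V_j(x))) ∫ χ(η) exp(i (xη - S_j(η)) / h) dη. This is uniform across the turning point, so
Airy asymptotics are never used.

In the product of two such integrals, with momenta η and ζ, integration in x against the smooth
weight f = r₀ √(U₁'∘V₁) √(U₂'∘V₂) produces the Fourier transform of f, which forces ζ = -η + O(h)
(`exists_norm_product_integral_sub_le`). Since S_j is odd, what remains is 2πh times ∫ χ(η) χ(-η)
f(U₂(E - η²)) exp(i (S₂ - S₁)(η) / h) dη. The derivative of S₂ - S₁ is (U₂ - U₁)(E - η²) = (E - η²)ⁿ
Ω(E - η²) with Ω(0) ≠ 0 (`exists_contact_factor`).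

Let a be of the size of h^{1/(2n+1)}, the natural scale of this degenerate phase. Replacing Ω by
Ω(0) and the amplitude by f(0) changes the integral by O(a²): directly for |η| ≤ a, and by
integration by parts beyond (`norm_integral_symbol_le`, `norm_integral_phase_change_le`). The model
integral that is left rescales to A_n (`tendsto_integral_modelPhase`).

Complex energies cost nothing: Im E = O(h) makes the imaginary part of every phase O(h), so the
exponentials stay bounded, and the difference between E and Re E is absorbed into amplitudes or into
a Lipschitz bound for A_n. The errors are O(h^{2/3}) from the Airy factors, O(h) from the
x-integration and O(h^{2/(2n+1)}) from the last step. As 2n + 1 ≥ 3, the total is O(h^{2/(2n+1)})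
for every n, and the stated remainder with its loss follows by weakening. -/

noncomputable section

/-! ### Integration by parts and the van der Corput bound -/

/-- The oscillating factor `exp (i z / h)`. -/
def osc (h : ℝ) (z : ℂ) : ℂ := exp (I * z / h)

theorem norm_osc (h : ℝ) (z : ℂ) : ‖osc h z‖ = Real.exp (-z.im / h) := by
  rw [osc, norm_exp, Complex.div_ofReal_re]
  simp

theorem norm_osc_le {h L : ℝ} (hh : 0 < h) {z : ℂ} (hz : |z.im| ≤ L * h) :
    ‖osc h z‖ ≤ Real.exp L := by
  rw [norm_osc]
  apply Real.exp_le_exp.2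
  rw [div_le_iff₀ hh]
  linarith [(abs_le.1 hz).1]

theorem continuous_osc (h : ℝ) : Continuous (osc h) := by
  unfold osc; fun_prop

theorem hasDerivAt_osc {h : ℝ} {F : ℝ → ℂ} {F' : ℂ} {x : ℝ} (hF : HasDerivAt F F' x) :
    HasDerivAt (fun x => osc h (F x)) (I / h * F' * osc h (F x)) x := by
  unfold osc
  have := (((hF.const_mul I).div_const (h : ℂ))).cexp
  convert this using 1
  ring

theorem osc_add (h : ℝ) (z w : ℂ) : osc h (z + w) = osc h z * osc h w := by
  unfold osc
  rw [← exp_add]; ring_nf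

theorem integral_ibp_osc {α β h : ℝ} (hh : h ≠ 0) {g g' F F' : ℝ → ℂ}
    (hg : ∀ x ∈ Set.uIcc α β, HasDerivAt g (g' x) x)
    (hF : ∀ x ∈ Set.uIcc α β, HasDerivAt F (F' x) x)
    (hg' : ContinuousOn g' (Set.uIcc α β)) (hF' : ContinuousOn F' (Set.uIcc α β)) :
    ∫ x in α..β, g x * F' x * osc h (F x) =
      h / I * (g β * osc h (F β) - g α * osc h (F α) - ∫ x in α..β, g' x * osc h (F x)) := by
  have hFc : ContinuousOn F (Set.uIcc α β) := fun x hx => (hF x hx).continuousAt.continuousWithinAt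
  have hoc : ContinuousOn (fun x => osc h (F x)) (Set.uIcc α β) :=
    (continuous_osc h).comp_continuousOn hFc
  have h1 := intervalIntegral.integral_mul_deriv_eq_deriv_mul (u := g)
    (v := fun x => osc h (F x)) (u' := g') (v' := fun x => I / h * F' x * osc h (F x))
    hg (fun x hx => hasDerivAt_osc (hF x hx)) hg'.intervalIntegrable
    (((continuousOn_const.mul hF').mul hoc).intervalIntegrable)
  have hh' : (h : ℂ) ≠ 0 := by exact_mod_cast hh
  rw [← h1, ← intervalIntegral.integral_const_mul]
  refine intervalIntegral.integral_congr fun x _ => ?_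
  field_simp

/-- The common form of every non-stationary-phase estimate below: with g the amplitude divided by
the phase derivative, one needs only end-point values of g and an integrable majorant of its
derivative. -/
theorem norm_integral_ibp_le {α β h B G P : ℝ} (hαβ : α ≤ β) (hh : 0 < h) (hB : 0 ≤ B)
    {g g' F F' : ℝ → ℂ} {p : ℝ → ℝ}
    (hg : ∀ x ∈ Set.Icc α β, HasDerivAt g (g' x) x)
    (hF : ∀ x ∈ Set.Icc α β, HasDerivAt F (F' x) x)
    (hg' : ContinuousOn g' (Set.Icc α β)) (hF' : ContinuousOn F' (Set.Icc α β))
    (hosc : ∀ x ∈ Set.Icc α β, ‖osc h (F x)‖ ≤ B)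
    (hα : ‖g α‖ ≤ G) (hβ : ‖g β‖ ≤ G) (hp : ∀ x ∈ Set.Icc α β, ‖g' x‖ ≤ p x)
    (hpc : ContinuousOn p (Set.Icc α β)) (hP : ∫ x in α..β, p x ≤ P) :
    ‖∫ x in α..β, g x * F' x * osc h (F x)‖ ≤ h * B * (2 * G + P) := by
  have hu := Set.uIcc_of_le hαβ
  rw [integral_ibp_osc hh.ne' (by rwa [hu]) (by rwa [hu]) (by rwa [hu]) (by rwa [hu]), norm_mul]
  have e1 : ‖(h : ℂ) / I‖ = h := by simp [abs_of_pos hh]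
  rw [e1, mul_assoc]
  refine mul_le_mul_of_nonneg_left ?_ hh.le
  have i1 : ‖∫ x in α..β, g' x * osc h (F x)‖ ≤ B * P := by
    refine (intervalIntegral.norm_integral_le_of_norm_le (g := fun x => B * p x) hαβ
      (Eventually.of_forall fun x hx => ?_) ?_).trans ?_
    · have hx' : x ∈ Set.Icc α β := ⟨hx.1.le, hx.2⟩
      rw [norm_mul, mul_comm]
      exact mul_le_mul (hosc x hx') (hp x hx') (norm_nonneg _) hB
    · exact (ContinuousOn.intervalIntegrable (by rw [hu]; exact continuousOn_const.mul hpc))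
    · rw [intervalIntegral.integral_const_mul]
      exact mul_le_mul_of_nonneg_left hP hB
  have hm1 : α ∈ Set.Icc α β := ⟨le_rfl, hαβ⟩
  have hm2 : β ∈ Set.Icc α β := ⟨hαβ, le_rfl⟩
  have hG : 0 ≤ G := (norm_nonneg _).trans hα
  have i2 : ‖g β * osc h (F β)‖ ≤ G * B := by
    rw [norm_mul]; exact mul_le_mul hβ (hosc _ hm2) (norm_nonneg _) hG
  have i3 : ‖g α * osc h (F α)‖ ≤ G * B := by
    rw [norm_mul]; exact mul_le_mul hα (hosc _ hm1) (norm_nonneg _) hG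
  have := norm_sub_le (g β * osc h (F β) - g α * osc h (F α)) (∫ x in α..β, g' x * osc h (F x))
  have := norm_sub_le (g β * osc h (F β)) (g α * osc h (F α))
  nlinarith

/-- One-sided part of the van der Corput bound: away from the critical point. -/
theorem norm_osc_integral_outer_le {c K B a h r s l σ α β : ℝ} {t : ℂ}
    {F k k' A A' : ℝ → ℂ}
    (hc : 0 < c) (hK : 0 ≤ K) (hB : 0 ≤ B) (ha : 0 ≤ a) (hh : 0 < h) (hl : 0 < l)
    (hσ : σ ^ 2 = 1) (hα : 0 ≤ α) (hαβ : α ≤ β) (hβ : β ≤ r)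
    (hs : ∀ η, 0 ≤ η → |η - s| ^ 2 ≤ |η ^ 2 - t.re| ∧ |η - s| * η ≤ |η ^ 2 - t.re|)
    (hd1 : ∀ η ∈ Set.Icc α β, |η - s| ≤ 1)
    (hsep : ∀ η ∈ Set.Icc α β, l ≤ σ * (η - s))
    (hF : ∀ x ∈ Set.Icc 0 r, HasDerivAt F (((x : ℂ) ^ 2 - t) * k x) x)
    (hk : ∀ x ∈ Set.Icc 0 r, HasDerivAt k (k' x) x) (hk'c : ContinuousOn k' (Set.Icc 0 r))
    (hA : ∀ x ∈ Set.Icc 0 r, HasDerivAt A (A' x) x) (hA'c : ContinuousOn A' (Set.Icc 0 r))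
    (hkc : ∀ x ∈ Set.Icc 0 r, c ≤ ‖k x‖) (hkK : ∀ x ∈ Set.Icc 0 r, ‖k x‖ ≤ K)
    (hk'K : ∀ x ∈ Set.Icc 0 r, ‖k' x‖ ≤ K) (hAa : ∀ x ∈ Set.Icc 0 r, ‖A x‖ ≤ a)
    (hA'a : ∀ x ∈ Set.Icc 0 r, ‖A' x‖ ≤ a)
    (hosc : ∀ x ∈ Set.Icc 0 r, ‖osc h (F x)‖ ≤ B) :
    ‖∫ x in α..β, A x * osc h (F x)‖ ≤
      h * B * (2 * (a / c) + (a / c + 3 * (a * K) / c ^ 2)) / l ^ 2 := by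
  have hsub : Set.Icc α β ⊆ Set.Icc 0 r := Set.Icc_subset_Icc hα hβ
  have habs : ∀ η ∈ Set.Icc α β, |η - s| = σ * (η - s) := by
    intro η hη
    have h1 := hsep η hη
    have h2 : 0 ≤ σ * (η - s) := hl.le.trans h1
    rw [← abs_of_nonneg h2, abs_mul, show |σ| = 1 from by
      rw [← Real.sqrt_sq_eq_abs, hσ, Real.sqrt_one], one_mul]
  have hre : ∀ η : ℝ, |η ^ 2 - t.re| ≤ ‖(η : ℂ) ^ 2 - t‖ := by
    intro η
    have : ((η : ℂ) ^ 2 - t).re = η ^ 2 - t.re := by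
      rw [sub_re, ← ofReal_pow, ofReal_re]
    rw [← this]
    exact abs_re_le_norm _
  have hdpos : ∀ η ∈ Set.Icc α β, 0 < |η - s| := fun η hη => by
    rw [habs η hη]; exact hl.trans_le (hsep η hη)
  have hq1 : ∀ η ∈ Set.Icc α β, |η - s| ^ 2 ≤ ‖(η : ℂ) ^ 2 - t‖ := fun η hη =>
    (hs η (hα.trans hη.1)).1.trans (hre η)
  have hq2 : ∀ η ∈ Set.Icc α β, |η - s| * η ≤ ‖(η : ℂ) ^ 2 - t‖ := fun η hη =>
    (hs η (hα.trans hη.1)).2.trans (hre η)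
  have hq0 : ∀ η ∈ Set.Icc α β, (η : ℂ) ^ 2 - t ≠ 0 := fun η hη => by
    have := hq1 η hη
    have h2 := pow_pos (hdpos η hη) 2
    exact norm_pos_iff.1 (h2.trans_le this)
  have hk0 : ∀ η ∈ Set.Icc α β, k η ≠ 0 := fun η hη =>
    norm_pos_iff.1 (hc.trans_le (hkc η (hsub hη)))
  set F' : ℝ → ℂ := fun x => ((x : ℂ) ^ 2 - t) * k x with hF'
  set F'' : ℝ → ℂ := fun x => 2 * (x : ℂ) * k x + ((x : ℂ) ^ 2 - t) * k' x with hF''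
  have hF'd : ∀ x ∈ Set.Icc α β, HasDerivAt F' (F'' x) x := by
    intro x hx
    have h1 : HasDerivAt (fun x : ℝ => ((x : ℂ) ^ 2 - t)) (2 * (x : ℂ)) x := by
      have := ((hasDerivAt_id x).ofReal_comp.pow 2).sub_const t
      simpa using this
    exact h1.mul (hk x (hsub hx))
  have hF'0 : ∀ x ∈ Set.Icc α β, F' x ≠ 0 := fun x hx => mul_ne_zero (hq0 x hx) (hk0 x hx)
  set g : ℝ → ℂ := fun x => A x / F' x with hgdef
  set g' : ℝ → ℂ := fun x => (A' x * F' x - A x * F'' x) / F' x ^ 2 with hg'def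
  have hg : ∀ x ∈ Set.Icc α β, HasDerivAt g (g' x) x := fun x hx =>
    (hA x (hsub hx)).div (hF'd x hx) (hF'0 x hx)
  have hkcont : ContinuousOn k (Set.Icc α β) := fun x hx =>
    (hk x (hsub hx)).continuousAt.continuousWithinAt
  have hAcont : ContinuousOn A (Set.Icc α β) := fun x hx =>
    (hA x (hsub hx)).continuousAt.continuousWithinAt
  have hF'cont : ContinuousOn F' (Set.Icc α β) := by
    have : ContinuousOn (fun x : ℝ => ((x : ℂ) ^ 2 - t)) (Set.Icc α β) := by fun_prop
    exact this.mul hkcont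
  have hF''cont : ContinuousOn F'' (Set.Icc α β) := by
    have h1 : ContinuousOn (fun x : ℝ => ((x : ℂ) ^ 2 - t)) (Set.Icc α β) := by fun_prop
    have h2 : ContinuousOn (fun x : ℝ => 2 * (x : ℂ)) (Set.Icc α β) := by fun_prop
    exact (h2.mul hkcont).add (h1.mul (hk'c.mono hsub))
  have hg'cont : ContinuousOn g' (Set.Icc α β) :=
    (((hA'c.mono hsub).mul hF'cont).sub (hAcont.mul hF''cont)).div (hF'cont.pow 2)
      fun x hx => pow_ne_zero 2 (hF'0 x hx)
  have hF'low : ∀ x ∈ Set.Icc α β, c * |x - s| ^ 2 ≤ ‖F' x‖ := by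
    intro x hx
    rw [hF']; simp only
    rw [norm_mul, mul_comm]
    exact mul_le_mul (hq1 x hx) (hkc x (hsub hx)) hc.le (norm_nonneg _)
  have hld : ∀ x ∈ Set.Icc α β, l ≤ |x - s| := fun x hx => by rw [habs x hx]; exact hsep x hx
  have hgb : ∀ x ∈ Set.Icc α β, ‖g x‖ ≤ a / c / l ^ 2 := by
    intro x hx
    have h1 := hF'low x hx
    rw [hgdef]; simp only
    rw [norm_div, div_div]
    have hl2 : l ^ 2 ≤ |x - s| ^ 2 := pow_le_pow_left₀ hl.le (hld x hx) 2
    exact div_le_div₀ ha (hAa x (hsub hx)) (by positivity)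
      ((mul_le_mul_of_nonneg_left hl2 hc.le).trans h1)
  set C1 : ℝ := a / c + 3 * (a * K) / c ^ 2 with hC1
  have hC1' : 0 ≤ C1 := by positivity
  have hg'b : ∀ x ∈ Set.Icc α β, ‖g' x‖ ≤ C1 * (σ * (x - s)) ^ (-3 : ℤ) := by
    intro x hx
    rw [← habs x hx]
    set d := |x - s| with hd
    have hd0 : 0 < d := hdpos x hx
    have hdle : d ≤ 1 := hd1 x hx
    have hx0 : 0 ≤ x := hα.trans hx.1
    set Q := ‖(x : ℂ) ^ 2 - t‖ with hQ
    have hQ1 : d ^ 2 ≤ Q := hq1 x hx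
    have hQ2 : d * x ≤ Q := hq2 x hx
    have hQ0 : 0 < Q := (pow_pos hd0 2).trans_le hQ1
    have hkx := hkc x (hsub hx)
    have hkx0 : 0 < ‖k x‖ := hc.trans_le hkx
    -- The middle term comes from differentiating x² - t and is the dangerous one; the other two are
    -- at most of order d⁻², which is below d⁻³ because d ≤ 1.
    have e1 : g' x = A' x / F' x - A x * (2 * (x : ℂ)) / (((x : ℂ) ^ 2 - t) ^ 2 * k x) -
        A x * k' x / (((x : ℂ) ^ 2 - t) * k x ^ 2) := by
      have := hq0 x hx
      have := hk0 x hx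
      simp only [hg'def, hF', hF'']
      field_simp
      ring
    have b1 : ‖A' x / F' x‖ ≤ a / c * d ^ (-3 : ℤ) := by
      rw [norm_div, zpow_neg, ← div_eq_mul_inv, div_div]
      refine div_le_div₀ ha (hA'a x (hsub hx)) (by positivity) (le_trans ?_ (hF'low x hx))
      have : d ^ (3 : ℤ) ≤ d ^ 2 := by
        have : d ^ (3 : ℤ) = d ^ 2 * d := by norm_cast
        rw [this]; nlinarith [sq_nonneg d]
      exact mul_le_mul_of_nonneg_left this hc.le
    have b2 : ‖A x * (2 * (x : ℂ)) / (((x : ℂ) ^ 2 - t) ^ 2 * k x)‖ ≤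
        2 * (a * K) / c ^ 2 * d ^ (-3 : ℤ) := by
      rw [norm_div, norm_mul, norm_mul, norm_mul, norm_pow, ← hQ, norm_real, Real.norm_eq_abs,
        abs_of_nonneg hx0, Complex.norm_ofNat, zpow_neg, ← div_eq_mul_inv, div_div,
        div_le_div_iff₀ (by positivity) (by positivity)]
      have hd3 : d ^ (3 : ℤ) = d ^ 2 * d := by norm_cast
      rw [hd3]
      have hAx := hAa x (hsub hx)
      have hkK' := hkK x (hsub hx)
      -- One factor Q is bounded below by d² and the other by d x. The factor x from differentiating
      -- x² is thus absorbed, uniformly in t.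
      have hQx : x * (d ^ 2 * d) ≤ Q ^ 2 := by nlinarith
      have h3 : c ^ 2 ≤ K * ‖k x‖ := by nlinarith
      calc ‖A x‖ * (2 * x) * (c ^ 2 * (d ^ 2 * d)) = 2 * ‖A x‖ * c ^ 2 * (x * (d ^ 2 * d)) := by ring
        _ ≤ 2 * a * (K * ‖k x‖) * Q ^ 2 := by gcongr
        _ = _ := by ring
    have b3 : ‖A x * k' x / (((x : ℂ) ^ 2 - t) * k x ^ 2)‖ ≤ (a * K) / c ^ 2 * d ^ (-3 : ℤ) := by
      rw [norm_div, norm_mul, norm_mul, norm_pow, ← hQ, zpow_neg, ← div_eq_mul_inv, div_div]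
      have hd3 : d ^ (3 : ℤ) = d ^ 2 * d := by norm_cast
      rw [hd3]
      refine div_le_div₀ (by positivity)
        (mul_le_mul (hAa x (hsub hx)) (hk'K x (hsub hx)) (norm_nonneg _) ha) (by positivity) ?_
      rw [mul_comm]
      refine mul_le_mul (le_trans ?_ hQ1) (pow_le_pow_left₀ hc.le hkx 2) (by positivity) hQ0.le
      nlinarith [sq_nonneg d]
    rw [e1, hC1]
    refine (norm_sub_le _ _).trans ((add_le_add ((norm_sub_le _ _).trans (add_le_add b1 b2)) b3).trans
      (le_of_eq ?_))
    ring
  have hpne : ∀ x ∈ Set.Icc α β, σ * (x - s) ≠ 0 := fun x hx => (hl.trans_le (hsep x hx)).ne'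
  have hpc : ContinuousOn (fun x : ℝ => C1 * (σ * (x - s)) ^ (-3 : ℤ)) (Set.Icc α β) := by
    refine continuousOn_const.mul (ContinuousOn.zpow₀ (by fun_prop) _ fun x hx => Or.inl (hpne x hx))
  have hIntegral : ∫ x in α..β, C1 * (σ * (x - s)) ^ (-3 : ℤ) ≤ C1 / l ^ 2 := by
    have hder : ∀ x ∈ Set.uIcc α β, HasDerivAt (fun x : ℝ => -(σ * C1 / 2) * (σ * (x - s)) ^ (-2 : ℤ))
        (C1 * (σ * (x - s)) ^ (-3 : ℤ)) x := by
      intro x hx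
      rw [Set.uIcc_of_le hαβ] at hx
      have h1 : HasDerivAt (fun x : ℝ => σ * (x - s)) (σ * 1) x :=
        ((hasDerivAt_id x).sub_const s).const_mul σ
      have h2 := ((hasDerivAt_zpow (-2) _ (Or.inl (hpne x hx))).comp x h1).const_mul (-(σ * C1 / 2))
      refine h2.congr_deriv ?_
      have : (-2 - 1 : ℤ) = -3 := by norm_num
      rw [this]
      push_cast
      linear_combination (C1 * (σ * (x - s)) ^ (-3 : ℤ)) * hσ
    rw [intervalIntegral.integral_eq_sub_of_hasDerivAt hder
      (ContinuousOn.intervalIntegrable (by rw [Set.uIcc_of_le hαβ]; exact hpc))]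
    have hb : ∀ x ∈ Set.Icc α β, |(-(σ * C1 / 2) * (σ * (x - s)) ^ (-2 : ℤ))| ≤ C1 / 2 / l ^ 2 := by
      intro x hx
      have hσ1 : |σ| = 1 := by rw [← Real.sqrt_sq_eq_abs, hσ, Real.sqrt_one]
      rw [abs_mul, abs_neg, abs_div, abs_mul, hσ1, one_mul, abs_of_nonneg hC1', abs_two, zpow_neg]
      have h1 := hsep x hx
      have h2 : l ^ 2 ≤ (σ * (x - s)) ^ 2 := pow_le_pow_left₀ hl.le h1 2
      have h3 : |((σ * (x - s)) ^ (2 : ℤ))⁻¹| ≤ (l ^ 2)⁻¹ := by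
        rw [abs_inv, abs_of_nonneg (by positivity)]
        exact inv_anti₀ (by positivity) (by exact_mod_cast h2)
      calc _ ≤ C1 / 2 * (l ^ 2)⁻¹ := by gcongr
        _ = _ := (div_eq_mul_inv _ _).symm
    have h1 := (abs_le.1 (hb β ⟨hαβ, le_rfl⟩)).2
    have h2 := (abs_le.1 (hb α ⟨le_rfl, hαβ⟩)).1
    have : C1 / l ^ 2 = C1 / 2 / l ^ 2 + C1 / 2 / l ^ 2 := by ring
    linarith
  have hmain := norm_integral_ibp_le (F := F) (F' := F') (g := g) hαβ hh hB hg
    (fun x hx => hF x (hsub hx)) hg'cont hF'cont (fun x hx => hosc x (hsub hx))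
    (hgb α ⟨le_rfl, hαβ⟩) (hgb β ⟨hαβ, le_rfl⟩) hg'b hpc hIntegral
  have hcongr : ∫ x in α..β, A x * osc h (F x) = ∫ x in α..β, g x * F' x * osc h (F x) := by
    refine intervalIntegral.integral_congr fun x hx => ?_
    rw [Set.uIcc_of_le hαβ] at hx
    simp only [hgdef]
    rw [div_mul_cancel₀ _ (hF'0 x hx)]
  rw [hcongr]
  refine hmain.trans (le_of_eq ?_)
  ring

/-- The constant in the van der Corput bound. -/
def vdcConst (c K B a : ℝ) : ℝ := 2 * (B * (2 * (a / c) + (a / c + 3 * (a * K) / c ^ 2))) + 2 * (a * B)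

theorem vdcConst_nonneg {c K B a : ℝ} (hc : 0 < c) (hK : 0 ≤ K) (hB : 0 ≤ B) (ha : 0 ≤ a) :
    0 ≤ vdcConst c K B a := by
  unfold vdcConst; positivity

/-- For η ≥ 0 the distance to the critical point is controlled uniformly in t by |η² - t| ≥ (η -
s)², where s = √max(Re t, 0). Off the window |η - s| ≤ l integration by parts gives h / l², and the
window itself contributes at most its length; l = h^{1/3} balances the two. -/
theorem norm_osc_integral_half_le {c K B a h r : ℝ} {t : ℂ} {F k k' A A' : ℝ → ℂ}
    (hc : 0 < c) (hK : 0 ≤ K) (hB : 0 ≤ B) (ha : 0 ≤ a) (hh : 0 < h) (hr0 : 0 ≤ r) (hr1 : r ≤ 1)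
    (ht : t.re ≤ 1)
    (hF : ∀ x ∈ Set.Icc 0 r, HasDerivAt F (((x : ℂ) ^ 2 - t) * k x) x)
    (hk : ∀ x ∈ Set.Icc 0 r, HasDerivAt k (k' x) x) (hk'c : ContinuousOn k' (Set.Icc 0 r))
    (hA : ∀ x ∈ Set.Icc 0 r, HasDerivAt A (A' x) x) (hA'c : ContinuousOn A' (Set.Icc 0 r))
    (hkc : ∀ x ∈ Set.Icc 0 r, c ≤ ‖k x‖) (hkK : ∀ x ∈ Set.Icc 0 r, ‖k x‖ ≤ K)
    (hk'K : ∀ x ∈ Set.Icc 0 r, ‖k' x‖ ≤ K) (hAa : ∀ x ∈ Set.Icc 0 r, ‖A x‖ ≤ a)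
    (hA'a : ∀ x ∈ Set.Icc 0 r, ‖A' x‖ ≤ a)
    (hosc : ∀ x ∈ Set.Icc 0 r, ‖osc h (F x)‖ ≤ B) :
    ‖∫ x in (0 : ℝ)..r, A x * osc h (F x)‖ ≤ vdcConst c K B a * h ^ (1 / 3 : ℝ) := by
  set s : ℝ := √(max t.re 0) with hsdef
  have hs0 : 0 ≤ s := Real.sqrt_nonneg _
  have hs1 : s ≤ 1 := by
    exact Real.sqrt_le_iff.2 ⟨zero_le_one, by simpa using ht⟩
  have hs2 : s ^ 2 = max t.re 0 := Real.sq_sqrt (le_max_right _ _)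
  set l : ℝ := h ^ (1 / 3 : ℝ) with hl
  have hl0 : 0 < l := Real.rpow_pos_of_pos hh _
  have hl3 : l ^ 3 = h := by
    rw [hl, ← Real.rpow_natCast, ← Real.rpow_mul hh.le]; norm_num
  have hs : ∀ η, 0 ≤ η → |η - s| ^ 2 ≤ |η ^ 2 - t.re| ∧ |η - s| * η ≤ |η ^ 2 - t.re| := by
    intro η hη
    rcases le_total 0 t.re with h0 | h0
    · rw [max_eq_left h0] at hs2
      have : η ^ 2 - t.re = (η - s) * (η + s) := by rw [← hs2]; ring
      rw [this, abs_mul, abs_of_nonneg (show 0 ≤ η + s by linarith)]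
      have h1 : |η - s| ≤ η + s := abs_le.2 ⟨by linarith, by linarith⟩
      constructor
      · rw [pow_two]; exact mul_le_mul_of_nonneg_left h1 (abs_nonneg _)
      · exact mul_le_mul_of_nonneg_left (by linarith) (abs_nonneg _)
    · rw [max_eq_right h0] at hs2
      have : s = 0 := by simpa using hs2
      rw [this, sub_zero, abs_of_nonneg hη, abs_of_nonneg (by nlinarith)]
      constructor <;> nlinarith
  have hd1 : ∀ η ∈ Set.Icc 0 r, |η - s| ≤ 1 := fun η hη =>
    abs_le.2 ⟨by linarith [hη.1], by linarith [hη.2]⟩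
  have hcont : ContinuousOn (fun x => A x * osc h (F x)) (Set.Icc 0 r) := by
    refine ContinuousOn.mul (fun x hx => (hA x hx).continuousAt.continuousWithinAt)
      ((continuous_osc h).comp_continuousOn fun x hx => (hF x hx).continuousAt.continuousWithinAt)
  have hii : ∀ α β : ℝ, 0 ≤ α → α ≤ β → β ≤ r →
      IntervalIntegrable (fun x => A x * osc h (F x)) volume α β := fun α β h1 h2 h3 =>
    (hcont.mono (by rw [Set.uIcc_of_le h2]; exact Set.Icc_subset_Icc h1 h3)).intervalIntegrable
  -- The window [s - l, s + l] clamped to [0, r]. It may be empty or touch an end, in which case one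
  -- of the outer integrals is over a point.
  set α₁ := max 0 (min r (s - l)) with hα₁
  set β₁ := min r (s + l) with hβ₁
  have o1 : 0 ≤ α₁ := le_max_left _ _
  have o2 : α₁ ≤ β₁ := by
    refine max_le (le_min hr0 (by linarith)) (le_min (min_le_left _ _) ((min_le_right _ _).trans ?_))
    linarith
  have o3 : β₁ ≤ r := min_le_left _ _
  have o4 : β₁ - α₁ ≤ 2 * l := by
    rcases le_total r (s - l) with h1 | h1
    · have : α₁ = r := by rw [hα₁, min_eq_left h1, max_eq_right hr0]
      linarith
    · have : s - l ≤ α₁ := by rw [hα₁, min_eq_right h1]; exact le_max_right _ _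
      have : β₁ ≤ s + l := min_le_right _ _
      linarith
  set D : ℝ := B * (2 * (a / c) + (a / c + 3 * (a * K) / c ^ 2)) with hD
  have hD0 : 0 ≤ D := by positivity
  have hout : h * B * (2 * (a / c) + (a / c + 3 * (a * K) / c ^ 2)) / l ^ 2 = D * l := by
    rw [← hl3, hD]; field_simp
  have p1 : ‖∫ x in (0 : ℝ)..α₁, A x * osc h (F x)‖ ≤ D * l := by
    rcases le_total (s - l) 0 with h1 | h1
    · have : α₁ = 0 := by rw [hα₁]; exact max_eq_left ((min_le_right _ _).trans h1)
      rw [this, intervalIntegral.integral_same, norm_zero]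
      positivity
    · have hα1 : α₁ ≤ s - l := max_le h1 (min_le_right _ _)
      rw [← hout]
      refine norm_osc_integral_outer_le (s := s) (σ := -1) hc hK hB ha hh hl0 (by norm_num) le_rfl o1
        (o2.trans o3) hs (fun η hη => hd1 η ⟨hη.1, hη.2.trans (o2.trans o3)⟩)
        (fun η hη => by linarith [hη.2]) hF hk hk'c hA hA'c hkc hkK hk'K hAa hA'a hosc
  have p3 : ‖∫ x in β₁..r, A x * osc h (F x)‖ ≤ D * l := by
    rcases le_total r (s + l) with h1 | h1
    · have : β₁ = r := min_eq_left h1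
      rw [this, intervalIntegral.integral_same, norm_zero]
      positivity
    · have hβ1 : β₁ = s + l := min_eq_right h1
      rw [← hout]
      refine norm_osc_integral_outer_le (s := s) (σ := 1) hc hK hB ha hh hl0 (by norm_num)
        (o1.trans o2) o3 le_rfl hs (fun η hη => hd1 η ⟨(o1.trans o2).trans hη.1, hη.2⟩)
        (fun η hη => by linarith [hη.1]) hF hk hk'c hA hA'c hkc hkK hk'K hAa hA'a hosc
  have p2 : ‖∫ x in α₁..β₁, A x * osc h (F x)‖ ≤ 2 * (a * B) * l := by
    refine (intervalIntegral.norm_integral_le_of_norm_le_const (C := a * B) fun x hx => ?_).trans ?_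
    · rw [Set.uIoc_of_le o2] at hx
      have hx' : x ∈ Set.Icc 0 r := ⟨o1.trans hx.1.le, hx.2.trans o3⟩
      rw [norm_mul]
      exact mul_le_mul (hAa x hx') (hosc x hx') (norm_nonneg _) ha
    · rw [abs_of_nonneg (by linarith)]
      have : 0 ≤ a * B := by positivity
      nlinarith
  rw [← intervalIntegral.integral_add_adjacent_intervals (hii 0 α₁ le_rfl o1 (o2.trans o3))
    (hii α₁ r o1 (o2.trans o3) le_rfl),
    ← intervalIntegral.integral_add_adjacent_intervals (hii α₁ β₁ o1 o2 o3)
    (hii β₁ r (o1.trans o2) o3 le_rfl)]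
  refine (norm_add_le _ _).trans ?_
  have := norm_add_le (∫ x in α₁..β₁, A x * osc h (F x)) (∫ x in β₁..r, A x * osc h (F x))
  unfold vdcConst
  rw [← hD]
  linarith

/-- **Van der Corput bound** for a phase with derivative `(η² - t) k(η)`, uniform in `t`. -/
theorem norm_osc_integral_le {c K B a h r : ℝ} {t : ℂ} {F k k' A A' : ℝ → ℂ}
    (hc : 0 < c) (hK : 0 ≤ K) (hB : 0 ≤ B) (ha : 0 ≤ a) (hh : 0 < h) (hr0 : 0 ≤ r) (hr1 : r ≤ 1)
    (ht : t.re ≤ 1)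
    (hF : ∀ x ∈ Set.Icc (-r) r, HasDerivAt F (((x : ℂ) ^ 2 - t) * k x) x)
    (hk : ∀ x ∈ Set.Icc (-r) r, HasDerivAt k (k' x) x) (hk'c : ContinuousOn k' (Set.Icc (-r) r))
    (hA : ∀ x ∈ Set.Icc (-r) r, HasDerivAt A (A' x) x) (hA'c : ContinuousOn A' (Set.Icc (-r) r))
    (hkc : ∀ x ∈ Set.Icc (-r) r, c ≤ ‖k x‖) (hkK : ∀ x ∈ Set.Icc (-r) r, ‖k x‖ ≤ K)
    (hk'K : ∀ x ∈ Set.Icc (-r) r, ‖k' x‖ ≤ K) (hAa : ∀ x ∈ Set.Icc (-r) r, ‖A x‖ ≤ a)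
    (hA'a : ∀ x ∈ Set.Icc (-r) r, ‖A' x‖ ≤ a)
    (hosc : ∀ x ∈ Set.Icc (-r) r, ‖osc h (F x)‖ ≤ B) :
    ‖∫ x in (-r)..r, A x * osc h (F x)‖ ≤ 2 * vdcConst c K B a * h ^ (1 / 3 : ℝ) := by
  have hsub : Set.Icc 0 r ⊆ Set.Icc (-r) r := Set.Icc_subset_Icc (by linarith) le_rfl
  have hneg : ∀ x ∈ Set.Icc 0 r, -x ∈ Set.Icc (-r) r := fun x hx =>
    ⟨by linarith [hx.2], by linarith [hx.1]⟩
  have hcont : ContinuousOn (fun x => A x * osc h (F x)) (Set.Icc (-r) r) := by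
    refine ContinuousOn.mul (fun x hx => (hA x hx).continuousAt.continuousWithinAt)
      ((continuous_osc h).comp_continuousOn fun x hx => (hF x hx).continuousAt.continuousWithinAt)
  have p1 := norm_osc_integral_half_le hc hK hB ha hh hr0 hr1 ht (fun x hx => hF x (hsub hx))
    (fun x hx => hk x (hsub hx)) (hk'c.mono hsub) (fun x hx => hA x (hsub hx)) (hA'c.mono hsub)
    (fun x hx => hkc x (hsub hx)) (fun x hx => hkK x (hsub hx)) (fun x hx => hk'K x (hsub hx))
    (fun x hx => hAa x (hsub hx)) (fun x hx => hA'a x (hsub hx)) (fun x hx => hosc x (hsub hx))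
  have hcn : ContinuousOn (fun x : ℝ => -x) (Set.Icc 0 r) := by fun_prop
  -- Reflection turns the negative half-line into the positive one: x² - t is even, so only k
  -- changes sign.
  have p2 := norm_osc_integral_half_le (F := fun x => F (-x)) (k := fun x => -k (-x))
    (k' := fun x => k' (-x)) (A := fun x => A (-x)) (A' := fun x => -A' (-x)) (t := t)
    hc hK hB ha hh hr0 hr1 ht
    (fun x hx => by
      have := (hF (-x) (hneg x hx)).scomp x (hasDerivAt_neg x)
      refine this.congr_deriv ?_
      simp)
    (fun x hx => by
      have := ((hk (-x) (hneg x hx)).scomp x (hasDerivAt_neg x)).neg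
      refine this.congr_deriv ?_
      simp)
    (hk'c.comp hcn hneg)
    (fun x hx => by
      have := (hA (-x) (hneg x hx)).scomp x (hasDerivAt_neg x)
      refine this.congr_deriv ?_
      simp)
    (hA'c.comp hcn hneg).neg
    (fun x hx => by simpa using hkc _ (hneg x hx)) (fun x hx => by simpa using hkK _ (hneg x hx))
    (fun x hx => hk'K _ (hneg x hx)) (fun x hx => hAa _ (hneg x hx))
    (fun x hx => by simpa using hA'a _ (hneg x hx)) (fun x hx => hosc _ (hneg x hx))
  have e : ∫ x in (0 : ℝ)..r, A (-x) * osc h (F (-x)) = ∫ x in (-r)..0, A x * osc h (F x) := by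
    rw [intervalIntegral.integral_comp_neg (fun x => A x * osc h (F x))]
    simp
  rw [e] at p2
  rw [← intervalIntegral.integral_add_adjacent_intervals (b := 0)
    ((hcont.mono (by rw [Set.uIcc_of_le (by linarith)]
                     exact Set.Icc_subset_Icc le_rfl hr0)).intervalIntegrable)
    ((hcont.mono (by rw [Set.uIcc_of_le hr0]; exact hsub)).intervalIntegrable)]
  refine (norm_add_le _ _).trans ?_
  linarith

/-! ### Bounded holomorphic functions on discs centred at the origin -/

/-- `f` is holomorphic on the disc of radius `s` about `0`, with norm at most `C` there. -/
structure HolBdd (s C : ℝ) (f : ℂ → ℂ) : Prop where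
  diff : DifferentiableOn ℂ f (Metric.ball 0 s)
  bdd : ∀ z ∈ Metric.ball (0 : ℂ) s, ‖f z‖ ≤ C

namespace HolBdd

variable {s s' C D c : ℝ} {f g : ℂ → ℂ}

theorem mono (hf : HolBdd s C f) (h : s' ≤ s) : HolBdd s' C f :=
  ⟨hf.diff.mono (Metric.ball_subset_ball h), fun z hz => hf.bdd z (Metric.ball_subset_ball h hz)⟩

theorem mono_bound (hf : HolBdd s C f) (h : C ≤ D) : HolBdd s D f :=
  ⟨hf.diff, fun z hz => (hf.bdd z hz).trans h⟩

theorem add (hf : HolBdd s C f) (hg : HolBdd s D g) : HolBdd s (C + D) fun z => f z + g z :=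
  ⟨hf.diff.add hg.diff, fun z hz => (norm_add_le _ _).trans (add_le_add (hf.bdd z hz) (hg.bdd z hz))⟩

theorem sub (hf : HolBdd s C f) (hg : HolBdd s D g) : HolBdd s (C + D) fun z => f z - g z :=
  ⟨hf.diff.sub hg.diff, fun z hz => (norm_sub_le _ _).trans (add_le_add (hf.bdd z hz) (hg.bdd z hz))⟩

theorem mul (hC : 0 ≤ C) (hf : HolBdd s C f) (hg : HolBdd s D g) :
    HolBdd s (C * D) fun z => f z * g z :=
  ⟨hf.diff.mul hg.diff, fun z hz => by
    rw [norm_mul]; exact mul_le_mul (hf.bdd z hz) (hg.bdd z hz) (norm_nonneg _) hC⟩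

theorem const {a : ℂ} (ha : ‖a‖ ≤ C) : HolBdd s C fun _ => a :=
  ⟨differentiableOn_const a, fun _ _ => ha⟩

theorem id : HolBdd s s fun z => z :=
  ⟨differentiableOn_id, fun z hz => by simpa using (mem_ball_zero_iff.1 hz).le⟩

theorem div (hC : 0 ≤ C) (hc : 0 < c) (hf : HolBdd s C f) (hg : HolBdd s D g)
    (hgc : ∀ z ∈ Metric.ball (0 : ℂ) s, c ≤ ‖g z‖) : HolBdd s (C / c) fun z => f z / g z :=
  ⟨hf.diff.div hg.diff fun z hz => norm_pos_iff.1 (hc.trans_le (hgc z hz)), fun z hz => by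
    rw [norm_div]; exact div_le_div₀ hC (hf.bdd z hz) hc (hgc z hz)⟩

theorem comp_sq (hf : HolBdd (s ^ 2) C f) : HolBdd s C fun z => f (z ^ 2) := by
  have hm : ∀ z ∈ Metric.ball (0 : ℂ) s, z ^ 2 ∈ Metric.ball (0 : ℂ) (s ^ 2) := by
    intro z hz
    rw [mem_ball_zero_iff] at hz ⊢
    rw [norm_pow]
    exact pow_lt_pow_left₀ hz (norm_nonneg _) two_ne_zero
  exact ⟨hf.diff.comp (by fun_prop) hm, fun z hz => hf.bdd _ (hm z hz)⟩

theorem hasDerivAt (hf : HolBdd s C f) {z : ℂ} (hz : z ∈ Metric.ball (0 : ℂ) s) :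
    HasDerivAt f (deriv f z) z :=
  (hf.diff.differentiableAt (Metric.isOpen_ball.mem_nhds hz)).hasDerivAt

theorem deriv (hf : HolBdd s C f) (h : s' < s) : HolBdd s' (C / (s - s')) (deriv f) := by
  refine ⟨(hf.diff.deriv Metric.isOpen_ball).mono (Metric.ball_subset_ball h.le), fun z hz => ?_⟩
  have hpos : 0 < s - s' := by linarith
  have hsub : Metric.ball z (s - s') ⊆ Metric.ball 0 s := by
    refine Metric.ball_subset_ball' ?_
    have := (mem_ball_zero_iff.1 hz).le
    rw [dist_zero_right]
    linarith
  -- The disc is open, so Cauchy's estimate on the full radius s - s' is unavailable. Each b above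
  -- the bound is reached with a radius R strictly between C / b and s - s'.
  refine le_of_forall_gt_imp_ge_of_dense fun b hb' => ?_
  have hzz : ‖f z‖ ≤ C := hf.bdd z (hsub (Metric.mem_ball_self hpos))
  have hC : 0 ≤ C := (norm_nonneg _).trans hzz
  have hb0 : 0 < b := (div_nonneg hC hpos.le).trans_lt hb'
  obtain ⟨R, hR1, hR2⟩ : ∃ R, C / b < R ∧ R < s - s' := by
    refine exists_between ?_
    rw [div_lt_iff₀ hb0]
    rw [div_lt_iff₀ hpos] at hb'
    linarith
  have hR0 : 0 < R := (div_nonneg hC hb0.le).trans_lt hR1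
  have hcl : Metric.closedBall z R ⊆ Metric.ball 0 s :=
    (Metric.closedBall_subset_ball hR2).trans hsub
  have := Complex.norm_deriv_le_of_forall_mem_sphere_norm_le hR0
    ((hf.diff.mono hcl).diffContOnCl_ball (U := Metric.closedBall z R) subset_rfl)
    (fun w hw => hf.bdd w (hcl (Metric.sphere_subset_closedBall hw)))
  have h2 : C / R < b := by
    rw [div_lt_iff₀ hR0]
    rw [div_lt_iff₀ hb0] at hR1
    linarith
  linarith

/-- The mean value inequality on the convex disc bounds divided differences by the Cauchy bound for
the derivative, with no loss as z approaches t. This uniformity lets the two critical points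
collide. -/
theorem dslope (hf : HolBdd s C f) (h : s' < s) {t : ℂ} (ht : t ∈ Metric.ball (0 : ℂ) s') :
    HolBdd s' (C / (s - s')) (dslope f t) := by
  have hts : t ∈ Metric.ball (0 : ℂ) s := Metric.ball_subset_ball h.le ht
  refine ⟨((Complex.differentiableOn_dslope (Metric.isOpen_ball.mem_nhds hts)).2 hf.diff).mono
    (Metric.ball_subset_ball h.le), fun z hz => ?_⟩
  have hd := hf.deriv h
  rcases eq_or_ne z t with rfl | hne
  · rw [dslope_same]; exact hd.bdd z hz
  · rw [dslope_of_ne _ hne, slope_def_field, norm_div]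
    rw [div_le_iff₀ (norm_pos_iff.2 (sub_ne_zero.2 hne))]
    refine (convex_ball (0 : ℂ) s').norm_image_sub_le_of_norm_deriv_le (fun x hx => ?_)
      (fun x hx => hd.bdd x hx) ht hz
    exact (hf.hasDerivAt (Metric.ball_subset_ball h.le hx)).differentiableAt

end HolBdd

/-! ### Averages `∫₀¹ p(θ) f(z θ²) dθ` -/

theorem mul_sq_mem_ball {s θ : ℝ} {z : ℂ} (hz : z ∈ Metric.ball (0 : ℂ) s) (hθ : θ ∈ Set.Icc (0 : ℝ) 1) :
    z * (θ : ℂ) ^ 2 ∈ Metric.ball (0 : ℂ) s := by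
  rw [mem_ball_zero_iff] at hz ⊢
  rw [norm_mul, norm_pow, norm_real, Real.norm_eq_abs, sq_abs]
  have : θ ^ 2 ≤ 1 := pow_le_one₀ hθ.1 hθ.2
  nlinarith [norm_nonneg z]

theorem continuousOn_comp_mul_sq {s : ℝ} {f : ℂ → ℂ} (hf : ContinuousOn f (Metric.ball 0 s))
    {z : ℂ} (hz : z ∈ Metric.ball (0 : ℂ) s) :
    ContinuousOn (fun θ : ℝ => f (z * (θ : ℂ) ^ 2)) (Set.uIcc 0 1) := by
  rw [Set.uIcc_of_le zero_le_one]
  exact hf.comp (by fun_prop) fun θ hθ => mul_sq_mem_ball hz hθ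

theorem hasDerivAt_sqAvg {s : ℝ} {f : ℂ → ℂ} (hf : DifferentiableOn ℂ f (Metric.ball 0 s))
    {p : ℝ → ℂ} (hp : Continuous p) {z : ℂ} (hz : z ∈ Metric.ball (0 : ℂ) s) :
    HasDerivAt (fun z : ℂ => ∫ θ in (0 : ℝ)..1, p θ * f (z * (θ : ℂ) ^ 2))
      (∫ θ in (0 : ℝ)..1, p θ * ((θ : ℂ) ^ 2 * deriv f (z * (θ : ℂ) ^ 2))) z := by
  obtain ⟨s₁, h1, h2⟩ : ∃ s₁, ‖z‖ < s₁ ∧ s₁ < s := exists_between (mem_ball_zero_iff.1 hz)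
  have hcl : Metric.closedBall (0 : ℂ) s₁ ⊆ Metric.ball 0 s := Metric.closedBall_subset_ball h2
  have hdc : ContinuousOn (deriv f) (Metric.ball 0 s) :=
    (hf.deriv Metric.isOpen_ball).continuousOn
  obtain ⟨M, hM⟩ := (isCompact_closedBall (0 : ℂ) s₁).exists_bound_of_continuousOn (hdc.mono hcl)
  have hM0 : 0 ≤ M := (norm_nonneg _).trans (hM z (by simpa using h1.le))
  refine (intervalIntegral.hasDerivAt_integral_of_dominated_loc_of_deriv_le (μ := volume)
    (F := fun z θ => p θ * f (z * (θ : ℂ) ^ 2))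
    (F' := fun z θ => p θ * ((θ : ℂ) ^ 2 * deriv f (z * (θ : ℂ) ^ 2)))
    (bound := fun θ => ‖p θ‖ * M) (s := Metric.ball 0 s₁)
    (Metric.isOpen_ball.mem_nhds (by simpa using h1)) ?_ ?_ ?_ ?_ ?_ ?_).2
  · filter_upwards [Metric.isOpen_ball.mem_nhds hz] with w hw
    exact ((hp.continuousOn.mul (continuousOn_comp_mul_sq hf.continuousOn hw)).mono
      Set.uIoc_subset_uIcc).aestronglyMeasurable measurableSet_uIoc
  · exact (hp.continuousOn.mul (continuousOn_comp_mul_sq hf.continuousOn hz)).intervalIntegrable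
  · refine ((hp.continuousOn.mul (ContinuousOn.mul (by fun_prop)
      (continuousOn_comp_mul_sq hdc hz))).mono
      Set.uIoc_subset_uIcc).aestronglyMeasurable measurableSet_uIoc
  · refine Eventually.of_forall fun θ hθ w hw => ?_
    have hθ' : θ ∈ Set.Icc (0 : ℝ) 1 := by
      rw [Set.uIoc_of_le zero_le_one] at hθ; exact ⟨hθ.1.le, hθ.2⟩
    have hm := Metric.ball_subset_closedBall (mul_sq_mem_ball hw hθ')
    rw [norm_mul, norm_mul]
    refine mul_le_mul_of_nonneg_left ?_ (norm_nonneg _)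
    have e : ‖(θ : ℂ) ^ 2‖ ≤ 1 := by
      rw [norm_pow, norm_real, Real.norm_eq_abs, sq_abs]; exact pow_le_one₀ hθ'.1 hθ'.2
    calc _ ≤ 1 * M := mul_le_mul e (hM _ hm) (norm_nonneg _) zero_le_one
      _ = M := one_mul M
  · exact (Continuous.intervalIntegrable (by fun_prop) _ _)
  · refine Eventually.of_forall fun θ hθ w hw => ?_
    have hθ' : θ ∈ Set.Icc (0 : ℝ) 1 := by
      rw [Set.uIoc_of_le zero_le_one] at hθ; exact ⟨hθ.1.le, hθ.2⟩
    have hm := hcl (Metric.ball_subset_closedBall (mul_sq_mem_ball hw hθ'))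
    have h3 : HasDerivAt f (deriv f (w * (θ : ℂ) ^ 2)) (w * (θ : ℂ) ^ 2) :=
      (hf.differentiableAt (Metric.isOpen_ball.mem_nhds hm)).hasDerivAt
    have h4 : HasDerivAt (fun w : ℂ => w * (θ : ℂ) ^ 2) ((θ : ℂ) ^ 2) w := by
      simpa using (hasDerivAt_id w).mul_const ((θ : ℂ) ^ 2)
    have h5 := (h3.comp w h4).const_mul (p θ)
    refine h5.congr_deriv ?_
    ring

/-- The Euler-type identity `P + 2 z P' = f` for `P(z) = ∫₀¹ f(z θ²) dθ`. -/
theorem sqAvg_add_two_mul_deriv {s : ℝ} {f : ℂ → ℂ} (hf : DifferentiableOn ℂ f (Metric.ball 0 s))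
    {z : ℂ} (hz : z ∈ Metric.ball (0 : ℂ) s) :
    (∫ θ in (0 : ℝ)..1, f (z * (θ : ℂ) ^ 2)) +
      2 * z * (∫ θ in (0 : ℝ)..1, (θ : ℂ) ^ 2 * deriv f (z * (θ : ℂ) ^ 2)) = f z := by
  have hdc : ContinuousOn (deriv f) (Metric.ball 0 s) :=
    (hf.deriv Metric.isOpen_ball).continuousOn
  have hder : ∀ θ ∈ Set.uIcc (0 : ℝ) 1, HasDerivAt (fun θ : ℝ => (θ : ℂ) * f (z * (θ : ℂ) ^ 2))
      (f (z * (θ : ℂ) ^ 2) + 2 * z * ((θ : ℂ) ^ 2 * deriv f (z * (θ : ℂ) ^ 2))) θ := by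
    intro θ hθ
    rw [Set.uIcc_of_le zero_le_one] at hθ
    have hm := mul_sq_mem_ball hz hθ
    have h3 : HasDerivAt f (deriv f (z * (θ : ℂ) ^ 2)) (z * (θ : ℂ) ^ 2) :=
      (hf.differentiableAt (Metric.isOpen_ball.mem_nhds hm)).hasDerivAt
    have h0 : HasDerivAt (fun θ : ℝ => (θ : ℂ)) 1 θ := by
      simpa using (hasDerivAt_id θ).ofReal_comp
    have h4 : HasDerivAt (fun θ : ℝ => z * (θ : ℂ) ^ 2) (z * (2 * (θ : ℂ))) θ := by
      have := (h0.pow 2).const_mul z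
      simpa using this
    have h5 := h0.mul (h3.comp θ h4)
    refine h5.congr_deriv ?_
    simp only [Function.comp_apply]
    ring
  have c1 : ContinuousOn (fun θ : ℝ => f (z * (θ : ℂ) ^ 2)) (Set.uIcc 0 1) :=
    continuousOn_comp_mul_sq hf.continuousOn hz
  have c2 : ContinuousOn (fun θ : ℝ => (θ : ℂ) ^ 2 * deriv f (z * (θ : ℂ) ^ 2)) (Set.uIcc 0 1) :=
    ContinuousOn.mul (by fun_prop) (continuousOn_comp_mul_sq hdc hz)
  have c3 : ContinuousOn (fun θ : ℝ => 2 * z * ((θ : ℂ) ^ 2 * deriv f (z * (θ : ℂ) ^ 2)))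
    (Set.uIcc 0 1) := continuousOn_const.mul c2
  have := intervalIntegral.integral_eq_sub_of_hasDerivAt hder
    (c1.add c3).intervalIntegrable
  rw [intervalIntegral.integral_add c1.intervalIntegrable c3.intervalIntegrable, intervalIntegral.integral_const_mul] at this
  rw [this]
  simp

/-! ### Comparison of a phase with two coalescing critical points with the cubic model -/

/-- The coefficient of the cubic with the same critical values as `∫₀^η (σ² - t) k(σ²) dσ`. -/
def cubicCoeff (k : ℂ → ℂ) (t : ℂ) : ℂ :=
  3 / 2 * ∫ θ in (0 : ℝ)..1, (1 - (θ : ℂ) ^ 2) * k (t * (θ : ℂ) ^ 2)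

/-- `η ↦ η * phaseGap k t (η²)` is the difference between the phase and its cubic model. -/
def phaseGap (k : ℂ → ℂ) (t w : ℂ) : ℂ :=
  ∫ θ in (0 : ℝ)..1, (w * (θ : ℂ) ^ 2 - t) * (k (w * (θ : ℂ) ^ 2) - cubicCoeff k t)

theorem integral_one_sub_sq : ∫ θ in (0 : ℝ)..1, (1 - (θ : ℂ) ^ 2) = 2 / 3 := by
  have : ∀ θ : ℝ, (1 - (θ : ℂ) ^ 2) = ((1 - θ ^ 2 : ℝ) : ℂ) := fun θ => by push_cast; ring
  simp_rw [this]
  rw [intervalIntegral.integral_ofReal, intervalIntegral.integral_sub (by simp)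
    (Continuous.intervalIntegrable (by fun_prop) _ _)]
  simp
  norm_num

/-- The weight (3/2)(1 - θ²) has integral 1 on [0, 1], so `cubicCoeff` is an average of values of k;
the factor 3/2 is the crude bound 1 - θ² ≤ 1. -/
theorem norm_cubicCoeff_sub_le {s κ ε : ℝ} {k : ℂ → ℂ} {t : ℂ} (hk : ContinuousOn k (Metric.ball 0 s))
    (ht : t ∈ Metric.ball (0 : ℂ) s)
    (hkε : ∀ z ∈ Metric.ball (0 : ℂ) s, ‖k z - κ‖ ≤ ε) : ‖cubicCoeff k t - κ‖ ≤ 3 / 2 * ε := by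
  have c1 := continuousOn_comp_mul_sq hk ht
  have e : cubicCoeff k t - κ = 3 / 2 * ∫ θ in (0 : ℝ)..1, (1 - (θ : ℂ) ^ 2) *
      (k (t * (θ : ℂ) ^ 2) - κ) := by
    have : ∀ θ : ℝ, (1 - (θ : ℂ) ^ 2) * (k (t * (θ : ℂ) ^ 2) - κ) =
      (1 - (θ : ℂ) ^ 2) * k (t * (θ : ℂ) ^ 2) - (1 - (θ : ℂ) ^ 2) * κ := fun θ => by ring
    simp_rw [this]
    rw [intervalIntegral.integral_sub, intervalIntegral.integral_mul_const, integral_one_sub_sq,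
      cubicCoeff]
    · ring
    · exact (ContinuousOn.mul (by fun_prop) c1).intervalIntegrable
    · exact Continuous.intervalIntegrable (by fun_prop) _ _
  rw [e, norm_mul]
  have h1 : ‖∫ θ in (0 : ℝ)..1, (1 - (θ : ℂ) ^ 2) * (k (t * (θ : ℂ) ^ 2) - κ)‖ ≤ ε * |1 - 0| := by
    refine intervalIntegral.norm_integral_le_of_norm_le_const fun θ hθ => ?_
    rw [Set.uIoc_of_le zero_le_one] at hθ
    have hθ' : θ ∈ Set.Icc (0 : ℝ) 1 := ⟨hθ.1.le, hθ.2⟩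
    have h2 : ‖(1 - (θ : ℂ) ^ 2)‖ ≤ 1 := by
      have : (1 - (θ : ℂ) ^ 2) = ((1 - θ ^ 2 : ℝ) : ℂ) := by push_cast; ring
      rw [this, norm_real, Real.norm_eq_abs, abs_le]
      constructor <;> nlinarith [hθ'.1, hθ'.2]
    rw [norm_mul]
    calc _ ≤ 1 * ε := mul_le_mul h2 (hkε _ (mul_sq_mem_ball ht hθ')) (norm_nonneg _) zero_le_one
      _ = ε := one_mul ε
  have h3 : ‖(3 / 2 : ℂ)‖ = 3 / 2 := by norm_num
  rw [h3]
  simp at h1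
  linarith

theorem hasDerivAt_phaseGap {s : ℝ} {k : ℂ → ℂ} (hk : DifferentiableOn ℂ k (Metric.ball 0 s))
    (t : ℂ) {w : ℂ} (hw : w ∈ Metric.ball (0 : ℂ) s) :
    HasDerivAt (phaseGap k t) (∫ θ in (0 : ℝ)..1, (θ : ℂ) ^ 2 *
      deriv (fun u => (u - t) * (k u - cubicCoeff k t)) (w * (θ : ℂ) ^ 2)) w := by
  have hf : DifferentiableOn ℂ (fun u => (u - t) * (k u - cubicCoeff k t)) (Metric.ball 0 s) := by
    fun_prop
  have := hasDerivAt_sqAvg hf (p := fun _ => 1) continuous_const hw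
  simp only [one_mul] at this
  exact this

/-- This is differentiation of η ↦ η · `phaseGap k t (η²)`, a primitive of (σ² - t)(k(σ²) - N),
expressed in the variable w = η². -/
theorem phaseGap_ode {s : ℝ} {k : ℂ → ℂ} (hk : DifferentiableOn ℂ k (Metric.ball 0 s))
    (t : ℂ) {w : ℂ} (hw : w ∈ Metric.ball (0 : ℂ) s) :
    phaseGap k t w + 2 * w * deriv (phaseGap k t) w = (w - t) * (k w - cubicCoeff k t) := by
  have hf : DifferentiableOn ℂ (fun u => (u - t) * (k u - cubicCoeff k t)) (Metric.ball 0 s) := by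
    fun_prop
  rw [(hasDerivAt_phaseGap hk t hw).deriv]
  exact sqAvg_add_two_mul_deriv hf hw

/-- The phase and its cubic model agree at the critical points; `cubicCoeff` is defined by exactly
this requirement. -/
theorem phaseGap_self {s : ℝ} {k : ℂ → ℂ} (hk : DifferentiableOn ℂ k (Metric.ball 0 s))
    {t : ℂ} (ht : t ∈ Metric.ball (0 : ℂ) s) : phaseGap k t t = 0 := by
  have c1 := continuousOn_comp_mul_sq hk.continuousOn ht
  have : ∀ θ : ℝ, (t * (θ : ℂ) ^ 2 - t) * (k (t * (θ : ℂ) ^ 2) - cubicCoeff k t) =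
      (-t) * ((1 - (θ : ℂ) ^ 2) * k (t * (θ : ℂ) ^ 2)) + (1 - (θ : ℂ) ^ 2) * (t * cubicCoeff k t) :=
    fun θ => by ring
  unfold phaseGap
  simp_rw [this]
  rw [intervalIntegral.integral_add, intervalIntegral.integral_mul_const, integral_one_sub_sq,
    intervalIntegral.integral_const_mul]
  · have : cubicCoeff k t = 3 / 2 * ∫ θ in (0 : ℝ)..1, (1 - (θ : ℂ) ^ 2) * k (t * (θ : ℂ) ^ 2) := rfl
    linear_combination (2 * t / 3) * this
  · exact (ContinuousOn.mul (by fun_prop) (ContinuousOn.mul (by fun_prop) c1)).intervalIntegrable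
  · exact Continuous.intervalIntegrable (by fun_prop) _ _

theorem cubicCoeff_zero (k : ℂ → ℂ) : cubicCoeff k 0 = k 0 := by
  unfold cubicCoeff
  simp only [zero_mul]
  rw [intervalIntegral.integral_mul_const, integral_one_sub_sq]
  ring

/-- For t ≠ 0 it follows from the differential equation at w = t. At t = 0 that equation is void,
and one uses instead that N = k(0), so the integrand itself vanishes to second order. -/
theorem deriv_phaseGap_self {s : ℝ} {k : ℂ → ℂ} (hk : DifferentiableOn ℂ k (Metric.ball 0 s))
    {t : ℂ} (ht : t ∈ Metric.ball (0 : ℂ) s) : deriv (phaseGap k t) t = 0 := by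
  rcases eq_or_ne t 0 with rfl | h0
  · rw [(hasDerivAt_phaseGap hk 0 ht).deriv]
    have hk0 : HasDerivAt k (deriv k 0) 0 :=
      (hk.differentiableAt (Metric.isOpen_ball.mem_nhds ht)).hasDerivAt
    have h1 : deriv (fun u : ℂ => (u - 0) * (k u - cubicCoeff k 0)) 0 = 0 := by
      have := (((hasDerivAt_id (0 : ℂ)).sub_const 0).fun_mul (hk0.sub_const (cubicCoeff k 0))).deriv
      simpa [cubicCoeff_zero] using this
    simp only [zero_mul, h1, mul_zero]
    simp
  · have := phaseGap_ode hk t ht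
    rw [phaseGap_self hk ht, sub_self, zero_mul, zero_add] at this
    simpa [h0] using this

/-- The quotient of `phaseGap k t` by `(w - t)²`. -/
def phaseQuot (k : ℂ → ℂ) (t : ℂ) : ℂ → ℂ := dslope (dslope (phaseGap k t) t) t

theorem phaseGap_eq {s : ℝ} {k : ℂ → ℂ} (hk : DifferentiableOn ℂ k (Metric.ball 0 s))
    {t : ℂ} (ht : t ∈ Metric.ball (0 : ℂ) s) (w : ℂ) :
    phaseGap k t w = (w - t) ^ 2 * phaseQuot k t w := by
  have h1 := sub_smul_dslope (phaseGap k t) t w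
  have h2 := sub_smul_dslope (dslope (phaseGap k t) t) t w
  rw [dslope_same, deriv_phaseGap_self hk ht, sub_zero, smul_eq_mul] at h2
  rw [phaseGap_self hk ht, sub_zero, smul_eq_mul, ← h2] at h1
  rw [← h1, phaseQuot]
  ring

/-- Substitute (w - t)² Q into the differential equation, cancel one factor w - t, and let w tend to
t. This value of Q at t is what cancels the derivative of the square-root prefactor along the
homotopy. -/
theorem four_mul_phaseQuot {s : ℝ} {k : ℂ → ℂ} (hk : DifferentiableOn ℂ k (Metric.ball 0 s))
    {t : ℂ} (ht : t ∈ Metric.ball (0 : ℂ) s)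
    (hQ : DifferentiableOn ℂ (phaseQuot k t) (Metric.ball 0 s)) :
    4 * t * phaseQuot k t t = k t - cubicCoeff k t := by
  set Q := phaseQuot k t
  have hQ' : DifferentiableOn ℂ (deriv Q) (Metric.ball 0 s) := hQ.deriv Metric.isOpen_ball
  have hnt := Metric.isOpen_ball.mem_nhds ht
  have hkt : ContinuousAt k t := (hk.differentiableAt hnt).continuousAt
  have hQt : ContinuousAt Q t := (hQ.differentiableAt hnt).continuousAt
  have hQt' : ContinuousAt (deriv Q) t := (hQ'.differentiableAt hnt).continuousAt
  set L : ℂ → ℂ := fun w => (w - t) * Q w + 4 * w * Q w + 2 * w * (w - t) * deriv Q w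
  set Rr : ℂ → ℂ := fun w => k w - cubicCoeff k t
  have hL : ContinuousAt L t := by fun_prop
  have hR : ContinuousAt Rr t := by fun_prop
  have heq : ∀ᶠ w in 𝓝[≠] t, L w = Rr w := by
    have h1 : ∀ᶠ w in 𝓝[≠] t, w ∈ Metric.ball (0 : ℂ) s := nhdsWithin_le_nhds hnt
    filter_upwards [h1, self_mem_nhdsWithin] with w hw hne
    have hne' : w - t ≠ 0 := sub_ne_zero.2 hne
    have hode := phaseGap_ode hk t hw
    have hfe : phaseGap k t = fun w => (w - t) ^ 2 * Q w := funext (phaseGap_eq hk ht)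
    have hQw : HasDerivAt Q (deriv Q w) w :=
      (hQ.differentiableAt (Metric.isOpen_ball.mem_nhds hw)).hasDerivAt
    have hd : HasDerivAt (fun w => (w - t) ^ 2 * Q w) (2 * (w - t) * Q w + (w - t) ^ 2 * deriv Q w) w := by
      have h2 : HasDerivAt (fun w => (w - t) ^ 2) (2 * (w - t)) w := by
        simpa using ((hasDerivAt_id w).sub_const t).fun_pow 2
      exact h2.mul hQw
    rw [hfe, hd.deriv] at hode
    refine mul_left_cancel₀ hne' ?_
    simp only [L, Rr]
    linear_combination hode
  have h3 : Tendsto L (𝓝[≠] t) (𝓝 (Rr t)) :=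
    (hR.tendsto.mono_left nhdsWithin_le_nhds).congr' (heq.mono fun w hw => hw.symm)
  have h4 := tendsto_nhds_unique h3 (hL.tendsto.mono_left nhdsWithin_le_nhds)
  simp only [L, Rr, sub_self, zero_mul, mul_zero, add_zero, zero_add] at h4
  exact h4.symm

/-- Each of the two divided differences costs a shrinking of the disc, hence the radii (9r)², (8r)²,
(7r)² in the variable w = η². The constant does not depend on t. -/
theorem exists_holBdd_phaseQuot {κ r : ℝ} (hκ : 0 < κ) (hr : 0 < r) : ∃ C, 0 ≤ C ∧
    ∀ (k : ℂ → ℂ) (t : ℂ), DifferentiableOn ℂ k (Metric.ball 0 ((9 * r) ^ 2)) →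
      (∀ z ∈ Metric.ball (0 : ℂ) ((9 * r) ^ 2), ‖k z - κ‖ ≤ κ / 8) → ‖t‖ < r ^ 2 →
      HolBdd ((7 * r) ^ 2) C (phaseQuot k t) := by
  refine ⟨((9 * r) ^ 2 + r ^ 2) * κ / ((9 * r) ^ 2 - (8 * r) ^ 2) / ((8 * r) ^ 2 - (7 * r) ^ 2), ?_,
    fun k t hk hkκ ht => ?_⟩
  · have : 0 ≤ (9 * r) ^ 2 - (8 * r) ^ 2 := by nlinarith
    have : 0 ≤ (8 * r) ^ 2 - (7 * r) ^ 2 := by nlinarith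
    positivity
  · have hmem : ∀ j : ℝ, 1 ≤ j → t ∈ Metric.ball (0 : ℂ) ((j * r) ^ 2) := fun j hj => by
      rw [mem_ball_zero_iff]
      refine ht.trans_le (pow_le_pow_left₀ hr.le (by nlinarith) 2)
    have hN := norm_cubicCoeff_sub_le hk.continuousOn (hmem 9 (by norm_num)) hkκ
    have hP : HolBdd ((9 * r) ^ 2) (((9 * r) ^ 2 + r ^ 2) * κ) (phaseGap k t) := by
      refine ⟨fun w hw => (hasDerivAt_phaseGap hk t hw).differentiableAt.differentiableWithinAt,
        fun w hw => ?_⟩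
      have := intervalIntegral.norm_integral_le_of_norm_le_const (a := (0 : ℝ)) (b := 1)
        (f := fun θ : ℝ => (w * (θ : ℂ) ^ 2 - t) * (k (w * (θ : ℂ) ^ 2) - cubicCoeff k t))
        (C := ((9 * r) ^ 2 + r ^ 2) * κ) fun θ hθ => ?_
      · simpa [phaseGap] using this
      · rw [Set.uIoc_of_le zero_le_one] at hθ
        have hm := mul_sq_mem_ball hw ⟨hθ.1.le, hθ.2⟩
        rw [norm_mul]
        refine mul_le_mul ((norm_sub_le _ _).trans (add_le_add (mem_ball_zero_iff.1 hm).le ht.le)) ?_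
          (norm_nonneg _) (by positivity)
        have e : k (w * (θ : ℂ) ^ 2) - cubicCoeff k t =
          (k (w * (θ : ℂ) ^ 2) - κ) - (cubicCoeff k t - κ) := by ring
        rw [e]
        refine (norm_sub_le _ _).trans ?_
        have := hkκ _ hm
        linarith
    exact (hP.dslope (by nlinarith) (hmem 8 (by norm_num))).dslope (by nlinarith)
      (hmem 7 (by norm_num))

/-- Data for the two integrations by parts along the homotopy from the cubic model to the phase. -/
theorem exists_homotopy_data {κ r : ℝ} (hκ : 0 < κ) (hr : 0 < r) : ∃ C, 0 ≤ C ∧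
    ∀ (k : ℂ → ℂ) (t : ℂ) (kτ : ℂ → ℂ) (a : ℂ),
      DifferentiableOn ℂ k (Metric.ball 0 ((9 * r) ^ 2)) →
      (∀ z ∈ Metric.ball (0 : ℂ) ((9 * r) ^ 2), ‖k z - κ‖ ≤ κ / 8) → ‖t‖ < r ^ 2 →
      HolBdd ((9 * r) ^ 2) (2 * κ) kτ →
      (∀ z ∈ Metric.ball (0 : ℂ) ((9 * r) ^ 2), κ / 2 ≤ ‖kτ z‖) → a ^ 2 = kτ t →
      ∃ c b₁ b₂ : ℂ → ℂ, DifferentiableOn ℂ c (Metric.ball 0 (3 * r)) ∧ HolBdd (3 * r) C b₁ ∧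
        HolBdd (3 * r) C b₂ ∧ ∀ η ∈ Metric.ball (0 : ℂ) (3 * r),
          η * phaseGap k t (η ^ 2) = c η * ((η ^ 2 - t) * kτ (η ^ 2)) ∧
          (k t - cubicCoeff k t) / (2 * a) - a * deriv c η = (η ^ 2 - t) * kτ (η ^ 2) * b₁ η ∧
          c η = (η ^ 2 - t) * kτ (η ^ 2) * b₂ η := by
  obtain ⟨C₁, hC₁, hquot⟩ := exists_holBdd_phaseQuot hκ hr
  set Cq : ℝ := ((7 * r) ^ 2 + r ^ 2) * C₁ / (κ / 2) with hCq
  have hCq0 : 0 ≤ Cq := by positivity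
  set Cq' : ℝ := Cq / ((7 * r) ^ 2 - (6 * r) ^ 2) with hCq'
  have r76 : 0 < (7 * r) ^ 2 - (6 * r) ^ 2 := by nlinarith
  have r65 : 0 < (6 * r) ^ 2 - (5 * r) ^ 2 := by nlinarith
  have hCq'0 : 0 ≤ Cq' := by positivity
  set CA : ℝ := κ / (2 * √(κ / 2)) + √(2 * κ) * (Cq + (2 * (6 * r) ^ 2) * Cq') with hCA
  have hCA0 : 0 ≤ CA := by positivity
  set Cb : ℝ := CA / ((6 * r) ^ 2 - (5 * r) ^ 2) with hCb
  have hCb0 : 0 ≤ Cb := by positivity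
  refine ⟨Cb / (κ / 2) + (3 * r) * C₁ / (κ / 2) ^ 2, by positivity,
    fun k t kτ a hk hkκ ht hkτ hkτc ha => ?_⟩
  have hmem : ∀ j : ℝ, 1 ≤ j → t ∈ Metric.ball (0 : ℂ) ((j * r) ^ 2) := fun j hj => by
    rw [mem_ball_zero_iff]
    refine ht.trans_le (pow_le_pow_left₀ hr.le (by nlinarith) 2)
  have hN := norm_cubicCoeff_sub_le hk.continuousOn (hmem 9 (by norm_num)) hkκ
  have hQ := hquot k t hk hkκ ht
  set Q := phaseQuot k t
  have hle : ∀ i j : ℝ, 0 ≤ i → i ≤ j → (i * r) ^ 2 ≤ (j * r) ^ 2 := fun i j hi hij =>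
    pow_le_pow_left₀ (by positivity) (by nlinarith) 2
  have hkτ7 := hkτ.mono (hle 7 9 (by norm_num) (by norm_num))
  have hkτc7 : ∀ z ∈ Metric.ball (0 : ℂ) ((7 * r) ^ 2), κ / 2 ≤ ‖kτ z‖ := fun z hz =>
    hkτc z (Metric.ball_subset_ball (hle 7 9 (by norm_num) (by norm_num)) hz)
  have hkτt : κ / 2 ≤ ‖kτ t‖ := hkτc t (hmem 9 (by norm_num))
  have hkτt' : ‖kτ t‖ ≤ 2 * κ := hkτ.bdd t (hmem 9 (by norm_num))
  have ha2 : ‖a‖ ^ 2 = ‖kτ t‖ := by rw [← norm_pow, ha]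
  have ha1 : √(κ / 2) ≤ ‖a‖ := Real.sqrt_le_iff.2 ⟨norm_nonneg _, by rw [ha2]; exact hkτt⟩
  have ha3 : ‖a‖ ≤ √(2 * κ) := Real.le_sqrt_of_sq_le (by rw [ha2]; exact hkτt')
  have hsq : 0 < √(κ / 2) := Real.sqrt_pos.2 (by positivity)
  have ha0 : a ≠ 0 := norm_pos_iff.1 (hsq.trans_le ha1)
  have hsubt : HolBdd ((7 * r) ^ 2) ((7 * r) ^ 2 + r ^ 2) fun w => w - t :=
    HolBdd.id.sub (HolBdd.const ht.le)
  -- Since the gap is (w - t)² Q, dividing it by the phase derivative (w - t) kτ leaves q; the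
  -- vector field c of the homotopy is c(η) = η q(η²).
  set q : ℂ → ℂ := fun w => (w - t) * Q w / kτ w with hqdef
  have hq : HolBdd ((7 * r) ^ 2) Cq q :=
    (HolBdd.mul (by positivity) hsubt hQ).div (by positivity) (by positivity) hkτ7 hkτc7
  have hq' : HolBdd ((6 * r) ^ 2) Cq' (deriv q) := hq.deriv (by linarith)
  have hq6 := hq.mono (hle 6 7 (by norm_num) (by norm_num))
  set a' : ℂ := (k t - cubicCoeff k t) / (2 * a) with ha'
  have ha'b : ‖a'‖ ≤ κ / (2 * √(κ / 2)) := by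
    rw [ha', norm_div, norm_mul, Complex.norm_ofNat]
    refine div_le_div₀ hκ.le ?_ (by positivity) (by linarith)
    have e : k t - cubicCoeff k t = (k t - κ) - (cubicCoeff k t - κ) := by ring
    rw [e]
    have := hkκ t (hmem 9 (by norm_num))
    have := norm_sub_le (k t - (κ : ℂ)) (cubicCoeff k t - κ)
    linarith
  -- With w = η² this is a' - a c'(η), where a' is the derivative of the prefactor in the homotopy
  -- parameter.
  set A : ℂ → ℂ := fun w => a' - a * (q w + 2 * w * deriv q w) with hA
  have h2w : HolBdd ((6 * r) ^ 2) (2 * (6 * r) ^ 2) fun w => 2 * w :=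
    HolBdd.mul (by norm_num) (HolBdd.const (by simp)) HolBdd.id
  have hAb : HolBdd ((6 * r) ^ 2) CA A :=
    (HolBdd.const ha'b).sub (HolBdd.mul (by positivity) (HolBdd.const ha3)
      (hq6.add (HolBdd.mul (by positivity) h2w hq')))
  have hB := hAb.dslope (s' := (5 * r) ^ 2) (by linarith) (hmem 5 (by norm_num))
  have hkτ0 : ∀ w ∈ Metric.ball (0 : ℂ) ((9 * r) ^ 2), kτ w ≠ 0 := fun w hw =>
    norm_pos_iff.1 ((by positivity : 0 < κ / 2).trans_le (hkτc w hw))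
  -- At w = t only 2 t q'(t) = 2 t Q(t) / a² survives in the bracket, and a' = 2 t Q(t) / a by
  -- `four_mul_phaseQuot`. The normalisation a² = kτ(t) is forced by this cancellation, and A
  -- becomes divisible by w - t.
  have hAt : A t = 0 := by
    have hkt0 := hkτ0 t (hmem 9 (by norm_num))
    have h4 := four_mul_phaseQuot (hk.mono (Metric.ball_subset_ball (hle 7 9 (by norm_num)
      (by norm_num)))) (hmem 7 (by norm_num)) hQ.diff
    have hqt : q t = 0 := by simp [hqdef]
    have hdq : deriv q t = Q t / kτ t := by
      have hQt := hQ.hasDerivAt (hmem 7 (by norm_num))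
      have hkt := hkτ7.hasDerivAt (hmem 7 (by norm_num))
      have := ((((hasDerivAt_id t).sub_const t).mul hQt).div hkt hkt0).deriv
      simp only [id_eq, sub_self, zero_mul, sub_zero, add_zero, one_mul, Pi.mul_apply] at this
      have e2 : deriv q t = Q t * kτ t / kτ t ^ 2 := this
      rw [e2]; field_simp
    simp only [hA, hqt, hdq, ha', ← h4]
    rw [← ha] at hkt0 ⊢
    field_simp
    ring
  have hr3 : ∀ η ∈ Metric.ball (0 : ℂ) (3 * r), η ^ 2 ∈ Metric.ball (0 : ℂ) ((3 * r) ^ 2) := by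
    intro η hη
    rw [mem_ball_zero_iff] at hη ⊢
    rw [norm_pow]
    exact pow_lt_pow_left₀ hη (norm_nonneg _) two_ne_zero
  have hkτ3 := (hkτ.mono (hle 3 9 (by norm_num) (by norm_num))).comp_sq
  have hkτc3 : ∀ z ∈ Metric.ball (0 : ℂ) (3 * r), κ / 2 ≤ ‖kτ (z ^ 2)‖ := fun z hz =>
    hkτc _ (Metric.ball_subset_ball (hle 3 9 (by norm_num) (by norm_num)) (hr3 z hz))
  have hB3 := (hB.mono (hle 3 5 (by norm_num) (by norm_num))).comp_sq
  have hQ3 := (hQ.mono (hle 3 7 (by norm_num) (by norm_num))).comp_sq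
  have hq3 := (hq.mono (hle 3 7 (by norm_num) (by norm_num))).comp_sq
  have hcd : ∀ η ∈ Metric.ball (0 : ℂ) (3 * r), HasDerivAt (fun η => η * q (η ^ 2))
      (q (η ^ 2) + 2 * η ^ 2 * deriv q (η ^ 2)) η := by
    intro η hη
    have h1 := hq.hasDerivAt (Metric.ball_subset_ball (hle 3 7 (by norm_num) (by norm_num)) (hr3 η hη))
    have h2 : HasDerivAt (fun η : ℂ => η ^ 2) (2 * η) η := by simpa using hasDerivAt_pow 2 η
    have h3 := (hasDerivAt_id η).mul (h1.comp η h2)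
    refine h3.congr_deriv ?_
    simp only [Function.comp_apply, id_eq]
    ring
  refine ⟨fun η => η * q (η ^ 2), fun η => dslope A t (η ^ 2) / kτ (η ^ 2),
    fun η => η * Q (η ^ 2) / (kτ (η ^ 2) * kτ (η ^ 2)),
    fun η hη => (hcd η hη).differentiableAt.differentiableWithinAt, ?_, ?_, fun η hη => ⟨?_, ?_, ?_⟩⟩
  · refine (hB3.div hCb0 (by positivity) hkτ3 hkτc3).mono_bound ?_
    linarith [show 0 ≤ (3 * r) * C₁ / (κ / 2) ^ 2 by positivity]
  · refine ((HolBdd.mul (by positivity) HolBdd.id hQ3).div (c := (κ / 2) ^ 2) (by positivity)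
      (by positivity) (HolBdd.mul (by positivity) hkτ3 hkτ3) fun z hz => ?_).mono_bound ?_
    · rw [norm_mul, pow_two]
      exact mul_le_mul (hkτc3 z hz) (hkτc3 z hz) (by positivity) (norm_nonneg _)
    · linarith [show 0 ≤ Cb / (κ / 2) by positivity]
  · have h0 := hkτ0 _ (Metric.ball_subset_ball (hle 3 9 (by norm_num) (by norm_num)) (hr3 η hη))
    rw [phaseGap_eq hk (hmem 9 (by norm_num))]
    simp only [hqdef]
    field_simp
    rfl
  · have h0 := hkτ0 _ (Metric.ball_subset_ball (hle 3 9 (by norm_num) (by norm_num)) (hr3 η hη))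
    rw [(hcd η hη).deriv]
    have := sub_smul_dslope A t (η ^ 2)
    rw [hAt, sub_zero, smul_eq_mul] at this
    have e : (η ^ 2 - t) * kτ (η ^ 2) * (dslope A t (η ^ 2) / kτ (η ^ 2)) = A (η ^ 2) := by
      rw [← this]; field_simp
    rw [e]
  · have h0 := hkτ0 _ (Metric.ball_subset_ball (hle 3 9 (by norm_num) (by norm_num)) (hr3 η hη))
    simp only [hqdef]
    field_simp

/-! ### Cut-off functions and parameter integrals -/

theorem hasDerivAt_intervalIntegral_param {α β : ℝ} (hαβ : α ≤ β) {f f' : ℝ → ℝ → ℂ}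
    (hd : ∀ θ, ∀ x ∈ Set.Icc α β, HasDerivAt (fun θ => f θ x) (f' θ x) θ)
    (hf : ∀ θ, ContinuousOn (f θ) (Set.Icc α β))
    (hf' : ContinuousOn (fun p : ℝ × ℝ => f' p.1 p.2) (Set.univ ×ˢ Set.Icc α β)) (θ₀ : ℝ) :
    HasDerivAt (fun θ => ∫ x in α..β, f θ x) (∫ x in α..β, f' θ₀ x) θ₀ := by
  have hu : Set.uIcc α β = Set.Icc α β := Set.uIcc_of_le hαβ
  have hK : IsCompact (Set.Icc (θ₀ - 1) (θ₀ + 1) ×ˢ Set.Icc α β) := isCompact_Icc.prod isCompact_Icc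
  obtain ⟨M, hM⟩ := hK.exists_bound_of_continuousOn
    (hf'.mono (Set.prod_mono (Set.subset_univ _) subset_rfl))
  have hf'c : ∀ θ, ContinuousOn (f' θ) (Set.Icc α β) := fun θ =>
    hf'.comp (f := fun x : ℝ => (θ, x)) (by fun_prop) fun x hx => ⟨Set.mem_univ _, hx⟩
  have hmem : ∀ x ∈ Set.uIoc α β, x ∈ Set.Icc α β := fun x hx => by
    rw [← hu]; exact Set.uIoc_subset_uIcc hx
  refine (intervalIntegral.hasDerivAt_integral_of_dominated_loc_of_deriv_le (μ := volume)
    (F := f) (F' := f') (bound := fun _ => M) (s := Set.Ioo (θ₀ - 1) (θ₀ + 1))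
    (Ioo_mem_nhds (by linarith) (by linarith)) ?_ ?_ ?_ ?_ ?_ ?_).2
  · exact Eventually.of_forall fun θ => ((hf θ).mono hmem).aestronglyMeasurable measurableSet_uIoc
  · exact ContinuousOn.intervalIntegrable (by rw [hu]; exact hf θ₀)
  · exact ((hf'c θ₀).mono hmem).aestronglyMeasurable measurableSet_uIoc
  · exact Eventually.of_forall fun x hx θ hθ => hM (θ, x) ⟨⟨hθ.1.le, hθ.2.le⟩, hmem x hx⟩
  · exact _root_.intervalIntegrable_const
  · exact Eventually.of_forall fun x hx θ _ => hd θ x (hmem x hx)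

/-- A `C³` cut-off function supported in `[-r, r]` and equal to `1` on `[-r/2, r/2]`, with its
derivatives and a common bound for them. -/
structure IsCutoff (r X : ℝ) (χ χ₁ χ₂ χ₃ : ℝ → ℂ) : Prop where
  deriv₁ : ∀ x, HasDerivAt χ (χ₁ x) x
  deriv₂ : ∀ x, HasDerivAt χ₁ (χ₂ x) x
  deriv₃ : ∀ x, HasDerivAt χ₂ (χ₃ x) x
  cont₃ : Continuous χ₃
  bdd₀ : ∀ x, ‖χ x‖ ≤ X
  bdd₁ : ∀ x, ‖χ₁ x‖ ≤ X
  bdd₂ : ∀ x, ‖χ₂ x‖ ≤ X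
  bdd₃ : ∀ x, ‖χ₃ x‖ ≤ X
  zero₀ : ∀ x, r ≤ |x| → χ x = 0
  zero₁ : ∀ x, r ≤ |x| → χ₁ x = 0
  one : ∀ x, |x| ≤ r / 2 → χ x = 1
  flat : ∀ x, |x| ≤ r / 2 → χ₁ x = 0

namespace IsCutoff

variable {r X : ℝ} {χ χ₁ χ₂ χ₃ : ℝ → ℂ}

theorem cont₀ (H : IsCutoff r X χ χ₁ χ₂ χ₃) : Continuous χ :=
  continuous_iff_continuousAt.2 fun x => (H.deriv₁ x).continuousAt

theorem cont₁ (H : IsCutoff r X χ χ₁ χ₂ χ₃) : Continuous χ₁ :=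
  continuous_iff_continuousAt.2 fun x => (H.deriv₂ x).continuousAt

theorem cont₂ (H : IsCutoff r X χ χ₁ χ₂ χ₃) : Continuous χ₂ :=
  continuous_iff_continuousAt.2 fun x => (H.deriv₃ x).continuousAt

theorem nonneg (H : IsCutoff r X χ χ₁ χ₂ χ₃) : 0 ≤ X := (norm_nonneg _).trans (H.bdd₀ 0)

end IsCutoff

theorem exists_isCutoff {r : ℝ} (hr : 0 < r) : ∃ X χ χ₁ χ₂ χ₃, IsCutoff r X χ χ₁ χ₂ χ₃ := by
  let f : ContDiffBump (0 : ℝ) := ⟨r / 2, r, by positivity, by linarith⟩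
  let g : ℝ → ℝ := f
  have hg : ContDiff ℝ (⊤ : ℕ∞) g := f.contDiff
  have hsupp : HasCompactSupport g := f.hasCompactSupport
  have hg1 : ContDiff ℝ (⊤ : ℕ∞) (deriv g) := ((contDiff_infty_iff_deriv).1 hg).2
  have hg2 : ContDiff ℝ (⊤ : ℕ∞) (deriv (deriv g)) := ((contDiff_infty_iff_deriv).1 hg1).2
  have hg3 : ContDiff ℝ (⊤ : ℕ∞) (deriv (deriv (deriv g))) := ((contDiff_infty_iff_deriv).1 hg2).2
  obtain ⟨X0, h0⟩ := hsupp.exists_bound_of_continuous hg.continuous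
  obtain ⟨X1, h1⟩ := hsupp.deriv.exists_bound_of_continuous hg1.continuous
  obtain ⟨X2, h2⟩ := hsupp.deriv.deriv.exists_bound_of_continuous hg2.continuous
  obtain ⟨X3, h3⟩ := hsupp.deriv.deriv.deriv.exists_bound_of_continuous hg3.continuous
  have p0 := (norm_nonneg _).trans (h0 0)
  have p1 := (norm_nonneg _).trans (h1 0)
  have p2 := (norm_nonneg _).trans (h2 0)
  have p3 := (norm_nonneg _).trans (h3 0)
  have hd : ∀ {u : ℝ → ℝ}, ContDiff ℝ (⊤ : ℕ∞) u → ∀ x,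
      HasDerivAt (fun x => ((u x : ℝ) : ℂ)) ((deriv u x : ℝ) : ℂ) x := fun hu x =>
    ((hu.differentiable (by simp)) x).hasDerivAt.ofReal_comp
  have hz : ∀ x, r ≤ |x| → g x = 0 := fun x hx => f.zero_of_le_dist (by simpa using hx)
  have ho : ∀ x, |x| ≤ r / 2 → g x = 1 := fun x hx => f.one_of_mem_closedBall (by simpa using hx)
  -- A nonnegative function has a minimum wherever it vanishes; the argument also covers the end
  -- points |x| = r. At the plateau value 1 the maximum is used in the same way.
  have hz1 : ∀ x, r ≤ |x| → deriv g x = 0 := by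
    intro x hx
    have hmin : IsLocalMin g x := Eventually.of_forall fun y => by
      rw [hz x hx]; exact f.nonneg
    exact hmin.deriv_eq_zero
  refine ⟨X0 + X1 + X2 + X3, fun x => (g x : ℂ), fun x => ((deriv g x : ℝ) : ℂ),
    fun x => ((deriv (deriv g) x : ℝ) : ℂ), fun x => ((deriv (deriv (deriv g)) x : ℝ) : ℂ),
    hd hg, hd hg1, hd hg2, continuous_ofReal.comp hg3.continuous, fun x => ?_, fun x => ?_,
    fun x => ?_, fun x => ?_, fun x hx => by rw [hz x hx]; simp,
    fun x hx => by rw [hz1 x hx]; simp,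
    fun x hx => by rw [ho x hx]; simp, fun x hx => ?_⟩
  · rw [norm_real]; linarith [h0 x]
  · rw [norm_real]; linarith [h1 x]
  · rw [norm_real]; linarith [h2 x]
  · rw [norm_real]; linarith [h3 x]
  · have hmax : IsLocalMax g x := Eventually.of_forall fun y => by
      rw [ho x hx]; exact f.le_one
    rw [hmax.deriv_eq_zero]; simp

/-! ### A holomorphic square root and the twofold integration by parts -/

/-- The square root `exp (log z / 2)`. -/
def halfPow (z : ℂ) : ℂ := exp (log z / 2)

theorem halfPow_sq {z : ℂ} (hz : z ≠ 0) : halfPow z ^ 2 = z := by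
  rw [halfPow, ← exp_nat_mul]
  push_cast
  rw [mul_div_cancel₀ _ (two_ne_zero), exp_log hz]

theorem halfPow_ne_zero (z : ℂ) : halfPow z ≠ 0 := exp_ne_zero _

theorem re_pos_of_norm_sub_le {κ ε : ℝ} {z : ℂ} (h : ‖z - κ‖ ≤ ε) (hε : ε < κ) : 0 < z.re := by
  have := (abs_le.1 ((abs_re_le_norm _).trans h)).1
  rw [sub_re, ofReal_re] at this
  linarith

/-- The cubic phase `N (η³/3 - t η)`. -/
def cubicPhase (N t : ℂ) (η : ℂ) : ℂ := N * (η ^ 3 / 3 - t * η)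

theorem norm_le_of_norm_sub_le {κ ε : ℝ} (hκ : 0 ≤ κ) {z : ℂ} (h : ‖z - κ‖ ≤ ε) : ‖z‖ ≤ κ + ε := by
  have e : z = (z - κ) + κ := by ring
  rw [e]
  refine (norm_add_le _ _).trans ?_
  rw [norm_real, Real.norm_eq_abs, abs_of_nonneg hκ]
  linarith

theorem le_norm_of_norm_sub_le {κ ε : ℝ} {z : ℂ} (h : ‖z - κ‖ ≤ ε) : κ - ε ≤ ‖z‖ := by
  have h1 := (abs_le.1 ((abs_re_le_norm _).trans h)).1
  have h2 := re_le_norm z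
  rw [sub_re, ofReal_re] at h1
  linarith

/-- If the amplitude is `F'` times `χ b₁ - a χ' b₂`, the oscillatory integral is `O(h^{4/3})`. -/
theorem exists_norm_integral_divisible_le {κ r X B C₀ a₀ : ℝ} (hκ : 0 < κ) (hr : 0 < r) (hr1 : r ≤ 1)
    (hB : 0 ≤ B) (hC₀ : 0 ≤ C₀) (ha₀ : 0 ≤ a₀) : ∃ C, 0 ≤ C ∧
    ∀ (χ χ₁ χ₂ χ₃ : ℝ → ℂ) (h : ℝ) (t a : ℂ) (kτ b₁ b₂ : ℂ → ℂ) (F : ℝ → ℂ),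
      IsCutoff r X χ χ₁ χ₂ χ₃ → 0 < h → ‖t‖ < r ^ 2 → ‖a‖ ≤ a₀ →
      HolBdd ((9 * r) ^ 2) (2 * κ) kτ →
      (∀ z ∈ Metric.ball (0 : ℂ) ((9 * r) ^ 2), κ / 2 ≤ ‖kτ z‖) →
      HolBdd (3 * r) C₀ b₁ → HolBdd (3 * r) C₀ b₂ →
      (∀ x ∈ Set.Icc (-r) r, HasDerivAt F (((x : ℂ) ^ 2 - t) * kτ ((x : ℂ) ^ 2)) x) →
      (∀ x ∈ Set.Icc (-r) r, ‖osc h (F x)‖ ≤ B) →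
      ‖∫ x in (-r)..r, (χ x * b₁ x - a * χ₁ x * b₂ x) * (((x : ℂ) ^ 2 - t) * kτ ((x : ℂ) ^ 2)) *
        osc h (F x)‖ ≤ C * (h * h ^ (1 / 3 : ℝ)) := by
  -- A cut-off bounded by X < 0 does not exist, so this case is vacuous; it is split off so that X ≥
  -- 0 is available when the constants are formed.
  rcases lt_or_ge X 0 with hX | hX
  · exact ⟨0, le_rfl, fun χ χ₁ χ₂ χ₃ h t a kτ b₁ b₂ F H => absurd H.nonneg (not_le.2 hX)⟩
  set b : ℝ := C₀ + C₀ / r + 2 * C₀ / r ^ 2 with hb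
  have hb0 : 0 ≤ b := by positivity
  -- The amplitude after the integration by parts and its derivative are sums of at most four terms
  -- with each of b₁ and b₂; every term is at most X b or X b a₀.
  set A₀ : ℝ := 4 * X * b * (1 + a₀) with hA₀
  have hA₀0 : 0 ≤ A₀ := by positivity
  set K : ℝ := 2 * κ + 2 * κ / r with hK
  refine ⟨2 * vdcConst (κ / 2) K B A₀, mul_nonneg zero_le_two
    (vdcConst_nonneg (by positivity) (by positivity) hB hA₀0), ?_⟩
  intro χ χ₁ χ₂ χ₃ h t a kτ b₁ b₂ F H hh ht ha hkτ hkτc hb₁ hb₂ hF hosc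
  have hmem : ∀ x ∈ Set.Icc (-r) r, ∀ j : ℝ, 1 < j → (x : ℂ) ∈ Metric.ball (0 : ℂ) (j * r) := by
    intro x hx j hj
    rw [mem_ball_zero_iff, norm_real, Real.norm_eq_abs]
    have := abs_le.2 ⟨by linarith [hx.1], hx.2⟩
    nlinarith
  have h39 : (3 * r) ^ 2 ≤ (9 * r) ^ 2 := by nlinarith
  have hkq := (hkτ.mono h39).comp_sq
  have hkq' : HolBdd (2 * r) (2 * κ / r) (deriv fun z => kτ (z ^ 2)) := by
    have := hkq.deriv (s' := 2 * r) (by linarith)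
    rwa [show 3 * r - 2 * r = r by ring] at this
  have hd1 : ∀ {f : ℂ → ℂ}, HolBdd (3 * r) C₀ f → HolBdd (2 * r) (C₀ / r) (deriv f) := fun hf => by
    have := hf.deriv (s' := 2 * r) (by linarith)
    rwa [show 3 * r - 2 * r = r by ring] at this
  have hd2 : ∀ {f : ℂ → ℂ}, HolBdd (3 * r) C₀ f →
      HolBdd (3 / 2 * r) (2 * C₀ / r ^ 2) (deriv (deriv f)) := fun hf => by
    have := (hd1 hf).deriv (s' := 3 / 2 * r) (by linarith)
    rwa [show C₀ / r / (2 * r - 3 / 2 * r) = 2 * C₀ / r ^ 2 by field_simp; ring] at this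
  have m3 := fun x hx => hmem x hx 3 (by norm_num)
  have m2 := fun x hx => hmem x hx 2 (by norm_num)
  have mh := fun x hx => hmem x hx (3 / 2) (by norm_num)
  have e0 : ∀ {f : ℂ → ℂ}, HolBdd (3 * r) C₀ f → ∀ x ∈ Set.Icc (-r) r, ‖f x‖ ≤ b := fun hf x hx => by
    have := hf.bdd x (m3 x hx)
    have : 0 ≤ C₀ / r + 2 * C₀ / r ^ 2 := by positivity
    linarith
  have e1 : ∀ {f : ℂ → ℂ}, HolBdd (3 * r) C₀ f → ∀ x ∈ Set.Icc (-r) r, ‖deriv f x‖ ≤ b :=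
    fun hf x hx => by
      have := (hd1 hf).bdd x (m2 x hx)
      have : 0 ≤ C₀ + 2 * C₀ / r ^ 2 := by positivity
      linarith
  have e2 : ∀ {f : ℂ → ℂ}, HolBdd (3 * r) C₀ f → ∀ x ∈ Set.Icc (-r) r, ‖deriv (deriv f) x‖ ≤ b :=
    fun hf x hx => by
      have := (hd2 hf).bdd x (mh x hx)
      have : 0 ≤ C₀ + C₀ / r := by positivity
      linarith
  have f0 : ∀ {f : ℂ → ℂ}, HolBdd (3 * r) C₀ f → ∀ x ∈ Set.Icc (-r) r,
      HasDerivAt (fun x : ℝ => f x) (deriv f x) x := fun hf x hx => (hf.hasDerivAt (m3 x hx)).comp_ofReal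
  have f1 : ∀ {f : ℂ → ℂ}, HolBdd (3 * r) C₀ f → ∀ x ∈ Set.Icc (-r) r,
      HasDerivAt (fun x : ℝ => deriv f x) (deriv (deriv f) x) x := fun hf x hx =>
    ((hd1 hf).hasDerivAt (m2 x hx)).comp_ofReal
  have f2 : ∀ {f : ℂ → ℂ}, HolBdd (3 * r) C₀ f →
      ContinuousOn (fun x : ℝ => deriv (deriv f) x) (Set.Icc (-r) r) := fun hf =>
    (hd2 hf).diff.continuousOn.comp (by fun_prop) mh
  set g : ℝ → ℂ := fun x => χ x * b₁ x - a * χ₁ x * b₂ x with hg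
  set A : ℝ → ℂ := fun x => (χ₁ x * b₁ x + χ x * deriv b₁ x) -
    (a * χ₂ x * b₂ x + a * χ₁ x * deriv b₂ x) with hA
  set A' : ℝ → ℂ := fun x => ((χ₂ x * b₁ x + χ₁ x * deriv b₁ x) +
      (χ₁ x * deriv b₁ x + χ x * deriv (deriv b₁) x)) -
    ((a * χ₃ x * b₂ x + a * χ₂ x * deriv b₂ x) +
      (a * χ₂ x * deriv b₂ x + a * χ₁ x * deriv (deriv b₂) x)) with hA'
  have hgA : ∀ x ∈ Set.Icc (-r) r, HasDerivAt g (A x) x := fun x hx =>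
    ((H.deriv₁ x).mul (f0 hb₁ x hx)).sub (((H.deriv₂ x).const_mul a).mul (f0 hb₂ x hx))
  have hAA' : ∀ x ∈ Set.Icc (-r) r, HasDerivAt A (A' x) x := fun x hx =>
    (((H.deriv₂ x).mul (f0 hb₁ x hx)).add ((H.deriv₁ x).mul (f1 hb₁ x hx))).sub
    ((((H.deriv₃ x).const_mul a).mul (f0 hb₂ x hx)).add
      (((H.deriv₂ x).const_mul a).mul (f1 hb₂ x hx)))
  have cf0 : ∀ {f : ℂ → ℂ}, HolBdd (3 * r) C₀ f → ContinuousOn (fun x : ℝ => f x) (Set.Icc (-r) r) :=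
    fun hf x hx => (f0 hf x hx).continuousAt.continuousWithinAt
  have cf1 : ∀ {f : ℂ → ℂ}, HolBdd (3 * r) C₀ f →
      ContinuousOn (fun x : ℝ => deriv f x) (Set.Icc (-r) r) :=
    fun hf x hx => (f1 hf x hx).continuousAt.continuousWithinAt
  have hA'c : ContinuousOn A' (Set.Icc (-r) r) := by
    have c0 := H.cont₀.continuousOn (s := Set.Icc (-r) r)
    have c1 := H.cont₁.continuousOn (s := Set.Icc (-r) r)
    have c2 := H.cont₂.continuousOn (s := Set.Icc (-r) r)
    have c3 := H.cont₃.continuousOn (s := Set.Icc (-r) r)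
    have ca : ContinuousOn (fun _ : ℝ => a) (Set.Icc (-r) r) := continuousOn_const
    exact (((c2.mul (cf0 hb₁)).add (c1.mul (cf1 hb₁))).add ((c1.mul (cf1 hb₁)).add
      (c0.mul (f2 hb₁)))).sub ((((ca.mul c3).mul (cf0 hb₂)).add ((ca.mul c2).mul (cf1 hb₂))).add
      (((ca.mul c2).mul (cf1 hb₂)).add ((ca.mul c1).mul (f2 hb₂))))
  have hpr : ∀ {u v : ℂ}, ‖u‖ ≤ X → ‖v‖ ≤ b → ‖u * v‖ ≤ X * b := fun hu hv => by
    rw [norm_mul]; exact mul_le_mul hu hv (norm_nonneg _) hX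
  have hpr' : ∀ {u v : ℂ}, ‖u‖ ≤ X → ‖v‖ ≤ b → ‖a * u * v‖ ≤ X * b * a₀ := fun hu hv => by
    rw [mul_assoc, norm_mul, mul_comm]
    exact mul_le_mul (hpr hu hv) ha (norm_nonneg _) (by positivity)
  have hXb : 0 ≤ X * b := by positivity
  have hXba : 0 ≤ X * b * a₀ := by positivity
  have hAb : ∀ x ∈ Set.Icc (-r) r, ‖A x‖ ≤ A₀ := fun x hx => by
    refine (norm_sub_le _ _).trans ((add_le_add ((norm_add_le _ _).trans (add_le_add
      (hpr (H.bdd₁ x) (e0 hb₁ x hx)) (hpr (H.bdd₀ x) (e1 hb₁ x hx)))) ((norm_add_le _ _).trans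
      (add_le_add (hpr' (H.bdd₂ x) (e0 hb₂ x hx)) (hpr' (H.bdd₁ x) (e1 hb₂ x hx))))).trans ?_)
    rw [hA₀]; linarith
  have hA'b : ∀ x ∈ Set.Icc (-r) r, ‖A' x‖ ≤ A₀ := fun x hx => by
    refine (norm_sub_le _ _).trans ((add_le_add ((norm_add_le _ _).trans (add_le_add
      ((norm_add_le _ _).trans (add_le_add
      (hpr (H.bdd₂ x) (e0 hb₁ x hx)) (hpr (H.bdd₁ x) (e1 hb₁ x hx))))
      ((norm_add_le _ _).trans (add_le_add
      (hpr (H.bdd₁ x) (e1 hb₁ x hx)) (hpr (H.bdd₀ x) (e2 hb₁ x hx))))))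
      ((norm_add_le _ _).trans (add_le_add ((norm_add_le _ _).trans
      (add_le_add (hpr' (H.bdd₃ x) (e0 hb₂ x hx)) (hpr' (H.bdd₂ x) (e1 hb₂ x hx))))
      ((norm_add_le _ _).trans
      (add_le_add (hpr' (H.bdd₂ x) (e1 hb₂ x hx)) (hpr' (H.bdd₁ x) (e2 hb₂ x hx))))))).trans ?_)
    rw [hA₀]; linarith
  have hkr : ∀ x ∈ Set.Icc (-r) r, HasDerivAt (fun x : ℝ => kτ ((x : ℂ) ^ 2))
      (deriv (fun z => kτ (z ^ 2)) x) x := fun x hx => (hkq.hasDerivAt (m3 x hx)).comp_ofReal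
  have hsq : ∀ x ∈ Set.Icc (-r) r, (x : ℂ) ^ 2 ∈ Metric.ball (0 : ℂ) ((9 * r) ^ 2) := by
    intro x hx
    have := hmem x hx 9 (by norm_num)
    rw [mem_ball_zero_iff] at this ⊢
    rw [norm_pow]
    exact pow_lt_pow_left₀ this (norm_nonneg _) two_ne_zero
  have hvdc := norm_osc_integral_le (c := κ / 2) (K := K) (B := B) (a := A₀) (h := h) (r := r) (t := t)
    (F := F) (k := fun x : ℝ => kτ ((x : ℂ) ^ 2)) (k' := fun x : ℝ => deriv (fun z => kτ (z ^ 2)) x)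
    (A := A) (A' := A') (by positivity) (by positivity) hB hA₀0 hh hr.le hr1
    ((re_le_norm t).trans (ht.le.trans (pow_le_one₀ hr.le hr1))) hF hkr
    (hkq'.diff.continuousOn.comp (by fun_prop) m2) hAA' hA'c (fun x hx => hkτc _ (hsq x hx))
    (fun x hx => (hkτ.bdd _ (hsq x hx)).trans (by rw [hK]; linarith [show 0 ≤ 2 * κ / r by positivity]))
    (fun x hx => (hkq'.bdd _ (m2 x hx)).trans (by rw [hK]; linarith)) hAb hA'b hosc
  have hu : Set.uIcc (-r) r = Set.Icc (-r) r := Set.uIcc_of_le (by linarith)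
  have hFc : ContinuousOn (fun x : ℝ => ((x : ℂ) ^ 2 - t) * kτ ((x : ℂ) ^ 2)) (Set.Icc (-r) r) :=
    ContinuousOn.mul (by fun_prop) fun x hx => (hkr x hx).continuousAt.continuousWithinAt
  have hibp := integral_ibp_osc (α := -r) (β := r) (h := h) hh.ne' (g := g) (g' := A) (F := F)
    (F' := fun x : ℝ => ((x : ℂ) ^ 2 - t) * kτ ((x : ℂ) ^ 2)) (by rwa [hu]) (by rwa [hu])
    (by rw [hu]; exact fun x hx => (hAA' x hx).continuousAt.continuousWithinAt) (by rwa [hu])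
  have hgr : g r = 0 := by
    have hr' : r ≤ |r| := le_abs_self r
    simp only [hg, H.zero₀ r hr', H.zero₁ r hr']; ring
  have hgr' : g (-r) = 0 := by
    have hr' : r ≤ |-r| := by rw [abs_neg]; exact le_abs_self r
    simp only [hg, H.zero₀ _ hr', H.zero₁ _ hr']; ring
  rw [hibp, hgr, hgr', norm_mul]
  have e1 : ‖(h : ℂ) / I‖ = h := by simp [abs_of_pos hh]
  rw [e1, zero_mul, zero_mul, sub_zero, zero_sub, norm_neg]
  calc h * ‖∫ x in (-r)..r, A x * osc h (F x)‖
      ≤ h * (2 * vdcConst (κ / 2) K B A₀ * h ^ (1 / 3 : ℝ)) := mul_le_mul_of_nonneg_left hvdc hh.le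
    _ = _ := by ring

/-! ### Deformation of a phase to the cubic model -/

theorem hasDerivAt_halfPow_affine {N D : ℂ} {τ : ℝ} (h : 0 < (N + τ * D).re) :
    HasDerivAt (fun τ : ℝ => halfPow (N + τ * D)) (D / (2 * halfPow (N + τ * D))) τ := by
  have h0 : N + τ * D ≠ 0 := fun h0 => by rw [h0] at h; simp at h
  have h1 : HasDerivAt (fun τ : ℝ => N + (τ : ℂ) * D) D τ := by
    simpa using (((hasDerivAt_id τ).ofReal_comp.mul_const D).const_add N)
  have h2 := ((h1.clog_real (Or.inl h)).div_const 2).cexp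
  refine h2.congr_deriv ?_
  have h3 := halfPow_sq h0
  have h4 := halfPow_ne_zero (N + τ * D)
  change halfPow (N + τ * D) * _ = _
  set a := halfPow (N + τ * D)
  rw [← h3]
  field_simp

/-- A phase with two coalescing critical points can be replaced by its cubic model, up to a
relative error of size `h`. -/
theorem exists_norm_homotopy_le {κ r X L : ℝ} (hκ : 0 < κ) (hr : 0 < r) (hr1 : r ≤ 1) : ∃ C, 0 ≤ C ∧
    ∀ (χ χ₁ χ₂ χ₃ : ℝ → ℂ) (h : ℝ) (t : ℂ) (k : ℂ → ℂ) (F₁ : ℝ → ℂ),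
      IsCutoff r X χ χ₁ χ₂ χ₃ → 0 < h → ‖t‖ < r ^ 2 →
      DifferentiableOn ℂ k (Metric.ball 0 ((9 * r) ^ 2)) →
      (∀ z ∈ Metric.ball (0 : ℂ) ((9 * r) ^ 2), ‖k z - κ‖ ≤ κ / 8) →
      (∀ x ∈ Set.Icc (-r) r, HasDerivAt F₁ (((x : ℂ) ^ 2 - t) * k ((x : ℂ) ^ 2)) x) → F₁ 0 = 0 →
      (∀ x ∈ Set.Icc (-r) r, |(F₁ x).im| ≤ L * h) →
      (∀ x ∈ Set.Icc (-r) r, |(cubicPhase (cubicCoeff k t) t x).im| ≤ L * h) →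
      ‖halfPow (k t) * (∫ x in (-r)..r, χ x * osc h (F₁ x)) -
        halfPow (cubicCoeff k t) * ∫ x in (-r)..r, χ x * osc h (cubicPhase (cubicCoeff k t) t x)‖ ≤
        C * (h * h ^ (1 / 3 : ℝ)) := by
  obtain ⟨C₀, hC₀, hdata⟩ := exists_homotopy_data hκ hr
  obtain ⟨C, hC, hdiv⟩ := exists_norm_integral_divisible_le (X := X) (B := Real.exp L) (C₀ := C₀)
    (a₀ := √(2 * κ)) hκ hr hr1 (Real.exp_pos L).le hC₀ (Real.sqrt_nonneg _)
  refine ⟨C, hC, fun χ χ₁ χ₂ χ₃ h t k F₁ H hh ht hk hkκ hF₁ hF₁0 him₁ him₀ => ?_⟩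
  set N := cubicCoeff k t with hN
  have ht9 : t ∈ Metric.ball (0 : ℂ) ((9 * r) ^ 2) := by
    rw [mem_ball_zero_iff]; nlinarith
  have hNκ : ‖N - κ‖ ≤ 3 / 2 * (κ / 8) := norm_cubicCoeff_sub_le hk.continuousOn ht9 hkκ
  set F₀ : ℝ → ℂ := fun x => cubicPhase N t x with hF₀
  set D : ℝ → ℂ := fun x => x * phaseGap k t ((x : ℂ) ^ 2) with hD
  have hsq : ∀ x ∈ Set.Icc (-r) r, (x : ℂ) ^ 2 ∈ Metric.ball (0 : ℂ) ((9 * r) ^ 2) := by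
    intro x hx
    have := abs_le.2 ⟨by linarith [hx.1], hx.2⟩
    rw [mem_ball_zero_iff, norm_pow, norm_real, Real.norm_eq_abs]
    exact pow_lt_pow_left₀ (by linarith) (abs_nonneg _) two_ne_zero
  have hofReal : ∀ x : ℝ, HasDerivAt (fun x : ℝ => (x : ℂ)) 1 x := fun x => by
    simpa using (hasDerivAt_id x).ofReal_comp
  have hF₀d : ∀ x : ℝ, HasDerivAt F₀ (((x : ℂ) ^ 2 - t) * N) x := by
    intro x
    have h1 := ((((hofReal x).fun_pow 3).div_const 3).sub ((hofReal x).const_mul t)).const_mul N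
    refine h1.congr_deriv ?_
    push_cast
    ring
  have hDd : ∀ x ∈ Set.Icc (-r) r, HasDerivAt D (((x : ℂ) ^ 2 - t) * (k ((x : ℂ) ^ 2) - N)) x := by
    intro x hx
    have h1 := (hasDerivAt_phaseGap hk t (hsq x hx)).differentiableAt.hasDerivAt
    have h2 : HasDerivAt (fun x : ℝ => (x : ℂ) ^ 2) (2 * (x : ℂ)) x := by
      simpa using (hofReal x).fun_pow 2
    have h3 := (hofReal x).fun_mul (h1.comp x h2)
    refine h3.congr_deriv ?_
    have := phaseGap_ode hk t (hsq x hx)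
    simp only [Function.comp_apply]
    linear_combination this
  -- Both sides vanish at 0 and have the same derivative.
  have hFD : ∀ x ∈ Set.Icc (-r) r, F₁ x = F₀ x + D x := by
    have h0r : (0 : ℝ) ∈ Set.Icc (-r) r := ⟨by linarith, hr.le⟩
    have hz : ∀ x ∈ Set.Icc (-r) r, HasDerivAt (fun x => F₁ x - (F₀ x + D x)) 0 x := fun x hx => by
      refine ((hF₁ x hx).sub ((hF₀d x).add (hDd x hx))).congr_deriv ?_
      ring
    intro x hx
    have hconst := (convex_Icc (-r) r).norm_image_sub_le_of_norm_hasDerivWithin_le (C := 0)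
      (fun x hx => (hz x hx).hasDerivWithinAt) (fun x _ => by simp) h0r hx
    simp only [zero_mul, norm_le_zero_iff] at hconst
    have e0 : F₁ 0 - (F₀ 0 + D 0) = 0 := by
      rw [hF₁0]; simp [hF₀, hD, cubicPhase]
    rw [e0, sub_zero] at hconst
    exact sub_eq_zero.1 hconst
  -- The homotopy. Its prefactor is the square root of the intermediate kτ at t, and the endpoints τ
  -- = 0, 1 are the two products to be compared.
  set Z : ℝ → ℂ := fun τ => halfPow (N + τ * (k t - N)) *
    ∫ x in (-r)..r, χ x * osc h (F₀ x + τ * D x) with hZ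
  have hF₀c : Continuous F₀ := continuous_iff_continuousAt.2 fun x => (hF₀d x).continuousAt
  have hDc : ContinuousOn D (Set.Icc (-r) r) := fun x hx =>
    (hDd x hx).continuousAt.continuousWithinAt
  have hrr : -r ≤ r := by linarith
  have hu : Set.uIcc (-r) r = Set.Icc (-r) r := Set.uIcc_of_le hrr
  -- Being close to κ is a convex condition, so every intermediate k stays in the right half-plane,
  -- where the logarithm defining `halfPow` is holomorphic.
  have hkτκ : ∀ τ ∈ Set.Icc (0 : ℝ) 1, ∀ z ∈ Metric.ball (0 : ℂ) ((9 * r) ^ 2),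
      ‖N + τ * (k z - N) - κ‖ ≤ 3 / 2 * (κ / 8) := by
    intro τ hτ z hz
    have e : N + τ * (k z - N) - κ = ((1 - τ : ℝ) : ℂ) * (N - κ) + (τ : ℂ) * (k z - κ) := by
      push_cast; ring
    rw [e]
    refine (norm_add_le _ _).trans ?_
    rw [norm_mul, norm_mul, norm_real, norm_real, Real.norm_eq_abs, Real.norm_eq_abs,
      abs_of_nonneg hτ.1, abs_of_nonneg (by linarith [hτ.2])]
    have := hkκ z hz
    nlinarith [hτ.1, hτ.2]
  have hZd : ∀ τ ∈ Set.Icc (0 : ℝ) 1, ∃ Z' : ℂ, HasDerivAt Z Z' τ ∧ ‖Z'‖ ≤ C * (h * h ^ (1 / 3 : ℝ)) := by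
    intro τ hτ
    set kτ : ℂ → ℂ := fun w => N + τ * (k w - N) with hkτ
    have hkτb : HolBdd ((9 * r) ^ 2) (2 * κ) kτ := ⟨by fun_prop, fun z hz =>
      (norm_le_of_norm_sub_le hκ.le (hkτκ τ hτ z hz)).trans (by linarith)⟩
    have hkτc : ∀ z ∈ Metric.ball (0 : ℂ) ((9 * r) ^ 2), κ / 2 ≤ ‖kτ z‖ := fun z hz =>
      le_trans (by linarith) (le_norm_of_norm_sub_le (hkτκ τ hτ z hz))
    have hre : 0 < (kτ t).re := re_pos_of_norm_sub_le (hkτκ τ hτ t ht9) (by linarith)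
    have hkt0 : kτ t ≠ 0 := fun h0 => by rw [h0] at hre; simp at hre
    set a := halfPow (kτ t) with ha
    have ha2 : a ^ 2 = kτ t := halfPow_sq hkt0
    have han : ‖a‖ ≤ √(2 * κ) := Real.le_sqrt_of_sq_le (by
      rw [← norm_pow, ha2]; exact hkτb.bdd t ht9)
    obtain ⟨c, b₁, b₂, hc, hb₁, hb₂, hid⟩ := hdata k t kτ a hk hkκ ht hkτb hkτc ha2
    set F : ℝ → ℂ := fun x => F₀ x + τ * D x with hF
    set F' : ℝ → ℂ := fun x => ((x : ℂ) ^ 2 - t) * kτ ((x : ℂ) ^ 2) with hF'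
    have hFd : ∀ x ∈ Set.Icc (-r) r, HasDerivAt F (F' x) x := fun x hx => by
      refine ((hF₀d x).add ((hDd x hx).const_mul (τ : ℂ))).congr_deriv ?_
      simp only [hF', hkτ]; ring
    have hosc : ∀ x ∈ Set.Icc (-r) r, ‖osc h (F x)‖ ≤ Real.exp L := fun x hx => by
      refine norm_osc_le hh ?_
      have e : F x = ((1 - τ : ℝ) : ℂ) * F₀ x + (τ : ℂ) * F₁ x := by
        rw [hFD x hx, hF]; push_cast; ring
      rw [e, add_im, im_ofReal_mul, im_ofReal_mul]
      refine (abs_add_le _ _).trans ?_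
      rw [abs_mul, abs_mul, abs_of_nonneg hτ.1, abs_of_nonneg (by linarith [hτ.2])]
      have h1 := him₀ x hx
      have h2 := him₁ x hx
      have e1 : (1 - τ) * |(F₀ x).im| ≤ (1 - τ) * (L * h) :=
        mul_le_mul_of_nonneg_left h1 (by linarith [hτ.2])
      have e2 : τ * |(F₁ x).im| ≤ τ * (L * h) := mul_le_mul_of_nonneg_left h2 hτ.1
      linarith
    have hmem3 : ∀ x ∈ Set.Icc (-r) r, (x : ℂ) ∈ Metric.ball (0 : ℂ) (3 * r) := by
      intro x hx
      have := abs_le.2 ⟨by linarith [hx.1], hx.2⟩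
      rw [mem_ball_zero_iff, norm_real, Real.norm_eq_abs]
      linarith
    have hcd : ∀ x ∈ Set.Icc (-r) r, HasDerivAt (fun x : ℝ => c x) (deriv c x) x := fun x hx =>
      ((hc.differentiableAt (Metric.isOpen_ball.mem_nhds (hmem3 x hx))).hasDerivAt).comp_ofReal
    have hcc : ContinuousOn (fun x : ℝ => c x) (Set.Icc (-r) r) := fun x hx =>
      (hcd x hx).continuousAt.continuousWithinAt
    have hcdc : ContinuousOn (fun x : ℝ => deriv c x) (Set.Icc (-r) r) :=
      (hc.deriv Metric.isOpen_ball).continuousOn.comp (by fun_prop) hmem3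
    have hFcont : ContinuousOn F (Set.Icc (-r) r) := fun x hx =>
      (hFd x hx).continuousAt.continuousWithinAt
    have hoscc : ContinuousOn (fun x => osc h (F x)) (Set.Icc (-r) r) :=
      (continuous_osc h).comp_continuousOn hFcont
    have hF'c : ContinuousOn F' (Set.Icc (-r) r) :=
      ContinuousOn.mul (by fun_prop) (hkτb.diff.continuousOn.comp (by fun_prop) hsq)
    have hDeriv : HasDerivAt (fun τ : ℝ => ∫ x in (-r)..r, χ x * osc h (F₀ x + τ * D x))
        (∫ x in (-r)..r, χ x * (I / h * D x * osc h (F₀ x + τ * D x))) τ := by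
      refine hasDerivAt_intervalIntegral_param hrr (f := fun θ x => χ x * osc h (F₀ x + θ * D x))
        (f' := fun θ x => χ x * (I / h * D x * osc h (F₀ x + θ * D x))) (fun θ x hx => ?_)
        (fun θ => ?_) ?_ τ
      · have h1 : HasDerivAt (fun θ : ℝ => F₀ x + (θ : ℂ) * D x) (D x) θ := by
          simpa using (((hofReal θ).mul_const (D x)).const_add (F₀ x))
        exact (hasDerivAt_osc h1).const_mul (χ x)
      · exact H.cont₀.continuousOn.mul ((continuous_osc h).comp_continuousOn
          (hF₀c.continuousOn.add (continuousOn_const.mul hDc)))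
      · have hD2 : ContinuousOn (fun p : ℝ × ℝ => D p.2) (Set.univ ×ˢ Set.Icc (-r) r) :=
          hDc.comp (by fun_prop) fun p hp => hp.2
        have hF2 : ContinuousOn (fun p : ℝ × ℝ => F₀ p.2) (Set.univ ×ˢ Set.Icc (-r) r) :=
          (hF₀c.comp continuous_snd).continuousOn
        have hχ2 : ContinuousOn (fun p : ℝ × ℝ => χ p.2) (Set.univ ×ˢ Set.Icc (-r) r) :=
          (H.cont₀.comp continuous_snd).continuousOn
        have hθ2 : ContinuousOn (fun p : ℝ × ℝ => (p.1 : ℂ)) (Set.univ ×ˢ Set.Icc (-r) r) := by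
          fun_prop
        exact hχ2.mul ((continuousOn_const.mul hD2).mul
          ((continuous_osc h).comp_continuousOn (hF2.add (hθ2.mul hD2))))
    refine ⟨_, (hasDerivAt_halfPow_affine hre).mul hDeriv, ?_⟩
    have hmain := hdiv χ χ₁ χ₂ χ₃ h t a kτ b₁ b₂ F H hh ht han hkτb hkτc hb₁ hb₂ hFd hosc
    refine le_trans (le_of_eq ?_) hmain
    congr 1
    change (k t - N) / (2 * a) * (∫ x in (-r)..r, χ x * osc h (F x)) +
      a * (∫ x in (-r)..r, χ x * (I / h * D x * osc h (F x))) = _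
    have hibp := integral_ibp_osc (α := -r) (β := r) (h := h) hh.ne' (g := fun x => χ x * c x)
      (g' := fun x => χ₁ x * c x + χ x * deriv c x) (F := F) (F' := F')
      (by rw [hu]; exact fun x hx => (H.deriv₁ x).mul (hcd x hx)) (by rwa [hu])
      (by rw [hu]; exact (H.cont₁.continuousOn.mul hcc).add (H.cont₀.continuousOn.mul hcdc))
      (by rwa [hu])
    have hz1 : χ r = 0 := H.zero₀ r (le_abs_self r)
    have hz2 : χ (-r) = 0 := H.zero₀ (-r) (by rw [abs_neg]; exact le_abs_self r)
    simp only [hz1, hz2, zero_mul, sub_zero, zero_sub] at hibp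
    have hh' : (h : ℂ) ≠ 0 := by exact_mod_cast hh.ne'
    -- The factor 1/h is removed by writing D = c F' and integrating by parts once. What remains has
    -- size O(1) a priori; it gains h · h^{1/3} because its amplitude is again a multiple of F'.
    have e1 : (∫ x in (-r)..r, χ x * (I / h * D x * osc h (F x))) =
        -∫ x in (-r)..r, (χ₁ x * c x + χ x * deriv c x) * osc h (F x) := by
      have e2 : (∫ x in (-r)..r, χ x * (I / h * D x * osc h (F x))) =
          I / h * ∫ x in (-r)..r, χ x * c x * F' x * osc h (F x) := by
        rw [← intervalIntegral.integral_const_mul]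
        refine intervalIntegral.integral_congr fun x hx => ?_
        rw [hu] at hx
        have := (hid x (hmem3 x hx)).1
        simp only [hD, hF']
        rw [this]; ring
      rw [e2, hibp]
      field_simp
    rw [e1, mul_neg, ← sub_eq_add_neg, ← intervalIntegral.integral_const_mul,
      ← intervalIntegral.integral_const_mul, ← intervalIntegral.integral_sub]
    · refine intervalIntegral.integral_congr fun x hx => ?_
      rw [hu] at hx
      obtain ⟨-, h2, h3⟩ := hid x (hmem3 x hx)
      linear_combination (χ x * osc h (F x)) * h2 - a * χ₁ x * osc h (F x) * h3
    · refine ContinuousOn.intervalIntegrable ?_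
      rw [hu]; exact continuousOn_const.mul (H.cont₀.continuousOn.mul hoscc)
    · refine ContinuousOn.intervalIntegrable ?_
      rw [hu]; exact continuousOn_const.mul (((H.cont₁.continuousOn.mul hcc).add
        (H.cont₀.continuousOn.mul hcdc)).mul hoscc)
  choose! Z' hZ1 hZ2 using hZd
  have hfin := norm_image_sub_le_of_norm_deriv_le_segment_01' (f := Z) (f' := Z')
    (fun τ hτ => (hZ1 τ hτ).hasDerivWithinAt) (fun τ hτ => hZ2 τ ⟨hτ.1, hτ.2.le⟩)
  have e1 : Z 1 = halfPow (k t) * ∫ x in (-r)..r, χ x * osc h (F₁ x) := by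
    simp only [hZ, ofReal_one, one_mul]
    congr 1
    · congr 1; ring
    · refine intervalIntegral.integral_congr fun x hx => ?_
      rw [hu] at hx
      simp only [hFD x hx]
  have e0 : Z 0 = halfPow N * ∫ x in (-r)..r, χ x * osc h (F₀ x) := by
    simp only [hZ, ofReal_zero, zero_mul, add_zero]
  rw [← e1, ← e0]
  exact hfin

/-! ### The Airy function as a local oscillatory integral -/

/-- The Airy phase `z³/3 + ξ z`. -/
def airyPhase (ξ z : ℂ) : ℂ := z ^ 3 / 3 + ξ * z

theorem continuous_airyPhase (ξ : ℂ) : Continuous (airyPhase ξ) := by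
  unfold airyPhase; fun_prop

theorem hasDerivAt_airyPhase (ξ z : ℂ) : HasDerivAt (airyPhase ξ) (z ^ 2 + ξ) z := by
  have h1 := (((hasDerivAt_id z).fun_pow 3).div_const 3).add ((hasDerivAt_id z).const_mul ξ)
  refine h1.congr_deriv ?_
  simp only [id_eq]
  push_cast
  ring

theorem airyPhase_im (ξ : ℂ) (a b : ℝ) : (airyPhase ξ (a + b * I)).im =
    (a ^ 2 + ξ.re) * b - b ^ 3 / 3 + ξ.im * a := by
  have e : ((a : ℂ) + b * I) ^ 3 / 3 =
      (((a ^ 3 - 3 * a * b ^ 2) / 3 : ℝ) : ℂ) + (((3 * a ^ 2 * b - b ^ 3) / 3 : ℝ) : ℂ) * I := by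
    push_cast
    linear_combination ((a : ℂ) * b ^ 2 + (b : ℂ) ^ 3 * I / 3) * I_sq
  rw [airyPhase, add_im, e]
  simp only [add_im, mul_im, add_re, mul_re, ofReal_re, ofReal_im, I_re, I_im]
  ring

theorem integrable_airy_line (y : ℂ) :
    Integrable fun t : ℝ => exp (I * (((t : ℂ) + I) ^ 3 / 3 + y * (t + I))) := by
  refine (integrable_genAiry 1 le_rfl y).congr (Eventually.of_forall fun t => ?_)
  simp only
  rw [genAiryPhase_eq_sum]
  simp [Finset.sum_range_succ]
  ring_nf

theorem rpow_third_pow {h : ℝ} (hh : 0 < h) : (h ^ (1 / 3 : ℝ)) ^ 3 = h := by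
  rw [← Real.rpow_natCast, ← Real.rpow_mul hh.le]; norm_num

theorem rpow_neg_two_thirds {h : ℝ} (hh : 0 < h) :
    h ^ (-(2 / 3) : ℝ) = ((h ^ (1 / 3 : ℝ)) ^ 2)⁻¹ := by
  rw [Real.rpow_neg hh.le, ← Real.rpow_natCast, ← Real.rpow_mul hh.le]; norm_num

theorem airy_scaled_phase {h m : ℝ} (hh : 0 < h) (ξ : ℂ) (η : ℝ) :
    exp (I * ((((m / h ^ (1 / 3 : ℝ) * η : ℝ) : ℂ) + I) ^ 3 / 3 +
      ((h ^ (-(2 / 3) : ℝ) : ℝ) : ℂ) * ξ * (((m / h ^ (1 / 3 : ℝ) * η : ℝ) : ℂ) + I))) =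
      osc h (airyPhase ξ (m * η + (h ^ (1 / 3 : ℝ) : ℝ) * I)) := by
  have hl3 := rpow_third_pow hh
  rw [rpow_neg_two_thirds hh]
  have hl0 : h ^ (1 / 3 : ℝ) ≠ 0 := (Real.rpow_pos_of_pos hh _).ne'
  set l := h ^ (1 / 3 : ℝ)
  have hl0' : (l : ℂ) ≠ 0 := by exact_mod_cast hl0
  rw [osc, ← hl3, airyPhase]
  congr 1
  push_cast
  field_simp

theorem airy_eq_scaled {h m : ℝ} (hh : 0 < h) (hm : 0 < m) (ξ : ℂ) :
    2 * (Real.pi : ℂ) * (h ^ (1 / 3 : ℝ) : ℝ) * airyAi (((h ^ (-(2 / 3) : ℝ) : ℝ) : ℂ) * ξ) =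
      m * ∫ η : ℝ, osc h (airyPhase ξ (m * η + (h ^ (1 / 3 : ℝ) : ℝ) * I)) := by
  have hl0 : 0 < h ^ (1 / 3 : ℝ) := Real.rpow_pos_of_pos hh _
  have key := Measure.integral_comp_mul_left (fun t : ℝ => exp (I * (((t : ℂ) + I) ^ 3 / 3 +
    ((h ^ (-(2 / 3) : ℝ) : ℝ) : ℂ) * ξ * (t + I)))) (m / h ^ (1 / 3 : ℝ))
  simp_rw [airy_scaled_phase hh] at key
  rw [key, airyAi, abs_of_nonneg (by positivity), real_smul]
  have hl0' : ((h ^ (1 / 3 : ℝ) : ℝ) : ℂ) ≠ 0 := by exact_mod_cast hl0.ne'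
  have hm' : (m : ℂ) ≠ 0 := by exact_mod_cast hm.ne'
  have hpi : (Real.pi : ℂ) ≠ 0 := by exact_mod_cast Real.pi_ne_zero
  push_cast
  field_simp

theorem integrable_airy_scaled {h m : ℝ} (hh : 0 < h) (hm : 0 < m) (ξ : ℂ) :
    Integrable fun η : ℝ => osc h (airyPhase ξ (m * η + (h ^ (1 / 3 : ℝ) : ℝ) * I)) := by
  have hl0 : 0 < h ^ (1 / 3 : ℝ) := Real.rpow_pos_of_pos hh _
  have := (integrable_airy_line (((h ^ (-(2 / 3) : ℝ) : ℝ) : ℂ) * ξ)).comp_mul_left'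
    (R := m / h ^ (1 / 3 : ℝ)) (by positivity)
  refine this.congr (Eventually.of_forall fun η => ?_)
  exact airy_scaled_phase hh ξ η

theorem exp_neg_le_two_div_sq {x : ℝ} (hx : 0 < x) : Real.exp (-x) ≤ 2 / x ^ 2 := by
  have h := Real.quadratic_le_exp_of_nonneg hx.le
  rw [Real.exp_neg, inv_le_comm₀ (Real.exp_pos x) (by positivity), inv_div]
  nlinarith

/-- On the line Im z = l the gain (a² + Re ξ) l / h is at least a² / (2 l²), because h = l³. Half of
it pays for the imaginary part of ξ, via L |a| ≤ a²/4 + L² and l ≤ 1. -/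
theorem airy_exponent_le {a l h L : ℝ} {ξ : ℂ} (hh : 0 < h) (hl0 : 0 < l) (hl1 : l ≤ 1)
    (hl3 : l ^ 3 = h) (hξr : -(a ^ 2 / 2) ≤ ξ.re) (hξi : |ξ.im| ≤ L * h) :
    -((a ^ 2 + ξ.re) * l - l ^ 3 / 3 + ξ.im * a) / h ≤
      (1 / 3 + L ^ 2) + -(a ^ 2 / (4 * l ^ 2)) := by
  rw [div_le_iff₀ hh]
  have i1 : -(ξ.im * a) ≤ L * h * |a| := by
    have h1 := abs_mul ξ.im a
    have h2 := neg_abs_le (ξ.im * a)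
    have h3 := mul_le_mul_of_nonneg_right hξi (abs_nonneg a)
    linarith
  have i2 : L * |a| ≤ a ^ 2 / 4 + L ^ 2 := by
    have h1 := sq_nonneg (|a| / 2 - L)
    have h2 := sq_abs a
    have h3 : (|a| / 2 - L) ^ 2 = |a| ^ 2 / 4 - L * |a| + L ^ 2 := by ring
    linarith
  have i3 : L * h * |a| ≤ h * (a ^ 2 / 4 + L ^ 2) := by
    have := mul_le_mul_of_nonneg_left i2 hh.le
    linarith
  have i4 : a ^ 2 / (4 * l ^ 2) * h = a ^ 2 * l / 4 := by
    rw [← hl3]; field_simp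
  have i5 : h ≤ l := by
    rw [← hl3]
    calc l ^ 3 ≤ l ^ 1 := pow_le_pow_of_le_one hl0.le hl1 (by norm_num)
      _ = l := pow_one l
  have i6 : h * a ^ 2 ≤ l * a ^ 2 := mul_le_mul_of_nonneg_right i5 (sq_nonneg a)
  have i7 : -(a ^ 2 / 2) * l ≤ ξ.re * l := mul_le_mul_of_nonneg_right hξr hl0.le
  rw [add_mul, add_mul, neg_mul, i4, hl3]
  linarith

/-- The part of the shifted Airy integral away from the origin is negligible. -/
theorem exists_norm_airy_tail_le {r X L m₀ : ℝ} (hr : 0 < r) (hm₀ : 0 < m₀) : ∃ C, 0 ≤ C ∧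
    ∀ (χ χ₁ χ₂ χ₃ : ℝ → ℂ) (h m : ℝ) (ξ : ℂ), IsCutoff r X χ χ₁ χ₂ χ₃ → 0 < h → h ≤ 1 → m₀ ≤ m →
      ‖ξ‖ ≤ m₀ ^ 2 * r ^ 2 / 16 → |ξ.im| ≤ L * h →
      ‖(∫ η : ℝ, osc h (airyPhase ξ (m * η + (h ^ (1 / 3 : ℝ) : ℝ) * I))) -
        ∫ η in (-r)..r, χ η * osc h (airyPhase ξ (m * η + (h ^ (1 / 3 : ℝ) : ℝ) * I))‖ ≤
        C * (h * h ^ (1 / 3 : ℝ)) := by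
  rcases lt_or_ge X 0 with hX | hX
  · exact ⟨0, le_rfl, fun χ χ₁ χ₂ χ₃ h m ξ H => absurd H.nonneg (not_le.2 hX)⟩
  set C₁ : ℝ := (1 + X) * (Real.exp (1 / 3 + L ^ 2) * (32 / m₀ ^ 4 * ((4 / r ^ 2) * (1 + 4 / r ^ 2)))) with hC₁
  have hC₁0 : 0 ≤ C₁ := by positivity
  refine ⟨C₁ * Real.pi, by positivity, fun χ χ₁ χ₂ χ₃ h m ξ H hh hh1 hm hξ hξi => ?_⟩
  have hm0 : 0 < m := hm₀.trans_le hm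
  set l : ℝ := h ^ (1 / 3 : ℝ) with hl
  have hl0 : 0 < l := Real.rpow_pos_of_pos hh _
  have hl3 : l ^ 3 = h := rpow_third_pow hh
  have hl1 : l ≤ 1 := Real.rpow_le_one hh.le hh1 (by norm_num)
  set f : ℝ → ℂ := fun η => osc h (airyPhase ξ (m * η + (l : ℝ) * I)) with hf
  have hfi : Integrable f := integrable_airy_scaled hh hm0 ξ
  have hχf : Integrable fun η => χ η * f η := by
    refine (hfi.bdd_mul (c := X) H.cont₀.aestronglyMeasurable (Eventually.of_forall H.bdd₀))
  have e1 : ∫ η in (-r)..r, χ η * f η = ∫ η, χ η * f η := by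
    rw [intervalIntegral.integral_of_le (by linarith)]
    refine setIntegral_eq_integral_of_forall_compl_eq_zero fun x hx => ?_
    have : r ≤ |x| := by
      by_contra hcon
      rw [not_le, abs_lt] at hcon
      exact hx ⟨hcon.1, hcon.2.le⟩
    rw [H.zero₀ x this, zero_mul]
  rw [e1, ← integral_sub hfi hχf]
  have hb : ∀ η : ℝ, ‖f η - χ η * f η‖ ≤ C₁ * (h * l) * (1 + η ^ 2)⁻¹ := by
    intro η
    rcases le_total |η| (r / 2) with hη | hη
    · rw [H.one η hη, one_mul, sub_self, norm_zero]; positivity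
    · have hη2 : r ^ 2 / 4 ≤ η ^ 2 := by
        have := pow_le_pow_left₀ (by positivity) hη 2
        rw [sq_abs] at this
        linarith [show (r / 2) ^ 2 = r ^ 2 / 4 by ring]
      have hη0 : 0 < η ^ 2 := lt_of_lt_of_le (by positivity) hη2
      have e2 : f η - χ η * f η = (1 - χ η) * f η := by ring
      rw [e2, norm_mul]
      have b1 : ‖1 - χ η‖ ≤ 1 + X := (norm_sub_le _ _).trans (by
        rw [norm_one]; linarith [H.bdd₀ η])
      set a := m * η with ha
      have ha2 : m₀ ^ 2 * η ^ 2 ≤ a ^ 2 := by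
        rw [ha, mul_pow]; gcongr
      have hξr : -(a ^ 2 / 2) ≤ ξ.re := by
        have h1 := (abs_le.1 ((abs_re_le_norm ξ).trans hξ)).1
        have : m₀ ^ 2 * (r ^ 2 / 4) ≤ m₀ ^ 2 * η ^ 2 := by gcongr
        nlinarith
      have ha0 : 0 < a ^ 2 := lt_of_lt_of_le (by positivity) ha2
      have b2 : ‖f η‖ ≤ Real.exp (1 / 3 + L ^ 2) * (32 / m₀ ^ 4 * ((4 / r ^ 2) * (1 + 4 / r ^ 2))) *
          (h * l) * (1 + η ^ 2)⁻¹ := by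
        have e3 : f η = osc h (airyPhase ξ ((a : ℝ) + (l : ℝ) * I)) := by
          simp only [hf, ha]; push_cast; rfl
        rw [e3, norm_osc, airyPhase_im]
        have e4 := airy_exponent_le hh hl0 hl1 hl3 hξr hξi
        refine (Real.exp_le_exp.2 e4).trans ?_
        rw [Real.exp_add, mul_assoc (Real.exp (1 / 3 + L ^ 2)), mul_assoc (Real.exp (1 / 3 + L ^ 2))]
        refine mul_le_mul_of_nonneg_left ?_ (Real.exp_pos _).le
        refine (exp_neg_le_two_div_sq (by positivity)).trans ?_
        -- The quadratic bound for the exponential is enough: l⁴ = h l is precisely the order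
        -- wanted, and a⁻⁴ gives integrability in η.
        have e5 : 2 / (a ^ 2 / (4 * l ^ 2)) ^ 2 = 32 * (h * l) / (a ^ 2) ^ 2 := by
          rw [← hl3]; field_simp; ring
        rw [e5]
        have e6 : 32 * (h * l) / (a ^ 2) ^ 2 ≤ 32 * (h * l) / (m₀ ^ 2 * η ^ 2) ^ 2 := by
          refine div_le_div_of_nonneg_left (by positivity) (by positivity) ?_
          exact pow_le_pow_left₀ (by positivity) ha2 2
        refine e6.trans ?_
        have e7 : (η ^ 2)⁻¹ ≤ 4 / r ^ 2 := by
          rw [inv_le_comm₀ hη0 (by positivity), inv_div]; linarith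
        have e8 : (η ^ 2)⁻¹ ≤ (1 + 4 / r ^ 2) * (1 + η ^ 2)⁻¹ := by
          rw [← div_eq_mul_inv, le_div_iff₀ (by positivity)]
          have : (η ^ 2)⁻¹ * (1 + η ^ 2) = (η ^ 2)⁻¹ + 1 := by
            rw [mul_add, mul_one, inv_mul_cancel₀ hη0.ne']
          linarith
        have e9 : 32 * (h * l) / (m₀ ^ 2 * η ^ 2) ^ 2 =
            32 / m₀ ^ 4 * (h * l) * ((η ^ 2)⁻¹ * (η ^ 2)⁻¹) := by
          field_simp
        rw [e9]
        calc 32 / m₀ ^ 4 * (h * l) * ((η ^ 2)⁻¹ * (η ^ 2)⁻¹)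
            ≤ 32 / m₀ ^ 4 * (h * l) * (4 / r ^ 2 * ((1 + 4 / r ^ 2) * (1 + η ^ 2)⁻¹)) := by gcongr
          _ = _ := by ring
      calc ‖1 - χ η‖ * ‖f η‖ ≤ (1 + X) * (Real.exp (1 / 3 + L ^ 2) *
            (32 / m₀ ^ 4 * ((4 / r ^ 2) * (1 + 4 / r ^ 2))) * (h * l) * (1 + η ^ 2)⁻¹) :=
          mul_le_mul b1 b2 (norm_nonneg _) (by positivity)
        _ = _ := by rw [hC₁]; ring
  refine (norm_integral_le_of_norm_le (integrable_inv_one_add_sq.const_mul _)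
    (Eventually.of_forall hb)).trans ?_
  rw [integral_const_mul, integral_univ_inv_one_add_sq]
  exact le_of_eq (by ring)

/-- Integration by parts where the cut-off varies, on a complex contour close to the real axis. -/
theorem norm_integral_cutoff_deriv_le {r X L m₀ m₁ h l α β b : ℝ} {χ χ₁ χ₂ χ₃ : ℝ → ℂ} {μ ν ξ : ℂ}
    (H : IsCutoff r X χ χ₁ χ₂ χ₃) (hr : 0 < r) (hm₀ : 0 < m₀) (hL : 0 ≤ L) (hh : 0 < h) (hl : 0 < l)
    (hl1 : l ≤ 1) (hl3 : l ^ 3 = h) (hm : m₀ ≤ μ.re) (hm' : μ.re ≤ m₁) (hμ : |μ.im| ≤ L * h)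
    (hν : ‖ν‖ ≤ L * h) (hb0 : 0 ≤ b) (hbl : b ≤ l)
    (hls : (L * r + 1) ^ 2 * l ^ 2 ≤ m₀ ^ 2 * r ^ 2 / 16)
    (hξ : ‖ξ‖ ≤ m₀ ^ 2 * r ^ 2 / 16) (hξi : |ξ.im| ≤ L * h) (hαβ : α ≤ β) (hlen : β - α ≤ r)
    (hI : ∀ x ∈ Set.Icc α β, r / 2 ≤ |x| ∧ |x| ≤ r) (hα : χ₁ α = 0) (hβ : χ₁ β = 0) :
    ‖∫ x in α..β, χ₁ x * (ν * x + l * I) * osc h (airyPhase ξ (μ * x + b * I))‖ ≤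
      h * l * (Real.exp ((m₁ ^ 2 + m₀ ^ 2) * r ^ 2 * (L * r) + (L * r + 1) ^ 3 / 3 + L * (m₁ * r)) *
        (r * ((X * (L * r + 1) + X * L) / (m₀ ^ 2 * r ^ 2 / 8 * m₀) +
          X * (L * r + 1) * (2 * ((m₁ + L) * r + 1) * (m₁ + L) ^ 2) /
            (m₀ ^ 2 * r ^ 2 / 8 * m₀) ^ 2))) := by
  have hX := H.nonneg
  have hm₁ : 0 < m₁ := hm₀.trans_le (hm.trans hm')
  have hhl : h ≤ l := by
    rw [← hl3]
    calc l ^ 3 ≤ l ^ 1 := pow_le_pow_of_le_one hl.le hl1 (by norm_num)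
      _ = l := pow_one l
  set ζ : ℝ → ℂ := fun x => μ * x + b * I with hζ
  have hζre : ∀ x, (ζ x).re = μ.re * x := fun x => by simp [hζ]
  have hζim : ∀ x, (ζ x).im = μ.im * x + b := fun x => by simp [hζ]
  have hζeq : ∀ x, ζ x = ((μ.re * x : ℝ) : ℂ) + ((μ.im * x + b : ℝ) : ℂ) * I := fun x => by
    apply Complex.ext <;> simp [hζ]
  have him : ∀ x ∈ Set.Icc α β, |μ.im * x| ≤ L * r * h := fun x hx => by
    rw [abs_mul]
    calc |μ.im| * |x| ≤ L * h * r := mul_le_mul hμ (hI x hx).2 (abs_nonneg _) (by positivity)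
      _ = _ := by ring
  have hLrh : L * r * h ≤ L * r * l := mul_le_mul_of_nonneg_left hhl (by positivity)
  have hbd : ∀ x ∈ Set.Icc α β, |μ.im * x + b| ≤ (L * r + 1) * l := fun x hx => by
    refine (abs_add_le _ _).trans ?_
    rw [abs_of_nonneg hb0]
    linarith [him x hx]
  have hre2 : ∀ x ∈ Set.Icc α β, m₀ ^ 2 * r ^ 2 / 4 ≤ (μ.re * x) ^ 2 := fun x hx => by
    rw [mul_pow, ← sq_abs x]
    have h1 : (r / 2) ^ 2 ≤ |x| ^ 2 := pow_le_pow_left₀ (by positivity) (hI x hx).1 2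
    calc m₀ ^ 2 * r ^ 2 / 4 = m₀ ^ 2 * (r / 2) ^ 2 := by ring
      _ ≤ μ.re ^ 2 * |x| ^ 2 := by gcongr
  have hre3 : ∀ x ∈ Set.Icc α β, (μ.re * x) ^ 2 ≤ m₁ ^ 2 * r ^ 2 := fun x hx => by
    rw [mul_pow, ← sq_abs x]
    have := (hI x hx).2
    have : 0 ≤ μ.re := hm₀.le.trans hm
    gcongr
  have hξr := abs_le.1 ((abs_re_le_norm ξ).trans hξ)
  have hmr : 0 < m₀ ^ 2 * r ^ 2 := by positivity
  -- Where the cut-off varies, |x| ≥ r/2 and ξ is small, so the contour stays away from the critical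
  -- points.
  have hG' : ∀ x ∈ Set.Icc α β, m₀ ^ 2 * r ^ 2 / 8 ≤ ‖ζ x ^ 2 + ξ‖ := fun x hx => by
    refine le_trans ?_ (re_le_norm _)
    have e : (ζ x ^ 2 + ξ).re = (μ.re * x) ^ 2 - (μ.im * x + b) ^ 2 + ξ.re := by
      rw [add_re, pow_two, mul_re, hζre, hζim]; ring
    rw [e]
    have h1 : (μ.im * x + b) ^ 2 ≤ (L * r + 1) ^ 2 * l ^ 2 := by
      rw [← mul_pow, ← sq_abs]
      exact pow_le_pow_left₀ (abs_nonneg _) (hbd x hx) 2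
    linarith [hre2 x hx, hξr.1]
  have hμn : ‖μ‖ ≤ m₁ + L := by
    refine (norm_le_abs_re_add_abs_im μ).trans ?_
    rw [abs_of_nonneg (hm₀.le.trans hm)]
    have : L * h ≤ L * 1 := mul_le_mul_of_nonneg_left (hhl.trans hl1) hL
    linarith
  have hμn' : m₀ ≤ ‖μ‖ := hm.trans (re_le_norm μ)
  have hζn : ∀ x ∈ Set.Icc α β, ‖ζ x‖ ≤ (m₁ + L) * r + 1 := fun x hx => by
    refine (norm_add_le _ _).trans ?_
    rw [norm_mul, norm_mul, norm_I, norm_real, norm_real, Real.norm_eq_abs, Real.norm_eq_abs,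
      abs_of_nonneg hb0]
    have : ‖μ‖ * |x| ≤ (m₁ + L) * r := mul_le_mul hμn (hI x hx).2 (abs_nonneg _) (by positivity)
    linarith
  have hofReal : ∀ x : ℝ, HasDerivAt (fun x : ℝ => (x : ℂ)) 1 x := fun x => by
    simpa using (hasDerivAt_id x).ofReal_comp
  have hζd : ∀ x : ℝ, HasDerivAt ζ μ x := fun x => by
    exact (((hofReal x).const_mul μ).add_const ((b : ℂ) * I)).congr_deriv (mul_one μ)
  set F : ℝ → ℂ := fun x => airyPhase ξ (ζ x) with hF
  set F' : ℝ → ℂ := fun x => (ζ x ^ 2 + ξ) * μ with hF'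
  set F'' : ℝ → ℂ := fun x => 2 * ζ x * μ * μ with hF''
  have hFd : ∀ x : ℝ, HasDerivAt F (F' x) x := fun x =>
    (hasDerivAt_airyPhase ξ (ζ x)).comp x (hζd x)
  have hF'd : ∀ x : ℝ, HasDerivAt F' (F'' x) x := fun x => by
    refine ((((hζd x).fun_pow 2).add_const ξ).mul_const μ).congr_deriv ?_
    simp [hF'']
  set c₀ : ℝ := m₀ ^ 2 * r ^ 2 / 8 * m₀ with hc₀
  have hc₀0 : 0 < c₀ := by positivity
  have hF'low : ∀ x ∈ Set.Icc α β, c₀ ≤ ‖F' x‖ := fun x hx => by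
    rw [hF']; simp only
    rw [norm_mul]
    exact mul_le_mul (hG' x hx) hμn' hm₀.le (norm_nonneg _)
  have hF'0 : ∀ x ∈ Set.Icc α β, F' x ≠ 0 := fun x hx => norm_pos_iff.1 (hc₀0.trans_le (hF'low x hx))
  set B : ℝ → ℂ := fun x => ν * x + l * I with hB
  have hBd : ∀ x : ℝ, HasDerivAt B ν x := fun x => by
    exact (((hofReal x).const_mul ν).add_const ((l : ℂ) * I)).congr_deriv (mul_one ν)
  have hBn : ∀ x ∈ Set.Icc α β, ‖B x‖ ≤ (L * r + 1) * l := fun x hx => by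
    refine (norm_add_le _ _).trans ?_
    rw [norm_mul, norm_mul, norm_I, norm_real, norm_real, Real.norm_eq_abs, Real.norm_eq_abs,
      abs_of_pos hl]
    have : ‖ν‖ * |x| ≤ L * h * r := mul_le_mul hν (hI x hx).2 (abs_nonneg _) (by positivity)
    linarith
  set g : ℝ → ℂ := fun x => χ₁ x * B x / F' x with hg
  set g' : ℝ → ℂ := fun x => ((χ₂ x * B x + χ₁ x * ν) * F' x - χ₁ x * B x * F'' x) / F' x ^ 2 with hg'
  have hgd : ∀ x ∈ Set.Icc α β, HasDerivAt g (g' x) x := fun x hx =>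
    ((H.deriv₂ x).mul (hBd x)).div (hF'd x) (hF'0 x hx)
  have hFc : Continuous F' := continuous_iff_continuousAt.2 fun x => (hF'd x).continuousAt
  have hζc : Continuous ζ := continuous_iff_continuousAt.2 fun x => (hζd x).continuousAt
  have hBc : Continuous B := continuous_iff_continuousAt.2 fun x => (hBd x).continuousAt
  have hF''c : Continuous F'' := by simp only [hF'']; fun_prop
  have hg'c : ContinuousOn g' (Set.Icc α β) := by
    have h1 := H.cont₁
    have h2 := H.cont₂
    exact ContinuousOn.div (by fun_prop) (by fun_prop) fun x hx => pow_ne_zero 2 (hF'0 x hx)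
  have hosc : ∀ x ∈ Set.Icc α β, ‖osc h (F x)‖ ≤
      Real.exp ((m₁ ^ 2 + m₀ ^ 2) * r ^ 2 * (L * r) + (L * r + 1) ^ 3 / 3 + L * (m₁ * r)) := by
    intro x hx
    rw [norm_osc]
    apply Real.exp_le_exp.2
    rw [div_le_iff₀ hh]
    simp only [hF]
    rw [hζeq x, airyPhase_im]
    set aa := μ.re * x with haa
    set bb := μ.im * x + b with hbb
    have hblow : -(L * r * h) ≤ bb := by linarith [(abs_le.1 (him x hx)).1]
    have i1 : 0 ≤ aa ^ 2 + ξ.re := by linarith [hre2 x hx, hξr.1]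
    have i2 : aa ^ 2 + ξ.re ≤ (m₁ ^ 2 + m₀ ^ 2) * r ^ 2 := by
      have := hre3 x hx
      have := hξr.2
      nlinarith
    have i3 : -((aa ^ 2 + ξ.re) * bb) ≤ (m₁ ^ 2 + m₀ ^ 2) * r ^ 2 * (L * r * h) := by
      -- The contour may dip below the real axis, but only by L r h, and aa² + Re ξ ≥ 0; hence the
      -- exponential growth is bounded.
      have h1 : (aa ^ 2 + ξ.re) * (-bb) ≤ (aa ^ 2 + ξ.re) * (L * r * h) :=
        mul_le_mul_of_nonneg_left (by linarith) i1
      have h2 : (aa ^ 2 + ξ.re) * (L * r * h) ≤ (m₁ ^ 2 + m₀ ^ 2) * r ^ 2 * (L * r * h) :=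
        mul_le_mul_of_nonneg_right i2 (by positivity)
      linarith
    have i4 : bb ^ 3 ≤ (L * r + 1) ^ 3 * h := by
      rw [← hl3, ← mul_pow]
      calc bb ^ 3 ≤ |bb| ^ 3 := by
            rw [← abs_pow]; exact le_abs_self _
        _ ≤ _ := pow_le_pow_left₀ (abs_nonneg _) (hbd x hx) 3
    have i5 : -(ξ.im * aa) ≤ L * h * (m₁ * r) := by
      refine (neg_le_abs _).trans ?_
      rw [abs_mul, haa, abs_mul, abs_of_nonneg (hm₀.le.trans hm)]
      exact mul_le_mul hξi (mul_le_mul hm' (hI x hx).2 (abs_nonneg _) hm₁.le)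
        (mul_nonneg (hm₀.le.trans hm) (abs_nonneg _)) (by positivity)
    linarith
  have hg'b : ∀ x ∈ Set.Icc α β, ‖g' x‖ ≤ ((X * (L * r + 1) + X * L) / c₀ +
          X * (L * r + 1) * (2 * ((m₁ + L) * r + 1) * (m₁ + L) ^ 2) / c₀ ^ 2) * l := by
    intro x hx
    have e : g' x = (χ₂ x * B x + χ₁ x * ν) / F' x - χ₁ x * B x * F'' x / F' x ^ 2 := by
      have := hF'0 x hx
      simp only [hg']
      field_simp
    rw [e]
    have hLl : L * h ≤ L * l := mul_le_mul_of_nonneg_left hhl hL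
    have n1 : ‖χ₂ x * B x + χ₁ x * ν‖ ≤ (X * (L * r + 1) + X * L) * l := by
      refine (norm_add_le _ _).trans ?_
      rw [norm_mul, norm_mul]
      have h1 := mul_le_mul (H.bdd₂ x) (hBn x hx) (norm_nonneg _) hX
      have h2 := mul_le_mul (H.bdd₁ x) (hν.trans hLl) (norm_nonneg _) hX
      linarith
    have n2 : ‖χ₁ x * B x * F'' x‖ ≤
        X * (L * r + 1) * (2 * ((m₁ + L) * r + 1) * (m₁ + L) ^ 2) * l := by
      rw [norm_mul, norm_mul]
      have h1 := mul_le_mul (H.bdd₁ x) (hBn x hx) (norm_nonneg _) hX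
      have h2 : ‖F'' x‖ ≤ 2 * ((m₁ + L) * r + 1) * (m₁ + L) ^ 2 := by
        simp only [hF'']
        rw [norm_mul, norm_mul, norm_mul, Complex.norm_ofNat, pow_two, ← mul_assoc]
        have := hζn x hx
        gcongr
      have h3 := mul_le_mul h1 h2 (norm_nonneg _) (by positivity)
      linarith
    refine (norm_sub_le _ _).trans ?_
    rw [norm_div, norm_div, norm_pow]
    have d1 := div_le_div₀ (by positivity) n1 hc₀0 (hF'low x hx)
    have d2 := div_le_div₀ (by positivity) n2 (by positivity : 0 < c₀ ^ 2)
      (pow_le_pow_left₀ hc₀0.le (hF'low x hx) 2)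
    refine (add_le_add d1 d2).trans (le_of_eq ?_)
    ring
  set Cg : ℝ := (X * (L * r + 1) + X * L) / c₀ +
          X * (L * r + 1) * (2 * ((m₁ + L) * r + 1) * (m₁ + L) ^ 2) / c₀ ^ 2 with hCg
  have hCg0 : 0 ≤ Cg := by positivity
  have hmain := norm_integral_ibp_le (G := 0) (P := Cg * l * r) (p := fun _ => Cg * l) hαβ hh
    (Real.exp_pos _).le hgd (fun x _ => hFd x) hg'c hFc.continuousOn hosc
    (by simp [hg, hα]) (by simp [hg, hβ]) hg'b continuousOn_const
    (by
      rw [intervalIntegral.integral_const, smul_eq_mul, mul_comm]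
      exact mul_le_mul_of_nonneg_left hlen (by positivity))
  have hcongr : ∫ x in α..β, χ₁ x * (ν * x + l * I) * osc h (airyPhase ξ (μ * x + b * I)) =
      ∫ x in α..β, g x * F' x * osc h (F x) := by
    refine intervalIntegral.integral_congr fun x hx => ?_
    rw [Set.uIcc_of_le hαβ] at hx
    simp only [hg]
    rw [div_mul_cancel₀ _ (hF'0 x hx)]
  rw [hcongr]
  refine hmain.trans (le_of_eq ?_)
  ring

/-- Moving the contour of a cut-off Airy integral from `M ℝ` to `ℝ + i h^{1/3}`. -/
theorem exists_norm_airy_shift_le {r X L m₀ m₁ : ℝ} (hr : 0 < r) (hL : 0 ≤ L) (hm₀ : 0 < m₀) :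
    ∃ C, 0 ≤ C ∧ ∃ h₀, 0 < h₀ ∧ h₀ ≤ 1 ∧
    ∀ (χ χ₁ χ₂ χ₃ : ℝ → ℂ) (h : ℝ) (M ξ : ℂ), IsCutoff r X χ χ₁ χ₂ χ₃ → 0 < h → h ≤ h₀ →
      m₀ ≤ M.re → M.re ≤ m₁ → |M.im| ≤ L * h →
      ‖ξ‖ ≤ m₀ ^ 2 * r ^ 2 / 16 → |ξ.im| ≤ L * h →
      ‖(M.re : ℂ) * (∫ η in (-r)..r, χ η * osc h (airyPhase ξ (M.re * η + (h ^ (1 / 3 : ℝ) : ℝ) * I))) -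
        M * ∫ η in (-r)..r, χ η * osc h (airyPhase ξ (M * η))‖ ≤
        C * (h * h ^ (1 / 3 : ℝ)) := by
  rcases lt_or_ge X 0 with hX | hX
  · exact ⟨0, le_rfl, 1, one_pos, le_rfl, fun χ χ₁ χ₂ χ₃ h m ξ H => absurd H.nonneg (not_le.2 hX)⟩
  rcases lt_or_ge m₁ m₀ with hmm | hmm
  · exact ⟨0, le_rfl, 1, one_pos, le_rfl, fun χ χ₁ χ₂ χ₃ h m ξ _ _ _ h1 h2 => by linarith⟩
  have hm₁ : 0 < m₁ := hm₀.trans_le hmm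
  set C : ℝ := Real.exp ((m₁ ^ 2 + m₀ ^ 2) * r ^ 2 * (L * r) + (L * r + 1) ^ 3 / 3 + L * (m₁ * r)) *
        (r * ((X * (L * r + 1) + X * L) / (m₀ ^ 2 * r ^ 2 / 8 * m₀) +
          X * (L * r + 1) * (2 * ((m₁ + L) * r + 1) * (m₁ + L) ^ 2) /
            (m₀ ^ 2 * r ^ 2 / 8 * m₀) ^ 2)) with hC
  have hC0 : 0 ≤ C := by positivity
  -- Smallness of l = h^{1/3} keeps the squared imaginary part of the contour below m₀² r² / 16, as
  -- the lower bound for ζ² + ξ requires.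
  set l₀ : ℝ := min 1 (m₀ * r / 4 / (L * r + 1)) with hl₀
  have hl₀0 : 0 < l₀ := lt_min one_pos (by positivity)
  refine ⟨2 * C, by positivity, l₀ ^ 3, by positivity,
    pow_le_one₀ hl₀0.le (min_le_left _ _), ?_⟩
  intro χ χ₁ χ₂ χ₃ h M ξ H hh hh₀ hm hm' hMi hξ hξi
  set l : ℝ := h ^ (1 / 3 : ℝ) with hl
  have hl0 : 0 < l := Real.rpow_pos_of_pos hh _
  have hl3 : l ^ 3 = h := rpow_third_pow hh
  have hll₀ : l ≤ l₀ := by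
    refine le_of_pow_le_pow_left₀ three_ne_zero hl₀0.le ?_
    rw [hl3]; exact hh₀
  have hl1 : l ≤ 1 := hll₀.trans (min_le_left _ _)
  have hls : (L * r + 1) ^ 2 * l ^ 2 ≤ m₀ ^ 2 * r ^ 2 / 16 := by
    have h1 : l ≤ m₀ * r / 4 / (L * r + 1) := hll₀.trans (min_le_right _ _)
    rw [le_div_iff₀ (by positivity)] at h1
    have h2 := pow_le_pow_left₀ (by positivity) h1 2
    calc (L * r + 1) ^ 2 * l ^ 2 = (l * (L * r + 1)) ^ 2 := by ring
      _ ≤ _ := h2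
      _ = _ := by ring
  set ν : ℂ := M.re - M with hν
  have hνI : ν = -((M.im : ℂ) * I) := by
    rw [hν]; nth_rw 2 [← re_add_im M]; ring
  have hνn : ‖ν‖ ≤ L * h := by
    rw [hνI, norm_neg, norm_mul, norm_I, mul_one, norm_real]; exact hMi
  have hrr : -r ≤ r := by linarith
  have hu : Set.uIcc (-r) r = Set.Icc (-r) r := Set.uIcc_of_le hrr
  have hofReal : ∀ x : ℝ, HasDerivAt (fun x : ℝ => (x : ℂ)) 1 x := fun x => by
    simpa using (hasDerivAt_id x).ofReal_comp
  set ζ : ℝ → ℝ → ℂ := fun s x => (M + s * ν) * x + s * l * I with hζ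
  -- The contours interpolate between M ℝ and Re M · ℝ + i l. For the holomorphic integrand the
  -- s-derivative is an exact x-derivative, so by Cauchy's theorem only the terms carrying χ'
  -- survive.
  set W : ℝ → ℂ := fun s => (M + s * ν) * ∫ x in (-r)..r, χ x * osc h (airyPhase ξ (ζ s x)) with hW
  have hWd : ∀ s ∈ Set.Icc (0 : ℝ) 1, ∃ W' : ℂ, HasDerivAt W W' s ∧ ‖W'‖ ≤ 2 * C * (h * l) := by
    intro s hs
    set μ : ℂ := M + s * ν with hμ
    have hμre : μ.re = M.re := by rw [hμ, hνI]; simp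
    have hμim : μ.im = (1 - s) * M.im := by rw [hμ, hνI]; simp; ring
    have hζx : ∀ x, HasDerivAt (ζ s) μ x := fun x =>
      (((hofReal x).const_mul μ).add_const _).congr_deriv (mul_one _)
    have hζs : ∀ (s x : ℝ), HasDerivAt (fun s => ζ s x) (ν * x + l * I) s := fun s x => by
      have h1 := ((((hofReal s).mul_const ν).const_add M).mul_const (x : ℂ)).add
        (((hofReal s).mul_const (l : ℂ)).mul_const I)
      exact h1.congr_deriv (by ring)
    have hζc : Continuous fun p : ℝ × ℝ => ζ p.1 p.2 := by simp only [hζ]; fun_prop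
    have hζsc : Continuous (ζ s) := by simp only [hζ]; fun_prop
    have hc0 := H.cont₀
    have hc1 := H.cont₁
    have hosc := continuous_osc h
    have hap := continuous_airyPhase ξ
    have hFs : ∀ (s x : ℝ), HasDerivAt (fun s => airyPhase ξ (ζ s x))
        ((ζ s x ^ 2 + ξ) * (ν * x + l * I)) s := fun s x => by
      have := HasDerivAt.comp (h := fun s => ζ s x) (h₂ := airyPhase ξ) s
        (hasDerivAt_airyPhase ξ (ζ s x)) (hζs s x)
      exact this
    have hDeriv := hasDerivAt_intervalIntegral_param hrr
      (f := fun s x => χ x * osc h (airyPhase ξ (ζ s x)))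
      (f' := fun s x => χ x * (I / h * ((ζ s x ^ 2 + ξ) * (ν * x + l * I)) * osc h (airyPhase ξ (ζ s x))))
      (fun s x _ => (hasDerivAt_osc (hFs s x)).const_mul (χ x))
      (fun s => Continuous.continuousOn (by
        have : Continuous (ζ s) := by simp only [hζ]; fun_prop
        fun_prop))
      (Continuous.continuousOn (by fun_prop)) s
    have hμd : HasDerivAt (fun s : ℝ => M + (s : ℂ) * ν) ν s := by
      exact (((hofReal s).mul_const ν).const_add M).congr_deriv (one_mul ν)
    refine ⟨_, hμd.mul hDeriv, ?_⟩
    set F : ℝ → ℂ := fun x => airyPhase ξ (ζ s x) with hF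
    have hFx : ∀ x : ℝ, HasDerivAt F ((ζ s x ^ 2 + ξ) * μ) x := fun x =>
      (hasDerivAt_airyPhase ξ (ζ s x)).comp x (hζx x)
    have hFc : Continuous F := by simp only [hF]; fun_prop
    have hibp := integral_ibp_osc (α := -r) (β := r) (h := h) hh.ne'
      (g := fun x => χ x * (ν * x + l * I))
      (g' := fun x => χ₁ x * (ν * x + l * I) + χ x * ν) (F := F)
      (F' := fun x => (ζ s x ^ 2 + ξ) * μ)
      (fun x _ => (H.deriv₁ x).mul
        ((((hofReal x).const_mul ν).add_const ((l : ℂ) * I)).congr_deriv (mul_one ν)))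
      (fun x _ => hFx x) (Continuous.continuousOn (by fun_prop)) (Continuous.continuousOn (by fun_prop))
    have hz1 : χ r = 0 := H.zero₀ r (le_abs_self r)
    have hz2 : χ (-r) = 0 := H.zero₀ (-r) (by rw [abs_neg]; exact le_abs_self r)
    simp only [hz1, hz2, zero_mul, sub_zero, zero_sub] at hibp
    have hh' : (h : ℂ) ≠ 0 := by exact_mod_cast hh.ne'
    have e1 : ν * (∫ x in (-r)..r, χ x * osc h (F x)) + μ * (∫ x in (-r)..r, χ x *
        (I / h * ((ζ s x ^ 2 + ξ) * (ν * x + l * I)) * osc h (F x))) =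
        -∫ x in (-r)..r, χ₁ x * (ν * x + l * I) * osc h (F x) := by
      have e2 : μ * (∫ x in (-r)..r, χ x *
          (I / h * ((ζ s x ^ 2 + ξ) * (ν * x + l * I)) * osc h (F x))) =
          I / h * ∫ x in (-r)..r, χ x * (ν * x + l * I) * ((ζ s x ^ 2 + ξ) * μ) * osc h (F x) := by
        rw [← intervalIntegral.integral_const_mul, ← intervalIntegral.integral_const_mul]
        refine intervalIntegral.integral_congr fun x _ => ?_
        ring
      have e3 : (∫ x in (-r)..r, (χ₁ x * (ν * x + l * I) + χ x * ν) * osc h (F x)) =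
          (∫ x in (-r)..r, χ₁ x * (ν * x + l * I) * osc h (F x)) +
          ν * ∫ x in (-r)..r, χ x * osc h (F x) := by
        rw [← intervalIntegral.integral_const_mul, ← intervalIntegral.integral_add]
        · refine intervalIntegral.integral_congr fun x _ => ?_
          ring
        · exact Continuous.intervalIntegrable (by fun_prop) _ _
        · exact Continuous.intervalIntegrable (by fun_prop) _ _
      rw [e2, hibp, e3]
      field_simp
      ring
    change ‖ν * (∫ x in (-r)..r, χ x * osc h (F x)) + μ * (∫ x in (-r)..r, χ x *
        (I / h * ((ζ s x ^ 2 + ξ) * (ν * x + l * I)) * osc h (F x)))‖ ≤ _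
    rw [e1, norm_neg]
    have hcI : Continuous fun x : ℝ => χ₁ x * (ν * x + l * I) * osc h (F x) := by fun_prop
    rw [← intervalIntegral.integral_add_adjacent_intervals (b := -(r / 2))
      (hcI.intervalIntegrable _ _) (hcI.intervalIntegrable _ _),
      ← intervalIntegral.integral_add_adjacent_intervals (a := -(r / 2)) (b := r / 2)
      (hcI.intervalIntegrable _ _) (hcI.intervalIntegrable _ _)]
    have hmid : ∫ x in (-(r / 2))..(r / 2), χ₁ x * (ν * x + l * I) * osc h (F x) = 0 := by
      rw [intervalIntegral.integral_congr (g := fun _ => (0 : ℂ)) fun x hx => ?_]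
      · simp
      · rw [Set.uIcc_of_le (by linarith)] at hx
        simp only [H.flat x (abs_le.2 hx), zero_mul]
    have hμim' : |μ.im| ≤ L * h := by
      rw [hμim, abs_mul, abs_of_nonneg (by linarith [hs.2])]
      calc (1 - s) * |M.im| ≤ 1 * |M.im| :=
            mul_le_mul_of_nonneg_right (by linarith [hs.1]) (abs_nonneg _)
        _ ≤ _ := by rw [one_mul]; exact hMi
    have hsl : s * l ≤ l := by nlinarith [hs.2]
    have hsl0 : 0 ≤ s * l := mul_nonneg hs.1 hl0.le
    have hζF : ∀ x : ℝ, F x = airyPhase ξ (μ * x + ((s * l : ℝ) : ℂ) * I) := fun x => by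
      simp only [hF, hζ, hμ]; push_cast; rfl
    simp_rw [hζF]
    have hz3 : χ₁ r = 0 := H.zero₁ r (le_abs_self r)
    have hz4 : χ₁ (-r) = 0 := H.zero₁ (-r) (by rw [abs_neg]; exact le_abs_self r)
    have hz5 : χ₁ (r / 2) = 0 := H.flat _ (by rw [abs_of_pos (by positivity)])
    have hz6 : χ₁ (-(r / 2)) = 0 := H.flat _ (by rw [abs_neg, abs_of_pos (by positivity)])
    have b1 := norm_integral_cutoff_deriv_le (m₀ := m₀) (m₁ := m₁) (α := -r) (β := -(r / 2)) (b := s * l) (μ := μ) (ν := ν)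
      H hr hm₀ hL hh hl0 hl1 hl3 (hm.trans hμre.ge) (hμre.le.trans hm') hμim' hνn hsl0 hsl
      hls hξ hξi (by linarith) (by linarith) (fun x hx => by
        rw [abs_of_nonpos (by linarith [hx.2])]; constructor <;> linarith [hx.1, hx.2]) hz4 hz6
    have b2 := norm_integral_cutoff_deriv_le (m₀ := m₀) (m₁ := m₁) (α := r / 2) (β := r) (b := s * l) (μ := μ) (ν := ν)
      H hr hm₀ hL hh hl0 hl1 hl3 (hm.trans hμre.ge) (hμre.le.trans hm') hμim' hνn hsl0 hsl
      hls hξ hξi (by linarith) (by linarith) (fun x hx => by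
        rw [abs_of_nonneg (by linarith [hx.1])]; constructor <;> linarith [hx.1, hx.2]) hz5 hz3
    simp_rw [hζF] at hmid
    rw [hmid, zero_add]
    refine (norm_add_le _ _).trans ?_
    rw [← hC] at b1 b2
    linarith
  choose! W' hW1 hW2 using hWd
  have hfin := norm_image_sub_le_of_norm_deriv_le_segment_01' (f := W) (f' := W')
    (fun τ hτ => (hW1 τ hτ).hasDerivWithinAt) (fun τ hτ => hW2 τ ⟨hτ.1, hτ.2.le⟩)
  have e1 : W 1 = (M.re : ℂ) * ∫ η in (-r)..r, χ η * osc h (airyPhase ξ (M.re * η + (l : ℝ) * I)) := by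
    simp only [hW, hζ, hν, ofReal_one, one_mul, add_sub_cancel]
  have e0 : W 0 = M * ∫ η in (-r)..r, χ η * osc h (airyPhase ξ (M * η)) := by
    simp only [hW, hζ, ofReal_zero, zero_mul, add_zero]
  rw [← e1, ← e0]
  exact hfin

/-- Two errors are combined: discarding the tail of the absolutely convergent shifted line, and
moving the compact piece to the line M ℝ with complex slope. The slope is needed because the cube
root of the Langer coefficient is not real when E is not. -/
theorem exists_norm_airy_sub_le {r X L m₀ m₁ : ℝ} (hr : 0 < r) (hL : 0 ≤ L) (hm₀ : 0 < m₀) :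
    ∃ C, 0 ≤ C ∧ ∃ h₀, 0 < h₀ ∧ h₀ ≤ 1 ∧
    ∀ (χ χ₁ χ₂ χ₃ : ℝ → ℂ) (h : ℝ) (M ξ : ℂ), IsCutoff r X χ χ₁ χ₂ χ₃ → 0 < h → h ≤ h₀ →
      m₀ ≤ M.re → M.re ≤ m₁ → |M.im| ≤ L * h →
      ‖ξ‖ ≤ m₀ ^ 2 * r ^ 2 / 16 → |ξ.im| ≤ L * h →
      ‖2 * (Real.pi : ℂ) * (h ^ (1 / 3 : ℝ) : ℝ) * airyAi (((h ^ (-(2 / 3) : ℝ) : ℝ) : ℂ) * ξ) -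
        M * ∫ η in (-r)..r, χ η * osc h (airyPhase ξ (M * η))‖ ≤ C * (h * h ^ (1 / 3 : ℝ)) := by
  rcases lt_or_ge m₁ m₀ with hmm | hmm
  · exact ⟨0, le_rfl, 1, one_pos, le_rfl, fun χ χ₁ χ₂ χ₃ h m ξ _ _ _ h1 h2 => by linarith⟩
  obtain ⟨C₁, hC₁, h1⟩ := exists_norm_airy_tail_le (r := r) (X := X) (L := L) hr hm₀
  obtain ⟨C₂, hC₂, h₀, hh₀, hh₀1, h2⟩ := exists_norm_airy_shift_le (r := r) (X := X) (L := L)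
    (m₀ := m₀) (m₁ := m₁) hr hL hm₀
  have hm₁ : 0 < m₁ := hm₀.trans_le hmm
  refine ⟨m₁ * C₁ + C₂, by positivity, h₀, hh₀, hh₀1, fun χ χ₁ χ₂ χ₃ h M ξ H hh hhh hm hm' hMi hξ hξi => ?_⟩
  have a1 := h1 χ χ₁ χ₂ χ₃ h M.re ξ H hh (hhh.trans hh₀1) hm hξ hξi
  have a2 := h2 χ χ₁ χ₂ χ₃ h M ξ H hh hhh hm hm' hMi hξ hξi
  rw [airy_eq_scaled hh (hm₀.trans_le hm)]
  set A := ∫ η : ℝ, osc h (airyPhase ξ (M.re * η + (h ^ (1 / 3 : ℝ) : ℝ) * I))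
  set B := ∫ η in (-r)..r, χ η * osc h (airyPhase ξ (M.re * η + (h ^ (1 / 3 : ℝ) : ℝ) * I))
  set D := ∫ η in (-r)..r, χ η * osc h (airyPhase ξ (M * η))
  have e : (M.re : ℂ) * A - M * D = (M.re : ℂ) * (A - B) + ((M.re : ℂ) * B - M * D) := by ring
  rw [e]
  refine (norm_add_le _ _).trans ?_
  rw [norm_mul, norm_real, Real.norm_eq_abs, abs_of_pos (hm₀.trans_le hm)]
  have := mul_le_mul hm' a1 (norm_nonneg _) hm₁.le
  linarith

/-! ### Complexification and local inverses of the potentials -/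

/-- The power series `∑ cₙ zⁿ` with the coefficients of `V` at `0`, over `ℂ`. -/
def taylorSeries (V : ℝ → ℝ) : FormalMultilinearSeries ℂ ℂ ℂ :=
  FormalMultilinearSeries.ofScalars ℂ fun k => ((iteratedDeriv k V 0 / k.factorial : ℝ) : ℂ)

/-- The Cauchy–Hadamard radius sees only the norms of the coefficients, so a real power series keeps
at least its radius over ℂ, or over any normed algebra as above. -/
theorem ofScalars_radius_le {𝕜 𝕜' E : Type*} [NontriviallyNormedField 𝕜] [NontriviallyNormedField 𝕜']
    [NormedRing E] [NormedAlgebra 𝕜' E] [NormOneClass E] {c : ℕ → 𝕜} {d : ℕ → 𝕜'}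
    (h : ∀ k, ‖d k‖ = ‖c k‖) :
    (FormalMultilinearSeries.ofScalars 𝕜 c).radius ≤ (FormalMultilinearSeries.ofScalars E d).radius := by
  refine ENNReal.le_of_forall_nnreal_lt fun r hr => ?_
  obtain ⟨C, hC, hb⟩ := FormalMultilinearSeries.norm_mul_pow_le_of_lt_radius _ hr
  refine FormalMultilinearSeries.le_radius_of_bound _ C fun n => ?_
  have := hb n
  rw [FormalMultilinearSeries.ofScalars_norm] at this ⊢
  rw [h]; exact this

/-- The complexification of a real-analytic germ. -/
theorem exists_complexification {V : ℝ → ℝ} (hV : AnalyticAt ℝ V 0) :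
    ∃ Vc : ℂ → ℂ, HasFPowerSeriesAt Vc (taylorSeries V) 0 ∧ ∀ᶠ x : ℝ in 𝓝 0, Vc x = V x := by
  have hp := hV.hasFPowerSeriesAt
  have hrad : 0 < (taylorSeries V).radius := by
    refine lt_of_lt_of_le hp.radius_pos (ofScalars_radius_le fun k => ?_)
    rw [norm_real]
  refine ⟨(taylorSeries V).sum, (FormalMultilinearSeries.hasFPowerSeriesOnBall _ hrad).hasFPowerSeriesAt, ?_⟩
  have h1 := hasFPowerSeriesAt_iff.1 hp
  filter_upwards [h1] with x hx
  simp only [FormalMultilinearSeries.coeff_ofScalars, smul_eq_mul, zero_add] at hx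
  have h2 := (Complex.hasSum_ofReal.2 hx).tsum_eq
  rw [FormalMultilinearSeries.sum, ← h2]
  refine tsum_congr fun k => ?_
  rw [taylorSeries, FormalMultilinearSeries.ofScalars_apply_eq]
  push_cast
  rw [smul_eq_mul, mul_comm]

/-- A complexification `Vc` of `V` on `ball 0 ρ`, with an inverse `U` on `ball 0 R`. -/
structure IsChart (V : ℝ → ℝ) (R ρ κ : ℝ) (Vc U : ℂ → ℂ) : Prop where
  R_pos : 0 < R
  ρ_pos : 0 < ρ
  κ_pos : 0 < κ
  diffV : DifferentiableOn ℂ Vc (Metric.ball 0 ρ)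
  diffU : DifferentiableOn ℂ U (Metric.ball 0 R)
  maps : ∀ z ∈ Metric.ball (0 : ℂ) ρ, Vc z ∈ Metric.ball (0 : ℂ) R
  left : ∀ z ∈ Metric.ball (0 : ℂ) ρ, U (Vc z) = z
  eq_real : ∀ x : ℝ, |x| < ρ → Vc x = V x
  real : ∀ y : ℝ, |y| < R → (U y).im = 0
  zero : Vc 0 = 0
  close : ∀ z ∈ Metric.ball (0 : ℂ) R, ‖deriv U z - κ‖ ≤ κ / 8

theorem exists_inverse {V : ℝ → ℝ} (hV : AnalyticAt ℝ V 0) (hV0 : V 0 = 0) (hV' : 0 < deriv V 0) :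
    ∃ Vc U : ℂ → ℂ, HasFPowerSeriesAt Vc (taylorSeries V) 0 ∧ AnalyticAt ℂ U 0 ∧
      HasStrictDerivAt U ((deriv V 0)⁻¹ : ℝ) 0 ∧ U 0 = 0 ∧ Vc 0 = 0 ∧
      (∀ᶠ x : ℝ in 𝓝 0, Vc x = V x) ∧ (∀ᶠ z in 𝓝 0, U (Vc z) = z) ∧
      (∀ᶠ z in 𝓝 0, Vc (U z) = z) ∧ ∀ᶠ y : ℝ in 𝓝 0, (U y).im = 0 := by
  obtain ⟨Vc, hp, hreal⟩ := exists_complexification hV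
  have hVc := hp.analyticAt
  have h0 : Vc 0 = 0 := by simpa [hV0] using hreal.self_of_nhds
  have hd : deriv Vc 0 = ((deriv V 0 : ℝ) : ℂ) := by
    have h1 := hp.deriv
    rw [h1]
    rw [taylorSeries]
    simp
  have hne : deriv Vc 0 ≠ 0 := by rw [hd]; exact_mod_cast hV'.ne'
  set U := hVc.hasStrictDerivAt.localInverse _ _ _ hne with hU
  have hUa : AnalyticAt ℂ U 0 := by
    have := hVc.analyticAt_localInverse hne
    rwa [h0] at this
  have hUd : HasStrictDerivAt U (deriv Vc 0)⁻¹ 0 := by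
    have := hVc.hasStrictDerivAt.to_localInverse hne
    rwa [h0] at this
  have hl : ∀ᶠ z in 𝓝 0, U (Vc z) = z := hVc.hasStrictDerivAt.eventually_left_inverse hne
  have hr : ∀ᶠ z in 𝓝 0, Vc (U z) = z := by
    have := hVc.hasStrictDerivAt.eventually_right_inverse hne
    rwa [h0] at this
  refine ⟨Vc, U, hp, hUa, ?_, ?_, h0, hreal, hl, hr, ?_⟩
  · rw [hd] at hUd; push_cast; exact hUd
  · have := hl.self_of_nhds; rwa [h0] at this
  -- Reality of the inverse on the real axis: V is a local homeomorphism of ℝ at 0, so every small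
  -- real y is V(x) with x real, and then U(y) = x.
  · have hmap := (hV.hasStrictDerivAt).map_nhds_eq hV'.ne'
    rw [hV0] at hmap
    rw [← hmap, Filter.eventually_map]
    have hl' : ∀ᶠ x : ℝ in 𝓝 0, U (Vc x) = x :=
      (continuous_ofReal.tendsto' (0 : ℝ) (0 : ℂ) (by simp)).eventually hl
    filter_upwards [hreal, hl'] with x h1 h2
    rw [← h1, h2, ofReal_im]

/-- The radius R may be any sufficiently small number, not just one. This allows two potentials to
be given charts with a common R. -/
theorem exists_isChart {V : ℝ → ℝ} {Vc U : ℂ → ℂ} {κ : ℝ} (hκ : 0 < κ) (hVc : AnalyticAt ℂ Vc 0)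
    (hU : AnalyticAt ℂ U 0) (hUd : HasStrictDerivAt U κ 0) (h0 : Vc 0 = 0)
    (hreal : ∀ᶠ x : ℝ in 𝓝 0, Vc x = V x) (hl : ∀ᶠ z in 𝓝 0, U (Vc z) = z)
    (him : ∀ᶠ y : ℝ in 𝓝 0, (U y).im = 0) :
    ∃ R₀ > 0, ∀ R, 0 < R → R ≤ R₀ → ∃ ρ, IsChart V R ρ κ Vc U := by
  have hc : ContinuousAt (deriv U) 0 := hU.deriv.continuousAt
  have h1 : ∀ᶠ z in 𝓝 (0 : ℂ), ‖deriv U z - κ‖ < κ / 8 := by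
    have : Tendsto (fun z => ‖deriv U z - κ‖) (𝓝 0) (𝓝 ‖deriv U 0 - κ‖) :=
      (hc.sub continuousAt_const).norm
    rw [hUd.hasDerivAt.deriv, sub_self, norm_zero] at this
    exact this.eventually_lt_const (by positivity)
  obtain ⟨R₁, hR₁, b1⟩ := Metric.eventually_nhds_iff.1 (h1.and hU.eventually_analyticAt)
  obtain ⟨R₂, hR₂, b2⟩ := Metric.eventually_nhds_iff.1 him
  refine ⟨min R₁ R₂, by positivity, fun R hR hRle => ?_⟩
  have hm : ∀ᶠ z in 𝓝 (0 : ℂ), Vc z ∈ Metric.ball (0 : ℂ) R := by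
    have := hVc.continuousAt
    refine this.eventually_mem ?_
    rw [h0]; exact Metric.ball_mem_nhds _ hR
  obtain ⟨ρ₁, hρ₁, c1⟩ := Metric.eventually_nhds_iff.1 ((hm.and hl).and hVc.eventually_analyticAt)
  obtain ⟨ρ₂, hρ₂, c2⟩ := Metric.eventually_nhds_iff.1 hreal
  have hs : ∀ z ∈ Metric.ball (0 : ℂ) (min ρ₁ ρ₂), dist z 0 < ρ₁ := fun z hz =>
    lt_of_lt_of_le (Metric.mem_ball.1 hz) (min_le_left _ _)
  have hs' : ∀ z ∈ Metric.ball (0 : ℂ) R, dist z 0 < R₁ := fun z hz =>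
    (Metric.mem_ball.1 hz).trans_le (hRle.trans (min_le_left _ _))
  refine ⟨min ρ₁ ρ₂, hR, by positivity, hκ, ?_, ?_, ?_, ?_, ?_, ?_, h0, ?_⟩
  · exact fun z hz => (c1 (hs z hz)).2.differentiableAt.differentiableWithinAt
  · exact fun z hz => (b1 (hs' z hz)).2.differentiableAt.differentiableWithinAt
  · exact fun z hz => (c1 (hs z hz)).1.1
  · exact fun z hz => (c1 (hs z hz)).1.2
  · exact fun x hx => c2 (by rw [Real.dist_eq, sub_zero]; exact hx.trans_le (min_le_right _ _))
  · exact fun x hx => b2 (by rw [Real.dist_eq, sub_zero]; exact hx.trans_le (hRle.trans (min_le_right _ _)))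
  · exact fun z hz => (b1 (hs' z hz)).1.le


/-- The inverses of two functions with contact of order `n` differ by `zⁿ` times an analytic
function. -/
theorem exists_contact_factor {V₁ V₂ : ℝ → ℝ} {n : ℕ} {Vc₁ Vc₂ U₁ U₂ : ℂ → ℂ} {κ₁ κ₂ : ℂ}
    (hcontact : ∀ k < n, iteratedDeriv k V₁ 0 = iteratedDeriv k V₂ 0)
    (hp₁ : HasFPowerSeriesAt Vc₁ (taylorSeries V₁) 0)
    (hp₂ : HasFPowerSeriesAt Vc₂ (taylorSeries V₂) 0)
    (hU₁ : AnalyticAt ℂ U₁ 0) (hU₂ : AnalyticAt ℂ U₂ 0) (hd₁ : HasStrictDerivAt U₁ κ₁ 0)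
    (hd₂ : HasStrictDerivAt U₂ κ₂ 0) (hU₂0 : U₂ 0 = 0) (h₁0 : Vc₁ 0 = 0)
    (hl₁ : ∀ᶠ z in 𝓝 0, U₁ (Vc₁ z) = z) (hr₂ : ∀ᶠ z in 𝓝 0, Vc₂ (U₂ z) = z) :
    ∃ Ω : ℂ → ℂ, AnalyticAt ℂ Ω 0 ∧
      Ω 0 = κ₁ * κ₂ ^ n * ((iteratedDeriv n V₁ 0 - iteratedDeriv n V₂ 0) / n.factorial : ℝ) ∧
      ∀ᶠ z in 𝓝[≠] 0, U₂ z - U₁ z = z ^ n * Ω z := by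
  set q : ℂ := (((iteratedDeriv n V₁ 0 - iteratedDeriv n V₂ 0) / n.factorial : ℝ) : ℂ) with hq
  set e : ℂ → ℂ := fun y => Vc₁ y - Vc₂ y - q * y ^ n with he
  have heO : e =O[𝓝 0] fun y => ‖y‖ ^ (n + 1) := by
    have h1 := (hp₁.sub hp₂).isBigO_sub_partialSum_pow (n + 1)
    refine h1.congr_left fun y => ?_
    simp only [zero_add, Pi.sub_apply, he]
    congr 1
    rw [FormalMultilinearSeries.partialSum, Finset.sum_range_succ, Finset.sum_eq_zero, zero_add]
    · simp only [taylorSeries, FormalMultilinearSeries.sub_apply,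
        FormalMultilinearSeries.ofScalars_apply_eq, sub_apply, hq]
      push_cast
      simp only [smul_eq_mul]
      ring
    · intro k hk
      simp only [taylorSeries, FormalMultilinearSeries.sub_apply,
        FormalMultilinearSeries.ofScalars_apply_eq, sub_apply]
      rw [hcontact k (Finset.mem_range.1 hk), sub_self]
  have hU₂t : Tendsto U₂ (𝓝 0) (𝓝 0) := by simpa [hU₂0] using hU₂.continuousAt.tendsto
  have hU₂O : U₂ =O[𝓝 0] fun z : ℂ => z := by
    simpa [hU₂0] using hd₂.hasDerivAt.isBigO_sub
  have heU : (fun z => e (U₂ z)) =o[𝓝 0] fun z => z ^ n := by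
    have h1 := (heO.comp_tendsto hU₂t).trans (hU₂O.norm_left.pow (n + 1))
    exact h1.trans_isLittleO (Asymptotics.isLittleO_pow_pow n.lt_succ_self)
  have hs : Tendsto (fun z => U₂ z / z) (𝓝[≠] 0) (𝓝 κ₂) := by
    have := hasDerivAt_iff_tendsto_slope.1 hd₂.hasDerivAt
    refine this.congr fun z => ?_
    rw [slope_def_field, hU₂0, sub_zero, sub_zero]
  have hsub : 𝓝[≠] (0 : ℂ) ≤ 𝓝 0 := nhdsWithin_le_nhds
  set d : ℂ → ℂ := fun z => Vc₁ (U₂ z) - Vc₂ (U₂ z) with hd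
  have hde : ∀ z, d z = q * U₂ z ^ n + e (U₂ z) := fun z => by simp only [hd, he]; ring
  have hdO : d =O[𝓝 0] fun z => z ^ n := by
    have h1 : (fun z => q * U₂ z ^ n) =O[𝓝 0] fun z => z ^ n := (hU₂O.pow n).const_mul_left q
    exact (h1.add heU.isBigO).congr_left fun z => (hde z).symm
  -- Since U₂(z) = U₁(V₁(U₂(z))) and V₁(U₂(z)) - z = (V₁ - V₂)(U₂(z)) = d(z), strict
  -- differentiability of U₁ linearises the difference. No higher-order inversion of power series is
  -- needed.
  have hlin : (fun z => U₂ z - U₁ z - κ₁ * d z) =o[𝓝 0] fun z => z ^ n := by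
    have h1 := hd₁.isLittleO
    have hVt : Tendsto (fun z => Vc₁ (U₂ z)) (𝓝 0) (𝓝 0) := by
      have := hp₁.analyticAt.continuousAt.tendsto
      rw [h₁0] at this
      exact this.comp hU₂t
    have h2 := h1.comp_tendsto (hVt.prodMk_nhds tendsto_id)
    have h3 : (fun z => Vc₁ (U₂ z) - z) =ᶠ[𝓝 0] d := by
      filter_upwards [hr₂] with z hz
      simp only [hd, hz]
    have h4 : (fun z => U₁ (Vc₁ (U₂ z)) - U₁ z - (Vc₁ (U₂ z) - z) * κ₁) =o[𝓝 0] fun z =>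
        Vc₁ (U₂ z) - z := by
      simpa [Function.comp_def] using h2
    refine ((h4.trans_eventuallyEq h3).trans_isBigO hdO).congr' ?_ EventuallyEq.rfl
    filter_upwards [h3, hU₂t.eventually hl₁] with z h5 h6
    rw [h6, h5]
    ring
  have hlim : Tendsto (fun z => (U₂ z - U₁ z) / z ^ n) (𝓝[≠] 0) (𝓝 (κ₁ * κ₂ ^ n * q)) := by
    have h1 := (hlin.mono hsub).tendsto_div_nhds_zero
    have h2 := (heU.mono hsub).tendsto_div_nhds_zero
    have h3 := h1.add ((((hs.pow n).const_mul q).add h2).const_mul κ₁)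
    simp only [zero_add, add_zero] at h3
    rw [show κ₁ * κ₂ ^ n * q = κ₁ * (q * κ₂ ^ n) by ring]
    refine h3.congr fun z => ?_
    rw [div_pow, hde]
    ring
  -- The quotient has a limit at 0; the removable singularity theorem makes the extension by that
  -- limit analytic.
  refine ⟨Function.update (fun z => (U₂ z - U₁ z) / z ^ n) 0 (κ₁ * κ₂ ^ n * q), ?_, by simp, ?_⟩
  · refine Complex.analyticAt_of_differentiable_on_punctured_nhds_of_continuousAt ?_ ?_
    · have := hsub (hU₁.eventually_analyticAt.and hU₂.eventually_analyticAt)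
      filter_upwards [this, self_mem_nhdsWithin] with z hz hz0
      have h1 : DifferentiableAt ℂ (fun z => (U₂ z - U₁ z) / z ^ n) z :=
        (hz.2.differentiableAt.sub hz.1.differentiableAt).div (by fun_prop) (pow_ne_zero _ hz0)
      refine h1.congr_of_eventuallyEq ?_
      filter_upwards [isOpen_ne.mem_nhds hz0] with y hy
      rw [Function.update_of_ne hy]
    · rw [continuousAt_update_same]; exact hlim
  · filter_upwards [self_mem_nhdsWithin] with z hz
    rw [Function.update_of_ne hz, mul_div_cancel₀ _ (pow_ne_zero _ hz)]

/-! ### The Langer variable -/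

/-- The coefficient `N = 3 ∫₀¹ s² U'(E - t s²) ds`: the Langer variable is `-t N^{2/3}`. -/
def langerCoeff (U : ℂ → ℂ) (t E : ℂ) : ℂ :=
  ∫ s in (0 : ℝ)..1, 3 * (s : ℂ) ^ 2 * deriv U (E - t * (s : ℂ) ^ 2)

/-- The principal cube root. -/
def cubeRoot (z : ℂ) : ℂ := exp (log z / 3)

theorem cubeRoot_ne_zero (z : ℂ) : cubeRoot z ≠ 0 := exp_ne_zero _

theorem cubeRoot_pow_three {z : ℂ} (hz : z ≠ 0) : cubeRoot z ^ 3 = z := by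
  rw [cubeRoot, ← exp_nat_mul]
  push_cast
  rw [mul_div_cancel₀ _ three_ne_zero, exp_log hz]

theorem hasDerivAt_cubeRoot {z : ℂ} (hz : z ∈ slitPlane) :
    HasDerivAt cubeRoot (cubeRoot z / (3 * z)) z := by
  have h := ((hasDerivAt_log hz).div_const 3).cexp
  refine h.congr_deriv ?_
  rw [cubeRoot]
  have := slitPlane_ne_zero hz
  field_simp

/-- The Langer variable `ξ = -t N^{2/3}`, `t = E - V(x)`. -/
def langer (Vc U : ℂ → ℂ) (p : ℂ × ℂ) : ℂ :=
  -(p.2 - Vc p.1) * cubeRoot (langerCoeff U (p.2 - Vc p.1) p.2) ^ 2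

theorem sub_mem_ball_of_half {R : ℝ} {E w : ℂ} (hE : ‖E‖ < R / 2) (hw : w ∈ Metric.ball (0 : ℂ) (R / 2)) :
    E - w ∈ Metric.ball (0 : ℂ) R := by
  rw [mem_ball_zero_iff] at hw ⊢
  refine (norm_sub_le _ _).trans_lt ?_
  linarith

theorem differentiableOn_comp_const_sub {R : ℝ} {f : ℂ → ℂ} {E : ℂ} (hf : DifferentiableOn ℂ f (Metric.ball 0 R))
    (hE : ‖E‖ < R / 2) : DifferentiableOn ℂ (fun w => f (E - w)) (Metric.ball 0 (R / 2)) :=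
  hf.comp (by fun_prop) fun _ hw => sub_mem_ball_of_half hE hw

/-- Integrate the derivative of θ³ U'(E - tθ²) over [0, 1]. The relation says that t^{3/2} N has
t-derivative (3/2) t^{1/2} U'(E - t), which is how N encodes the action integral without fractional
powers. -/
theorem langerCoeff_ode {R : ℝ} {U : ℂ → ℂ} {t E : ℂ} (hU : DifferentiableOn ℂ U (Metric.ball 0 R))
    (hE : ‖E‖ < R / 2) (ht : t ∈ Metric.ball (0 : ℂ) (R / 2)) :
    ∃ N' : ℂ, HasDerivAt (fun t => langerCoeff U t E) N' t ∧
      langerCoeff U t E + 2 / 3 * t * N' = deriv U (E - t) := by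
  set f : ℂ → ℂ := fun w => deriv U (E - w) with hf
  have hfd : DifferentiableOn ℂ f (Metric.ball 0 (R / 2)) :=
    differentiableOn_comp_const_sub (hU.deriv Metric.isOpen_ball) hE
  have hdc : ContinuousOn (deriv f) (Metric.ball 0 (R / 2)) :=
    (hfd.deriv Metric.isOpen_ball).continuousOn
  have c1 := continuousOn_comp_mul_sq hfd.continuousOn ht
  have c2 := continuousOn_comp_mul_sq hdc ht
  refine ⟨_, hasDerivAt_sqAvg hfd (p := fun s => 3 * (s : ℂ) ^ 2) (by fun_prop) ht, ?_⟩
  have hder : ∀ θ ∈ Set.uIcc (0 : ℝ) 1, HasDerivAt (fun θ : ℝ => (θ : ℂ) ^ 3 * f (t * (θ : ℂ) ^ 2))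
      (3 * (θ : ℂ) ^ 2 * f (t * (θ : ℂ) ^ 2) +
        2 / 3 * t * (3 * (θ : ℂ) ^ 2 * ((θ : ℂ) ^ 2 * deriv f (t * (θ : ℂ) ^ 2)))) θ := by
    intro θ hθ
    rw [Set.uIcc_of_le zero_le_one] at hθ
    have hmem := mul_sq_mem_ball ht hθ
    have h0 : HasDerivAt (fun θ : ℝ => (θ : ℂ)) 1 θ := by simpa using (hasDerivAt_id θ).ofReal_comp
    have h1 : HasDerivAt (fun θ : ℝ => t * (θ : ℂ) ^ 2) (t * (2 * (θ : ℂ))) θ := by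
      refine ((h0.fun_pow 2).const_mul t).congr_deriv ?_
      push_cast; ring
    have h2 := (hfd.differentiableAt (Metric.isOpen_ball.mem_nhds hmem)).hasDerivAt.comp θ h1
    refine ((h0.fun_pow 3).mul h2).congr_deriv ?_
    simp only [Function.comp_apply]
    push_cast; ring
  have hI1 : IntervalIntegrable (fun θ : ℝ => 3 * (θ : ℂ) ^ 2 * f (t * (θ : ℂ) ^ 2)) volume 0 1 :=
    ContinuousOn.intervalIntegrable (ContinuousOn.mul (by fun_prop) c1)
  have hI2 : IntervalIntegrable (fun θ : ℝ => 2 / 3 * t * (3 * (θ : ℂ) ^ 2 *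
      ((θ : ℂ) ^ 2 * deriv f (t * (θ : ℂ) ^ 2)))) volume 0 1 :=
    ContinuousOn.intervalIntegrable (ContinuousOn.mul (by fun_prop)
      (ContinuousOn.mul (by fun_prop) (ContinuousOn.mul (by fun_prop) c2)))
  have := intervalIntegral.integral_eq_sub_of_hasDerivAt hder (hI1.add hI2)
  rw [intervalIntegral.integral_add hI1 hI2, intervalIntegral.integral_const_mul] at this
  rw [langerCoeff]
  simp only [hf] at this ⊢
  rw [this]
  simp

/-- The weight 3s² has mass 1 on [0, 1], so N is an average of values of U'. -/
theorem norm_langerCoeff_sub_le {R κ : ℝ} {U : ℂ → ℂ} {t E : ℂ}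
    (hU : DifferentiableOn ℂ U (Metric.ball 0 R))
    (hκ : ∀ z ∈ Metric.ball (0 : ℂ) R, ‖deriv U z - κ‖ ≤ κ / 8)
    (hE : ‖E‖ < R / 2) (ht : t ∈ Metric.ball (0 : ℂ) (R / 2)) :
    ‖langerCoeff U t E - κ‖ ≤ κ / 8 := by
  have c1 := continuousOn_comp_mul_sq
    (differentiableOn_comp_const_sub (hU.deriv Metric.isOpen_ball) hE).continuousOn ht
  have i3 : ∫ s in (0 : ℝ)..1, 3 * s ^ 2 = 1 := by
    rw [intervalIntegral.integral_const_mul, integral_pow]; norm_num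
  have e : langerCoeff U t E - κ = ∫ s in (0 : ℝ)..1, 3 * (s : ℂ) ^ 2 *
      (deriv U (E - t * (s : ℂ) ^ 2) - κ) := by
    have i4 : ∫ s in (0 : ℝ)..1, 3 * (s : ℂ) ^ 2 * (κ : ℂ) = (κ : ℂ) := by
      have : ∀ s : ℝ, 3 * (s : ℂ) ^ 2 * (κ : ℂ) = ((3 * s ^ 2 : ℝ) : ℂ) * κ := fun s => by push_cast; ring
      simp_rw [this]
      rw [intervalIntegral.integral_mul_const, intervalIntegral.integral_ofReal, i3]
      simp
    simp_rw [mul_sub]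
    rw [intervalIntegral.integral_sub, i4, langerCoeff]
    · exact ContinuousOn.intervalIntegrable (ContinuousOn.mul (by fun_prop) c1)
    · exact Continuous.intervalIntegrable (by fun_prop) _ _
  rw [e]
  refine (intervalIntegral.norm_integral_le_of_norm_le (g := fun s => 3 * s ^ 2 * (κ / 8)) zero_le_one
    (Eventually.of_forall fun s hs => ?_) (Continuous.intervalIntegrable (by fun_prop) _ _)).trans ?_
  · rw [norm_mul, norm_mul, norm_pow, norm_real, Real.norm_eq_abs, sq_abs]
    have := hκ _ (sub_mem_ball_of_half hE (mul_sq_mem_ball ht (Set.Ioc_subset_Icc_self hs)))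
    simp only [norm_ofNat]
    gcongr
  · rw [intervalIntegral.integral_mul_const, i3, one_mul]

theorem langerCoeff_zero (U : ℂ → ℂ) (E : ℂ) : langerCoeff U 0 E = deriv U E := by
  have : ∀ s : ℝ, 3 * (s : ℂ) ^ 2 = ((3 * s ^ 2 : ℝ) : ℂ) := fun s => by push_cast; ring
  simp only [langerCoeff, zero_mul, sub_zero, this]
  rw [intervalIntegral.integral_mul_const, intervalIntegral.integral_ofReal,
    intervalIntegral.integral_const_mul, integral_pow]
  norm_num

theorem deriv_comp_const_sub_neg {U : ℂ → ℂ} {E w : ℂ} (hU : DifferentiableAt ℂ U (E - w)) :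
    HasDerivAt (fun w => -U (E - w)) (deriv U (E - w)) w := by
  have h1 : HasDerivAt (fun w : ℂ => E - w) (-1) w := by simpa using (hasDerivAt_id w).const_sub E
  have h2 := (hU.hasDerivAt.comp w h1).neg
  exact h2.congr_deriv (by ring)

/-- Both coefficients record the critical value of the same phase. Concretely, (1 - θ²) cancels the
denominator of the divided difference, and the resulting f(t) - ∫ f(tθ²) dθ is rewritten with
`sqAvg_add_two_mul_deriv`; t = 0 is separate. -/
theorem cubicCoeff_dslope {R : ℝ} {U : ℂ → ℂ} {t E : ℂ} (hU : DifferentiableOn ℂ U (Metric.ball 0 R))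
    (hE : ‖E‖ < R / 2) (ht : t ∈ Metric.ball (0 : ℂ) (R / 2)) :
    cubicCoeff (dslope (fun w => -U (E - w)) t) t = langerCoeff U t E := by
  set f : ℂ → ℂ := fun w => -U (E - w) with hf
  have hfd : DifferentiableOn ℂ f (Metric.ball 0 (R / 2)) := (differentiableOn_comp_const_sub hU hE).neg
  have hfder : ∀ w ∈ Metric.ball (0 : ℂ) (R / 2), deriv f w = deriv U (E - w) := fun w hw =>
    (deriv_comp_const_sub_neg (hU.differentiableAt
      (Metric.isOpen_ball.mem_nhds (sub_mem_ball_of_half hE hw)))).deriv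
  rcases eq_or_ne t 0 with rfl | h0
  · rw [cubicCoeff_zero, dslope_same, langerCoeff_zero, hfder 0 ht, sub_zero]
  · have h1 := sqAvg_add_two_mul_deriv hfd ht
    have c1 := continuousOn_comp_mul_sq hfd.continuousOn ht
    have e1 : t * (2 / 3 * cubicCoeff (dslope f t) t) =
        f t - ∫ θ in (0 : ℝ)..1, f (t * (θ : ℂ) ^ 2) := by
      have e2 : f t - (∫ θ in (0 : ℝ)..1, f (t * (θ : ℂ) ^ 2)) =
          ∫ θ in (0 : ℝ)..1, (f t - f (t * (θ : ℂ) ^ 2)) := by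
        rw [intervalIntegral.integral_sub (by simp) c1.intervalIntegrable]
        simp
      rw [e2, cubicCoeff, ← mul_assoc (2 / 3 : ℂ), show (2 / 3 : ℂ) * (3 / 2) = 1 by norm_num, one_mul,
        ← intervalIntegral.integral_const_mul]
      refine intervalIntegral.integral_congr fun θ _ => ?_
      have := sub_smul_dslope f t (t * (θ : ℂ) ^ 2)
      rw [smul_eq_mul] at this
      linear_combination -this
    have e3 : langerCoeff U t E = 3 * ∫ θ in (0 : ℝ)..1, (θ : ℂ) ^ 2 * deriv f (t * (θ : ℂ) ^ 2) := by
      rw [langerCoeff, ← intervalIntegral.integral_const_mul]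
      refine intervalIntegral.integral_congr fun θ hθ => ?_
      rw [Set.uIcc_of_le zero_le_one] at hθ
      rw [hfder _ (mul_sq_mem_ball ht hθ)]
      ring
    rw [e3]
    apply mul_left_cancel₀ h0
    linear_combination (3 / 2) * e1 - (3 / 2) * h1

/-! ### Joint analyticity of the Langer coefficient in (t, E) -/

/-- Integration of `3 s² f(s)` over `[0, 1]`, as a functional on continuous functions. -/
def sqWeightIntegral : C(unitInterval, ℂ) →L[ℂ] ℂ :=
  LinearMap.mkContinuous
    { toFun := fun f => ∫ s in (0 : ℝ)..1, 3 * (s : ℂ) ^ 2 * f (Set.projIcc 0 1 zero_le_one s)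
      map_add' := fun f g => by
        rw [← intervalIntegral.integral_add]
        · refine intervalIntegral.integral_congr fun s _ => ?_
          simp only [ContinuousMap.add_apply]
          ring
        · exact Continuous.intervalIntegrable (by have := continuous_projIcc (h := zero_le_one (α := ℝ)); fun_prop) _ _
        · exact Continuous.intervalIntegrable (by have := continuous_projIcc (h := zero_le_one (α := ℝ)); fun_prop) _ _
      map_smul' := fun c f => by
        rw [RingHom.id_apply, smul_eq_mul, ← intervalIntegral.integral_const_mul]
        refine intervalIntegral.integral_congr fun s _ => ?_
        simp only [ContinuousMap.smul_apply, smul_eq_mul]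
        ring } 3 fun f => by
    have : ∀ s ∈ Set.uIoc (0 : ℝ) 1, ‖3 * (s : ℂ) ^ 2 * f (Set.projIcc 0 1 zero_le_one s)‖ ≤ 3 * ‖f‖ := by
      intro s hs
      rw [Set.uIoc_of_le zero_le_one] at hs
      rw [norm_mul, norm_mul, norm_pow, norm_real, Real.norm_eq_abs, sq_abs]
      have h1 : s ^ 2 ≤ 1 := pow_le_one₀ hs.1.le hs.2
      have h2 := f.norm_coe_le_norm (Set.projIcc 0 1 zero_le_one s)
      simp only [norm_ofNat]
      calc 3 * s ^ 2 * _ ≤ 3 * 1 * ‖f‖ := by gcongr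
        _ = _ := by ring
    simpa using intervalIntegral.norm_integral_le_of_norm_le_const this

/-- The function `s ↦ E - t s²` of `s ∈ [0, 1]`, depending linearly on `(t, E)`. -/
def affineSq : ℂ × ℂ →L[ℂ] C(unitInterval, ℂ) :=
  (ContinuousLinearMap.snd ℂ ℂ ℂ).smulRight (1 : C(unitInterval, ℂ)) -
    (ContinuousLinearMap.fst ℂ ℂ ℂ).smulRight
      (⟨fun s => ((s : ℝ) : ℂ) ^ 2, by fun_prop⟩ : C(unitInterval, ℂ))

theorem affineSq_apply (p : ℂ × ℂ) (s : unitInterval) :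
    affineSq p s = p.2 - p.1 * ((s : ℝ) : ℂ) ^ 2 := by
  simp [affineSq]

/-- The power series of U' is summed in the Banach algebra of continuous functions on [0, 1] at the
element s ↦ E - t s², which depends linearly on (t, E). Applying a continuous linear functional
gives joint analyticity directly, with no differentiation under the integral in two variables. -/
theorem analyticAt_langerCoeff {U : ℂ → ℂ} (hU : AnalyticAt ℂ U 0) :
    AnalyticAt ℂ (fun p : ℂ × ℂ => langerCoeff U p.1 p.2) (0, 0) := by
  have hp := hU.deriv.hasFPowerSeriesAt
  set c : ℕ → ℂ := fun n => iteratedDeriv n (deriv U) 0 / n.factorial with hc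
  set q := FormalMultilinearSeries.ofScalars C(unitInterval, ℂ) c with hq
  have hrad : 0 < q.radius := lt_of_lt_of_le hp.radius_pos (ofScalars_radius_le fun _ => rfl)
  have hqb := q.hasFPowerSeriesOnBall hrad
  have h0 : affineSq (0, 0) = 0 := map_zero affineSq
  have hqa : AnalyticAt ℂ q.sum (affineSq (0, 0)) := by rw [h0]; exact hqb.analyticAt
  have hA : AnalyticAt ℂ (fun p : ℂ × ℂ => sqWeightIntegral (q.sum (affineSq p))) (0, 0) :=
    (sqWeightIntegral.analyticAt _).comp
      (hqa.comp (affineSq.analyticAt _))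
  refine hA.congr ?_
  have hs := hasFPowerSeriesAt_iff.1 hp
  obtain ⟨r, hr, hs⟩ := Metric.eventually_nhds_iff.1 hs
  have htend : Tendsto (fun p : ℂ × ℂ => affineSq p) (𝓝 (0, 0)) (𝓝 0) :=
    affineSq.continuous.tendsto' _ _ h0
  filter_upwards [htend.eventually (Metric.ball_mem_nhds _ hr),
    htend.eventually (Metric.eball_mem_nhds _ hrad)] with p hp1 hp2
  -- Evaluation at s is continuous and linear, so it commutes with the sum; uniqueness of sums
  -- identifies the value with that of U'.
  have hev : ∀ s : unitInterval, q.sum (affineSq p) s = deriv U (p.2 - p.1 * ((s : ℝ) : ℂ) ^ 2) := by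
    intro s
    have h1 := (hqb.hasSum hp2).mapL (ContinuousMap.evalCLM ℂ s)
    have h2 := hs (y := affineSq p s) (by
      rw [dist_zero_right]
      exact ((affineSq p).norm_coe_le_norm s).trans_lt (by simpa using hp1))
    rw [zero_add] at h2
    rw [← affineSq_apply]
    refine HasSum.unique ?_ h2
    refine (h1.congr_fun fun n => ?_).trans_eq ?_
    · simp [hq, FormalMultilinearSeries.ofScalars_apply_eq, mul_comm]
    · simp
  change ∫ s in (0 : ℝ)..1, 3 * (s : ℂ) ^ 2 * q.sum (affineSq p) (Set.projIcc 0 1 zero_le_one s) = _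
  refine intervalIntegral.integral_congr fun s hs => ?_
  rw [Set.uIcc_of_le zero_le_one] at hs
  rw [hev, Set.projIcc_of_mem zero_le_one hs]

theorem mem_slitPlane_of_norm_sub_le {κ : ℝ} (hκ : 0 < κ) {z : ℂ} (h : ‖z - κ‖ ≤ κ / 8) : z ∈ slitPlane :=
  Or.inl (re_pos_of_norm_sub_le h (by linarith))

namespace IsChart

variable {V : ℝ → ℝ} {R ρ κ : ℝ} {Vc U : ℂ → ℂ}

theorem deriv_mul_deriv (H : IsChart V R ρ κ Vc U) {z : ℂ} (hz : z ∈ Metric.ball (0 : ℂ) ρ) :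
    deriv U (Vc z) * deriv Vc z = 1 := by
  have h1 := (H.diffU.differentiableAt (Metric.isOpen_ball.mem_nhds (H.maps z hz))).hasDerivAt
  have h2 := (H.diffV.differentiableAt (Metric.isOpen_ball.mem_nhds hz)).hasDerivAt
  have h3 := h1.comp z h2
  refine h3.unique ((hasDerivAt_id z).congr_of_eventuallyEq ?_)
  filter_upwards [Metric.isOpen_ball.mem_nhds hz] with w hw
  exact H.left w hw

/-- Differentiating -t N^{2/3} with dt/dx = -V' gives N^{-1/3} (N + (2/3) t N') V', and the bracket
is U'(V) by `langerCoeff_ode`, the inverse of V'. So the Jacobian factor in the overlap is an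
explicit root of N. -/
theorem hasDerivAt_langer (H : IsChart V R ρ κ Vc U) {z E : ℂ} (hz : z ∈ Metric.ball (0 : ℂ) ρ)
    (hE : ‖E‖ < R / 2) (ht : E - Vc z ∈ Metric.ball (0 : ℂ) (R / 2)) :
    HasDerivAt (fun z => langer Vc U (z, E)) (cubeRoot (langerCoeff U (E - Vc z) E))⁻¹ z := by
  have h2 := (H.diffV.differentiableAt (Metric.isOpen_ball.mem_nhds hz)).hasDerivAt
  have hN := norm_langerCoeff_sub_le H.diffU H.close hE ht
  have hsl := mem_slitPlane_of_norm_sub_le H.κ_pos hN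
  obtain ⟨N', hN', hode⟩ := langerCoeff_ode H.diffU hE ht
  have ht' := h2.const_sub E
  have h3 := ((hasDerivAt_cubeRoot hsl).comp z (hN'.comp z ht')).fun_pow 2
  have h4 := ht'.neg.mul h3
  refine h4.congr_deriv ?_
  have hUV := H.deriv_mul_deriv hz
  rw [sub_sub_cancel] at hode
  rw [← hode] at hUV
  simp only [Function.comp_apply, neg_neg, Pi.neg_apply]
  set N := langerCoeff U (E - Vc z) E
  have hN0 : N ≠ 0 := slitPlane_ne_zero hsl
  have hM3 := cubeRoot_pow_three hN0
  set M := cubeRoot N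
  have hM0 : M ≠ 0 := cubeRoot_ne_zero N
  rw [← hM3] at hUV hN0 ⊢
  field_simp
  field_simp at hUV
  push_cast
  linear_combination M * hUV


theorem deriv_im (H : IsChart V R ρ κ Vc U) {y : ℝ} (hy : |y| < R) : (deriv U y).im = 0 := by
  have hm : (y : ℂ) ∈ Metric.ball (0 : ℂ) R := by
    rw [mem_ball_zero_iff, norm_real]; exact hy
  have h1 := (H.diffU.differentiableAt (Metric.isOpen_ball.mem_nhds hm)).hasDerivAt
  have h2 : HasDerivAt (fun y : ℝ => U y) (deriv U y) y := h1.comp_ofReal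
  have h3 : HasDerivAt (fun y : ℝ => (U y).im) (deriv U y).im y :=
    (imCLM.hasFDerivAt.comp_hasDerivAt y h2)
  refine h3.unique ((hasDerivAt_const y (0 : ℝ)).congr_of_eventuallyEq ?_)
  filter_upwards [(isOpen_lt continuous_abs continuous_const).mem_nhds hy] with x hx
  exact H.real x hx

theorem deriv_re_mul_deriv (H : IsChart V R ρ κ Vc U) {y v : ℝ} (hy : |y| < ρ) (hV : HasDerivAt V v y) :
    (deriv U (V y : ℂ)).re * v = 1 := by
  have hm : ∀ x : ℝ, |x| < ρ → (x : ℂ) ∈ Metric.ball (0 : ℂ) ρ := fun x hx => by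
    rw [mem_ball_zero_iff, norm_real]; exact hx
  have h0 : (V y : ℂ) ∈ Metric.ball (0 : ℂ) R := by
    rw [← H.eq_real y hy]; exact H.maps _ (hm y hy)
  have h1 := (H.diffU.differentiableAt (Metric.isOpen_ball.mem_nhds h0)).hasDerivAt
  have h2 := HasDerivAt.comp (h := fun x : ℝ => (V x : ℂ)) y h1 hV.ofReal_comp
  have h3 : deriv U (V y : ℂ) * v = 1 := by
    refine h2.unique (((hasDerivAt_id y).ofReal_comp).congr_of_eventuallyEq ?_)
    filter_upwards [(isOpen_lt continuous_abs continuous_const).mem_nhds hy] with x hx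
    simp only [Function.comp_apply, id]
    rw [← H.eq_real x hx, H.left _ (hm x hx)]
  have := congrArg re h3
  simpa using this

theorem langerCoeff_im (H : IsChart V R ρ κ Vc U) {t E : ℝ} (ht : |t| < R / 2) (hE : |E| < R / 2) :
    (langerCoeff U t E).im = 0 := by
  have : langerCoeff U t E = ((∫ s in (0 : ℝ)..1, 3 * s ^ 2 * (deriv U (E - t * (s : ℂ) ^ 2)).re : ℝ) : ℂ) := by
    rw [langerCoeff, ← intervalIntegral.integral_ofReal]
    refine intervalIntegral.integral_congr fun s hs => ?_
    rw [Set.uIcc_of_le zero_le_one] at hs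
    have hs1 : s ^ 2 ≤ 1 := pow_le_one₀ hs.1 hs.2
    have h1 : |E - t * s ^ 2| < R := by
      have : |t * s ^ 2| ≤ |t| := by
        rw [abs_mul, abs_of_nonneg (sq_nonneg s)]
        exact mul_le_of_le_one_right (abs_nonneg _) hs1
      have := abs_sub E (t * s ^ 2)
      linarith
    have h2 := H.deriv_im h1
    push_cast at h2 ⊢
    conv_lhs => rw [← re_add_im (deriv U (E - t * (s : ℂ) ^ 2)), h2]
    simp
  rw [this, ofReal_im]

end IsChart

/-! ### Agreement with the real definition of the Langer variable -/

theorem cubeRoot_ofReal {x : ℝ} (hx : 0 < x) : cubeRoot x = ((x ^ (1 / 3 : ℝ) : ℝ) : ℂ) := by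
  rw [cubeRoot, ← ofReal_log hx.le, Real.rpow_def_of_pos hx]
  push_cast
  ring_nf

/-- Integrating `√|E - V|` from the turning point: `(3/2) |∫ₓᵃ √|E - V|| = |t|^{3/2} N`. -/
theorem integral_sqrt_eq {V Nr Nr' : ℝ → ℝ} {E x a σ : ℝ} (hσ : σ ^ 2 = 1) (ha : V a = E)
    (hV : ∀ y ∈ Set.uIcc x a, DifferentiableAt ℝ V y)
    (hpos : ∀ y ∈ Set.uIcc x a, 0 ≤ σ * (E - V y))
    (hN : ∀ y ∈ Set.uIcc x a, HasDerivAt Nr (Nr' (E - V y)) (E - V y))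
    (hode : ∀ y ∈ Set.uIcc x a, (Nr (E - V y) + 2 / 3 * (E - V y) * Nr' (E - V y)) * deriv V y = 1) :
    3 / 2 * ∫ y in x..a, √(σ * (E - V y)) = σ * ((σ * (E - V x)) ^ (3 / 2 : ℝ) * Nr (E - V x)) := by
  -- The sign σ is 1 on the allowed side V ≤ E and -1 on the forbidden side, so both cases share one
  -- primitive.
  have hd : ∀ y ∈ Set.uIcc x a, HasDerivAt (fun y => (σ * (E - V y)) ^ (3 / 2 : ℝ) * Nr (E - V y))
      (-σ * (3 / 2 * √(σ * (E - V y)))) y := by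
    intro y hy
    have h1 := (hV y hy).hasDerivAt.const_sub E
    have h2 := (h1.const_mul σ).rpow_const (p := 3 / 2) (Or.inr (by norm_num))
    have h3 := h2.mul ((hN y hy).comp y h1)
    refine h3.congr_deriv ?_
    have h4 := hode y hy
    have hp := hpos y hy
    simp only [Function.comp_apply]
    rw [show (3 / 2 - 1 : ℝ) = 1 / 2 by norm_num, ← Real.sqrt_eq_rpow]
    have e : (σ * (E - V y)) ^ (3 / 2 : ℝ) = σ * (E - V y) * √(σ * (E - V y)) := by
      rw [Real.sqrt_eq_rpow, show (3 / 2 : ℝ) = 1 + 1 / 2 by norm_num,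
        Real.rpow_add_of_nonneg hp zero_le_one (by norm_num), Real.rpow_one]
    rw [e]
    linear_combination -(σ * (3 / 2) * √(σ * (E - V y))) * h4
  have hc : ContinuousOn (fun y => √(σ * (E - V y))) (Set.uIcc x a) := by
    have : ContinuousOn V (Set.uIcc x a) := fun y hy => (hV y hy).continuousAt.continuousWithinAt
    fun_prop
  have := intervalIntegral.integral_eq_sub_of_hasDerivAt hd
    (ContinuousOn.intervalIntegrable (by fun_prop))
  rw [intervalIntegral.integral_const_mul, intervalIntegral.integral_const_mul] at this
  rw [ha, sub_self, mul_zero, Real.zero_rpow (by norm_num), zero_mul, zero_sub] at this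
  linear_combination -σ * this - (3 / 2 * ∫ y in x..a, √(σ * (E - V y))) * hσ

theorem rpow_mul_rpow_two_thirds {u N : ℝ} (hu : 0 ≤ u) (hN : 0 ≤ N) :
    (u ^ (3 / 2 : ℝ) * N) ^ (2 / 3 : ℝ) = u * (N ^ (1 / 3 : ℝ)) ^ 2 := by
  rw [Real.mul_rpow (by positivity) hN, ← Real.rpow_mul hu, ← Real.rpow_natCast, ← Real.rpow_mul hN]
  norm_num

/-- Analyticity is composition of analytic maps, the cube root being taken near a positive number.
On real arguments the action integral is |t|^{3/2} N by `integral_sqrt_eq`, and its power 2/3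
carries the sign conventions of the two sides of the turning point. -/
theorem isXi_langer {V : ℝ → ℝ} {R ρ κ : ℝ} {Vc U : ℂ → ℂ} (H : IsChart V R ρ κ Vc U)
    (hV : AnalyticAt ℝ V 0) (hV0 : V 0 = 0) (hV' : 0 < deriv V 0) (hVc : AnalyticAt ℂ Vc 0)
    (hU : AnalyticAt ℂ U 0) : IsXi V (langer Vc U) := by
  constructor
  · have h1 : AnalyticAt ℂ (fun p : ℂ × ℂ => p.2 - Vc p.1) (0, 0) :=
      analyticAt_snd.sub (hVc.comp_of_eq analyticAt_fst rfl)
    have h00 : ((0 : ℂ) - Vc 0, (0 : ℂ)) = (0, 0) := by rw [H.zero, sub_zero]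
    have h2 : AnalyticAt ℂ (fun p : ℂ × ℂ => langerCoeff U (p.2 - Vc p.1) p.2) (0, 0) :=
      AnalyticAt.comp_of_eq (g := fun p : ℂ × ℂ => langerCoeff U p.1 p.2)
        (f := fun p : ℂ × ℂ => (p.2 - Vc p.1, p.2)) (analyticAt_langerCoeff hU)
        (h1.prod analyticAt_snd) h00
    have h3 : AnalyticAt ℂ cubeRoot (langerCoeff U (0 - Vc 0) 0) := by
      have hsl : langerCoeff U (0 - Vc 0) 0 ∈ slitPlane := by
        rw [H.zero, sub_zero]
        have hR := H.R_pos
        exact mem_slitPlane_of_norm_sub_le H.κ_pos (norm_langerCoeff_sub_le H.diffU H.close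
          (by simpa using hR) (Metric.mem_ball_self (by linarith)))
      exact ((analyticAt_clog hsl).div_const).cexp
    have h4 := AnalyticAt.comp_of_eq (g := cubeRoot)
      (f := fun p : ℂ × ℂ => langerCoeff U (p.2 - Vc p.1) p.2) h3 h2 rfl
    exact h1.neg.mul (h4.pow 2)
  · have hev : ∀ᶠ x in 𝓝 (0 : ℝ), 0 < deriv V x ∧ AnalyticAt ℝ V x ∧ |V x| < R / 4 := by
      have h1 : Tendsto (fun x => |V x|) (𝓝 0) (𝓝 0) := by
        simpa [hV0] using hV.continuousAt.abs.tendsto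
      have hR := H.R_pos
      exact (hV.deriv.continuousAt.eventually_const_lt hV').and
        (hV.eventually_analyticAt.and (h1.eventually_lt_const (by linarith)))
    obtain ⟨ρ₁, hρ₁, hev⟩ := Metric.eventually_nhds_iff.1 hev
    have hR := H.R_pos
    have hρ := H.ρ_pos
    refine ⟨min (min ρ ρ₁) (R / 4), by positivity, fun x E a hx hE ha hVa => ?_⟩
    simp only [lt_min_iff] at hx hE ha
    set I := Set.Ioo (-(min ρ ρ₁)) (min ρ ρ₁) with hI
    have hIm : ∀ y ∈ I, |y| < ρ ∧ |y| < ρ₁ := fun y hy => lt_min_iff.1 (abs_lt.2 hy)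
    have hev' : ∀ y ∈ I, 0 < deriv V y ∧ AnalyticAt ℝ V y ∧ |V y| < R / 4 := fun y hy =>
      hev (by rw [Real.dist_eq, sub_zero]; exact (hIm y hy).2)
    -- Monotonicity makes E - V have constant sign between x and the turning point, so the square
    -- roots are of nonnegative numbers.
    have hmono : StrictMonoOn V I := by
      refine strictMonoOn_of_deriv_pos (convex_Ioo _ _)
        (fun y hy => (hev' y hy).2.1.continuousAt.continuousWithinAt) fun y hy => ?_
      rw [interior_Ioo] at hy
      exact (hev' y hy).1
    have hxI : x ∈ I := abs_lt.1 (lt_min hx.1.1 hx.1.2)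
    have haI : a ∈ I := abs_lt.1 (lt_min ha.1.1 ha.1.2)
    have hsub : Set.uIcc x a ⊆ I := (Set.ordConnected_Ioo).uIcc_subset hxI haI
    have hEh : ‖(E : ℂ)‖ < R / 2 := by rw [norm_real, Real.norm_eq_abs]; linarith [hE.2]
    have hEr : |E| < R / 2 := by linarith [hE.2]
    have htr : ∀ y ∈ I, |E - V y| < R / 2 := fun y hy => by
      have := abs_sub E (V y)
      linarith [(hev' y hy).2.2, hE.2]
    have ht : ∀ y ∈ I, ((E - V y : ℝ) : ℂ) ∈ Metric.ball (0 : ℂ) (R / 2) := fun y hy => by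
      rw [mem_ball_zero_iff, norm_real]; exact htr y hy
    have hode := fun t (ht : t ∈ Metric.ball (0 : ℂ) (R / 2)) => langerCoeff_ode H.diffU hEh ht
    choose! N' hN' hode using hode
    set Nr : ℝ → ℝ := fun t => (langerCoeff U t E).re with hNr
    have key : ∀ σ : ℝ, σ ^ 2 = 1 → (∀ y ∈ Set.uIcc x a, 0 ≤ σ * (E - V y)) →
        3 / 2 * ∫ y in x..a, √(σ * (E - V y)) = σ * ((σ * (E - V x)) ^ (3 / 2 : ℝ) * Nr (E - V x)) := by
      intro σ hσ hpos
      refine integral_sqrt_eq (Nr' := fun t => (N' t).re) hσ hVa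
        (fun y hy => (hev' y (hsub hy)).2.1.differentiableAt) hpos
        (fun y hy => (hN' _ (ht y (hsub hy))).real_of_complex) fun y hy => ?_
      have h1 := hode _ (ht y (hsub hy))
      have h2 := H.deriv_re_mul_deriv (hIm y (hsub hy)).1 (hev' y (hsub hy)).2.1.differentiableAt.hasDerivAt
      have h3 := congrArg re h1
      rw [show (E : ℂ) - ((E - V y : ℝ) : ℂ) = (V y : ℂ) by push_cast; ring] at h3
      rw [← h2, ← h3]
      congr 1
      simp [hNr]
    have hNeq : langerCoeff U ((E - V x : ℝ) : ℂ) E = (Nr (E - V x) : ℂ) := by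
      conv_lhs => rw [← re_add_im (langerCoeff U ((E - V x : ℝ) : ℂ) E), H.langerCoeff_im (htr x hxI) hEr]
      simp [hNr]
    have hNpos : 0 < Nr (E - V x) := by
      have := norm_langerCoeff_sub_le H.diffU H.close hEh (ht x hxI)
      exact re_pos_of_norm_sub_le this (by linarith [H.κ_pos])
    have hξ : langer Vc U ((x : ℂ), (E : ℂ)) =
        ((-(E - V x) * (Nr (E - V x) ^ (1 / 3 : ℝ)) ^ 2 : ℝ) : ℂ) := by
      simp only [langer]
      rw [H.eq_real x hx.1.1, ← ofReal_sub, hNeq, cubeRoot_ofReal hNpos]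
      push_cast
      ring
    rw [hξ, xiReal]
    congr 1
    split_ifs with hxa
    · have hp : ∀ y ∈ Set.uIcc x a, 0 ≤ 1 * (E - V y) := fun y hy => by
        have h1 := hsub hy
        rw [Set.uIcc_of_le hxa] at hy
        have := hmono.monotoneOn h1 haI hy.2
        linarith
      have h1 := key 1 (by norm_num) hp
      simp only [one_mul] at h1 hp
      rw [h1, rpow_mul_rpow_two_thirds (hp x Set.left_mem_uIcc) hNpos.le]
      ring
    · have hxa' : a ≤ x := (not_le.1 hxa).le
      have hp : ∀ y ∈ Set.uIcc x a, 0 ≤ (-1) * (E - V y) := fun y hy => by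
        have h1 := hsub hy
        rw [Set.uIcc_of_ge hxa'] at hy
        have := hmono.monotoneOn haI h1 hy.1
        linarith
      have h1 := key (-1) (by norm_num) hp
      rw [intervalIntegral.integral_symm] at h1
      have h2 : 3 / 2 * ∫ t in a..x, √(V t - E) = (-1 * (E - V x)) ^ (3 / 2 : ℝ) * Nr (E - V x) := by
        rw [intervalIntegral.integral_congr (g := fun y => √(-1 * (E - V y)))
          fun y _ => by simp only [neg_mul, one_mul, neg_sub]]
        linarith
      rw [h2, rpow_mul_rpow_two_thirds (hp x Set.left_mem_uIcc) hNpos.le]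
      ring

/-! ### The action integral -/

/-- The mean value inequality along the vertical segment from Re z. It is how Im E = O(h) propagates
to every quantity that is real for real energies. -/
theorem abs_im_le_of_real {S : Set ℂ} (hS : Convex ℝ S) {f f' : ℂ → ℂ} {C : ℝ}
    (hf : ∀ z ∈ S, HasDerivAt f (f' z) z) (hC : ∀ z ∈ S, ‖f' z‖ ≤ C) {z : ℂ} (hz : z ∈ S)
    (hz' : (z.re : ℂ) ∈ S) (hre : (f z.re).im = 0) : |(f z).im| ≤ C * |z.im| := by
  have h := hS.norm_image_sub_le_of_norm_hasDerivWithin_le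
    (fun w hw => (hf w hw).hasDerivWithinAt) hC hz' hz
  have e : ‖z - z.re‖ = |z.im| := by
    have : z - z.re = (z.im : ℂ) * I := by nth_rw 1 [← re_add_im z]; ring
    rw [this, norm_mul, norm_I, mul_one, norm_real, Real.norm_eq_abs]
  rw [e] at h
  refine le_trans ?_ h
  have := abs_im_le_norm (f z - f z.re)
  rwa [sub_im, hre, sub_zero] at this

theorem abs_im_mul_le (a b : ℂ) : |(a * b).im| ≤ |a.im| * ‖b‖ + ‖a‖ * |b.im| := by
  rw [mul_im]
  refine (abs_add_le _ _).trans ?_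
  rw [abs_mul, abs_mul]
  have h1 := abs_re_le_norm a
  have h2 := abs_re_le_norm b
  have := mul_le_mul_of_nonneg_right h1 (abs_nonneg b.im)
  have := mul_le_mul_of_nonneg_left h2 (abs_nonneg a.im)
  linarith

theorem ofReal_re_mem_ball {z : ℂ} {R : ℝ} (hz : z ∈ Metric.ball (0 : ℂ) R) :
    (z.re : ℂ) ∈ Metric.ball (0 : ℂ) R := by
  rw [mem_ball_zero_iff] at hz ⊢
  rw [norm_real]
  exact (abs_re_le_norm z).trans_lt hz

theorem hasDerivAt_primitive {f : ℝ → ℂ} {a x : ℝ} (hf : ContinuousOn f (Set.Ioo (-a) a))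
    (hx : x ∈ Set.Ioo (-a) a) : HasDerivAt (fun x => ∫ τ in (0 : ℝ)..x, f τ) (f x) x := by
  have h0 : (0 : ℝ) ∈ Set.Ioo (-a) a := ⟨by linarith [hx.1, hx.2], by linarith [hx.1, hx.2]⟩
  refine intervalIntegral.integral_hasDerivAt_right ?_
    (hf.stronglyMeasurableAtFilter isOpen_Ioo x hx) (hf.continuousAt (isOpen_Ioo.mem_nhds hx))
  exact (hf.mono (Set.ordConnected_Ioo.uIcc_subset h0 hx)).intervalIntegrable

/-- The action `∫₀^η U(E - τ²) dτ`. -/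
def action (U : ℂ → ℂ) (E : ℂ) (η : ℝ) : ℂ := ∫ τ in (0 : ℝ)..η, U (E - (τ : ℂ) ^ 2)

theorem sub_sq_mem_ball {R r : ℝ} {E : ℂ} (hrR : r ^ 2 ≤ R / 2) (hE : ‖E‖ < R / 2)
    {x : ℝ} (hx : |x| ≤ r) : E - (x : ℂ) ^ 2 ∈ Metric.ball (0 : ℂ) R := by
  rw [mem_ball_zero_iff]
  refine (norm_sub_le _ _).trans_lt ?_
  rw [norm_pow, norm_real, Real.norm_eq_abs]
  have := pow_le_pow_left₀ (abs_nonneg x) hx 2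
  linarith

theorem hasDerivAt_action {R r : ℝ} {U : ℂ → ℂ} {E : ℂ} (hU : ContinuousOn U (Metric.ball 0 R))
    (hrR : r ^ 2 ≤ R / 2) (hE : ‖E‖ < R / 2) {x : ℝ} (hx : x ∈ Set.Ioo (-r) r) :
    HasDerivAt (action U E) (U (E - (x : ℂ) ^ 2)) x := by
  refine hasDerivAt_primitive (a := r) (f := fun τ : ℝ => U (E - (τ : ℂ) ^ 2)) ?_ hx
  exact hU.comp (by fun_prop) fun τ hτ => sub_sq_mem_ball hrR hE (abs_le.2 ⟨hτ.1.le, hτ.2.le⟩)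

theorem cubeRoot_re_pos (z : ℂ) : 0 < (cubeRoot z).re := by
  rw [cubeRoot, exp_re]
  refine mul_pos (Real.exp_pos _) (Real.cos_pos_of_mem_Ioo ?_)
  have e : (log z / 3).im = z.arg / 3 := by
    rw [show (3 : ℂ) = ((3 : ℝ) : ℂ) by push_cast; rfl, div_ofReal_im, log_im]
  have h1 := neg_pi_lt_arg z
  have h2 := arg_le_pi z
  have := Real.pi_pos
  rw [e]
  constructor <;> linarith

/-- The closed disc of radius κ/8 about κ is compact and inside the slit plane, so the bounds are
extrema of continuous functions on it. -/
theorem exists_cubeRoot_bounds {κ : ℝ} (hκ : 0 < κ) : ∃ m₀ m₁ : ℝ, 0 < m₀ ∧ 0 < m₁ ∧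
    ∀ z : ℂ, ‖z - κ‖ ≤ κ / 8 → m₀ ≤ (cubeRoot z).re ∧ ‖cubeRoot z‖ ≤ m₁ ∧
      |(cubeRoot z).im| ≤ m₁ * |z.im| := by
  have hsl : ∀ z ∈ Metric.closedBall (κ : ℂ) (κ / 8), z ∈ slitPlane := fun z hz => by
    rw [mem_closedBall_iff_norm] at hz
    exact mem_slitPlane_of_norm_sub_le hκ hz
  have hK := isCompact_closedBall (κ : ℂ) (κ / 8)
  have hc : ContinuousOn cubeRoot (Metric.closedBall (κ : ℂ) (κ / 8)) := fun z hz =>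
    (hasDerivAt_cubeRoot (hsl z hz)).continuousAt.continuousWithinAt
  obtain ⟨z₀, _, hmin⟩ := hK.exists_isMinOn ⟨(κ : ℂ), Metric.mem_closedBall_self (by positivity)⟩
    (continuous_re.comp_continuousOn hc)
  obtain ⟨m, hm⟩ := hK.exists_bound_of_continuousOn hc
  obtain ⟨d, hd⟩ := hK.exists_bound_of_continuousOn (f := fun z => cubeRoot z / (3 * z))
    (hc.div (by fun_prop) fun z hz => mul_ne_zero three_ne_zero (slitPlane_ne_zero (hsl z hz)))
  refine ⟨_, max (max m d) 1, cubeRoot_re_pos z₀,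
    lt_max_of_lt_right one_pos, fun z hz => ?_⟩
  have hz' := mem_closedBall_iff_norm.2 hz
  refine ⟨hmin hz', (hm z hz').trans ((le_max_left _ _).trans (le_max_left _ _)), ?_⟩
  have hzr : (z.re : ℂ) ∈ Metric.closedBall (κ : ℂ) (κ / 8) := by
    rw [mem_closedBall_iff_norm, ← ofReal_sub, norm_real]
    refine le_trans ?_ hz
    have := abs_re_le_norm (z - κ)
    rwa [sub_re, ofReal_re] at this
  have hpos : 0 < z.re := re_pos_of_norm_sub_le hz (by linarith)
  refine (abs_im_le_of_real (convex_closedBall _ _) (fun w hw => hasDerivAt_cubeRoot (hsl w hw)) hd hz' hzr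
    ?_).trans ?_
  · rw [cubeRoot_ofReal hpos, ofReal_im]
  · exact mul_le_mul_of_nonneg_right ((le_max_right _ _).trans (le_max_left _ _)) (abs_nonneg _)

namespace IsChart

variable {V : ℝ → ℝ} {R ρ κ : ℝ} {Vc U : ℂ → ℂ}

theorem norm_deriv_le (H : IsChart V R ρ κ Vc U) {z : ℂ} (hz : z ∈ Metric.ball (0 : ℂ) R) :
    ‖deriv U z‖ ≤ 2 * κ := by
  have := norm_le_of_norm_sub_le H.κ_pos.le (H.close z hz)
  linarith [H.κ_pos]

theorem hasDerivAt_inverse (H : IsChart V R ρ κ Vc U) {z : ℂ} (hz : z ∈ Metric.ball (0 : ℂ) R) :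
    HasDerivAt U (deriv U z) z :=
  (H.diffU.differentiableAt (Metric.isOpen_ball.mem_nhds hz)).hasDerivAt

theorem abs_im_inverse_le (H : IsChart V R ρ κ Vc U) {z : ℂ} (hz : z ∈ Metric.ball (0 : ℂ) R) :
    |(U z).im| ≤ 2 * κ * |z.im| := by
  have hz' := ofReal_re_mem_ball hz
  refine abs_im_le_of_real (convex_ball 0 R) (fun w hw => H.hasDerivAt_inverse hw)
    (fun w hw => H.norm_deriv_le hw) hz hz' (H.real _ ?_)
  simpa using hz'

theorem holBdd_deriv (H : IsChart V R ρ κ Vc U) : HolBdd R (2 * κ) (deriv U) :=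
  ⟨H.diffU.deriv Metric.isOpen_ball, fun _ hz => H.norm_deriv_le hz⟩

theorem abs_im_deriv_le (H : IsChart V R ρ κ Vc U) {z : ℂ} (hz : z ∈ Metric.ball (0 : ℂ) (R / 2)) :
    |(deriv U z).im| ≤ 4 * κ / R * |z.im| := by
  have hR := H.R_pos
  have hz' := ofReal_re_mem_ball hz
  have hsub : Metric.ball (0 : ℂ) (R / 2) ⊆ Metric.ball 0 R := Metric.ball_subset_ball (by linarith)
  have hd := H.holBdd_deriv.deriv (s' := R / 2) (by linarith)
  refine abs_im_le_of_real (convex_ball 0 (R / 2)) (fun w hw => H.holBdd_deriv.hasDerivAt (hsub hw))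
    (fun w hw => (hd.bdd w hw).trans (le_of_eq ?_)) hz hz' (H.deriv_im ?_)
  · field_simp; ring
  · have := hsub hz'; simpa using this

/-- With t = E - V(x) and x real, t and E have the same imaginary part, so E - t s² has imaginary
part (1 - s²) Im E, at most |Im E|. -/
theorem abs_im_langerCoeff_le (H : IsChart V R ρ κ Vc U) {t E : ℂ} (htE : t.im = E.im)
    (hE : ‖E‖ < R / 4) (ht : ‖t‖ < R / 4) : |(langerCoeff U t E).im| ≤ 12 * κ / R * |E.im| := by
  have hR := H.R_pos
  have hκ := H.κ_pos
  have hmem : ∀ s ∈ Set.Icc (0 : ℝ) 1, E - t * (s : ℂ) ^ 2 ∈ Metric.ball (0 : ℂ) (R / 2) := fun s hs =>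
    sub_mem_ball_of_half (by linarith) (mul_sq_mem_ball (by rw [mem_ball_zero_iff]; linarith) hs)
  have c1 : ContinuousOn (fun s : ℝ => deriv U (E - t * (s : ℂ) ^ 2)) (Set.uIcc 0 1) := by
    rw [Set.uIcc_of_le zero_le_one]
    exact (H.holBdd_deriv.diff.continuousOn.mono (Metric.ball_subset_ball (by linarith))).comp
      (by fun_prop) hmem
  have e : (langerCoeff U t E).im =
      ∫ s in (0 : ℝ)..1, (3 * (s : ℂ) ^ 2 * deriv U (E - t * (s : ℂ) ^ 2)).im := by
    rw [langerCoeff]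
    exact (imCLM.intervalIntegral_comp_comm (ContinuousOn.intervalIntegrable
      (ContinuousOn.mul (by fun_prop) c1))).symm
  rw [e]
  have hb : ∀ s ∈ Set.uIoc (0 : ℝ) 1, ‖(3 * (s : ℂ) ^ 2 * deriv U (E - t * (s : ℂ) ^ 2)).im‖ ≤
      12 * κ / R * |E.im| := by
    intro s hs
    rw [Set.uIoc_of_le zero_le_one] at hs
    have hs1 : s ^ 2 ≤ 1 := pow_le_one₀ hs.1.le hs.2
    have h1 := H.abs_im_deriv_le (hmem s ⟨hs.1.le, hs.2⟩)
    have e1 : (E - t * (s : ℂ) ^ 2).im = (1 - s ^ 2) * E.im := by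
      rw [sub_im, ← ofReal_pow, im_mul_ofReal, htE]; ring
    rw [show 3 * (s : ℂ) ^ 2 = ((3 * s ^ 2 : ℝ) : ℂ) by push_cast; ring, im_ofReal_mul, Real.norm_eq_abs,
      abs_mul, abs_of_nonneg (by positivity)]
    rw [e1, abs_mul, abs_of_nonneg (show (0 : ℝ) ≤ 1 - s ^ 2 by linarith)] at h1
    have hE0 := abs_nonneg E.im
    have h2 : (1 - s ^ 2) * |E.im| ≤ 1 * |E.im| := by
      apply mul_le_mul_of_nonneg_right _ hE0; linarith [sq_nonneg s]
    calc 3 * s ^ 2 * _ ≤ 3 * 1 * (4 * κ / R * (1 * |E.im|)) := by gcongr; exact h1.trans (by gcongr)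
      _ = _ := by ring
  simpa using intervalIntegral.norm_integral_le_of_norm_le_const hb

theorem abs_im_action_le (H : IsChart V R ρ κ Vc U) {r : ℝ} {E : ℂ} (hr1 : r ≤ 1)
    (hrR : r ^ 2 ≤ R / 2) (hE : ‖E‖ < R / 2) {x : ℝ} (hx : |x| ≤ r) :
    |(action U E x).im| ≤ 2 * κ * |E.im| := by
  have hκ := H.κ_pos
  have hmem : ∀ τ ∈ Set.uIcc 0 x, |τ| ≤ r := fun τ hτ => by
    have := Set.abs_sub_left_of_mem_uIcc hτ
    simp only [sub_zero] at this
    exact this.trans hx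
  have c1 : ContinuousOn (fun τ : ℝ => U (E - (τ : ℂ) ^ 2)) (Set.uIcc 0 x) :=
    H.diffU.continuousOn.comp (by fun_prop) fun τ hτ => sub_sq_mem_ball hrR hE (hmem τ hτ)
  have e : (action U E x).im = ∫ τ in (0 : ℝ)..x, (U (E - (τ : ℂ) ^ 2)).im :=
    (imCLM.intervalIntegral_comp_comm c1.intervalIntegrable).symm
  rw [e]
  have hb : ∀ τ ∈ Set.uIoc 0 x, ‖(U (E - (τ : ℂ) ^ 2)).im‖ ≤ 2 * κ * |E.im| := fun τ hτ => by
    have h1 := H.abs_im_inverse_le (sub_sq_mem_ball hrR hE (hmem τ (Set.uIoc_subset_uIcc hτ)))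
    have e2 : (E - (τ : ℂ) ^ 2).im = E.im := by rw [sub_im, ← ofReal_pow, ofReal_im, sub_zero]
    rw [e2] at h1
    exact h1
  refine (intervalIntegral.norm_integral_le_of_norm_le_const hb).trans ?_
  rw [sub_zero]
  exact mul_le_of_le_one_right (by positivity) (hx.trans hr1)

/-- The divided difference of `w ↦ -U(E - w)` is close to `κ`. -/
theorem norm_dslope_sub_le (H : IsChart V R ρ κ Vc U) {t E : ℂ}
    (hE : ‖E‖ < R / 2) (ht : t ∈ Metric.ball (0 : ℂ) (R / 2)) {w : ℂ} (hw : w ∈ Metric.ball (0 : ℂ) (R / 2)) :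
    ‖dslope (fun w => -U (E - w)) t w - κ‖ ≤ κ / 8 := by
  have hd : ∀ w ∈ Metric.ball (0 : ℂ) (R / 2), HasDerivAt (fun w => -U (E - w)) (deriv U (E - w)) w :=
    fun w hw => deriv_comp_const_sub_neg (H.hasDerivAt_inverse (sub_mem_ball_of_half hE hw)).differentiableAt
  rcases eq_or_ne w t with rfl | hne
  · rw [dslope_same, (hd w hw).deriv]
    exact H.close _ (sub_mem_ball_of_half hE hw)
  · have h1 := (convex_ball (0 : ℂ) (R / 2)).norm_image_sub_le_of_norm_hasDerivWithin_le
      (f := fun w => -U (E - w) - κ * w) (f' := fun w => deriv U (E - w) - κ) (C := κ / 8)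
      (fun z hz => ((hd z hz).sub (((hasDerivAt_id z).const_mul (κ : ℂ)).congr_deriv (mul_one _))).hasDerivWithinAt)
      (fun z hz => H.close _ (sub_mem_ball_of_half hE hz)) ht hw
    have hne' : 0 < ‖w - t‖ := norm_pos_iff.2 (sub_ne_zero.2 hne)
    rw [dslope_of_ne _ hne, slope_def_field]
    have e : (-U (E - w) - -U (E - t)) / (w - t) - κ =
        ((-U (E - w) - κ * w) - (-U (E - t) - κ * t)) / (w - t) := by
      have := sub_ne_zero.2 hne
      field_simp
      ring
    rw [e, norm_div, div_le_iff₀ hne']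
    exact h1

end IsChart

/-! ### Airy functions of the Langer variable as oscillatory integrals -/

/-- The principal sixth root. -/
def sixthRoot (z : ℂ) : ℂ := exp (log z / 6)

theorem sixthRoot_mul_cubeRoot (z : ℂ) : sixthRoot z * cubeRoot z = halfPow z := by
  rw [sixthRoot, cubeRoot, halfPow, ← exp_add]; ring_nf

theorem sixthRoot_sq (z : ℂ) : sixthRoot z ^ 2 = cubeRoot z := by
  rw [sixthRoot, cubeRoot, ← exp_nat_mul]; push_cast; ring_nf

theorem norm_sixthRoot_le {z : ℂ} {m : ℝ} (h : ‖cubeRoot z‖ ≤ m) : ‖sixthRoot z‖ ≤ 1 + m := by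
  rw [← sixthRoot_sq, norm_pow] at h
  nlinarith [norm_nonneg (sixthRoot z), sq_nonneg (‖sixthRoot z‖ - 1)]

/-- Branch check for the principal power: the arguments of the two cube roots add up to at most 2π/3
in absolute value, so the logarithm of the product is the sum of the logarithms. -/
theorem inv_cubeRoot_mul_cpow_half (z w : ℂ) :
    ((cubeRoot z)⁻¹ * (cubeRoot w)⁻¹) ^ (1 / 2 : ℂ) = (sixthRoot z * sixthRoot w)⁻¹ := by
  have e : (cubeRoot z)⁻¹ * (cubeRoot w)⁻¹ = exp (-(log z + log w) / 3) := by
    rw [cubeRoot, cubeRoot, ← exp_neg, ← exp_neg, ← exp_add]; ring_nf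
  have him : (-(log z + log w) / 3).im = -(z.arg + w.arg) / 3 := by
    rw [show (3 : ℂ) = ((3 : ℝ) : ℂ) by push_cast; rfl, div_ofReal_im, neg_im, add_im, log_im, log_im]
  have h1 := neg_pi_lt_arg z
  have h2 := arg_le_pi z
  have h3 := neg_pi_lt_arg w
  have h4 := arg_le_pi w
  have := Real.pi_pos
  rw [e, cpow_def_of_ne_zero (exp_ne_zero _), log_exp (by rw [him]; linarith) (by rw [him]; linarith),
    sixthRoot, sixthRoot, ← exp_add, ← exp_neg]
  ring_nf

theorem airyPhase_cubeRoot {N t : ℂ} (hN : N ≠ 0) (η : ℂ) :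
    airyPhase (-t * cubeRoot N ^ 2) (cubeRoot N * η) = cubicPhase N t η := by
  have h := cubeRoot_pow_three hN
  rw [airyPhase, cubicPhase]
  linear_combination (η ^ 3 / 3 - t * η) * h

namespace IsChart

variable {V : ℝ → ℝ} {R ρ κ : ℝ} {Vc U : ℂ → ℂ}

set_option maxHeartbeats 1000000 in
/-- The Airy factor at a simple turning point, as an oscillatory integral over a fixed interval
whose phase is linear in `x`. -/
theorem exists_airy_approx (H : IsChart V R ρ κ Vc U) (hV : ContinuousAt V 0) (hV0 : V 0 = 0)
    {r : ℝ} (hr : 0 < r) (hr1 : r ≤ 1) (hrR : (9 * r) ^ 2 ≤ R / 4) :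
    ∃ δ > 0, δ ≤ ρ ∧ ∃ e₀ > 0, e₀ < R / 8 ∧ ∀ X L : ℝ, 0 ≤ L → ∃ C, 0 ≤ C ∧ ∃ h₀, 0 < h₀ ∧ h₀ ≤ 1 ∧
      L * h₀ ≤ R / 8 ∧
      ∀ (χ χ₁ χ₂ χ₃ : ℝ → ℂ) (h : ℝ) (E : ℂ) (x : ℝ), IsCutoff r X χ χ₁ χ₂ χ₃ → 0 < h → h ≤ h₀ →
        |E.re| ≤ e₀ → |E.im| ≤ L * h → |x| < δ →
        ∃ N : ℂ, xiDeriv (langer Vc U) E x = (cubeRoot N)⁻¹ ∧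
          ‖sixthRoot N * (2 * (Real.pi : ℂ) * (h ^ (1 / 3 : ℝ) : ℝ) *
              airyAi (((h ^ (-(2 / 3) : ℝ) : ℝ) : ℂ) * langer Vc U (x, E))) -
            halfPow (deriv U (V x : ℂ)) * ∫ η in (-r)..r, χ η * osc h (x * η - action U E η)‖ ≤
              C * (h * h ^ (1 / 3 : ℝ)) ∧
          ‖∫ η in (-r)..r, χ η * osc h (x * η - action U E η)‖ ≤ C * h ^ (1 / 3 : ℝ) := by
  have hR := H.R_pos
  have hκ := H.κ_pos
  obtain ⟨m₀, m₁, hm₀, hm₁, hroot⟩ := exists_cubeRoot_bounds hκ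
  -- The bound on |t|: below r² for the homotopy, small enough for |ξ| ≤ m₀² r² / 16 in the Airy
  -- localisation, and inside the domain of the chart. Both V(x) and E are then kept below fractions
  -- of it.
  set e₁ : ℝ := min (r ^ 2) (min (m₀ ^ 2 * r ^ 2 / 16 / m₁ ^ 2) (R / 4)) with he₁
  have he₁0 : 0 < e₁ := by positivity
  have he₁r : e₁ ≤ r ^ 2 := min_le_left _ _
  have he₁m : e₁ * m₁ ^ 2 ≤ m₀ ^ 2 * r ^ 2 / 16 := by
    rw [← le_div_iff₀ (by positivity)]
    exact (min_le_right _ _).trans (min_le_left _ _)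
  have he₁R : e₁ ≤ R / 4 := (min_le_right _ _).trans (min_le_right _ _)
  have hr2 : r ^ 2 ≤ 1 := pow_le_one₀ hr.le hr1
  obtain ⟨δ₁, hδ₁, hδ⟩ : ∃ δ > 0, ∀ x : ℝ, |x| < δ → |V x| < e₁ / 4 := by
    have h1 : Tendsto (fun x => |V x|) (𝓝 0) (𝓝 0) := by simpa [hV0] using hV.abs.tendsto
    obtain ⟨δ, hδ, hb⟩ := Metric.eventually_nhds_iff.1 (h1.eventually_lt_const (show 0 < e₁ / 4 by positivity))
    exact ⟨δ, hδ, fun x hx => hb (by rw [Real.dist_eq, sub_zero]; exact hx)⟩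
  refine ⟨min δ₁ ρ, lt_min hδ₁ H.ρ_pos, min_le_right _ _, e₁ / 4, by positivity, by linarith, fun X L hL => ?_⟩
  -- One constant dominating the imaginary parts, in units of h, of the action, the cubic phase, the
  -- cube root M and the Langer variable ξ.
  set L' : ℝ := L * (1 + 2 * κ + 2 * (12 * κ / R) + m₁ * (12 * κ / R) + m₁ ^ 2 + 2 * m₁ * (m₁ * (12 * κ / R)))
    with hL'
  have hL'0 : 0 ≤ L' := by positivity
  obtain ⟨C₁, hC₁, b₁⟩ := exists_norm_homotopy_le (X := X) (L := L') hκ hr hr1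
  obtain ⟨C₂, hC₂, h₀, hh₀, hh₀1, b₂⟩ := exists_norm_airy_sub_le (X := X) (m₁ := m₁) hr hL'0 hm₀
  set K : ℝ := max (2 * κ) (2 * (κ * 2 / ((9 * r) ^ 2 - (8 * r) ^ 2))) with hK
  set C₃ : ℝ := 2 * vdcConst (κ / 2) K (Real.exp L') (max X 0) with hC₃
  have hK0 : 0 ≤ K := le_max_of_le_left (by positivity)
  have hC₃0 : 0 ≤ C₃ := mul_nonneg zero_le_two
    (vdcConst_nonneg (by positivity) hK0 (Real.exp_pos _).le (le_max_right _ _))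
  clear_value C₃ K L'
  refine ⟨(1 + m₁) * C₂ + C₁ + C₃, by positivity, min h₀ (e₁ / (4 * (L + 1))), by positivity,
    (min_le_left _ _).trans hh₀1, ?_, ?_⟩
  · have h1 : min h₀ (e₁ / (4 * (L + 1))) ≤ e₁ / (4 * (L + 1)) := min_le_right _ _
    rw [le_div_iff₀ (by positivity)] at h1
    have h2 : 0 < min h₀ (e₁ / (4 * (L + 1))) := by positivity
    nlinarith
  intro χ χ₁ χ₂ χ₃ h E x hχ hh hhle hEr hEi hx
  have hhh₀ : h ≤ h₀ := hhle.trans (min_le_left _ _)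
  have hLh : L * h ≤ e₁ / 4 := by
    have h1 : h ≤ e₁ / (4 * (L + 1)) := hhle.trans (min_le_right _ _)
    rw [le_div_iff₀ (by positivity)] at h1
    nlinarith
  have hEn : ‖E‖ ≤ e₁ / 2 := (norm_le_abs_re_add_abs_im E).trans (by linarith)
  have hxρ : |x| < ρ := hx.trans_le (min_le_right _ _)
  have hVx := hδ x (hx.trans_le (min_le_left _ _))
  have hxm : (x : ℂ) ∈ Metric.ball (0 : ℂ) ρ := by rw [mem_ball_zero_iff, norm_real]; exact hxρ
  set t : ℂ := E - Vc x with ht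
  have htV : t = E - (V x : ℂ) := by rw [ht, H.eq_real x hxρ]
  have htn : ‖t‖ < e₁ := by
    rw [htV]
    refine (norm_sub_le _ _).trans_lt ?_
    rw [norm_real, Real.norm_eq_abs]
    linarith
  have hti : t.im = E.im := by rw [htV, sub_im, ofReal_im, sub_zero]
  have hE2 : ‖E‖ < R / 2 := by linarith
  have htm : t ∈ Metric.ball (0 : ℂ) (R / 2) := by rw [mem_ball_zero_iff]; linarith
  set N : ℂ := langerCoeff U t E with hN
  have hNκ : ‖N - κ‖ ≤ κ / 8 := norm_langerCoeff_sub_le H.diffU H.close hE2 htm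
  have hN0 : N ≠ 0 := slitPlane_ne_zero (mem_slitPlane_of_norm_sub_le hκ hNκ)
  obtain ⟨hMre, hMn, hMi⟩ := hroot N hNκ
  have hNi : |N.im| ≤ 12 * κ / R * |E.im| :=
    H.abs_im_langerCoeff_le hti (by linarith) (by linarith)
  have hEi0 := abs_nonneg E.im
  have hNiL : |N.im| ≤ 12 * κ / R * (L * h) := hNi.trans (by gcongr)
  have hNn : ‖N‖ ≤ 2 * κ := by linarith [norm_le_of_norm_sub_le hκ.le hNκ]
  have hgrow : ∀ c, 0 ≤ c → c ≤ 1 + 2 * κ + 2 * (12 * κ / R) + m₁ * (12 * κ / R) + m₁ ^ 2 +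
      2 * m₁ * (m₁ * (12 * κ / R)) → c * (L * h) ≤ L' * h := fun c _ hc => by
    calc c * (L * h) ≤ _ * (L * h) := mul_le_mul_of_nonneg_right hc (mul_nonneg hL hh.le)
      _ = L' * h := by rw [hL']; ring
  have p1 : 0 ≤ 12 * κ / R := by positivity
  have p2 : 0 ≤ m₁ * (12 * κ / R) := by positivity
  have p3 : 0 ≤ 2 * m₁ * (m₁ * (12 * κ / R)) := by positivity
  have p4 : 0 ≤ m₁ ^ 2 := by positivity
  set M := cubeRoot N with hM
  set ξ : ℂ := -t * M ^ 2 with hξ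
  have hlanger : langer Vc U (x, E) = ξ := rfl
  have hMi' : |M.im| ≤ L' * h := by
    refine hMi.trans ?_
    refine le_trans ?_ (hgrow (m₁ * (12 * κ / R)) (by positivity) ?_)
    · rw [mul_assoc]; gcongr
    · linarith
  have hξn : ‖ξ‖ ≤ m₀ ^ 2 * r ^ 2 / 16 := by
    rw [hξ, norm_mul, norm_neg, norm_pow]
    refine le_trans ?_ he₁m
    gcongr
  have hξi : |ξ.im| ≤ L' * h := by
    have h1 := abs_im_mul_le (-t) (M ^ 2)
    have h2 := abs_im_mul_le M M
    rw [← pow_two] at h2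
    rw [neg_im, abs_neg, norm_neg, hti, norm_pow] at h1
    have h3 : |M.im| ≤ m₁ * (12 * κ / R * (L * h)) := hMi.trans (by gcongr)
    have h4 : |(M ^ 2).im| ≤ 2 * m₁ * (m₁ * (12 * κ / R * (L * h))) := by
      calc _ ≤ _ := h2
        _ ≤ m₁ * (12 * κ / R * (L * h)) * m₁ + m₁ * (m₁ * (12 * κ / R * (L * h))) := by gcongr
        _ = _ := by ring
    have ht1 : ‖t‖ ≤ 1 := by linarith
    calc |ξ.im| ≤ _ := h1
      _ ≤ (L * h) * m₁ ^ 2 + 1 * (2 * m₁ * (m₁ * (12 * κ / R * (L * h)))) := by gcongr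
      _ = (m₁ ^ 2 + 2 * m₁ * (m₁ * (12 * κ / R))) * (L * h) := by ring
      _ ≤ _ := hgrow _ (by positivity) (by linarith)
  have a₂ := b₂ χ χ₁ χ₂ χ₃ h M ξ hχ hh hhh₀ hMre ((re_le_norm M).trans hMn) hMi' hξn hξi
  have hph : ∀ η : ℝ, airyPhase ξ (M * η) = cubicPhase N t η := fun η => airyPhase_cubeRoot hN0 η
  simp_rw [hph] at a₂
  -- Since U(E - t) = x, the phase derivative x - U(E - η²) is exactly (η² - t) k(η²); the divided
  -- difference stays holomorphic when the critical points merge.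
  set k : ℂ → ℂ := dslope (fun w => -U (E - w)) t with hk
  have hsub : Metric.ball (0 : ℂ) ((9 * r) ^ 2) ⊆ Metric.ball 0 (R / 2) :=
    Metric.ball_subset_ball (by linarith)
  have hkd : DifferentiableOn ℂ k (Metric.ball 0 ((9 * r) ^ 2)) :=
    ((Complex.differentiableOn_dslope (Metric.isOpen_ball.mem_nhds htm)).2
      (differentiableOn_comp_const_sub H.diffU hE2).neg).mono hsub
  have hkκ : ∀ z ∈ Metric.ball (0 : ℂ) ((9 * r) ^ 2), ‖k z - κ‖ ≤ κ / 8 := fun z hz =>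
    H.norm_dslope_sub_le hE2 htm (hsub hz)
  have hkN : cubicCoeff k t = N := cubicCoeff_dslope H.diffU hE2 htm
  have hkt : k t = deriv U (V x : ℂ) := by
    rw [hk, dslope_same, (deriv_comp_const_sub_neg (H.hasDerivAt_inverse
      (sub_mem_ball_of_half hE2 htm)).differentiableAt).deriv, htV, sub_sub_cancel]
  have hUx : U (V x : ℂ) = x := by rw [← H.eq_real x hxρ, H.left _ hxm]
  have h9r : (9 * r) ^ 2 = 81 * r ^ 2 := by ring
  have hrr : 0 < r ^ 2 := by positivity
  have h2r : (2 * r) ^ 2 ≤ R / 2 := by rw [show (2 * r) ^ 2 = 4 * r ^ 2 by ring]; linarith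
  have hofReal : ∀ x : ℝ, HasDerivAt (fun x : ℝ => (x : ℂ)) 1 x := fun x => by
    simpa using (hasDerivAt_id x).ofReal_comp
  set F : ℝ → ℂ := fun η => x * η - action U E η with hF
  have hFd : ∀ η ∈ Set.Icc (-r) r, HasDerivAt F (((η : ℂ) ^ 2 - t) * k ((η : ℂ) ^ 2)) η := by
    intro η hη
    have h1 := hasDerivAt_action H.diffU.continuousOn h2r hE2 (x := η)
      ⟨by linarith [hη.1], by linarith [hη.2]⟩
    have h2 := (((hofReal η).const_mul (x : ℂ)).sub h1)
    refine h2.congr_deriv ?_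
    have h3 := sub_smul_dslope (fun w => -U (E - w)) t ((η : ℂ) ^ 2)
    rw [smul_eq_mul] at h3
    rw [h3, show E - t = (V x : ℂ) by rw [htV]; ring, hUx]
    ring
  have hF0 : F 0 = 0 := by simp [hF, action]
  have hFi : ∀ η ∈ Set.Icc (-r) r, |(F η).im| ≤ L' * h := by
    intro η hη
    have h1 := H.abs_im_action_le hr1 (by linarith) hE2 (abs_le.2 hη)
    have h2 : (F η).im = -(action U E η).im := by
      rw [hF, sub_im, ← ofReal_mul, ofReal_im, zero_sub]
    rw [h2, abs_neg]
    refine (h1.trans ?_).trans (hgrow (2 * κ) (by positivity) ?_)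
    · gcongr
    · linarith
  have hci : ∀ η ∈ Set.Icc (-r) r, |(cubicPhase (cubicCoeff k t) t η).im| ≤ L' * h := by
    intro η hη
    have hη1 : |η| ≤ 1 := (abs_le.2 hη).trans hr1
    rw [hkN, cubicPhase]
    have h1 := abs_im_mul_le N ((η : ℂ) ^ 3 / 3 - t * η)
    have e1 : ((η : ℂ) ^ 3 / 3 - t * η).im = -(E.im * η) := by
      rw [sub_im, im_mul_ofReal, hti, show (η : ℂ) ^ 3 / 3 = ((η ^ 3 / 3 : ℝ) : ℂ) by push_cast; rfl,
        ofReal_im, zero_sub]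
    have e2 : ‖(η : ℂ) ^ 3 / 3 - t * η‖ ≤ 2 := by
      refine (norm_sub_le _ _).trans ?_
      rw [norm_div, norm_pow, norm_mul, norm_real, Real.norm_eq_abs, norm_ofNat]
      have : |η| ^ 3 ≤ 1 := pow_le_one₀ (abs_nonneg _) hη1
      have ht1 : ‖t‖ ≤ 1 := by linarith
      have : ‖t‖ * |η| ≤ 1 := mul_le_one₀ ht1 (abs_nonneg _) hη1
      linarith
    rw [e1, abs_neg, abs_mul] at h1
    calc _ ≤ _ := h1
      _ ≤ 12 * κ / R * (L * h) * 2 + 2 * κ * ((L * h) * 1) := by gcongr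
      _ = (2 * κ + 2 * (12 * κ / R)) * (L * h) := by ring
      _ ≤ _ := hgrow _ (by positivity) (by linarith)
  have a₁ := b₁ χ χ₁ χ₂ χ₃ h t k F hχ hh (htn.trans_le he₁r) hkd hkκ hFd hF0 hFi hci
  rw [hkN, hkt] at a₁
  set A : ℂ := 2 * (Real.pi : ℂ) * (h ^ (1 / 3 : ℝ) : ℝ) * airyAi (((h ^ (-(2 / 3) : ℝ) : ℝ) : ℂ) * ξ)
  set J₀ : ℂ := ∫ η in (-r)..r, χ η * osc h (cubicPhase N t η)
  have hl0 : 0 < h ^ (1 / 3 : ℝ) := Real.rpow_pos_of_pos hh _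
  set J₁ : ℂ := ∫ η in (-r)..r, χ η * osc h (F η) with hJ₁
  set D : ℂ := halfPow (deriv U (V x : ℂ)) with hD
  refine ⟨N, (H.hasDerivAt_langer hxm hE2 htm).deriv, ?_, ?_⟩
  · change ‖sixthRoot N * A - D * J₁‖ ≤ _
    -- Because N^{1/6} N^{1/3} = N^{1/2}, the Airy normalisation matches the square-root prefactor
    -- of the homotopy exactly, leaving only the two errors.
    have e : sixthRoot N * A - D * J₁ = sixthRoot N * (A - M * J₀) - (D * J₁ - halfPow N * J₀) := by
      rw [← sixthRoot_mul_cubeRoot N]; ring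
    rw [e]
    have h1 : ‖sixthRoot N * (A - M * J₀)‖ ≤ (1 + m₁) * (C₂ * (h * h ^ (1 / 3 : ℝ))) := by
      rw [norm_mul]
      exact mul_le_mul (norm_sixthRoot_le hMn) a₂ (norm_nonneg _) (by positivity)
    have h2 : 0 ≤ C₃ * (h * h ^ (1 / 3 : ℝ)) := by positivity
    have h3 := (norm_sub_le _ _).trans (add_le_add h1 a₁)
    refine h3.trans ?_
    calc _ ≤ (1 + m₁) * (C₂ * (h * h ^ (1 / 3 : ℝ))) + C₁ * (h * h ^ (1 / 3 : ℝ)) +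
          C₃ * (h * h ^ (1 / 3 : ℝ)) := le_add_of_nonneg_right h2
      _ = _ := by ring
  -- The size h^{1/3} of the oscillatory integral is the van der Corput bound with amplitude χ; it
  -- is needed to multiply two approximations.
  · have hk2 : HolBdd ((9 * r) ^ 2) (κ * 2) k := ⟨hkd, fun z hz => by
      linarith [norm_le_of_norm_sub_le hκ.le (hkκ z hz)]⟩
    have h89 : (8 * r) ^ 2 < (9 * r) ^ 2 :=
      pow_lt_pow_left₀ (by linarith) (by positivity) two_ne_zero
    have hk3 := hk2.deriv h89
    have hm : ∀ η ∈ Set.Icc (-r) r, (η : ℂ) ^ 2 ∈ Metric.ball (0 : ℂ) ((8 * r) ^ 2) := fun η hη => by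
      rw [mem_ball_zero_iff, norm_pow, norm_real]
      exact pow_lt_pow_left₀ ((abs_le.2 hη).trans_lt (by linarith)) (abs_nonneg _) two_ne_zero
    have hm' : ∀ η ∈ Set.Icc (-r) r, (η : ℂ) ^ 2 ∈ Metric.ball (0 : ℂ) ((9 * r) ^ 2) := fun η hη =>
      Metric.ball_subset_ball h89.le (hm η hη)
    have hkc1 : ContinuousOn (deriv k) (Metric.ball 0 ((8 * r) ^ 2)) := hk3.diff.continuousOn
    have hc1 := hχ.cont₁
    have hX : X ≤ max X 0 := le_max_left _ _
    have h1 := norm_osc_integral_le (c := κ / 2) (K := K) (B := Real.exp L') (a := max X 0) (h := h) (r := r)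
      (t := t) (F := F) (k := fun η => k ((η : ℂ) ^ 2))
      (k' := fun η => deriv k ((η : ℂ) ^ 2) * (2 * η)) (A := χ) (A' := χ₁)
      (by positivity) hK0 (Real.exp_pos _).le (le_max_right _ _) hh hr.le hr1
      ((re_le_norm t).trans (by linarith)) hFd
      (fun η hη => by
        have g1 := (hkd.differentiableAt (Metric.isOpen_ball.mem_nhds (hm' η hη))).hasDerivAt
        have g2 : HasDerivAt (fun η : ℝ => (η : ℂ) ^ 2) (2 * η) η := by
          simpa using (hofReal η).fun_pow 2
        exact HasDerivAt.comp (h := fun η : ℝ => (η : ℂ) ^ 2) η g1 g2)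
      ((hkc1.comp (by fun_prop) hm).mul (by fun_prop)) (fun η _ => hχ.deriv₁ η) hc1.continuousOn
      (fun η hη => by linarith [le_norm_of_norm_sub_le (hkκ _ (hm' η hη))])
      (fun η hη => (hk2.bdd _ (hm' η hη)).trans (by rw [mul_comm, hK]; exact le_max_left _ _))
      (fun η hη => by
        rw [norm_mul, norm_mul, norm_real, Real.norm_eq_abs, norm_ofNat]
        have g1 := hk3.bdd _ (hm η hη)
        have g2 : |η| ≤ 1 := (abs_le.2 hη).trans hr1
        rw [hK]
        refine le_trans ?_ (le_max_right _ _)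
        have : 0 ≤ κ * 2 / ((9 * r) ^ 2 - (8 * r) ^ 2) := (norm_nonneg _).trans g1
        calc _ ≤ κ * 2 / ((9 * r) ^ 2 - (8 * r) ^ 2) * (2 * 1) := by gcongr
          _ = _ := by ring)
      (fun η _ => (hχ.bdd₀ η).trans hX) (fun η _ => (hχ.bdd₁ η).trans hX)
      (fun η hη => norm_osc_le hh (hFi η hη))
    refine h1.trans ?_
    rw [← hC₃]
    gcongr
    have : 0 ≤ (1 + m₁) * C₂ + C₁ := by positivity
    linarith

end IsChart

/-! ### Products of oscillatory integrals against a smooth weight -/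

noncomputable section

open scoped FourierTransform SchwartzMap

/-- The Fourier integral `∫ f(x) e^{i x s} dx`. -/
def waveIntegral (f : ℝ → ℂ) (s : ℝ) : ℂ := ∫ x, f x * exp (I * (x * s))

/-- Smooth compactly supported functions are Schwartz, and `waveIntegral` is their Fourier transform
rescaled by -1/(2π). The weight 1 + s² is what the quadratic Taylor remainder in the s-integral
requires. -/
theorem waveIntegral_facts {f : ℝ → ℂ} (hf : ContDiff ℝ (⊤ : ℕ∞) f) (hc : HasCompactSupport f) :
    Continuous (waveIntegral f) ∧ Integrable (fun s => (1 + s ^ 2) * ‖waveIntegral f s‖) ∧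
      ∀ u : ℝ, ∫ s, waveIntegral f s * exp (-(I * (u * s))) = 2 * Real.pi * f u := by
  set g : 𝓢(ℝ, ℂ) := hc.toSchwartzMap hf with hg
  have hgf : ∀ x, g x = f x := fun x => rfl
  set a : ℝ := -(2 * Real.pi)⁻¹ with ha
  have hpi := Real.pi_pos
  have ha0 : a ≠ 0 := by rw [ha]; exact neg_ne_zero.2 (by positivity)
  have e1 : ∀ s, waveIntegral f s = (𝓕 g) (a * s) := by
    intro s
    rw [SchwartzMap.fourier_coe, Real.fourier_real_eq_integral_exp_smul]
    refine integral_congr_ae (Eventually.of_forall fun x => ?_)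
    simp only [smul_eq_mul, hgf]
    rw [mul_comm]
    congr 2
    rw [ha]
    push_cast
    field_simp
  have hcont : Continuous (waveIntegral f) := by
    rw [funext e1]
    exact (𝓕 g).continuous.comp (by fun_prop)
  refine ⟨hcont, ?_, ?_⟩
  · have h0 := (𝓕 g).integrable_pow_mul volume 0
    have h2 := ((𝓕 g).integrable_pow_mul volume 2).const_mul (4 * Real.pi ^ 2)
    have h3 := (h0.add h2).comp_mul_left' ha0
    refine h3.congr (Eventually.of_forall fun s => ?_)
    simp only [Pi.add_apply, e1, pow_zero, one_mul, Real.norm_eq_abs, sq_abs]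
    rw [ha]
    field_simp
    ring
  · intro u
    have hinv := Continuous.fourierInv_fourier_eq (f := (g : ℝ → ℂ)) g.continuous g.integrable
      (by rw [← SchwartzMap.fourier_coe]; exact (𝓕 g).integrable)
    have h1 := congrFun hinv u
    rw [Real.fourierInv_eq', ← SchwartzMap.fourier_coe] at h1
    have h2 := Measure.integral_comp_mul_left (fun v : ℝ =>
      exp ((2 * Real.pi * inner ℝ v u : ℝ) * I) • (𝓕 g) v) a
    rw [h1] at h2
    have e2 : |a⁻¹| = 2 * Real.pi := by
      rw [ha, inv_neg, inv_inv, abs_neg, abs_of_pos (by positivity)]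
    rw [e2, hgf, real_smul] at h2
    push_cast at h2
    rw [← h2]
    refine integral_congr_ae (Eventually.of_forall fun s => ?_)
    simp only [e1, smul_eq_mul]
    rw [mul_comm]
    congr 2
    rw [ha]
    simp
    field_simp

theorem osc_mul_ofReal {h : ℝ} (hh : h ≠ 0) (x s : ℝ) : osc h ((x : ℂ) * ((h * s : ℝ) : ℂ)) = exp (I * (x * s)) := by
  have : (h : ℂ) ≠ 0 := by exact_mod_cast hh
  rw [osc]
  push_cast
  congr 1
  field_simp

/-- Fubini, then the substitution ζ = -η + h s. Rapid decay in s expresses conservation of momentum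
up to O(h). -/
theorem integral_mul_wave_eq {f a : ℝ → ℂ} (hf : Continuous f) (hfc : HasCompactSupport f) (ha : Continuous a)
    (hac : HasCompactSupport a) {h : ℝ} (hh : 0 < h) (η : ℝ) :
    ∫ x, f x * osc h (x * η) * ∫ ζ, a ζ * osc h (x * ζ) =
      h * ∫ s, a (-η + h * s) * waveIntegral f s := by
  have hosc := continuous_osc h
  have h1 : ∀ x : ℝ, f x * osc h (x * η) * ∫ ζ, a ζ * osc h (x * ζ) =
      ∫ ζ, a ζ * (f x * osc h (x * (η + ζ : ℝ))) := fun x => by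
    rw [← integral_const_mul]
    refine integral_congr_ae (Eventually.of_forall fun ζ => ?_)
    simp only
    push_cast
    rw [mul_add, osc_add]
    ring
  simp_rw [h1]
  rw [integral_integral_swap_of_hasCompactSupport (f := fun (x ζ : ℝ) => a ζ * (f x * osc h (x * (η + ζ : ℝ))))]
  · have h2 : ∀ ζ : ℝ, ∫ x, a ζ * (f x * osc h (x * (η + ζ : ℝ))) = a ζ * waveIntegral f ((η + ζ) / h) := by
      intro ζ
      rw [integral_const_mul, waveIntegral]
      congr 1
      refine integral_congr_ae (Eventually.of_forall fun x => ?_)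
      simp only
      rw [← ofReal_mul, ← osc_mul_ofReal hh.ne', mul_div_cancel₀ _ hh.ne', ofReal_mul]
    simp_rw [h2]
    have h3 := Measure.integral_comp_mul_left (fun ζ : ℝ => a (-η + ζ) * waveIntegral f ((η + (-η + ζ)) / h)) h
    have h4 := integral_add_left_eq_self (μ := volume)
      (fun ζ : ℝ => a ζ * waveIntegral f ((η + ζ) / h)) (-η)
    rw [h4, abs_of_pos (by positivity), real_smul] at h3
    have hh' : (h : ℂ) ≠ 0 := by exact_mod_cast hh.ne'
    rw [show (∫ s, a (-η + h * s) * waveIntegral f s) =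
        ∫ s, a (-η + h * s) * waveIntegral f ((η + (-η + h * s)) / h) from
      integral_congr_ae (Eventually.of_forall fun s => by
        simp only
        rw [add_neg_cancel_left, mul_div_cancel_left₀ _ hh.ne'])]
    rw [h3]
    push_cast
    rw [mul_inv_cancel_left₀ hh']
  · simp only [Function.uncurry_def]
    fun_prop
  · refine HasCompactSupport.intro (K := tsupport f ×ˢ tsupport a) (hfc.isCompact.prod hac.isCompact)
      fun p hp => ?_
    simp only [Function.uncurry_def]
    rw [Set.mem_prod, not_and_or] at hp
    rcases hp with hp | hp
    · rw [image_eq_zero_of_notMem_tsupport hp]; ring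
    · rw [image_eq_zero_of_notMem_tsupport hp]; ring

theorem integral_mul_waves_eq {f a b : ℝ → ℂ} (hf : Continuous f) (hfc : HasCompactSupport f) (ha : Continuous a)
    (hac : HasCompactSupport a) (hb : Continuous b) (hbc : HasCompactSupport b) {h : ℝ} (hh : 0 < h) :
    ∫ x, f x * (∫ η, b η * osc h (x * η)) * (∫ ζ, a ζ * osc h (x * ζ)) =
      ∫ η, b η * (h * ∫ s, a (-η + h * s) * waveIntegral f s) := by
  have hosc := continuous_osc h
  have hG : Continuous fun x : ℝ => ∫ ζ, a ζ * osc h (x * ζ) := by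
    refine continuous_of_dominated (bound := fun ζ => ‖a ζ‖) (fun x => ?_) (fun x => ?_) ?_ ?_
    · exact Continuous.aestronglyMeasurable (by fun_prop)
    · refine Eventually.of_forall fun ζ => ?_
      rw [norm_mul, norm_osc, ← ofReal_mul, ofReal_im, neg_zero, zero_div, Real.exp_zero, mul_one]
    · exact (ha.integrable_of_hasCompactSupport hac).norm
    · exact Eventually.of_forall fun ζ => by fun_prop
  have h1 : ∀ x : ℝ, f x * (∫ η, b η * osc h (x * η)) * (∫ ζ, a ζ * osc h (x * ζ)) =
      ∫ η, b η * (f x * osc h (x * η) * ∫ ζ, a ζ * osc h (x * ζ)) := fun x => by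
    rw [mul_right_comm, ← integral_const_mul]
    refine integral_congr_ae (Eventually.of_forall fun η => ?_)
    simp only
    ring
  simp_rw [h1]
  rw [integral_integral_swap_of_hasCompactSupport
    (f := fun (x η : ℝ) => b η * (f x * osc h (x * η) * ∫ ζ, a ζ * osc h (x * ζ)))]
  · refine integral_congr_ae (Eventually.of_forall fun η => ?_)
    simp only
    rw [integral_const_mul, integral_mul_wave_eq hf hfc ha hac hh]
  · have hG' : Continuous fun p : ℝ × ℝ => ∫ ζ, a ζ * osc h (p.1 * ζ) := hG.comp continuous_fst
    have h2 : Continuous fun p : ℝ × ℝ => f p.1 * osc h (p.1 * p.2) := by fun_prop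
    exact (hb.comp continuous_snd).mul (h2.mul hG')
  · refine HasCompactSupport.intro (K := tsupport f ×ˢ tsupport b) (hfc.isCompact.prod hbc.isCompact)
      fun p hp => ?_
    simp only [Function.uncurry_def]
    rw [Set.mem_prod, not_and_or] at hp
    rcases hp with hp | hp
    · rw [image_eq_zero_of_notMem_tsupport hp]; ring
    · rw [image_eq_zero_of_notMem_tsupport hp]; ring

/-- The half-plane Im ≥ -L h is convex and the exponential has derivative at most e^L / h there. -/
theorem norm_osc_sub_le {h L : ℝ} (hh : 0 < h) {z w : ℂ} (hz : |z.im| ≤ L * h) (hw : |w.im| ≤ L * h) :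
    ‖osc h z - osc h w‖ ≤ Real.exp L * (‖z - w‖ / h) := by
  have hS : Convex ℝ {z : ℂ | -(L * h) ≤ z.im} := convex_halfSpace_im_ge _
  have hh' : (h : ℂ) ≠ 0 := by exact_mod_cast hh.ne'
  have h1 := hS.norm_image_sub_le_of_norm_hasDerivWithin_le (f := osc h) (f' := fun z => I / h * osc h z)
    (C := Real.exp L / h) (x := w) (y := z) (fun z _ => ?_) (fun z hz => ?_) (abs_le.1 hw).1 (abs_le.1 hz).1
  · refine h1.trans (le_of_eq ?_); ring
  · have h2 := (((hasDerivAt_id z).const_mul I).div_const (h : ℂ)).cexp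
    refine (h2.congr_deriv ?_).hasDerivWithinAt
    rw [osc]
    simp only [id]
    ring
  · rw [norm_mul, norm_div, norm_I, norm_real, Real.norm_eq_abs, abs_of_pos hh, norm_osc, div_mul_eq_mul_div,
      one_mul]
    gcongr
    rw [div_le_iff₀ hh]
    have : -(L * h) ≤ z.im := hz
    linarith

end

/-! ### Evaluation of the inner momentum integral -/

namespace IsCutoff

variable {r X : ℝ} {χ χ₁ χ₂ χ₃ : ℝ → ℂ}

theorem norm_sub_le (H : IsCutoff r X χ χ₁ χ₂ χ₃) (x y : ℝ) : ‖χ x - χ y‖ ≤ X * |x - y| := by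
  have := convex_univ.norm_image_sub_le_of_norm_hasDerivWithin_le (f := χ) (f' := χ₁) (C := X) (x := y) (y := x)
    (fun x _ => (H.deriv₁ x).hasDerivWithinAt) (fun x _ => H.bdd₁ x) (Set.mem_univ _) (Set.mem_univ _)
  simpa using this

/-- The phase is controlled only on [-r, r], but the cut-off vanishes at both ends, so the product
extends continuously by zero. Integrals over ℝ can then be used without extending the phase. -/
theorem continuous_mul_osc (H : IsCutoff r X χ χ₁ χ₂ χ₃) (hr : 0 < r) {φ : ℝ → ℂ} {h : ℝ}
    (hφ : ContinuousOn φ (Set.Icc (-r) r)) : Continuous fun η => χ η * osc h (φ η) := by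
  have hrr : -r ≤ r := by linarith
  have h1 : ContinuousOn (fun η => χ η * osc h (φ η)) (Set.Icc (-r) r) :=
    H.cont₀.continuousOn.mul ((continuous_osc h).comp_continuousOn hφ)
  have h2 := (continuousOn_iff_continuous_domRestrict.1 h1).Icc_extend' (h := hrr)
  convert h2 using 1
  funext η
  by_cases hη : η ∈ Set.Icc (-r) r
  · rw [Set.IccExtend_of_mem _ _ hη]; rfl
  · have h0 : χ η = 0 := H.zero₀ η (le_of_not_gt fun h => hη ⟨(abs_lt.1 h).1.le, (abs_lt.1 h).2.le⟩)
    rw [h0, zero_mul]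
    rcases lt_or_ge η (-r) with h3 | h3
    · rw [Set.IccExtend_of_le_left _ _ h3.le, Set.domRestrict_apply]
      simp [H.zero₀ (-r) (by rw [abs_neg]; exact le_abs_self r)]
    · have h4 : r ≤ η := le_of_not_gt fun h4 => hη ⟨h3, h4.le⟩
      rw [Set.IccExtend_of_right_le _ _ h4, Set.domRestrict_apply]
      simp [H.zero₀ r (le_abs_self r)]

theorem hasCompactSupport_mul (H : IsCutoff r X χ χ₁ χ₂ χ₃) (g : ℝ → ℂ) :
    HasCompactSupport fun η => χ η * g η := by
  refine HasCompactSupport.intro (isCompact_Icc (a := -r) (b := r)) fun η hη => ?_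
  rw [H.zero₀ η (le_of_not_gt fun h => hη ⟨(abs_lt.1 h).1.le, (abs_lt.1 h).2.le⟩), zero_mul]

theorem integral_eq (H : IsCutoff r X χ χ₁ χ₂ χ₃) (hr : 0 < r) (g : ℝ → ℂ) :
    ∫ η, χ η * g η = ∫ η in (-r)..r, χ η * g η := by
  rw [intervalIntegral.integral_of_le (by linarith)]
  refine (setIntegral_eq_integral_of_forall_compl_eq_zero fun η hη => ?_).symm
  rw [H.zero₀ η (le_of_not_gt fun h => hη ⟨(abs_lt.1 h).1, (abs_lt.1 h).2.le⟩), zero_mul]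

end IsCutoff

/-- The inner stationary-phase evaluation. -/
theorem norm_wave_average_sub_le {r X L c h : ℝ} {f : ℝ → ℂ} (hf : ContDiff ℝ (⊤ : ℕ∞) f)
    (hfc : HasCompactSupport f) {χ χ₁ χ₂ χ₃ : ℝ → ℂ} (H : IsCutoff r X χ χ₁ χ₂ χ₃) (hr : 0 < r) (hh : 0 < h)
    (hc : 0 ≤ c) {φ φ' : ℝ → ℂ} {u y : ℝ} (hy : y ∈ Set.Icc (-r) r)
    (hφ : ∀ ζ ∈ Set.Icc (-r) r, HasDerivAt φ (φ' ζ) ζ)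
    (hlip : ∀ ζ ∈ Set.Icc (-r) r, ∀ ζ' ∈ Set.Icc (-r) r, ‖φ' ζ - φ' ζ'‖ ≤ c * |ζ - ζ'|)
    (hu : ‖φ' y + u‖ ≤ c * h) (him : ∀ ζ ∈ Set.Icc (-r) r, |(φ ζ).im| ≤ L * h) :
    ‖(∫ s, χ (y + h * s) * osc h (φ (y + h * s)) * waveIntegral f s) -
      2 * Real.pi * (χ y * osc h (φ y) * f u)‖ ≤
      X * Real.exp L * (1 + 2 * c) * (∫ s, (1 + s ^ 2) * ‖waveIntegral f s‖) * h := by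
  obtain ⟨hRc, hRi, hinv⟩ := waveIntegral_facts hf hfc
  have hX := H.nonneg
  have hφc : ContinuousOn φ (Set.Icc (-r) r) := fun ζ hζ => (hφ ζ hζ).continuousAt.continuousWithinAt
  have hac := H.continuous_mul_osc hr (h := h) hφc
  set R := waveIntegral f
  have hRi0 : Integrable R := by
    refine hRi.mono' hRc.aestronglyMeasurable (Eventually.of_forall fun s => ?_)
    nlinarith [norm_nonneg (R s), sq_nonneg s]
  have hexp : ∀ s : ℝ, osc h (φ y - u * (h * s : ℝ)) = osc h (φ y) * exp (-(I * (u * s))) := by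
    intro s
    have hh' : (h : ℂ) ≠ 0 := by exact_mod_cast hh.ne'
    rw [osc, osc, ← exp_add]
    congr 1
    push_cast
    field_simp
    ring
  -- Fourier inversion is the exact evaluation of the linearised phase. It needs a real point u,
  -- whereas -φ'(y) is complex for complex E; the hypothesis keeps u within O(h) of it.
  have e1 : 2 * Real.pi * (χ y * osc h (φ y) * f u) =
      ∫ s, χ y * osc h (φ y - u * (h * s : ℝ)) * R s := by
    simp_rw [hexp]
    rw [show 2 * (Real.pi : ℂ) * (χ y * osc h (φ y) * f u) =
      χ y * osc h (φ y) * (2 * Real.pi * f u) by ring, ← hinv u, ← integral_const_mul]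
    refine integral_congr_ae (Eventually.of_forall fun s => ?_)
    simp only
    ring
  have hBim : ∀ s : ℝ, |(φ y - u * (h * s : ℝ)).im| ≤ L * h := fun s => by
    rw [sub_im, ← ofReal_mul, ofReal_im, sub_zero]; exact him y hy
  have hpt : ∀ s : ℝ, ‖χ (y + h * s) * osc h (φ (y + h * s)) - χ y * osc h (φ y - u * (h * s : ℝ))‖ ≤
      X * Real.exp L * (1 + 2 * c) * h * (1 + s ^ 2) := by
    intro s
    set ζ := y + h * s with hζ
    set B := φ y - u * (h * s : ℝ) with hB
    have hs1 : |s| ≤ 1 + s ^ 2 := by nlinarith [abs_nonneg s, sq_abs s, sq_nonneg (|s| - 1)]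
    have e2 : χ ζ * osc h (φ ζ) - χ y * osc h B =
        (χ ζ - χ y) * osc h B + χ ζ * (osc h (φ ζ) - osc h B) := by ring
    have b1 : ‖(χ ζ - χ y) * osc h B‖ ≤ X * (h * (1 + s ^ 2)) * Real.exp L := by
      rw [norm_mul]
      refine mul_le_mul ((H.norm_sub_le ζ y).trans ?_) (norm_osc_le hh (hBim s)) (norm_nonneg _) (by positivity)
      rw [hζ, add_sub_cancel_left, abs_mul, abs_of_pos hh]
      gcongr
    have b2 : ‖χ ζ * (osc h (φ ζ) - osc h B)‖ ≤ X * (Real.exp L * (2 * c * h * (1 + s ^ 2))) := by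
      by_cases hm : ζ ∈ Set.Icc (-r) r
      · rw [norm_mul]
        refine mul_le_mul (H.bdd₀ ζ) ((norm_osc_sub_le hh (him ζ hm) (hBim s)).trans ?_) (norm_nonneg _) hX
        gcongr
        rw [div_le_iff₀ hh]
        have hsub : Set.uIcc y ζ ⊆ Set.Icc (-r) r := Set.ordConnected_Icc.uIcc_subset hy hm
        have hT : ‖(φ ζ - φ' y * ζ) - (φ y - φ' y * y)‖ ≤ c * |ζ - y| * ‖ζ - y‖ := by
          refine (convex_uIcc y ζ).norm_image_sub_le_of_norm_hasDerivWithin_le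
            (f := fun z => φ z - φ' y * z) (f' := fun z => φ' z - φ' y)
            (fun z hz => ?_) (fun z hz => ?_) Set.left_mem_uIcc Set.right_mem_uIcc
          · have h0 : HasDerivAt (fun z : ℝ => φ' y * (z : ℂ)) (φ' y) z := by
              simpa using ((hasDerivAt_id z).ofReal_comp).const_mul (φ' y)
            exact ((hφ z (hsub hz)).sub h0).hasDerivWithinAt
          · refine (hlip z (hsub hz) y hy).trans ?_
            have := Set.abs_sub_left_of_mem_uIcc hz
            gcongr
        -- The first bracket is the Taylor remainder, of size (h s)², and the second is the O(h)
        -- slope error times h s. Both are O(h² (1 + s²)), hence O(h (1 + s²)) after division by h.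
        have e3 : φ ζ - B = ((φ ζ - φ' y * ζ) - (φ y - φ' y * y)) + (φ' y + u) * (h * s : ℝ) := by
          rw [hB, hζ]; push_cast; ring
        rw [e3]
        refine (norm_add_le _ _).trans ?_
        rw [norm_mul, norm_real, Real.norm_eq_abs, abs_mul, abs_of_pos hh]
        rw [Real.norm_eq_abs, show ζ - y = h * s by rw [hζ]; ring, abs_mul, abs_of_pos hh] at hT
        have h5 : ‖φ' y + u‖ * (h * |s|) ≤ c * h * (h * (1 + s ^ 2)) := by gcongr
        have h6 : c * (h * |s|) * (h * |s|) ≤ c * h * (h * (1 + s ^ 2)) := by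
          have : |s| * |s| = s ^ 2 := by rw [← abs_mul, abs_of_nonneg (mul_self_nonneg s), pow_two]
          calc c * (h * |s|) * (h * |s|) = c * h * (h * (|s| * |s|)) := by ring
            _ ≤ _ := by rw [this]; gcongr; linarith
        calc _ ≤ c * h * (h * (1 + s ^ 2)) + c * h * (h * (1 + s ^ 2)) := add_le_add (hT.trans h6) h5
          _ = _ := by ring
      · have h0 : χ ζ = 0 := H.zero₀ ζ (le_of_not_gt fun h => hm ⟨(abs_lt.1 h).1.le, (abs_lt.1 h).2.le⟩)
        rw [h0, zero_mul, norm_zero]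
        positivity
    rw [e2]
    refine (norm_add_le _ _).trans ((add_le_add b1 b2).trans (le_of_eq ?_))
    ring
  have hi1 : Integrable fun s : ℝ => χ (y + h * s) * osc h (φ (y + h * s)) * R s := by
    refine (hRi0.norm.const_mul (X * Real.exp L)).mono' ?_ (Eventually.of_forall fun s => ?_)
    · exact ((hac.comp (by fun_prop : Continuous fun s : ℝ => y + h * s)).mul hRc).aestronglyMeasurable
    · rw [norm_mul]
      gcongr
      by_cases hm : y + h * s ∈ Set.Icc (-r) r
      · rw [norm_mul]
        exact mul_le_mul (H.bdd₀ _) (norm_osc_le hh (him _ hm)) (norm_nonneg _) hX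
      · have h0 : χ (y + h * s) = 0 :=
          H.zero₀ _ (le_of_not_gt fun h => hm ⟨(abs_lt.1 h).1.le, (abs_lt.1 h).2.le⟩)
        rw [h0, zero_mul, norm_zero]
        positivity
  have hi2 : Integrable fun s : ℝ => χ y * osc h (φ y - u * (h * s : ℝ)) * R s := by
    refine (hRi0.norm.const_mul (X * Real.exp L)).mono' ?_ (Eventually.of_forall fun s => ?_)
    · have := continuous_osc h
      exact Continuous.aestronglyMeasurable (by fun_prop)
    · rw [norm_mul, norm_mul]
      gcongr
      · exact H.bdd₀ _
      · exact norm_osc_le hh (hBim s)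
  rw [e1, ← integral_sub hi1 hi2]
  refine (norm_integral_le_of_norm_le (hRi.const_mul (X * Real.exp L * (1 + 2 * c) * h))
    (Eventually.of_forall fun s => ?_)).trans (le_of_eq ?_)
  · rw [← sub_mul, norm_mul, ← mul_assoc]
    exact mul_le_mul_of_nonneg_right (hpt s) (norm_nonneg _)
  · rw [integral_const_mul]; ring

/-- The product of two oscillatory integrals, integrated against a smooth weight. -/
theorem exists_norm_product_integral_sub_le {r X L c : ℝ} {f : ℝ → ℂ} (hf : ContDiff ℝ (⊤ : ℕ∞) f)
    (hfc : HasCompactSupport f) (hr : 0 < r) (hc : 0 ≤ c) : ∃ C, 0 ≤ C ∧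
    ∀ (χ χ₁ χ₂ χ₃ : ℝ → ℂ) (h : ℝ) (φ ψ ψ' : ℝ → ℂ) (u : ℝ → ℝ), IsCutoff r X χ χ₁ χ₂ χ₃ → 0 < h →
      ContinuousOn φ (Set.Icc (-r) r) → ContinuousOn u (Set.Icc (-r) r) →
      (∀ ζ ∈ Set.Icc (-r) r, HasDerivAt ψ (ψ' ζ) ζ) →
      (∀ ζ ∈ Set.Icc (-r) r, ∀ ζ' ∈ Set.Icc (-r) r, ‖ψ' ζ - ψ' ζ'‖ ≤ c * |ζ - ζ'|) →
      (∀ ζ ∈ Set.Icc (-r) r, ‖ψ' ζ + u ζ‖ ≤ c * h) →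
      (∀ ζ ∈ Set.Icc (-r) r, |(φ ζ).im| ≤ L * h) → (∀ ζ ∈ Set.Icc (-r) r, |(ψ ζ).im| ≤ L * h) →
      ‖(∫ x, f x * (∫ η in (-r)..r, χ η * osc h (x * η + φ η)) *
          (∫ η in (-r)..r, χ η * osc h (x * η + ψ η))) -
        2 * Real.pi * h * ∫ η in (-r)..r, χ η * osc h (φ η) * (χ (-η) * osc h (ψ (-η)) * f (u (-η)))‖ ≤
        C * h ^ 2 := by
  rcases lt_or_ge X 0 with hX | hX
  · exact ⟨0, le_rfl, fun χ χ₁ χ₂ χ₃ h _ _ _ _ H => absurd H.nonneg (not_le.2 hX)⟩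
  set K : ℝ := X * Real.exp L * (1 + 2 * c) * (∫ s, (1 + s ^ 2) * ‖waveIntegral f s‖) with hK
  have hK0 : 0 ≤ K := by
    refine mul_nonneg (by positivity) (integral_nonneg fun s => ?_)
    positivity
  refine ⟨X * Real.exp L * K * (2 * r), by positivity, ?_⟩
  intro χ χ₁ χ₂ χ₃ h φ ψ ψ' u H hh hφ hu hψ hlip hψu hφi hψi
  obtain ⟨hRc, hRi, -⟩ := waveIntegral_facts hf hfc
  have hψc : ContinuousOn ψ (Set.Icc (-r) r) := fun ζ hζ => (hψ ζ hζ).continuousAt.continuousWithinAt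
  have hb := H.continuous_mul_osc hr (h := h) hφ
  have ha := H.continuous_mul_osc hr (h := h) hψc
  have hbc := H.hasCompactSupport_mul fun η => osc h (φ η)
  have hac := H.hasCompactSupport_mul fun η => osc h (ψ η)
  have hconv : ∀ (θ : ℝ → ℂ) (x : ℝ), ∫ η in (-r)..r, χ η * osc h (x * η + θ η) =
      ∫ η, χ η * osc h (θ η) * osc h (x * η) := fun θ x => by
    rw [← H.integral_eq hr fun η => osc h (x * η + θ η)]
    refine integral_congr_ae (Eventually.of_forall fun η => ?_)
    simp only [osc_add]
    ring
  simp_rw [hconv]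
  rw [integral_mul_waves_eq hf.continuous hfc ha hac hb hbc hh]
  have e1 : ∫ η, χ η * osc h (φ η) * (h * ∫ s, χ (-η + h * s) * osc h (ψ (-η + h * s)) * waveIntegral f s) =
      ∫ η in (-r)..r, χ η * osc h (φ η) *
        (h * ∫ s, χ (-η + h * s) * osc h (ψ (-η + h * s)) * waveIntegral f s) := by
    have := H.integral_eq hr fun η => osc h (φ η) *
      (h * ∫ s, χ (-η + h * s) * osc h (ψ (-η + h * s)) * waveIntegral f s)
    simpa only [mul_assoc] using this
  rw [e1, ← intervalIntegral.integral_const_mul]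
  have hrr : -r ≤ r := by linarith
  have hu' : Set.uIcc (-r) r = Set.Icc (-r) r := Set.uIcc_of_le hrr
  have hneg : ∀ η ∈ Set.Icc (-r) r, -η ∈ Set.Icc (-r) r := fun η hη => ⟨by linarith [hη.2], by linarith [hη.1]⟩
  obtain ⟨A, hA⟩ := hac.exists_bound_of_continuous ha
  have hRi0 : Integrable (waveIntegral f) := by
    refine hRi.mono' hRc.aestronglyMeasurable (Eventually.of_forall fun s => ?_)
    nlinarith [norm_nonneg (waveIntegral f s), sq_nonneg s]
  have hQ : Continuous fun η : ℝ => ∫ s, χ (-η + h * s) * osc h (ψ (-η + h * s)) * waveIntegral f s := by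
    refine continuous_of_dominated (bound := fun s => A * ‖waveIntegral f s‖) (fun η => ?_) (fun η => ?_) ?_ ?_
    · exact ((ha.comp (by fun_prop : Continuous fun s : ℝ => -η + h * s)).mul hRc).aestronglyMeasurable
    · refine Eventually.of_forall fun s => ?_
      rw [norm_mul]
      gcongr
      exact hA _
    · exact hRi0.norm.const_mul A
    · refine Eventually.of_forall fun s => ?_
      exact (ha.comp (by fun_prop : Continuous fun η : ℝ => -η + h * s)).mul continuous_const
  have c2 : ContinuousOn (fun η => χ η * osc h (φ η) * (χ (-η) * osc h (ψ (-η)) * f (u (-η)))) (Set.Icc (-r) r) := by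
    refine hb.continuousOn.mul (ContinuousOn.mul (ha.comp continuous_neg).continuousOn ?_)
    exact hf.continuous.comp_continuousOn (hu.comp continuous_neg.continuousOn hneg)
  rw [← intervalIntegral.integral_sub]
  · have hbd : ∀ η ∈ Set.uIoc (-r) r, ‖χ η * osc h (φ η) *
        (h * ∫ s, χ (-η + h * s) * osc h (ψ (-η + h * s)) * waveIntegral f s) -
        2 * Real.pi * h * (χ η * osc h (φ η) * (χ (-η) * osc h (ψ (-η)) * f (u (-η))))‖ ≤
        X * Real.exp L * K * h ^ 2 := by
      intro η hη
      rw [Set.uIoc_of_le hrr] at hη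
      have hη' := Set.Ioc_subset_Icc_self hη
      have h1 := norm_wave_average_sub_le hf hfc H hr hh hc (hneg η hη') hψ hlip (hψu _ (hneg η hη')) hψi
      rw [← hK] at h1
      -- The substitution supplied a factor h and the inner evaluation has error O(h), so the total
      -- is O(h²) uniformly in η.
      have e2 : χ η * osc h (φ η) *
        (h * ∫ s, χ (-η + h * s) * osc h (ψ (-η + h * s)) * waveIntegral f s) -
        2 * Real.pi * h * (χ η * osc h (φ η) * (χ (-η) * osc h (ψ (-η)) * f (u (-η)))) =
        χ η * osc h (φ η) * (h * ((∫ s, χ (-η + h * s) * osc h (ψ (-η + h * s)) * waveIntegral f s) -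
          2 * Real.pi * (χ (-η) * osc h (ψ (-η)) * f (u (-η))))) := by ring
      rw [e2, norm_mul, norm_mul, norm_mul, norm_real, Real.norm_eq_abs, abs_of_pos hh]
      calc _ ≤ X * Real.exp L * (h * (K * h)) := by
            gcongr
            · exact H.bdd₀ η
            · exact norm_osc_le hh (hφi η hη')
        _ = _ := by ring
    refine (intervalIntegral.norm_integral_le_of_norm_le_const hbd).trans (le_of_eq ?_)
    rw [abs_of_pos (by linarith)]
    ring
  · exact (hb.mul (continuous_const.mul hQ)).intervalIntegrable _ _
  · refine ContinuousOn.intervalIntegrable ?_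
    rw [hu']
    exact continuousOn_const.mul c2

/-! ### Oscillatory integrals with a degenerate stationary point -/

theorem integral_inv_pow_le {m : ℕ} (hm : 1 ≤ m) {a b : ℝ} (ha : 0 < a) (hab : a ≤ b) :
    ∫ x in a..b, 1 / x ^ (m + 1) ≤ 1 / a ^ m := by
  have hm0 : (0 : ℝ) < m := by exact_mod_cast hm
  have hpos : ∀ x ∈ Set.uIcc a b, 0 < x := fun x hx => by
    rw [Set.uIcc_of_le hab] at hx; linarith [hx.1]
  have hd : ∀ x ∈ Set.uIcc a b, HasDerivAt (fun x : ℝ => -(1 / m) * (x ^ m)⁻¹) (1 / x ^ (m + 1)) x := by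
    intro x hx
    have hx0 := hpos x hx
    have h1 := ((hasDerivAt_pow m x).inv (pow_ne_zero _ hx0.ne')).const_mul (-(1 / (m : ℝ)))
    refine h1.congr_deriv ?_
    obtain ⟨k, rfl⟩ : ∃ k, m = k + 1 := ⟨m - 1, by omega⟩
    simp only [Nat.add_sub_cancel]
    field_simp
    ring
  have hc : ContinuousOn (fun x : ℝ => 1 / x ^ (m + 1)) (Set.uIcc a b) := by
    refine continuousOn_const.div (by fun_prop) fun x hx => pow_ne_zero _ (hpos x hx).ne'
  rw [intervalIntegral.integral_eq_sub_of_hasDerivAt hd hc.intervalIntegrable]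
  have hb : 0 < b := ha.trans_le hab
  have h1 : 0 ≤ 1 / (m : ℝ) * (b ^ m)⁻¹ := by positivity
  have h2 : 1 / (m : ℝ) * (a ^ m)⁻¹ ≤ 1 * (a ^ m)⁻¹ := by
    gcongr
    rw [div_le_one hm0]
    exact_mod_cast hm
  rw [one_div (a ^ m)]
  linarith

/-- Non-stationary phase away from a degenerate critical point at `0`, with an amplitude of size `x`. -/
theorem norm_integral_symbol_le {m : ℕ} (hm : 1 ≤ m) {a b h c t A B : ℝ} (ha : 0 < a) (hab : a ≤ b) (hh : 0 < h)
    (hc : 0 < c) (ht : 0 ≤ t) (hA : 0 ≤ A) (hB : 0 ≤ B) {g g' F T T' : ℝ → ℂ}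
    (hF : ∀ x ∈ Set.Icc a b, HasDerivAt F (T x) x) (hT : ∀ x ∈ Set.Icc a b, HasDerivAt T (T' x) x)
    (hT' : ContinuousOn T' (Set.Icc a b)) (hg : ∀ x ∈ Set.Icc a b, HasDerivAt g (g' x) x)
    (hg' : ContinuousOn g' (Set.Icc a b))
    (hTc : ∀ x ∈ Set.Icc a b, c * x ^ (m + 1) ≤ ‖T x‖) (hTt : ∀ x ∈ Set.Icc a b, ‖T' x‖ ≤ t * x ^ m)
    (hgA : ∀ x ∈ Set.Icc a b, ‖g x‖ ≤ A * x) (hgA' : ∀ x ∈ Set.Icc a b, ‖g' x‖ ≤ A)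
    (hosc : ∀ x ∈ Set.Icc a b, ‖osc h (F x)‖ ≤ B) :
    ‖∫ x in a..b, g x * osc h (F x)‖ ≤ h * B * (2 * (A / c) + (A / c + A * t / c ^ 2)) / a ^ m := by
  have hx0 : ∀ x ∈ Set.Icc a b, 0 < x := fun x hx => ha.trans_le hx.1
  have hTn : ∀ x ∈ Set.Icc a b, 0 < ‖T x‖ := fun x hx =>
    lt_of_lt_of_le (mul_pos hc (pow_pos (hx0 x hx) _)) (hTc x hx)
  have hT0 : ∀ x ∈ Set.Icc a b, T x ≠ 0 := fun x hx => norm_pos_iff.1 (hTn x hx)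
  have hgc : ContinuousOn g (Set.Icc a b) := fun x hx => (hg x hx).continuousAt.continuousWithinAt
  have hTcont : ContinuousOn T (Set.Icc a b) := fun x hx => (hT x hx).continuousAt.continuousWithinAt
  have hbd : ∀ x ∈ Set.Icc a b, ‖g x / T x‖ ≤ A / c / a ^ m := by
    intro x hx
    have hx' := hx0 x hx
    rw [norm_div]
    calc ‖g x‖ / ‖T x‖ ≤ A * x / (c * x ^ (m + 1)) := by
          gcongr
          · exact hgA x hx
          · exact hTc x hx
      _ = A / c / x ^ m := by field_simp; ring
      _ ≤ A / c / a ^ m := by gcongr; exact hx.1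
  -- Here g / T is of size x^{-m} and its derivative of size x^{-m-1}; integrating down to a gives
  -- a^{-m} for both.
  have key := norm_integral_ibp_le (α := a) (β := b) (h := h) (B := B) (G := A / c / a ^ m)
    (P := (A / c + A * t / c ^ 2) / a ^ m) hab hh hB
    (g := fun x => g x / T x) (g' := fun x => (g' x * T x - g x * T' x) / T x ^ 2) (F := F) (F' := T)
    (p := fun x => (A / c + A * t / c ^ 2) * (1 / x ^ (m + 1)))
    (fun x hx => (hg x hx).div (hT x hx) (hT0 x hx)) hF
    (ContinuousOn.div (by fun_prop) (by fun_prop) fun x hx => pow_ne_zero _ (hT0 x hx))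
    hTcont hosc (hbd a (Set.left_mem_Icc.2 hab)) (hbd b (Set.right_mem_Icc.2 hab))
    (fun x hx => ?_) ?_ ?_
  · rw [intervalIntegral.integral_congr (g := fun x => g x / T x * T x * osc h (F x)) fun x hx => by
      rw [Set.uIcc_of_le hab] at hx
      simp only [div_mul_cancel₀ _ (hT0 x hx)]]
    refine key.trans (le_of_eq ?_)
    field_simp
  · have hx' := hx0 x hx
    have e : (g' x * T x - g x * T' x) / T x ^ 2 = g' x / T x - g x * T' x / T x ^ 2 := by
      have := hT0 x hx
      field_simp
    rw [e]
    refine (norm_sub_le _ _).trans ?_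
    rw [norm_div, norm_div, norm_mul, norm_pow]
    have b1 : ‖g' x‖ / ‖T x‖ ≤ A / (c * x ^ (m + 1)) := by
      gcongr
      · exact hgA' x hx
      · exact hTc x hx
    have b2 : ‖g x‖ * ‖T' x‖ / ‖T x‖ ^ 2 ≤ A * x * (t * x ^ m) / (c * x ^ (m + 1)) ^ 2 := by
      gcongr
      · exact hgA x hx
      · exact hTt x hx
      · exact hTc x hx
    refine (add_le_add b1 b2).trans (le_of_eq ?_)
    field_simp
    ring
  · refine ContinuousOn.mul continuousOn_const (continuousOn_const.div (by fun_prop) fun x hx =>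
      pow_ne_zero _ (hx0 x hx).ne')
  · rw [intervalIntegral.integral_const_mul, div_eq_mul_one_div _ (a ^ m)]
    exact mul_le_mul_of_nonneg_left (integral_inv_pow_le hm ha hab) (by positivity)

/-- Cauchy's estimates on discs of radius proportional to x, so each derivative costs one power of
x. This yields homogeneous symbol bounds without computing derivatives of the phase. -/
theorem norm_deriv_le_of_cone {f : ℂ → ℂ} {x M : ℝ} (hx : 0 < x)
    (hf : DifferentiableOn ℂ f (Metric.ball x (x / 2)))
    (hM : ∀ z ∈ Metric.ball (x : ℂ) (x / 2), ‖f z‖ ≤ M) :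
    ‖deriv f x‖ ≤ 4 * M / x ∧ ‖deriv (deriv f) x‖ ≤ 64 * M / x ^ 2 := by
  have hcauchy : ∀ (g : ℂ → ℂ) (z : ℂ) (M ρ : ℝ), 0 < ρ → DifferentiableOn ℂ g (Metric.closedBall z ρ) →
      (∀ w ∈ Metric.sphere z ρ, ‖g w‖ ≤ M) → ‖deriv g z‖ ≤ M / ρ := by
    intro g z M ρ hρ hg hM
    refine Complex.norm_deriv_le_of_forall_mem_sphere_norm_le hρ ?_ hM
    refine (hg.mono ?_).diffContOnCl
    exact closure_minimal Metric.ball_subset_closedBall Metric.isClosed_closedBall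
  have hsub : ∀ z ∈ Metric.closedBall (x : ℂ) (x / 8), Metric.closedBall z (x / 4) ⊆ Metric.ball (x : ℂ) (x / 2) := by
    intro z hz
    refine Metric.closedBall_subset_ball' ?_
    have := Metric.mem_closedBall.1 hz
    linarith
  have h1 : ∀ z ∈ Metric.closedBall (x : ℂ) (x / 8), ‖deriv f z‖ ≤ M / (x / 4) := fun z hz =>
    hcauchy f z M (x / 4) (by positivity) (hf.mono (hsub z hz))
      fun w hw => hM w (hsub z hz (Metric.sphere_subset_closedBall hw))
  have hd : DifferentiableOn ℂ (deriv f) (Metric.ball x (x / 2)) := hf.deriv Metric.isOpen_ball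
  refine ⟨(h1 x (Metric.mem_closedBall_self (by positivity))).trans (le_of_eq (by field_simp)), ?_⟩
  have h2 := hcauchy (deriv f) x (M / (x / 4)) (x / 8) (by positivity)
    (hd.mono (Metric.closedBall_subset_ball (by linarith)))
    fun w hw => h1 w (Metric.sphere_subset_closedBall hw)
  refine h2.trans ?_
  have hM0 : 0 ≤ M := (norm_nonneg _).trans (hM x (Metric.mem_ball_self (by positivity)))
  rw [div_div, div_le_div_iff₀ (by positivity) (by positivity)]
  nlinarith [mul_nonneg hM0 (sq_nonneg x)]

/-- Deforming the phase from `F` to `F + D`, where `D` vanishes to higher order at `0` than `F`. -/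
theorem norm_integral_phase_change_le {m : ℕ} (hm : 1 ≤ m) {a b h c t p : ℝ} (ha : 0 < a) (hab : a ≤ b)
    (hh : 0 < h) (hc : 0 < c) (ht : 0 ≤ t) (hp : 0 ≤ p)
    {X F T T' T'' D D' D'' D₃ P P' P'' : ℝ → ℂ}
    (hF : ∀ x ∈ Set.Icc a b, HasDerivAt F (T x) x) (hT : ∀ x ∈ Set.Icc a b, HasDerivAt T (T' x) x)
    (hT' : ∀ x ∈ Set.Icc a b, HasDerivAt T' (T'' x) x) (hT'' : ContinuousOn T'' (Set.Icc a b))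
    (hD : ∀ x ∈ Set.Icc a b, HasDerivAt D (D' x) x) (hD' : ∀ x ∈ Set.Icc a b, HasDerivAt D' (D'' x) x)
    (hD'' : ∀ x ∈ Set.Icc a b, HasDerivAt D'' (D₃ x) x) (hD₃ : ContinuousOn D₃ (Set.Icc a b))
    (hXc : ContinuousOn X (Set.Icc a b)) (hXb : X b = 0)
    (hP : ∀ x ∈ Set.Icc a b, HasDerivAt P (P' x) x) (hP' : ∀ x ∈ Set.Icc a b, HasDerivAt P' (P'' x) x)
    (hP'' : ContinuousOn P'' (Set.Icc a b)) (hPX : ∀ x ∈ Set.Icc a b, P x = X x * D x)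
    (hTc : ∀ θ ∈ Set.Icc (0 : ℝ) 1, ∀ x ∈ Set.Icc a b, c * x ^ (m + 1) ≤ ‖T x + θ * D' x‖)
    (hT't : ∀ θ ∈ Set.Icc (0 : ℝ) 1, ∀ x ∈ Set.Icc a b, ‖T' x + θ * D'' x‖ ≤ t * x ^ m)
    (hT''t : ∀ θ ∈ Set.Icc (0 : ℝ) 1, ∀ x ∈ Set.Icc a b, ‖T'' x + θ * D₃ x‖ * x ≤ t * x ^ m)
    (hPp : ∀ x ∈ Set.Icc a b, ‖P x‖ ≤ p * x ^ (m + 3)) (hPp' : ∀ x ∈ Set.Icc a b, ‖P' x‖ ≤ p * x ^ (m + 2))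
    (hPp'' : ∀ x ∈ Set.Icc a b, ‖P'' x‖ ≤ p * x ^ (m + 1))
    (hFr : ∀ x ∈ Set.Icc a b, (F x).im = 0) (hDr : ∀ x ∈ Set.Icc a b, (D x).im = 0) :
    ‖(∫ x in a..b, X x * osc h (F x + D x)) - ∫ x in a..b, X x * osc h (F x)‖ ≤
      p / c * a ^ 2 + h * (4 * ((p / c + p * t / c ^ 2 + (p / c + 3 * p * t / c ^ 2 + 2 * p * t ^ 2 / c ^ 3)) / c +
        (p / c + p * t / c ^ 2 + (p / c + 3 * p * t / c ^ 2 + 2 * p * t ^ 2 / c ^ 3)) * t / c ^ 2)) / a ^ m := by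
  set A : ℝ := p / c + p * t / c ^ 2 + (p / c + 3 * p * t / c ^ 2 + 2 * p * t ^ 2 / c ^ 3) with hA
  have hA0 : 0 ≤ A := by positivity
  have hu : Set.uIcc a b = Set.Icc a b := Set.uIcc_of_le hab
  have hx0 : ∀ x ∈ Set.Icc a b, 0 < x := fun x hx => ha.trans_le hx.1
  have hFc : ContinuousOn F (Set.Icc a b) := fun x hx => (hF x hx).continuousAt.continuousWithinAt
  have hTcn : ContinuousOn T (Set.Icc a b) := fun x hx => (hT x hx).continuousAt.continuousWithinAt
  have hT'cn : ContinuousOn T' (Set.Icc a b) := fun x hx => (hT' x hx).continuousAt.continuousWithinAt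
  have hDc : ContinuousOn D (Set.Icc a b) := fun x hx => (hD x hx).continuousAt.continuousWithinAt
  have hD'c : ContinuousOn D' (Set.Icc a b) := fun x hx => (hD' x hx).continuousAt.continuousWithinAt
  have hD''c : ContinuousOn D'' (Set.Icc a b) := fun x hx => (hD'' x hx).continuousAt.continuousWithinAt
  have hPc : ContinuousOn P (Set.Icc a b) := fun x hx => (hP x hx).continuousAt.continuousWithinAt
  have hP'c : ContinuousOn P' (Set.Icc a b) := fun x hx => (hP' x hx).continuousAt.continuousWithinAt
  have hosc := continuous_osc h
  have hh' : (h : ℂ) ≠ 0 := by exact_mod_cast hh.ne'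
  set Z : ℝ → ℂ := fun θ => ∫ x in a..b, X x * osc h (F x + θ * D x) with hZ
  have hθ : ∀ (θ : ℝ) x, HasDerivAt (fun θ : ℝ => F x + (θ : ℂ) * D x) (D x) θ := fun θ x => by
    simpa using (((hasDerivAt_id θ).ofReal_comp).mul_const (D x)).const_add (F x)
  have hfst : ∀ {g : ℝ → ℂ}, ContinuousOn g (Set.Icc a b) →
      ContinuousOn (fun q : ℝ × ℝ => g q.2) (Set.univ ×ˢ Set.Icc a b) := fun hg =>
    hg.comp continuousOn_snd fun q hq => hq.2
  have hZd : ∀ θ ∈ Set.Icc (0 : ℝ) 1, ∃ Z', HasDerivAt Z Z' θ ∧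
      ‖Z'‖ ≤ p / c * a ^ 2 + h * (4 * (A / c + A * t / c ^ 2)) / a ^ m := by
    intro θ hθm
    have hDeriv := hasDerivAt_intervalIntegral_param hab (f := fun θ x => X x * osc h (F x + θ * D x))
      (f' := fun θ x => X x * (I / h * D x * osc h (F x + θ * D x)))
      (fun θ x _ => (hasDerivAt_osc (hθ θ x)).const_mul (X x))
      (fun θ => hXc.mul (hosc.comp_continuousOn (by fun_prop)))
      ((hfst hXc).mul ((continuousOn_const.mul (hfst hDc)).mul (hosc.comp_continuousOn
        ((hfst hFc).add ((by fun_prop : Continuous fun q : ℝ × ℝ => (q.1 : ℂ)).continuousOn.mul (hfst hDc)))))) θ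
    refine ⟨_, hDeriv, ?_⟩
    set G : ℝ → ℂ := fun x => F x + θ * D x with hG
    set S : ℝ → ℂ := fun x => T x + θ * D' x with hS
    set S' : ℝ → ℂ := fun x => T' x + θ * D'' x with hS'
    set S'' : ℝ → ℂ := fun x => T'' x + θ * D₃ x with hS''
    have hGd : ∀ x ∈ Set.Icc a b, HasDerivAt G (S x) x := fun x hx => (hF x hx).add ((hD x hx).const_mul _)
    have hSd : ∀ x ∈ Set.Icc a b, HasDerivAt S (S' x) x := fun x hx => (hT x hx).add ((hD' x hx).const_mul _)
    have hS'd : ∀ x ∈ Set.Icc a b, HasDerivAt S' (S'' x) x := fun x hx =>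
      (hT' x hx).add ((hD'' x hx).const_mul _)
    have hSc : ContinuousOn S (Set.Icc a b) := by simp only [hS]; fun_prop
    have hS'c : ContinuousOn S' (Set.Icc a b) := by simp only [hS']; fun_prop
    have hS''c : ContinuousOn S'' (Set.Icc a b) := by simp only [hS'']; fun_prop
    have hSl := hTc θ hθm
    have hSn : ∀ x ∈ Set.Icc a b, 0 < ‖S x‖ := fun x hx =>
      lt_of_lt_of_le (mul_pos hc (pow_pos (hx0 x hx) _)) (hSl x hx)
    have hS0 : ∀ x ∈ Set.Icc a b, S x ≠ 0 := fun x hx => norm_pos_iff.1 (hSn x hx)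
    have hGi : ∀ x ∈ Set.Icc a b, ‖osc h (G x)‖ ≤ 1 := fun x hx => by
      rw [norm_osc, hG]
      simp only [add_im, im_ofReal_mul]
      rw [hFr x hx, hDr x hx]
      simp
    set Q : ℝ → ℂ := fun x => P x / S x with hQ
    set Q' : ℝ → ℂ := fun x => (P' x * S x - P x * S' x) / S x ^ 2 with hQ'
    set Q'' : ℝ → ℂ := fun x => P'' x / S x - 2 * (P' x * S' x) / S x ^ 2 - P x * S'' x / S x ^ 2 +
      2 * (P x * S' x ^ 2) / S x ^ 3 with hQ''
    -- Q is the perturbation divided by the intermediate phase derivative. It vanishes like x², so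
    -- Q' is of size x and Q' itself qualifies as an amplitude for `norm_integral_symbol_le`.
    have hQd : ∀ x ∈ Set.Icc a b, HasDerivAt Q (Q' x) x := fun x hx => (hP x hx).div (hSd x hx) (hS0 x hx)
    have hQ'd : ∀ x ∈ Set.Icc a b, HasDerivAt Q' (Q'' x) x := fun x hx => by
      have h1 := (((hP' x hx).mul (hSd x hx)).sub ((hP x hx).mul (hS'd x hx))).div ((hSd x hx).fun_pow 2)
        (pow_ne_zero 2 (hS0 x hx))
      refine h1.congr_deriv ?_
      have := hS0 x hx
      simp only [hQ'', Pi.sub_apply, Pi.mul_apply]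
      field_simp
      push_cast
      ring
    have hQ'c : ContinuousOn Q' (Set.Icc a b) :=
      ContinuousOn.div (by fun_prop) (by fun_prop) fun x hx => pow_ne_zero _ (hS0 x hx)
    have hQ''c : ContinuousOn Q'' (Set.Icc a b) := by
      refine ContinuousOn.add (ContinuousOn.sub (ContinuousOn.sub ?_ ?_) ?_) ?_
      · exact ContinuousOn.div (by fun_prop) (by fun_prop) fun x hx => hS0 x hx
      · exact ContinuousOn.div (by fun_prop) (by fun_prop) fun x hx => pow_ne_zero _ (hS0 x hx)
      · exact ContinuousOn.div (by fun_prop) (by fun_prop) fun x hx => pow_ne_zero _ (hS0 x hx)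
      · exact ContinuousOn.div (by fun_prop) (by fun_prop) fun x hx => pow_ne_zero _ (hS0 x hx)
    have hQb : Q b = 0 := by
      simp only [hQ]; rw [hPX b (Set.right_mem_Icc.2 hab), hXb, zero_mul, zero_div]
    have hibp := integral_ibp_osc (α := a) (β := b) (h := h) hh.ne' (g := Q) (g' := Q') (F := G) (F' := S)
      (fun x hx => hQd x (hu ▸ hx)) (fun x hx => hGd x (hu ▸ hx)) (hu ▸ hQ'c) (hu ▸ hSc)
    -- The first integration by parts removes the factor 1/h. The boundary term at b vanishes with
    -- X, the one at a is O(a²), and the remaining integral gets a second integration by parts.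
    have e1 : ∫ x in a..b, X x * (I / h * D x * osc h (F x + θ * D x)) =
        -(Q a * osc h (G a)) - ∫ x in a..b, Q' x * osc h (G x) := by
      have e2 : ∫ x in a..b, X x * (I / h * D x * osc h (F x + θ * D x)) =
          I / h * ∫ x in a..b, Q x * S x * osc h (G x) := by
        rw [← intervalIntegral.integral_const_mul]
        refine intervalIntegral.integral_congr fun x hx => ?_
        rw [hu] at hx
        simp only [hQ, div_mul_cancel₀ _ (hS0 x hx), hPX x hx, hG]
        ring
      rw [e2, hibp, hQb]
      field_simp
      ring
    rw [e1]
    refine (norm_sub_le _ _).trans (add_le_add ?_ ?_)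
    · have hal := Set.left_mem_Icc.2 hab
      rw [norm_neg, norm_mul]
      have : ‖Q a‖ ≤ p / c * a ^ 2 := by
        simp only [hQ, norm_div]
        calc ‖P a‖ / ‖S a‖ ≤ p * a ^ (m + 3) / (c * a ^ (m + 1)) := by
              gcongr
              · exact hPp a hal
              · exact hSl a hal
          _ = _ := by field_simp; ring
      calc ‖Q a‖ * ‖osc h (G a)‖ ≤ (p / c * a ^ 2) * 1 := by
            gcongr
            exact hGi a hal
        _ = _ := mul_one _
    · have := norm_integral_symbol_le hm ha hab hh hc ht hA0 zero_le_one hGd hSd hS'c hQ'd hQ''c hSl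
        (hT't θ hθm) (fun x hx => ?_) (fun x hx => ?_) hGi
      · refine this.trans ?_
        have ha' : 0 < a ^ m := pow_pos ha m
        rw [mul_one]
        gcongr
        have : 0 ≤ A / c := by positivity
        have : 0 ≤ A * t / c ^ 2 := by positivity
        linarith
      · have hx' := hx0 x hx
        simp only [hQ', norm_div, norm_pow]
        have b1 : ‖P' x * S x - P x * S' x‖ / ‖S x‖ ^ 2 ≤ ‖P' x‖ / ‖S x‖ + ‖P x‖ * ‖S' x‖ / ‖S x‖ ^ 2 := by
          have := hSn x hx
          have h1 := _root_.norm_sub_le (P' x * S x) (P x * S' x)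
          rw [norm_mul, norm_mul] at h1
          calc _ ≤ (‖P' x‖ * ‖S x‖ + ‖P x‖ * ‖S' x‖) / ‖S x‖ ^ 2 := by gcongr
            _ = _ := by field_simp
        refine b1.trans ?_
        calc _ ≤ p * x ^ (m + 2) / (c * x ^ (m + 1)) + p * x ^ (m + 3) * (t * x ^ m) / (c * x ^ (m + 1)) ^ 2 := by
              gcongr
              · exact hPp' x hx
              · exact hSl x hx
              · exact hPp x hx
              · exact hT't θ hθm x hx
              · exact hSl x hx
          _ = (p / c + p * t / c ^ 2) * x := by field_simp; ring
          _ ≤ A * x := by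
              gcongr
              rw [hA]
              have : 0 ≤ p / c + 3 * p * t / c ^ 2 + 2 * p * t ^ 2 / c ^ 3 := by positivity
              linarith
      · have hx' := hx0 x hx
        have h3 : ‖S'' x‖ ≤ t * x ^ m / x := by
          rw [le_div_iff₀ hx']; exact hT''t θ hθm x hx
        have b1 : ‖Q'' x‖ ≤ ‖P'' x‖ / ‖S x‖ + 2 * (‖P' x‖ * ‖S' x‖) / ‖S x‖ ^ 2 +
            ‖P x‖ * ‖S'' x‖ / ‖S x‖ ^ 2 + 2 * (‖P x‖ * ‖S' x‖ ^ 2) / ‖S x‖ ^ 3 := by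
          simp only [hQ'']
          refine (norm_add_le _ _).trans (add_le_add ((norm_sub_le _ _).trans (add_le_add
            ((norm_sub_le _ _).trans (add_le_add ?_ ?_)) ?_)) ?_) <;>
            simp only [norm_div, norm_mul, norm_pow, norm_ofNat, le_refl]
        refine b1.trans ?_
        calc _ ≤ p * x ^ (m + 1) / (c * x ^ (m + 1)) +
              2 * (p * x ^ (m + 2) * (t * x ^ m)) / (c * x ^ (m + 1)) ^ 2 +
              p * x ^ (m + 3) * (t * x ^ m / x) / (c * x ^ (m + 1)) ^ 2 +
              2 * (p * x ^ (m + 3) * (t * x ^ m) ^ 2) / (c * x ^ (m + 1)) ^ 3 := by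
              gcongr
              · exact hPp'' x hx
              · exact hSl x hx
              · exact hPp' x hx
              · exact hT't θ hθm x hx
              · exact hSl x hx
              · exact hPp x hx
              · exact hSl x hx
              · exact hPp x hx
              · exact hT't θ hθm x hx
              · exact hSl x hx
          _ = p / c + 3 * p * t / c ^ 2 + 2 * p * t ^ 2 / c ^ 3 := by field_simp; ring
          _ ≤ A := by
              rw [hA]
              have : 0 ≤ p / c + p * t / c ^ 2 := by positivity
              linarith
  choose! Z' hZ1 hZ2 using hZd
  have hfin := norm_image_sub_le_of_norm_deriv_le_segment_01' (f := Z) (f' := Z')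
    (fun τ hτ => (hZ1 τ hτ).hasDerivWithinAt) (fun τ hτ => hZ2 τ ⟨hτ.1, hτ.2.le⟩)
  simpa only [hZ, ofReal_one, one_mul, ofReal_zero, zero_mul, add_zero] using hfin

/-! ### The polynomial model phase -/

theorem norm_sub_sq_le_of_cone {e x : ℝ} (hx : 0 < x) (he : 2 * |e| ≤ x ^ 2) {z : ℂ}
    (hz : z ∈ Metric.ball (x : ℂ) (x / 2)) : ‖(e : ℂ) - z ^ 2‖ ≤ 3 * x ^ 2 := by
  have h1 : ‖z‖ ≤ 3 / 2 * x := by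
    have h2 : ‖z - x‖ < x / 2 := by simpa [dist_eq_norm] using hz
    have h3 := norm_le_norm_add_norm_sub' z x
    rw [norm_real, Real.norm_eq_abs, abs_of_pos hx] at h3
    linarith
  refine (norm_sub_le _ _).trans ?_
  rw [norm_pow, norm_real, Real.norm_eq_abs]
  have := pow_le_pow_left₀ (norm_nonneg z) h1 2
  nlinarith [sq_nonneg x]

theorem le_norm_sub_sq {e x : ℝ} (he : 2 * |e| ≤ x ^ 2) : x ^ 2 / 2 ≤ ‖(e : ℂ) - (x : ℂ) ^ 2‖ := by
  rw [← ofReal_pow, ← ofReal_sub, norm_real, Real.norm_eq_abs, abs_sub_comm]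
  refine le_trans ?_ (le_abs_self _)
  linarith [le_abs_self e]

/-- Once x² ≥ 2|e|, the factor e - z² has size at most 3x² on the disc of radius x/2, so the cone
estimates apply to its powers times any bounded holomorphic function. -/
theorem norm_deriv_sub_sq_pow_mul_le {p : ℕ} {e x G : ℝ} (hx : 0 < x) (he : 2 * |e| ≤ x ^ 2) {g : ℂ → ℂ}
    (hg : DifferentiableOn ℂ g (Metric.ball x (x / 2)))
    (hG : ∀ z ∈ Metric.ball (x : ℂ) (x / 2), ‖g z‖ ≤ G) :
    ‖deriv (fun z => ((e : ℂ) - z ^ 2) ^ (p + 1) * g z) x‖ ≤ 64 * 3 ^ (p + 1) * G * x ^ (2 * p + 1) ∧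
    ‖deriv (deriv fun z => ((e : ℂ) - z ^ 2) ^ (p + 1) * g z) x‖ * x ≤
      64 * 3 ^ (p + 1) * G * x ^ (2 * p + 1) := by
  have hG0 : 0 ≤ G := (norm_nonneg _).trans (hG x (Metric.mem_ball_self (by positivity)))
  obtain ⟨h1, h2⟩ := norm_deriv_le_of_cone (f := fun z => ((e : ℂ) - z ^ 2) ^ (p + 1) * g z) hx
    (M := 3 ^ (p + 1) * G * x ^ (2 * p + 2))
    (DifferentiableOn.mul (by fun_prop) hg) fun z hz => by
      rw [norm_mul, norm_pow]
      calc _ ≤ (3 * x ^ 2) ^ (p + 1) * G := by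
            gcongr
            · exact norm_sub_sq_le_of_cone hx he hz
            · exact hG z hz
        _ = _ := by rw [mul_pow, ← pow_mul]; ring_nf
  constructor
  · refine h1.trans ?_
    rw [div_le_iff₀ hx]
    have : 0 ≤ 3 ^ (p + 1) * G * x ^ (2 * p + 2) := by positivity
    calc _ ≤ 64 * (3 ^ (p + 1) * G * x ^ (2 * p + 2)) := by linarith
      _ = _ := by ring
  · rw [← le_div_iff₀ hx]
    refine h2.trans (le_of_eq ?_)
    field_simp
    ring

/-- The polynomial phase `w ∫₀^x (e - τ²)ⁿ dτ`. -/
def modelPhase (n : ℕ) (w e x : ℝ) : ℂ := ∫ τ in (0 : ℝ)..x, (w : ℂ) * ((e : ℂ) - (τ : ℂ) ^ 2) ^ n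

theorem hasDerivAt_modelPhase (n : ℕ) (w e x : ℝ) :
    HasDerivAt (modelPhase n w e) ((w : ℂ) * ((e : ℂ) - (x : ℂ) ^ 2) ^ n) x := by
  have hc : Continuous fun τ : ℝ => (w : ℂ) * ((e : ℂ) - (τ : ℂ) ^ 2) ^ n := by fun_prop
  exact intervalIntegral.integral_hasDerivAt_right (hc.intervalIntegrable _ _)
    (hc.stronglyMeasurableAtFilter _ _) hc.continuousAt

theorem modelPhase_eq_ofReal (n : ℕ) (w e x : ℝ) :
    modelPhase n w e x = ((w * ∫ τ in (0 : ℝ)..x, (e - τ ^ 2) ^ n : ℝ) : ℂ) := by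
  rw [← intervalIntegral.integral_const_mul, ← intervalIntegral.integral_ofReal, modelPhase]
  push_cast
  rfl

theorem modelPhase_im (n : ℕ) (w e x : ℝ) : (modelPhase n w e x).im = 0 := by
  rw [modelPhase_eq_ofReal, ofReal_im]

theorem hasDerivAt_model_symbol (p : ℕ) (w e x : ℝ) :
    HasDerivAt (fun x : ℝ => (w : ℂ) * ((e : ℂ) - (x : ℂ) ^ 2) ^ (p + 1))
      (deriv (fun z : ℂ => (w : ℂ) * ((e : ℂ) - z ^ 2) ^ (p + 1)) x) x :=
  HasDerivAt.comp_ofReal (e := fun z : ℂ => (w : ℂ) * ((e : ℂ) - z ^ 2) ^ (p + 1))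
    (DifferentiableAt.hasDerivAt (by fun_prop))

theorem hasDerivAt_model_symbol_deriv (p : ℕ) (w e x : ℝ) :
    HasDerivAt (fun x : ℝ => deriv (fun z : ℂ => (w : ℂ) * ((e : ℂ) - z ^ 2) ^ (p + 1)) x)
      (deriv (deriv fun z : ℂ => (w : ℂ) * ((e : ℂ) - z ^ 2) ^ (p + 1)) x) x :=
  HasDerivAt.comp_ofReal (e := deriv fun z : ℂ => (w : ℂ) * ((e : ℂ) - z ^ 2) ^ (p + 1))
    (DifferentiableAt.hasDerivAt (((by fun_prop : Differentiable ℂ fun z : ℂ =>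
      (w : ℂ) * ((e : ℂ) - z ^ 2) ^ (p + 1)).contDiff (n := 2)).differentiable_deriv_two _))

theorem continuous_model_symbol_deriv₂ (p : ℕ) (w e : ℝ) :
    Continuous fun x : ℝ => deriv (deriv fun z : ℂ => (w : ℂ) * ((e : ℂ) - z ^ 2) ^ (p + 1)) x := by
  have h1 : Differentiable ℂ fun z : ℂ => (w : ℂ) * ((e : ℂ) - z ^ 2) ^ (p + 1) := by fun_prop
  have h2 := (h1.contDiff (n := 2)).continuous_iteratedDeriv 2 le_rfl
  rw [iteratedDeriv_succ, iteratedDeriv_one] at h2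
  exact h2.comp continuous_ofReal

theorem model_symbol_bounds {p : ℕ} {w e x : ℝ} (hx : 0 < x) (he : 2 * |e| ≤ x ^ 2) :
    |w| / 2 ^ (p + 1) * x ^ (2 * p + 1 + 1) ≤ ‖(w : ℂ) * ((e : ℂ) - (x : ℂ) ^ 2) ^ (p + 1)‖ ∧
    ‖deriv (fun z : ℂ => (w : ℂ) * ((e : ℂ) - z ^ 2) ^ (p + 1)) x‖ ≤
      64 * 3 ^ (p + 1) * |w| * x ^ (2 * p + 1) := by
  constructor
  · rw [norm_mul, norm_pow, norm_real, Real.norm_eq_abs]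
    calc _ = |w| * (x ^ 2 / 2) ^ (p + 1) := by rw [div_pow, ← pow_mul]; ring_nf
      _ ≤ _ := by gcongr; exact le_norm_sub_sq he
  · have := (norm_deriv_sub_sq_pow_mul_le (p := p) hx he (g := fun _ => (w : ℂ)) (G := |w|)
      (differentiableOn_const _) fun z _ => by simp).1
    simpa only [mul_comm (w : ℂ)] using this

/-- The contribution of the region away from `0` to the model integral, for an amplitude vanishing at `0`. -/
theorem norm_integral_model_le {p : ℕ} {w e a b h α : ℝ} (hw : w ≠ 0) (ha : 0 < a) (hab : a ≤ b) (hh : 0 < h)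
    (hα : 0 ≤ α) (he : 2 * |e| ≤ a ^ 2) {g g' : ℝ → ℂ} (hg : ∀ x ∈ Set.Icc a b, HasDerivAt g (g' x) x)
    (hg' : ContinuousOn g' (Set.Icc a b)) (hgA : ∀ x ∈ Set.Icc a b, ‖g x‖ ≤ α * x)
    (hgA' : ∀ x ∈ Set.Icc a b, ‖g' x‖ ≤ α) :
    ‖∫ x in a..b, g x * osc h (modelPhase (p + 1) w e x)‖ ≤
      α * (3 / (|w| / 2 ^ (p + 1)) + 64 * 3 ^ (p + 1) * |w| / (|w| / 2 ^ (p + 1)) ^ 2) * (h / a ^ (2 * p + 1)) := by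
  have hw' : 0 < |w| := abs_pos.2 hw
  have hxe : ∀ x ∈ Set.Icc a b, 2 * |e| ≤ x ^ 2 := fun x hx =>
    he.trans (pow_le_pow_left₀ ha.le hx.1 2)
  have := norm_integral_symbol_le (m := 2 * p + 1) (by omega) ha hab hh
    (c := |w| / 2 ^ (p + 1)) (t := 64 * 3 ^ (p + 1) * |w|) (B := 1) (by positivity) (by positivity) hα zero_le_one
    (fun x _ => hasDerivAt_modelPhase (p + 1) w e x) (fun x _ => hasDerivAt_model_symbol p w e x)
    (fun x _ => (hasDerivAt_model_symbol_deriv p w e x).continuousAt.continuousWithinAt) hg hg'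
    (fun x hx => (model_symbol_bounds (ha.trans_le hx.1) (hxe x hx)).1)
    (fun x hx => (model_symbol_bounds (ha.trans_le hx.1) (hxe x hx)).2) hgA hgA'
    (fun x _ => by rw [norm_osc, modelPhase_im]; simp)
  refine this.trans (le_of_eq ?_)
  field_simp
  ring

/-! ### Replacing the analytic factor by its value at the origin -/

/-- A holomorphic germ, real on the real axis, with a quantitative bound for its distance to its value
`w ≠ 0` at the origin. -/
structure IsUnitFactor (R B w : ℝ) (Ω : ℂ → ℂ) : Prop where
  diff : DifferentiableOn ℂ Ω (Metric.ball 0 R)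
  real : ∀ y : ℝ, |y| < R → (Ω y).im = 0
  close : ∀ z ∈ Metric.ball (0 : ℂ) R, ‖Ω z - w‖ ≤ B * ‖z‖
  ne_zero : w ≠ 0
  nonneg : 0 ≤ B

/-- The phase `∫₀^x (e - τ²)ⁿ Ω(e - τ²) dτ`. -/
def contactPhase (n : ℕ) (Ω : ℂ → ℂ) (e x : ℝ) : ℂ :=
  ∫ τ in (0 : ℝ)..x, ((e : ℂ) - (τ : ℂ) ^ 2) ^ n * Ω ((e : ℂ) - (τ : ℂ) ^ 2)

namespace IsUnitFactor

variable {R B w r : ℝ} {Ω : ℂ → ℂ} {p : ℕ}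

theorem neg (H : IsUnitFactor R B w Ω) : IsUnitFactor R B (-w) (fun z => -Ω z) where
  diff := H.diff.neg
  real y hy := by rw [neg_im, H.real y hy, neg_zero]
  close z hz := by
    rw [ofReal_neg, show -Ω z - -(w : ℂ) = -(Ω z - w) by ring, norm_neg]
    exact H.close z hz
  ne_zero := neg_ne_zero.2 H.ne_zero
  nonneg := H.nonneg

theorem mem_ball {a e x : ℝ} (hr : 0 < r) (hrR : 8 * r ^ 2 ≤ R) (ha : 0 ≤ a) (har : a ≤ r)
    (he : 2 * |e| ≤ a ^ 2) (hx : |x| ≤ 2 * r) : (e : ℂ) - (x : ℂ) ^ 2 ∈ Metric.ball (0 : ℂ) R := by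
  rw [mem_ball_zero_iff]
  refine (norm_sub_le _ _).trans_lt ?_
  rw [norm_pow, norm_real, norm_real, Real.norm_eq_abs, Real.norm_eq_abs]
  have h1 := pow_le_pow_left₀ (abs_nonneg x) hx 2
  have h2 := pow_le_pow_left₀ ha har 2
  nlinarith [pow_pos hr 2]

theorem mem_ball_of_cone {a e x : ℝ} (hrR : 8 * r ^ 2 ≤ R) (ha : 0 < a) (he : 2 * |e| ≤ a ^ 2)
    (hx : x ∈ Set.Icc a r) {z : ℂ} (hz : z ∈ Metric.ball (x : ℂ) (x / 2)) :
    (e : ℂ) - z ^ 2 ∈ Metric.ball (0 : ℂ) R := by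
  have hx0 := ha.trans_le hx.1
  rw [mem_ball_zero_iff]
  have h1 := norm_sub_sq_le_of_cone hx0 (he.trans (pow_le_pow_left₀ ha.le hx.1 2)) hz
  have h2 := pow_le_pow_left₀ hx0.le hx.2 2
  nlinarith [pow_pos hx0 2]

theorem hasDerivAt_contactPhase (hΩ : ContinuousOn Ω (Metric.ball 0 R)) {a e x : ℝ} (n : ℕ) (hr : 0 < r)
    (hrR : 8 * r ^ 2 ≤ R) (ha : 0 ≤ a) (har : a ≤ r) (he : 2 * |e| ≤ a ^ 2) (hx : |x| ≤ r) :
    HasDerivAt (contactPhase n Ω e) (((e : ℂ) - (x : ℂ) ^ 2) ^ n * Ω ((e : ℂ) - (x : ℂ) ^ 2)) x := by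
  refine hasDerivAt_primitive (a := 2 * r)
    (f := fun τ : ℝ => ((e : ℂ) - (τ : ℂ) ^ 2) ^ n * Ω ((e : ℂ) - (τ : ℂ) ^ 2)) ?_ ?_
  · exact ContinuousOn.mul (by fun_prop) (hΩ.comp (by fun_prop) fun τ hτ =>
      mem_ball hr hrR ha har he (abs_le.2 ⟨hτ.1.le, hτ.2.le⟩))
  · have := abs_le.1 hx
    exact ⟨by linarith, by linarith⟩

theorem contactPhase_im (H : IsUnitFactor R B w Ω) {a e x : ℝ} (n : ℕ) (hr : 0 < r)
    (hrR : 8 * r ^ 2 ≤ R) (ha : 0 ≤ a) (har : a ≤ r) (he : 2 * |e| ≤ a ^ 2) (hx : |x| ≤ r) :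
    (contactPhase n Ω e x).im = 0 := by
  have hmem : ∀ τ ∈ Set.uIcc 0 x, |τ| ≤ 2 * r := fun τ hτ => by
    have := Set.abs_sub_left_of_mem_uIcc hτ
    simp only [sub_zero] at this
    linarith
  have c1 : ContinuousOn (fun τ : ℝ => ((e : ℂ) - (τ : ℂ) ^ 2) ^ n * Ω ((e : ℂ) - (τ : ℂ) ^ 2)) (Set.uIcc 0 x) :=
    ContinuousOn.mul (by fun_prop) (H.diff.continuousOn.comp (by fun_prop) fun τ hτ =>
      mem_ball hr hrR ha har he (hmem τ hτ))
  have e1 : (contactPhase n Ω e x).im =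
      ∫ τ in (0 : ℝ)..x, (((e : ℂ) - (τ : ℂ) ^ 2) ^ n * Ω ((e : ℂ) - (τ : ℂ) ^ 2)).im :=
    (imCLM.intervalIntegral_comp_comm c1.intervalIntegrable).symm
  rw [e1]
  refine (intervalIntegral.integral_congr fun τ hτ => ?_).trans intervalIntegral.integral_zero
  have h1 := mem_ball hr hrR ha har he (hmem τ hτ)
  have e2 : (e : ℂ) - (τ : ℂ) ^ 2 = ((e - τ ^ 2 : ℝ) : ℂ) := by push_cast; rfl
  rw [e2] at h1 ⊢
  rw [mem_ball_zero_iff, norm_real, Real.norm_eq_abs] at h1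
  rw [← ofReal_pow, im_ofReal_mul, H.real _ h1, mul_zero]

/-- The difference between the phase and its model. -/
theorem contactPhase_sub_modelPhase (H : IsUnitFactor R B w Ω) {a e x : ℝ} (n : ℕ) (hr : 0 < r)
    (hrR : 8 * r ^ 2 ≤ R) (ha : 0 ≤ a) (har : a ≤ r) (he : 2 * |e| ≤ a ^ 2) (hx : |x| ≤ r) :
    contactPhase n (fun z => Ω z - w) e x = contactPhase n Ω e x - modelPhase n w e x := by
  have hmem : ∀ τ ∈ Set.uIcc 0 x, |τ| ≤ 2 * r := fun τ hτ => by
    have := Set.abs_sub_left_of_mem_uIcc hτ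
    simp only [sub_zero] at this
    linarith
  rw [contactPhase, contactPhase, modelPhase, ← intervalIntegral.integral_sub]
  · refine intervalIntegral.integral_congr fun τ _ => ?_
    ring
  · refine ContinuousOn.intervalIntegrable (ContinuousOn.mul (by fun_prop) (H.diff.continuousOn.comp (by fun_prop)
      fun τ hτ => mem_ball hr hrR ha har he (hmem τ hτ)))
  · exact Continuous.intervalIntegrable (by fun_prop) _ _

/-- The integrand has one more factor e - τ² than the model, each factor being at most 3y².
Separating y from x lets one bound serve both the core (y = a) and the outer region (y = x). -/
theorem norm_contactPhase_sub_le (H : IsUnitFactor R B w Ω) {a e x y : ℝ} (hr : 0 < r)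
    (hrR : 8 * r ^ 2 ≤ R) (ha : 0 ≤ a) (har : a ≤ r) (he : 2 * |e| ≤ a ^ 2) (hx : 0 ≤ x) (hxy : x ≤ y)
    (hay : a ≤ y) (hy : y ≤ r) :
    ‖contactPhase (p + 1) (fun z => Ω z - w) e x‖ ≤ 3 ^ (p + 2) * B * y ^ (2 * p + 5) := by
  have hB := H.nonneg
  have hy0 : 0 ≤ y := hx.trans hxy
  have hb : ∀ τ ∈ Set.uIoc 0 x, ‖((e : ℂ) - (τ : ℂ) ^ 2) ^ (p + 1) * (Ω ((e : ℂ) - (τ : ℂ) ^ 2) - w)‖ ≤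
      3 ^ (p + 2) * B * y ^ (2 * p + 4) := by
    intro τ hτ
    rw [Set.uIoc_of_le hx] at hτ
    have hτ1 : |τ| ≤ y := by rw [abs_of_pos hτ.1]; linarith [hτ.2]
    have h1 := H.close _ (mem_ball hr hrR ha har he (x := τ) (by linarith))
    have h2 : ‖(e : ℂ) - (τ : ℂ) ^ 2‖ ≤ 3 * y ^ 2 := by
      refine (norm_sub_le _ _).trans ?_
      rw [norm_pow, norm_real, norm_real, Real.norm_eq_abs, Real.norm_eq_abs]
      have h3 := pow_le_pow_left₀ (abs_nonneg τ) hτ1 2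
      have h4 := pow_le_pow_left₀ ha hay 2
      nlinarith [sq_nonneg y]
    rw [norm_mul, norm_pow]
    calc _ ≤ (3 * y ^ 2) ^ (p + 1) * (B * (3 * y ^ 2)) := by
          gcongr
          exact h1.trans (by gcongr)
      _ = _ := by rw [mul_pow, ← pow_mul]; ring_nf
  refine (intervalIntegral.norm_integral_le_of_norm_le_const hb).trans ?_
  rw [sub_zero, abs_of_nonneg hx]
  calc _ ≤ 3 ^ (p + 2) * B * y ^ (2 * p + 4) * y := by gcongr
    _ = _ := by ring

theorem differentiableOn_comp_sub_sq (H : IsUnitFactor R B w Ω) (e : ℝ) :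
    DifferentiableOn ℂ (fun z : ℂ => Ω ((e : ℂ) - z ^ 2)) {z : ℂ | (e : ℂ) - z ^ 2 ∈ Metric.ball (0 : ℂ) R} :=
  H.diff.comp (by fun_prop) fun _ hz => hz

theorem isOpen_domain (e R : ℝ) : IsOpen {z : ℂ | (e : ℂ) - z ^ 2 ∈ Metric.ball (0 : ℂ) R} :=
  Metric.isOpen_ball.preimage (by fun_prop)

/-- Bounds for the derivatives of an intermediate phase between the model and the actual one. -/
theorem intermediate_symbol_bounds (H : IsUnitFactor R B w Ω) {a e x θ : ℝ} (hrR : 8 * r ^ 2 ≤ R)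
    (hrw : 6 * B * r ^ 2 ≤ |w|) (ha : 0 < a) (he : 2 * |e| ≤ a ^ 2) (hx : x ∈ Set.Icc a r)
    (hθ : θ ∈ Set.Icc (0 : ℝ) 1) :
    |w| / 2 ^ (p + 2) * x ^ (2 * p + 1 + 1) ≤ ‖((e : ℂ) - (x : ℂ) ^ 2) ^ (p + 1) *
      (w + θ * (Ω ((e : ℂ) - (x : ℂ) ^ 2) - w))‖ ∧
    ‖deriv (fun z : ℂ => ((e : ℂ) - z ^ 2) ^ (p + 1) * (w + θ * (Ω ((e : ℂ) - z ^ 2) - w))) x‖ ≤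
      64 * 3 ^ (p + 1) * (2 * |w|) * x ^ (2 * p + 1) ∧
    ‖deriv (deriv fun z : ℂ => ((e : ℂ) - z ^ 2) ^ (p + 1) * (w + θ * (Ω ((e : ℂ) - z ^ 2) - w))) x‖ * x ≤
      64 * 3 ^ (p + 1) * (2 * |w|) * x ^ (2 * p + 1) := by
  have hx0 := ha.trans_le hx.1
  have hB := H.nonneg
  have hxe : 2 * |e| ≤ x ^ 2 := he.trans (pow_le_pow_left₀ ha.le hx.1 2)
  have hsmall : ∀ z ∈ Metric.ball (x : ℂ) (x / 2), ‖(θ : ℂ) * (Ω ((e : ℂ) - z ^ 2) - w)‖ ≤ |w| / 2 := by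
    intro z hz
    have h1 := H.close _ (mem_ball_of_cone hrR ha he hx hz)
    have h2 := norm_sub_sq_le_of_cone hx0 hxe hz
    have h3 := pow_le_pow_left₀ hx0.le hx.2 2
    -- The smallness 6 B r² ≤ |w| keeps the perturbation below |w|/2, so no intermediate phase
    -- acquires new critical points in the outer region.
    rw [norm_mul, norm_real, Real.norm_eq_abs, abs_of_nonneg hθ.1]
    calc _ ≤ 1 * (B * (3 * r ^ 2)) := by
          gcongr
          · exact hθ.2
          · exact h1.trans (by gcongr; linarith)
      _ ≤ _ := by linarith
  refine ⟨?_, norm_deriv_sub_sq_pow_mul_le hx0 hxe ?_ fun z hz => ?_⟩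
  · have h1 := hsmall x (Metric.mem_ball_self (by positivity))
    have h2 : |w| / 2 ≤ ‖(w : ℂ) + θ * (Ω ((e : ℂ) - (x : ℂ) ^ 2) - w)‖ := by
      have h3 := norm_sub_le ((w : ℂ) + θ * (Ω ((e : ℂ) - (x : ℂ) ^ 2) - w)) (θ * (Ω ((e : ℂ) - (x : ℂ) ^ 2) - w))
      rw [add_sub_cancel_right, norm_real, Real.norm_eq_abs] at h3
      linarith
    rw [norm_mul, norm_pow]
    calc _ = (x ^ 2 / 2) ^ (p + 1) * (|w| / 2) := by rw [div_pow, ← pow_mul]; field_simp; ring_nf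
      _ ≤ _ := by gcongr; exact le_norm_sub_sq hxe
  · exact (((H.differentiableOn_comp_sub_sq e).mono fun z hz => mem_ball_of_cone hrR ha he hx hz).sub_const
      (w : ℂ)).const_mul (θ : ℂ) |>.const_add (w : ℂ)
  · refine (norm_add_le _ _).trans ?_
    rw [norm_real, Real.norm_eq_abs]
    linarith [hsmall z hz, abs_nonneg w]

end IsUnitFactor

namespace IsUnitFactor

variable {R B w r : ℝ} {Ω : ℂ → ℂ} {p : ℕ}

theorem hasDerivAt_intermediate_symbol (H : IsUnitFactor R B w Ω) (e θ : ℝ) {z : ℂ}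
    (hz : (e : ℂ) - z ^ 2 ∈ Metric.ball (0 : ℂ) R) :
    HasDerivAt (fun z : ℂ => ((e : ℂ) - z ^ 2) ^ (p + 1) * (w + θ * (Ω ((e : ℂ) - z ^ 2) - w)))
      (deriv (fun z : ℂ => (w : ℂ) * ((e : ℂ) - z ^ 2) ^ (p + 1)) z +
        θ * deriv (fun z : ℂ => ((e : ℂ) - z ^ 2) ^ (p + 1) * (Ω ((e : ℂ) - z ^ 2) - w)) z) z := by
  have h1 : DifferentiableAt ℂ (fun z : ℂ => (w : ℂ) * ((e : ℂ) - z ^ 2) ^ (p + 1)) z := by fun_prop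
  have h3 := (H.differentiableOn_comp_sub_sq e).differentiableAt ((isOpen_domain e R).mem_nhds hz)
  have h2 : DifferentiableAt ℂ (fun z : ℂ => ((e : ℂ) - z ^ 2) ^ (p + 1) * (Ω ((e : ℂ) - z ^ 2) - w)) z :=
    DifferentiableAt.mul (by fun_prop) (h3.sub_const _)
  refine (h1.hasDerivAt.add (h2.hasDerivAt.const_mul (θ : ℂ))).congr_of_eventuallyEq
    (Eventually.of_forall fun y => ?_)
  simp only [Pi.add_apply]
  ring

/-- The gap between the phases vanishes like x^{2p+5}, two orders beyond the phase itself. The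
general deformation bound therefore gives a² + h / a^{2p+1}, and h ≤ a^{2p+3} makes both terms
O(a²). -/
theorem norm_integral_contact_sub_model_le (H : IsUnitFactor R B w Ω) (hr : 0 < r) (hr1 : r ≤ 1)
    (hrR : 8 * r ^ 2 ≤ R) (hrw : 6 * B * r ^ 2 ≤ |w|) (X : ℝ) (p : ℕ) : ∃ C, 0 ≤ C ∧
    ∀ (χ χ₁ χ₂ χ₃ : ℝ → ℂ) (a h e : ℝ), IsCutoff r X χ χ₁ χ₂ χ₃ → 0 < a → a ≤ r → 0 < h →
      h ≤ a ^ (2 * p + 3) → 2 * |e| ≤ a ^ 2 →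
      ‖(∫ x in a..r, χ x * osc h (contactPhase (p + 1) Ω e x)) -
        ∫ x in a..r, χ x * osc h (modelPhase (p + 1) w e x)‖ ≤ C * a ^ 2 := by
  rcases lt_or_ge X 0 with hX | hX
  · exact ⟨0, le_rfl, fun χ χ₁ χ₂ χ₃ _ _ _ H => absurd H.nonneg (not_le.2 hX)⟩
  have hB := H.nonneg
  have hw' : 0 < |w| := abs_pos.2 H.ne_zero
  set d : ℝ := 64 * 3 ^ (p + 2) * B with hd
  have hd0 : 0 ≤ d := by positivity
  -- Derivatives falling on χ do not produce negative powers of x; since x ≤ 1, spare powers are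
  -- discarded and four terms of size X d cover all cases.
  set P : ℝ := 4 * (X * d) with hPdef
  have hP0 : 0 ≤ P := by positivity
  set c : ℝ := |w| / 2 ^ (p + 2) with hc
  have hc0 : 0 < c := by positivity
  set t : ℝ := 64 * 3 ^ (p + 1) * (2 * |w|) with ht
  have ht0 : 0 ≤ t := by positivity
  refine ⟨P / c + 4 * ((P / c + P * t / c ^ 2 + (P / c + 3 * P * t / c ^ 2 + 2 * P * t ^ 2 / c ^ 3)) / c +
        (P / c + P * t / c ^ 2 + (P / c + 3 * P * t / c ^ 2 + 2 * P * t ^ 2 / c ^ 3)) * t / c ^ 2),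
    by positivity, ?_⟩
  intro χ χ₁ χ₂ χ₃ a h e hχ ha har hh hha he
  have hx0 : ∀ x ∈ Set.Icc a r, 0 < x := fun x hx => ha.trans_le hx.1
  have habs : ∀ x ∈ Set.Icc a r, |x| ≤ r := fun x hx => by rw [abs_of_pos (hx0 x hx)]; exact hx.2
  have hxe : ∀ x ∈ Set.Icc a r, 2 * |e| ≤ x ^ 2 := fun x hx => he.trans (pow_le_pow_left₀ ha.le hx.1 2)
  set D : ℝ → ℂ := contactPhase (p + 1) (fun z => Ω z - w) e with hDdef
  set N : ℂ → ℂ := fun z => ((e : ℂ) - z ^ 2) ^ (p + 1) * (Ω ((e : ℂ) - z ^ 2) - w) with hN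
  have hmem : ∀ x ∈ Set.Icc a r, (e : ℂ) - (x : ℂ) ^ 2 ∈ Metric.ball (0 : ℂ) R := fun x hx =>
    mem_ball hr hrR ha.le har he ((habs x hx).trans (by linarith))
  have hNd : DifferentiableOn ℂ N {z : ℂ | (e : ℂ) - z ^ 2 ∈ Metric.ball (0 : ℂ) R} :=
    DifferentiableOn.mul (by fun_prop) ((H.differentiableOn_comp_sub_sq e).sub_const _)
  have hopen := isOpen_domain e R
  have hN'd := hNd.deriv hopen
  have hN''d := hN'd.deriv hopen
  have hD : ∀ x ∈ Set.Icc a r, HasDerivAt D (N x) x := fun x hx =>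
    hasDerivAt_contactPhase (H.diff.continuousOn.sub continuousOn_const) (p + 1) hr hrR ha.le har he (habs x hx)
  have hD' : ∀ x ∈ Set.Icc a r, HasDerivAt (fun x : ℝ => N x) (deriv N x) x := fun x hx =>
    (hNd.differentiableAt (hopen.mem_nhds (hmem x hx))).hasDerivAt.comp_ofReal
  have hD'' : ∀ x ∈ Set.Icc a r, HasDerivAt (fun x : ℝ => deriv N x) (deriv (deriv N) x) x := fun x hx =>
    (hN'd.differentiableAt (hopen.mem_nhds (hmem x hx))).hasDerivAt.comp_ofReal
  have hD₃ : ContinuousOn (fun x : ℝ => deriv (deriv N) x) (Set.Icc a r) :=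
    hN''d.continuousOn.comp (by fun_prop) hmem
  have bD : ∀ x ∈ Set.Icc a r, ‖D x‖ ≤ d * x ^ (2 * p + 4) := fun x hx => by
    have hx' := hx0 x hx
    refine (H.norm_contactPhase_sub_le hr hrR ha.le har he hx'.le le_rfl hx.1 hx.2).trans ?_
    have h1 : x ^ (2 * p + 5) ≤ x ^ (2 * p + 4) := pow_le_pow_of_le_one hx'.le (hx.2.trans hr1) (by omega)
    have h2 : 3 ^ (p + 2) * B ≤ d := by
      have : 0 ≤ 3 ^ (p + 2) * B := by positivity
      rw [hd]; linarith
    gcongr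
  have bg : ∀ x ∈ Set.Icc a r, ∀ z ∈ Metric.ball (x : ℂ) (x / 2), ‖Ω ((e : ℂ) - z ^ 2) - w‖ ≤ B * (3 * x ^ 2) :=
    fun x hx z hz => (H.close _ (mem_ball_of_cone hrR ha he hx hz)).trans
      (mul_le_mul_of_nonneg_left (norm_sub_sq_le_of_cone (hx0 x hx) (hxe x hx) hz) hB)
  have bN : ∀ x ∈ Set.Icc a r, ‖N x‖ ≤ d * x ^ (2 * p + 3) := fun x hx => by
    have hx' := hx0 x hx
    have hs := Metric.mem_ball_self (x := (x : ℂ)) (half_pos hx')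
    simp only [hN]
    rw [norm_mul, norm_pow]
    calc _ ≤ (3 * x ^ 2) ^ (p + 1) * (B * (3 * x ^ 2)) := by
          gcongr
          · exact norm_sub_sq_le_of_cone hx' (hxe x hx) hs
          · exact bg x hx x hs
      _ = 3 ^ (p + 2) * B * x ^ (2 * p + 4) := by rw [mul_pow, ← pow_mul]; ring_nf
      _ ≤ d * x ^ (2 * p + 3) := by
          have h1 : x ^ (2 * p + 4) ≤ x ^ (2 * p + 3) := pow_le_pow_of_le_one hx'.le (hx.2.trans hr1) (by omega)
          have h2 : 3 ^ (p + 2) * B ≤ d := by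
            have : 0 ≤ 3 ^ (p + 2) * B := by positivity
            rw [hd]; linarith
          gcongr
  have bN' : ∀ x ∈ Set.Icc a r, ‖deriv N x‖ ≤ d * x ^ (2 * p + 2) := fun x hx => by
    have hx' := hx0 x hx
    have h3 := (norm_deriv_sub_sq_pow_mul_le (p := p) hx' (hxe x hx) (g := fun z => Ω ((e : ℂ) - z ^ 2) - w)
      (((H.differentiableOn_comp_sub_sq e).mono fun z hz => mem_ball_of_cone hrR ha he hx hz).sub
        (differentiableOn_const _)) (bg x hx)).1
    refine h3.trans ?_
    have h1 : x ^ (2 * p + 3) ≤ x ^ (2 * p + 2) := pow_le_pow_of_le_one hx'.le (hx.2.trans hr1) (by omega)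
    calc _ = d * x ^ (2 * p + 3) := by rw [hd]; ring
      _ ≤ _ := by gcongr
  have hdec : ∀ x ∈ Set.Icc a r, ∀ i j : ℕ, i ≤ j → x ^ j ≤ x ^ i := fun x hx i j hij =>
    pow_le_pow_of_le_one (hx0 x hx).le (hx.2.trans hr1) hij
  have key := norm_integral_phase_change_le (m := 2 * p + 1) (by omega) ha har hh hc0 ht0 hP0
    (X := χ) (F := modelPhase (p + 1) w e) (D := D) (D' := fun x : ℝ => N x) (P := fun x => χ x * D x)
    (P' := fun x => χ₁ x * D x + χ x * N x)
    (P'' := fun x => (χ₂ x * D x + χ₁ x * N x) + (χ₁ x * N x + χ x * deriv N x))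
    (fun x _ => hasDerivAt_modelPhase (p + 1) w e x) (fun x _ => hasDerivAt_model_symbol p w e x)
    (fun x _ => hasDerivAt_model_symbol_deriv p w e x) (continuous_model_symbol_deriv₂ p w e).continuousOn
    hD hD' hD'' hD₃ hχ.cont₀.continuousOn (hχ.zero₀ r (le_abs_self r))
    (fun x hx => (hχ.deriv₁ x).mul (hD x hx))
    (fun x hx => ((hχ.deriv₂ x).mul (hD x hx)).add ((hχ.deriv₁ x).mul (hD' x hx)))
    ?_ (fun x _ => rfl) ?_ ?_ ?_ ?_ ?_ ?_ (fun x _ => modelPhase_im _ _ _ _) ?_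
  · have e1 : ∫ x in a..r, χ x * osc h (contactPhase (p + 1) Ω e x) =
        ∫ x in a..r, χ x * osc h (modelPhase (p + 1) w e x + D x) := by
      refine intervalIntegral.integral_congr fun x hx => ?_
      rw [Set.uIcc_of_le har] at hx
      simp only [hDdef]
      rw [H.contactPhase_sub_modelPhase (p + 1) hr hrR ha.le har he (habs x hx), add_sub_cancel]
    rw [e1]
    refine key.trans ?_
    have h5 : h / a ^ (2 * p + 1) ≤ a ^ 2 := by
      rw [div_le_iff₀ (by positivity), ← pow_add]
      refine hha.trans (le_of_eq (by ring))
    have h6 : ∀ Q : ℝ, 0 ≤ Q → h * Q / a ^ (2 * p + 1) ≤ Q * a ^ 2 := fun Q hQ => by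
      calc _ = Q * (h / a ^ (2 * p + 1)) := by ring
        _ ≤ _ := by gcongr
    rw [add_mul (P / c)]
    exact add_le_add le_rfl (h6 _ (by positivity))
  · have c0 := hχ.cont₀
    have c1 := hχ.cont₁
    have c2 := hχ.cont₂
    have c3 : ContinuousOn D (Set.Icc a r) := fun x hx => (hD x hx).continuousAt.continuousWithinAt
    have c4 : ContinuousOn (fun x : ℝ => N x) (Set.Icc a r) := fun x hx =>
      (hD' x hx).continuousAt.continuousWithinAt
    have c5 : ContinuousOn (fun x : ℝ => deriv N x) (Set.Icc a r) := fun x hx =>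
      (hD'' x hx).continuousAt.continuousWithinAt
    exact ((c2.continuousOn.mul c3).add (c1.continuousOn.mul c4)).add
      ((c1.continuousOn.mul c4).add (c0.continuousOn.mul c5))
  · intro θ hθ x hx
    have h1 := (H.intermediate_symbol_bounds (p := p) hrR hrw ha he hx hθ).1
    refine h1.trans (le_of_eq (congrArg norm ?_))
    simp only [hN]
    ring
  · intro θ hθ x hx
    have h1 := (H.intermediate_symbol_bounds (p := p) hrR hrw ha he hx hθ).2.1
    rwa [(H.hasDerivAt_intermediate_symbol e θ (hmem x hx)).deriv] at h1
  · intro θ hθ x hx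
    have h1 := (H.intermediate_symbol_bounds (p := p) hrR hrw ha he hx hθ).2.2
    have h2 : deriv (fun z : ℂ => ((e : ℂ) - z ^ 2) ^ (p + 1) * (w + θ * (Ω ((e : ℂ) - z ^ 2) - w))) =ᶠ[𝓝 (x : ℂ)]
        fun z => deriv (fun z : ℂ => (w : ℂ) * ((e : ℂ) - z ^ 2) ^ (p + 1)) z + θ * deriv N z := by
      filter_upwards [hopen.mem_nhds (hmem x hx)] with z hz
      exact (H.hasDerivAt_intermediate_symbol e θ hz).deriv
    have h3 : DifferentiableAt ℂ (deriv fun z : ℂ => (w : ℂ) * ((e : ℂ) - z ^ 2) ^ (p + 1)) x :=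
      ((by fun_prop : Differentiable ℂ fun z : ℂ =>
        (w : ℂ) * ((e : ℂ) - z ^ 2) ^ (p + 1)).contDiff (n := 2)).differentiable_deriv_two _
    have h4 := (hN'd.differentiableAt (hopen.mem_nhds (hmem x hx))).hasDerivAt
    rw [h2.deriv_eq, (h3.hasDerivAt.fun_add (h4.const_mul (θ : ℂ))).deriv] at h1
    exact h1
  · intro x hx
    rw [norm_mul]
    have hx' := hx0 x hx
    calc _ ≤ X * (d * x ^ (2 * p + 4)) := by gcongr; exacts [hχ.bdd₀ x, bD x hx]
      _ ≤ P * x ^ (2 * p + 4) := by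
        rw [← mul_assoc]; gcongr; rw [hPdef]; nlinarith [mul_nonneg hX hd0]
  · intro x hx
    have hx' := hx0 x hx
    refine (norm_add_le _ _).trans ?_
    rw [norm_mul (χ₁ x), norm_mul (χ x)]
    calc _ ≤ X * (d * x ^ (2 * p + 3)) + X * (d * x ^ (2 * p + 3)) := by
          gcongr
          · exact hχ.bdd₁ x
          · exact (bD x hx).trans (by gcongr ?_ * ?_; exact hdec x hx _ _ (by omega))
          · exact hχ.bdd₀ x
          · exact bN x hx
      _ = 2 * (X * d) * x ^ (2 * p + 3) := by ring
      _ ≤ P * x ^ (2 * p + 3) := by gcongr; rw [hPdef]; nlinarith [mul_nonneg hX hd0]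
  · intro x hx
    have hx' := hx0 x hx
    refine (norm_add_le _ _).trans ((add_le_add (norm_add_le _ _) (norm_add_le _ _)).trans ?_)
    rw [norm_mul (χ₂ x), norm_mul (χ₁ x), norm_mul (χ x)]
    have q1 : ‖D x‖ ≤ d * x ^ (2 * p + 2) := (bD x hx).trans (by gcongr ?_ * ?_; exact hdec x hx _ _ (by omega))
    have q2 : ‖N x‖ ≤ d * x ^ (2 * p + 2) := (bN x hx).trans (by gcongr ?_ * ?_; exact hdec x hx _ _ (by omega))
    calc _ ≤ (X * (d * x ^ (2 * p + 2)) + X * (d * x ^ (2 * p + 2))) +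
          (X * (d * x ^ (2 * p + 2)) + X * (d * x ^ (2 * p + 2))) := by
          gcongr
          exacts [hχ.bdd₂ x, hχ.bdd₁ x, hχ.bdd₁ x, hχ.bdd₀ x, bN' x hx]
      _ = P * x ^ (2 * p + 1 + 1) := by rw [hPdef]; ring
  · intro x hx
    simp only [hDdef]
    rw [H.contactPhase_sub_modelPhase (p + 1) hr hrR ha.le har he (habs x hx), sub_im, modelPhase_im,
      H.contactPhase_im (p + 1) hr hrR ha.le har he (habs x hx), sub_zero]

end IsUnitFactor

namespace IsUnitFactor

variable {R B w r : ℝ} {Ω : ℂ → ℂ} {p : ℕ}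

/-- The symbol bounds are those of the intermediate family at its end θ = 1, where it is the actual
phase. -/
theorem norm_integral_contact_symbol_le (H : IsUnitFactor R B w Ω) (hr : 0 < r)
    (hrR : 8 * r ^ 2 ≤ R) (hrw : 6 * B * r ^ 2 ≤ |w|) {a h e α : ℝ} (ha : 0 < a) (har : a ≤ r) (hh : 0 < h)
    (hα : 0 ≤ α) (he : 2 * |e| ≤ a ^ 2) {g g' : ℝ → ℂ} (hg : ∀ x ∈ Set.Icc a r, HasDerivAt g (g' x) x)
    (hg' : ContinuousOn g' (Set.Icc a r)) (hgA : ∀ x ∈ Set.Icc a r, ‖g x‖ ≤ α * x)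
    (hgA' : ∀ x ∈ Set.Icc a r, ‖g' x‖ ≤ α) :
    ‖∫ x in a..r, g x * osc h (contactPhase (p + 1) Ω e x)‖ ≤
      α * (3 / (|w| / 2 ^ (p + 2)) + 64 * 3 ^ (p + 1) * (2 * |w|) / (|w| / 2 ^ (p + 2)) ^ 2) *
        (h / a ^ (2 * p + 1)) := by
  have hw' : 0 < |w| := abs_pos.2 H.ne_zero
  have h1m : (1 : ℝ) ∈ Set.Icc (0 : ℝ) 1 := ⟨zero_le_one, le_rfl⟩
  have habs : ∀ x ∈ Set.Icc a r, |x| ≤ r := fun x hx => by rw [abs_of_pos (ha.trans_le hx.1)]; exact hx.2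
  have hmem : ∀ x ∈ Set.Icc a r, (e : ℂ) - (x : ℂ) ^ 2 ∈ Metric.ball (0 : ℂ) R := fun x hx =>
    mem_ball hr hrR ha.le har he ((habs x hx).trans (by linarith))
  set Q : ℂ → ℂ := fun z => ((e : ℂ) - z ^ 2) ^ (p + 1) * (w + (1 : ℝ) * (Ω ((e : ℂ) - z ^ 2) - w)) with hQ
  have hopen := isOpen_domain e R
  have hQd : DifferentiableOn ℂ Q {z : ℂ | (e : ℂ) - z ^ 2 ∈ Metric.ball (0 : ℂ) R} :=
    DifferentiableOn.mul (by fun_prop)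
      ((((H.differentiableOn_comp_sub_sq e).sub_const (w : ℂ)).const_mul ((1 : ℝ) : ℂ)).const_add (w : ℂ))
  have := norm_integral_symbol_le (m := 2 * p + 1) (by omega) ha har hh
    (c := |w| / 2 ^ (p + 2)) (t := 64 * 3 ^ (p + 1) * (2 * |w|)) (B := 1) (T := fun x : ℝ => Q x)
    (T' := fun x : ℝ => deriv Q x) (by positivity) (by positivity) hα zero_le_one
    (fun x hx => (hasDerivAt_contactPhase H.diff.continuousOn (p + 1) hr hrR ha.le har he (habs x hx)).congr_deriv
      (by simp [hQ]))
    (fun x hx => (hQd.differentiableAt (hopen.mem_nhds (hmem x hx))).hasDerivAt.comp_ofReal)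
    ((hQd.deriv hopen).continuousOn.comp (by fun_prop) hmem) hg hg'
    (fun x hx => (H.intermediate_symbol_bounds hrR hrw ha he hx h1m).1)
    (fun x hx => (H.intermediate_symbol_bounds hrR hrw ha he hx h1m).2.1) hgA hgA'
    (fun x hx => by rw [norm_osc, H.contactPhase_im _ hr hrR ha.le har he (habs x hx)]; simp)
  refine this.trans (le_of_eq ?_)
  field_simp
  ring

/-- On a half-line, the oscillatory integral with a degenerate phase is the model integral up to `O(a²)`,
where `a` is the natural scale. -/
theorem exists_norm_half_line_sub_le (H : IsUnitFactor R B w Ω) (hr : 0 < r) (hr1 : r ≤ 1)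
    (hrR : 8 * r ^ 2 ≤ R) (hrw : 6 * B * r ^ 2 ≤ |w|) (X : ℝ) (p : ℕ) {k α : ℝ} (hk : 0 ≤ k) (hα : 0 ≤ α) :
    ∃ C, 0 ≤ C ∧ ∀ (χ χ₁ χ₂ χ₃ A A' : ℝ → ℂ) (a h e b : ℝ) (A₀ : ℂ), IsCutoff r X χ χ₁ χ₂ χ₃ → 0 < a → a ≤ r →
      0 < h → h ≤ a ^ (2 * p + 3) → a ^ (2 * p + 3) ≤ k * h → 2 * |e| ≤ a ^ 2 → r ≤ b →
      (∀ x ∈ Set.Icc 0 r, HasDerivAt A (A' x) x) → ContinuousOn A' (Set.Icc 0 r) →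
      (∀ x ∈ Set.Icc 0 r, ‖A x - A₀‖ ≤ α * (a + x)) → (∀ x ∈ Set.Icc 0 r, ‖A' x‖ ≤ α) → ‖A₀‖ ≤ α →
      ‖(∫ x in (0 : ℝ)..r, A x * osc h (contactPhase (p + 1) Ω e x)) -
        A₀ * ∫ x in (0 : ℝ)..b, osc h (modelPhase (p + 1) w e x)‖ ≤ C * a ^ 2 := by
  rcases lt_or_ge X 0 with hX | hX
  · exact ⟨0, le_rfl, fun χ χ₁ χ₂ χ₃ _ _ _ _ _ _ _ H => absurd H.nonneg (not_le.2 hX)⟩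
  obtain ⟨C₃, hC₃, h₃⟩ := H.norm_integral_contact_sub_model_le hr hr1 hrR hrw X p
  have hB := H.nonneg
  have hw' : 0 < |w| := abs_pos.2 H.ne_zero
  set K₂ : ℝ := 3 / (|w| / 2 ^ (p + 2)) + 64 * 3 ^ (p + 1) * (2 * |w|) / (|w| / 2 ^ (p + 2)) ^ 2 with hK₂
  set K₄ : ℝ := 3 / (|w| / 2 ^ (p + 1)) + 64 * 3 ^ (p + 1) * |w| / (|w| / 2 ^ (p + 1)) ^ 2 with hK₄
  have hK₂0 : 0 ≤ K₂ := by positivity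
  have hK₄0 : 0 ≤ K₄ := by positivity
  refine ⟨(2 * α + α * (3 ^ (p + 2) * B * k)) + (2 * α + α * X) * K₂ + α * C₃ + α * (X * K₄), by positivity, ?_⟩
  intro χ χ₁ χ₂ χ₃ A A' a h e b A₀ hχ ha har hh hha hak he hb hA hA' hAα hAα' hA₀
  have ha1 : a ≤ 1 := har.trans hr1
  have hha' : h / a ^ (2 * p + 1) ≤ a ^ 2 := by
    rw [div_le_iff₀ (by positivity), ← pow_add]
    refine hha.trans (le_of_eq (by ring))
  have habs : ∀ x ∈ Set.Icc 0 r, |x| ≤ r := fun x hx => by rw [abs_of_nonneg hx.1]; exact hx.2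
  set S : ℝ → ℂ := fun x => osc h (contactPhase (p + 1) Ω e x) with hS
  set M : ℝ → ℂ := fun x => osc h (modelPhase (p + 1) w e x) with hM
  have hosc := continuous_osc h
  have cA : ContinuousOn A (Set.Icc 0 r) := fun x hx => (hA x hx).continuousAt.continuousWithinAt
  have cS : ContinuousOn S (Set.Icc 0 r) := hosc.comp_continuousOn fun x hx =>
    (hasDerivAt_contactPhase H.diff.continuousOn (p + 1) hr hrR ha.le har he
      (habs x hx)).continuousAt.continuousWithinAt
  have cM : Continuous M := hosc.comp (continuous_iff_continuousAt.2 fun x =>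
    (hasDerivAt_modelPhase (p + 1) w e x).continuousAt)
  have cχ := hχ.cont₀
  have cχM : Continuous fun x => χ x * M x := cχ.mul cM
  have hsub1 : Set.uIcc 0 a ⊆ Set.Icc 0 r := by
    rw [Set.uIcc_of_le ha.le]; exact Set.Icc_subset_Icc le_rfl har
  have hsub2' : Set.Icc a r ⊆ Set.Icc 0 r := Set.Icc_subset_Icc ha.le le_rfl
  have hsub2 : Set.uIcc a r ⊆ Set.Icc 0 r := by rw [Set.uIcc_of_le har]; exact hsub2'
  have iAS1 : IntervalIntegrable (fun x => A x * S x) volume 0 a := ((cA.mul cS).mono hsub1).intervalIntegrable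
  have iAS2 : IntervalIntegrable (fun x => A x * S x) volume a r := ((cA.mul cS).mono hsub2).intervalIntegrable
  have iχS : IntervalIntegrable (fun x => χ x * S x) volume a r :=
    (cχ.continuousOn.mul (cS.mono hsub2)).intervalIntegrable
  -- Four errors: the core [0, a], the amplitude A - A₀χ (of size x) on [a, r], the change of phase
  -- on [a, r], and the model's tail with amplitude 1 - χ, which is of size x as well.
  have eT : (∫ x in (0 : ℝ)..r, A x * S x) - A₀ * ∫ x in (0 : ℝ)..b, M x =
      (∫ x in (0 : ℝ)..a, A x * S x - A₀ * M x) + (∫ x in a..r, (A x - A₀ * χ x) * S x) +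
      A₀ * ((∫ x in a..r, χ x * S x) - ∫ x in a..r, χ x * M x) - A₀ * ∫ x in a..b, (1 - χ x) * M x := by
    have e1 : ∫ x in a..r, (A x - A₀ * χ x) * S x = (∫ x in a..r, A x * S x) - A₀ * ∫ x in a..r, χ x * S x := by
      rw [← intervalIntegral.integral_const_mul, ← intervalIntegral.integral_sub iAS2 (iχS.const_mul A₀)]
      refine intervalIntegral.integral_congr fun x _ => ?_
      ring
    have e2 : ∫ x in (0 : ℝ)..a, A x * S x - A₀ * M x = (∫ x in (0 : ℝ)..a, A x * S x) - A₀ * ∫ x in (0 : ℝ)..a, M x := by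
      rw [intervalIntegral.integral_sub iAS1 ((cM.intervalIntegrable _ _).const_mul A₀),
        intervalIntegral.integral_const_mul]
    have e3 : ∫ x in a..b, (1 - χ x) * M x = (∫ x in a..b, M x) - ∫ x in a..b, χ x * M x := by
      rw [← intervalIntegral.integral_sub (cM.intervalIntegrable _ _) (cχM.intervalIntegrable _ _)]
      refine intervalIntegral.integral_congr fun x _ => ?_
      ring
    have e4 : ∫ x in a..b, χ x * M x = ∫ x in a..r, χ x * M x := by
      rw [← intervalIntegral.integral_add_adjacent_intervals (b := r) (cχM.intervalIntegrable _ _)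
        (cχM.intervalIntegrable _ _)]
      have : ∫ x in r..b, χ x * M x = 0 := by
        refine (intervalIntegral.integral_congr fun x hx => ?_).trans intervalIntegral.integral_zero
        rw [Set.uIcc_of_le hb] at hx
        rw [hχ.zero₀ x (hx.1.trans (le_abs_self x)), zero_mul]
      rw [this, add_zero]
    rw [e1, e2, e3, e4, ← intervalIntegral.integral_add_adjacent_intervals iAS1 iAS2,
      ← intervalIntegral.integral_add_adjacent_intervals (a := 0) (b := a) (c := b) (cM.intervalIntegrable _ _)
        (cM.intervalIntegrable _ _)]
    ring
  have nS : ∀ x ∈ Set.Icc 0 r, ‖S x‖ = 1 := fun x hx => by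
    simp only [hS]; rw [norm_osc, H.contactPhase_im _ hr hrR ha.le har he (habs x hx)]; simp
  have b1 : ‖∫ x in (0 : ℝ)..a, A x * S x - A₀ * M x‖ ≤ (2 * α + α * (3 ^ (p + 2) * B * k)) * a ^ 2 := by
    have hb : ∀ x ∈ Set.uIoc 0 a, ‖A x * S x - A₀ * M x‖ ≤ (2 * α + α * (3 ^ (p + 2) * B * k)) * a := by
      intro x hx
      rw [Set.uIoc_of_le ha.le] at hx
      have hx' : x ∈ Set.Icc 0 r := ⟨hx.1.le, hx.2.trans har⟩
      have q1 : ‖S x - M x‖ ≤ 3 ^ (p + 2) * B * k * a := by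
        have i1 : |(contactPhase (p + 1) Ω e x).im| ≤ 0 * h := by
          rw [H.contactPhase_im _ hr hrR ha.le har he (habs x hx')]; simp
        have i2 : |(modelPhase (p + 1) w e x).im| ≤ 0 * h := by rw [modelPhase_im]; simp
        refine (norm_osc_sub_le hh i1 i2).trans ?_
        rw [Real.exp_zero, one_mul, div_le_iff₀ hh,
          ← H.contactPhase_sub_modelPhase (p + 1) hr hrR ha.le har he (habs x hx')]
        refine (H.norm_contactPhase_sub_le hr hrR ha.le har he hx.1.le hx.2 le_rfl har).trans ?_
        -- In the core the phases differ by at most a multiple of a · a^{2p+3}, and a^{2p+3} ≤ k h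
        -- turns the quotient by h into O(a).
        have : a ^ (2 * p + 5) ≤ a * a ^ (2 * p + 3) := by
          rw [show 2 * p + 5 = 1 + (1 + (2 * p + 3)) by ring, pow_add, pow_add a 1, pow_one]
          have : 0 ≤ a * a ^ (2 * p + 3) := by positivity
          nlinarith
        calc _ ≤ 3 ^ (p + 2) * B * (a * (k * h)) := by gcongr; exact this.trans (by gcongr)
          _ = _ := by ring
      have e5 : A x * S x - A₀ * M x = (A x - A₀) * S x + A₀ * (S x - M x) := by ring
      rw [e5]
      refine (norm_add_le _ _).trans ?_
      rw [norm_mul, norm_mul, nS x hx', mul_one, add_mul]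
      refine add_le_add ((hAα x hx').trans ?_) ?_
      · nlinarith [hx.2]
      · calc _ ≤ α * (3 ^ (p + 2) * B * k * a) := by gcongr
          _ = _ := by ring
    refine (intervalIntegral.norm_integral_le_of_norm_le_const hb).trans (le_of_eq ?_)
    rw [sub_zero, abs_of_pos ha]
    ring
  have hχ0 : ∀ x, 0 ≤ x → ‖1 - χ x‖ ≤ X * x := fun x hx => by
    have := hχ.norm_sub_le x 0
    rwa [hχ.one 0 (by rw [abs_zero]; linarith), sub_zero, abs_of_nonneg hx, norm_sub_rev] at this
  have b2 : ‖∫ x in a..r, (A x - A₀ * χ x) * S x‖ ≤ (2 * α + α * X) * K₂ * a ^ 2 := by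
    refine (H.norm_integral_contact_symbol_le (p := p) hr hrR hrw ha har hh (α := 2 * α + α * X) (by positivity) he
      (g := fun x => A x - A₀ * χ x) (g' := fun x => A' x - A₀ * χ₁ x)
      (fun x hx => (hA x (hsub2' hx)).sub ((hχ.deriv₁ x).const_mul A₀))
      ((hA'.mono hsub2').sub (continuousOn_const.mul hχ.cont₁.continuousOn)) (fun x hx => ?_) (fun x hx => ?_)).trans
      (mul_le_mul_of_nonneg_left hha' (by positivity))
    · have hx0 : 0 ≤ x := ha.le.trans hx.1
      have e6 : A x - A₀ * χ x = (A x - A₀) + A₀ * (1 - χ x) := by ring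
      rw [e6]
      refine (norm_add_le _ _).trans ?_
      rw [norm_mul, add_mul]
      refine add_le_add ((hAα x (hsub2' hx)).trans ?_) ?_
      · nlinarith [hx.1]
      · calc _ ≤ α * (X * x) := by gcongr; exact hχ0 x hx0
          _ = _ := by ring
    · refine (norm_sub_le _ _).trans ?_
      rw [norm_mul]
      have q1 := hAα' x (hsub2' hx)
      have q2 : ‖A₀‖ * ‖χ₁ x‖ ≤ α * X := by gcongr; exact hχ.bdd₁ x
      linarith
  have b4 : ‖∫ x in a..b, (1 - χ x) * M x‖ ≤ X * K₄ * a ^ 2 := by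
    refine (norm_integral_model_le (p := p) H.ne_zero ha (har.trans hb) hh hX he (g := fun x => 1 - χ x)
      (g' := fun x => -χ₁ x) (fun x _ => (hχ.deriv₁ x).const_sub 1) hχ.cont₁.neg.continuousOn
      (fun x hx => hχ0 x (ha.le.trans hx.1)) (fun x _ => ?_)).trans
      (mul_le_mul_of_nonneg_left hha' (by positivity))
    rw [norm_neg]; exact hχ.bdd₁ x
  rw [eT]
  refine (norm_sub_le _ _).trans ?_
  rw [add_mul _ (α * (X * K₄))]
  refine add_le_add ((norm_add_le _ _).trans ?_) ?_
  · rw [add_mul _ (α * C₃)]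
    refine add_le_add ((norm_add_le _ _).trans ?_) ?_
    · rw [add_mul]
      exact add_le_add b1 b2
    · rw [norm_mul, mul_assoc]
      exact mul_le_mul hA₀ (h₃ _ _ _ _ _ _ _ hχ ha har hh hha he) (norm_nonneg _) hα
  · rw [norm_mul, mul_assoc]
    exact mul_le_mul hA₀ b4 (norm_nonneg _) hα

end IsUnitFactor

/-! ### Scaling the model integral to the generalized Airy function -/

/-- The substitution τ ↦ τ / l with l^{2n+1} |w| = h. The sign s absorbs both the sign of w and the
factor (-1)ⁿ from turning e - τ² into τ² - e. -/
theorem modelPhase_div_eq {n : ℕ} {w e h l s : ℝ} (hh : 0 < h) (hl : 0 < l) (hlw : l ^ (2 * n + 1) * |w| = h)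
    (hs : s * |w| = (-1) ^ n * w) (x : ℝ) :
    (w * ∫ τ in (0 : ℝ)..x, (e - τ ^ 2) ^ n) / h = s * ∫ τ in (0 : ℝ)..(x / l), (-e / l ^ 2 + τ ^ 2) ^ n := by
  have h1 : ∫ τ in (0 : ℝ)..(x / l), (-e / l ^ 2 + τ ^ 2) ^ n =
      l⁻¹ * ∫ τ in (0 : ℝ)..x, (-e / l ^ 2 + (τ / l) ^ 2) ^ n := by
    rw [intervalIntegral.integral_comp_div (fun τ => (-e / l ^ 2 + τ ^ 2) ^ n) hl.ne', zero_div, smul_eq_mul,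
      ← mul_assoc, inv_mul_cancel₀ hl.ne', one_mul]
  have h2 : ∀ τ : ℝ, (-e / l ^ 2 + (τ / l) ^ 2) ^ n = ((-1) ^ n / l ^ (2 * n)) * (e - τ ^ 2) ^ n := fun τ => by
    rw [show -e / l ^ 2 + (τ / l) ^ 2 = (-1) * (e - τ ^ 2) / l ^ 2 by field_simp; ring, div_pow, mul_pow, ← pow_mul]
    ring
  rw [h1]
  simp_rw [h2]
  rw [intervalIntegral.integral_const_mul]
  have h3 : w / h = s * (l⁻¹ * ((-1) ^ n / l ^ (2 * n))) := by
    rw [div_eq_iff hh.ne', ← hlw]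
    have h4 : ((-1 : ℝ) ^ n) * (-1) ^ n = 1 := by rw [← mul_pow]; simp
    have : s * (l⁻¹ * ((-1) ^ n / l ^ (2 * n))) * (l ^ (2 * n + 1) * |w|) = (-1) ^ n * (s * |w|) := by
      field_simp
      ring
    rw [this, hs, ← mul_assoc, h4, one_mul]
  calc _ = w / h * ∫ τ in (0 : ℝ)..x, (e - τ ^ 2) ^ n := by ring
    _ = _ := by rw [h3]; ring

/-- The scaled integral is a truncated A_n up to the sign of the phase. That sign is harmless: the
phase is odd and the interval is symmetric, so η ↦ -η reverses it. -/
theorem tendsto_integral_modelPhase {n : ℕ} (hn : 1 ≤ n) {w e h l : ℝ} (hh : 0 < h) (hl : 0 < l)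
    (hlw : l ^ (2 * n + 1) * |w| = h) :
    Tendsto (fun b : ℝ => ∫ x in (-b)..b, osc h (modelPhase n w e x)) atTop
      (𝓝 (2 * Real.pi * l * genAiry n ((-e / l ^ 2 : ℝ) : ℂ))) := by
  set y : ℝ := -e / l ^ 2 with hy
  set g : ℝ → ℂ := fun η => exp (I * ((∫ τ in (0 : ℝ)..η, (y + τ ^ 2) ^ n : ℝ) : ℂ)) with hg
  have hh' : (h : ℂ) ≠ 0 := by exact_mod_cast hh.ne'
  have hpi : (Real.pi : ℂ) ≠ 0 := by exact_mod_cast Real.pi_ne_zero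
  have hosc : ∀ x, osc h (modelPhase n w e x) =
      exp (I * (((w * ∫ τ in (0 : ℝ)..x, (e - τ ^ 2) ^ n) / h : ℝ) : ℂ)) := fun x => by
    rw [osc, modelPhase_eq_ofReal, ofReal_div, mul_div_assoc]
  have hval : ∀ b : ℝ, ∫ x in (-b)..b, osc h (modelPhase n w e x) = l * ∫ η in (-(b / l))..(b / l), g η := by
    intro b
    have hdiv : ∀ f : ℝ → ℂ, ∫ x in (-b)..b, f (x / l) = l * ∫ η in (-(b / l))..(b / l), f η := fun f => by
      rw [intervalIntegral.integral_comp_div f hl.ne', neg_div, real_smul]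
    have hcase : (1 : ℝ) * |w| = (-1) ^ n * w ∨ (-1 : ℝ) * |w| = (-1) ^ n * w := by
      rcases neg_one_pow_eq_or ℝ n with h1 | h1 <;> rcases abs_choice w with h2 | h2 <;> rw [h1, h2] <;> simp
    rcases hcase with hs | hs
    · rw [← hdiv g]
      refine intervalIntegral.integral_congr fun x _ => ?_
      simp only [hosc, hg]
      rw [modelPhase_div_eq hh hl hlw hs, one_mul]
    · have hneg : ∫ η in (-(b / l))..(b / l), g η = ∫ η in (-(b / l))..(b / l), g (-η) := by
        rw [intervalIntegral.integral_comp_neg, neg_neg]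
      rw [hneg, ← hdiv fun η => g (-η)]
      refine intervalIntegral.integral_congr fun x _ => ?_
      simp only [hosc, hg]
      rw [modelPhase_div_eq hh hl hlw hs]
      congr 3
      have := intervalIntegral.integral_comp_neg (fun τ : ℝ => (y + τ ^ 2) ^ n) (a := 0) (b := x / l)
      simp only [neg_sq, neg_zero] at this
      rw [this, intervalIntegral.integral_symm]
      ring
  have h1 := (tendsto_genAiry n hn y).comp
    ((tendsto_id.atTop_div_const hl).prodMk (tendsto_id.atTop_div_const hl))
  have h2 := h1.const_mul (2 * Real.pi * l : ℂ)
  refine h2.congr fun b => ?_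
  simp only [Function.comp_def, id_eq]
  rw [hval b]
  field_simp
  rfl

theorem modelPhase_neg (n : ℕ) (w e x : ℝ) : modelPhase n w e (-x) = modelPhase n (-w) e x := by
  have := intervalIntegral.integral_comp_neg (fun τ : ℝ => (w : ℂ) * ((e : ℂ) - (τ : ℂ) ^ 2) ^ n) (a := 0) (b := x)
  simp only [ofReal_neg, neg_sq, neg_zero] at this
  rw [modelPhase, modelPhase, intervalIntegral.integral_symm, ← this, ← intervalIntegral.integral_neg]
  simp only [ofReal_neg, neg_mul]

theorem contactPhase_neg (n : ℕ) (Ω : ℂ → ℂ) (e x : ℝ) :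
    contactPhase n Ω e (-x) = contactPhase n (fun z => -Ω z) e x := by
  have := intervalIntegral.integral_comp_neg
    (fun τ : ℝ => ((e : ℂ) - (τ : ℂ) ^ 2) ^ n * Ω ((e : ℂ) - (τ : ℂ) ^ 2)) (a := 0) (b := x)
  simp only [ofReal_neg, neg_sq, neg_zero] at this
  rw [contactPhase, contactPhase, intervalIntegral.integral_symm, ← this, ← intervalIntegral.integral_neg]
  simp only [mul_neg]

theorem integral_symm_eq_add {f : ℝ → ℂ} {b : ℝ} (hf : ContinuousOn f (Set.Icc (-b) b)) (hb : 0 ≤ b) :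
    ∫ x in (-b)..b, f x = (∫ x in (0 : ℝ)..b, f x) + ∫ x in (0 : ℝ)..b, f (-x) := by
  rw [intervalIntegral.integral_comp_neg, neg_zero, add_comm]
  refine (intervalIntegral.integral_add_adjacent_intervals ?_ ?_).symm <;>
    refine ContinuousOn.intervalIntegrable (hf.mono ?_)
  · rw [Set.uIcc_of_le (by linarith)]; exact Set.Icc_subset_Icc le_rfl hb
  · rw [Set.uIcc_of_le hb]; exact Set.Icc_subset_Icc (by linarith) le_rfl

namespace IsUnitFactor

variable {R B w r : ℝ} {Ω : ℂ → ℂ} {p : ℕ}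

/-- The leading asymptotics of the oscillatory integral with a degenerate phase. -/
theorem exists_norm_contact_integral_sub_le (H : IsUnitFactor R B w Ω) (hr : 0 < r) (hr1 : r ≤ 1)
    (hrR : 8 * r ^ 2 ≤ R) (hrw : 6 * B * r ^ 2 ≤ |w|) (p : ℕ) {k α : ℝ} (hk : 0 ≤ k) (hα : 0 ≤ α) :
    ∃ C, 0 ≤ C ∧ ∀ (A A' : ℝ → ℂ) (a h e l : ℝ) (A₀ : ℂ), 0 < a → a ≤ r →
      0 < h → h ≤ a ^ (2 * p + 3) → a ^ (2 * p + 3) ≤ k * h → 2 * |e| ≤ a ^ 2 →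
      0 < l → l ^ (2 * p + 3) * |w| = h →
      (∀ x ∈ Set.Icc (-r) r, HasDerivAt A (A' x) x) → ContinuousOn A' (Set.Icc (-r) r) →
      (∀ x ∈ Set.Icc (-r) r, ‖A x - A₀‖ ≤ α * (a + |x|)) → (∀ x ∈ Set.Icc (-r) r, ‖A' x‖ ≤ α) → ‖A₀‖ ≤ α →
      ‖(∫ x in (-r)..r, A x * osc h (contactPhase (p + 1) Ω e x)) -
        A₀ * (2 * Real.pi * l * genAiry (p + 1) ((-e / l ^ 2 : ℝ) : ℂ))‖ ≤ C * a ^ 2 := by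
  obtain ⟨X, χ, χ₁, χ₂, χ₃, hχ⟩ := exists_isCutoff hr
  obtain ⟨C₁, hC₁, h₁⟩ := H.exists_norm_half_line_sub_le hr hr1 hrR hrw X p hk hα
  obtain ⟨C₂, hC₂, h₂⟩ := H.neg.exists_norm_half_line_sub_le hr hr1 hrR (by rwa [abs_neg]) X p hk hα
  refine ⟨C₁ + C₂, by positivity, ?_⟩
  intro A A' a h e l A₀ ha har hh hha hak he hl hlw hA hA' hAα hAα' hA₀
  have hlim := (tendsto_integral_modelPhase (n := p + 1) (by omega) (e := e) hh hl hlw).const_mul A₀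
  -- A_n is only conditionally convergent on ℝ. The half-line estimates are uniform in the
  -- truncation b, so the limit may be taken at the end.
  refine le_of_tendsto (tendsto_const_nhds.sub hlim).norm ?_
  filter_upwards [eventually_ge_atTop r] with b hb
  have hosc := continuous_osc h
  have cM : Continuous fun x => osc h (modelPhase (p + 1) w e x) := hosc.comp
    (continuous_iff_continuousAt.2 fun x => (hasDerivAt_modelPhase (p + 1) w e x).continuousAt)
  have cA : ContinuousOn (fun x => A x * osc h (contactPhase (p + 1) Ω e x)) (Set.Icc (-r) r) :=
    ContinuousOn.mul (fun x hx => (hA x hx).continuousAt.continuousWithinAt)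
      (hosc.comp_continuousOn fun x hx => (hasDerivAt_contactPhase H.diff.continuousOn (p + 1) hr hrR ha.le har he
        (abs_le.2 hx)).continuousAt.continuousWithinAt)
  rw [integral_symm_eq_add cA hr.le, integral_symm_eq_add cM.continuousOn (hr.le.trans hb)]
  simp_rw [contactPhase_neg, modelPhase_neg]
  -- On the negative half-line the reflected phase belongs to -Ω, which satisfies the same
  -- hypotheses with -w.
  have hp : Set.Icc 0 r ⊆ Set.Icc (-r) r := Set.Icc_subset_Icc (by linarith) le_rfl
  have hm : ∀ x ∈ Set.Icc 0 r, -x ∈ Set.Icc (-r) r := fun x hx => ⟨by linarith [hx.2], by linarith [hx.1]⟩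
  have q1 := h₁ χ χ₁ χ₂ χ₃ A A' a h e b A₀ hχ ha har hh hha hak he hb (fun x hx => hA x (hp hx)) (hA'.mono hp)
    (fun x hx => by have := hAα x (hp hx); rwa [abs_of_nonneg hx.1] at this) (fun x hx => hAα' x (hp hx)) hA₀
  have q2 := h₂ χ χ₁ χ₂ χ₃ (fun x => A (-x)) (fun x => -A' (-x)) a h e b A₀ hχ ha har hh hha hak he hb
    (fun x hx => by simpa [Function.comp_def] using (hA (-x) (hm x hx)).scomp x (hasDerivAt_neg x))
    ((hA'.comp continuousOn_neg hm).neg)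
    (fun x hx => by have := hAα _ (hm x hx); rwa [abs_neg, abs_of_nonneg hx.1] at this)
    (fun x hx => by rw [norm_neg]; exact hAα' _ (hm x hx)) hA₀
  refine le_trans (le_of_eq (congrArg norm ?_)) ((norm_add_le _ _).trans ((add_le_add q1 q2).trans (le_of_eq ?_)))
  · ring
  · ring

end IsUnitFactor

/-! ### The overlap integral -/

theorem action_neg (U : ℂ → ℂ) (E : ℂ) (x : ℝ) : action U E (-x) = -action U E x := by
  have := intervalIntegral.integral_comp_neg (fun τ : ℝ => U (E - (τ : ℂ) ^ 2)) (a := 0) (b := x)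
  simp only [ofReal_neg, neg_sq, neg_zero] at this
  rw [action, action, intervalIntegral.integral_symm, ← this]

theorem norm_sub_ofReal_re (z : ℂ) : ‖z - z.re‖ = |z.im| := by
  have : z - z.re = (z.im : ℂ) * I := by nth_rw 1 [← re_add_im z]; ring
  rw [this, norm_mul, norm_I, mul_one, norm_real, Real.norm_eq_abs]

theorem norm_sub_le_of_norm_deriv_le {A A' : ℝ → ℂ} {r α : ℝ} (hr : 0 ≤ r)
    (hA : ∀ x ∈ Set.Icc (-r) r, HasDerivAt A (A' x) x) (hα : ∀ x ∈ Set.Icc (-r) r, ‖A' x‖ ≤ α)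
    {x : ℝ} (hx : x ∈ Set.Icc (-r) r) : ‖A x - A 0‖ ≤ α * |x| := by
  have := (convex_Icc (-r) r).norm_image_sub_le_of_norm_hasDerivWithin_le
    (fun x hx => (hA x hx).hasDerivWithinAt) hα (x := 0) (y := x) ⟨by linarith, hr⟩ hx
  simpa using this

set_option maxHeartbeats 1000000 in
/-- The stationary-phase integral over the crossing region. -/
theorem exists_norm_reduced_integral_sub_le {V₁ V₂ : ℝ → ℝ} {R ρ₁ ρ₂ κ₁ κ₂ R' B w r X k L : ℝ}
    {Vc₁ Vc₂ U₁ U₂ Ω : ℂ → ℂ} {p : ℕ} (H₁ : IsChart V₁ R ρ₁ κ₁ Vc₁ U₁) (H₂ : IsChart V₂ R ρ₂ κ₂ Vc₂ U₂)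
    (H : IsUnitFactor R' B w Ω) (hR' : R' ≤ R) (hU₂ : U₂ 0 = 0)
    (hW : ∀ z ∈ Metric.ball (0 : ℂ) R', U₂ z - U₁ z = z ^ (p + 1) * Ω z) (hr : 0 < r) (hr1 : r ≤ 1)
    (hrR : 8 * r ^ 2 ≤ R') (hrw : 6 * B * r ^ 2 ≤ |w|) (hk : 0 ≤ k) (hL : 0 ≤ L)
    {f : ℝ → ℂ} (hf : ContDiff ℝ (⊤ : ℕ∞) f) (hfc : HasCompactSupport f) :
    ∃ C, 0 ≤ C ∧ ∀ (χ χ₁ χ₂ χ₃ : ℝ → ℂ) (a h l : ℝ) (E : ℂ), IsCutoff r X χ χ₁ χ₂ χ₃ → 0 < a → a ≤ r →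
      0 < h → h ≤ a ^ (2 * p + 3) → a ^ (2 * p + 3) ≤ k * h → 2 * |E.re| ≤ a ^ 2 → |E.im| ≤ L * h →
      ‖E‖ < R / 2 → 0 < l → l ^ (2 * p + 3) * |w| = h →
      ‖(∫ η in (-r)..r, χ η * osc h (-action U₁ E η) *
          (χ (-η) * osc h (-action U₂ E (-η)) * f ((U₂ (E.re - ((-η : ℝ) : ℂ) ^ 2)).re))) -
        f 0 * (2 * Real.pi * l * genAiry (p + 1) ((-E.re / l ^ 2 : ℝ) : ℂ))‖ ≤ C * a ^ 2 := by
  rcases lt_or_ge X 0 with hX | hX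
  · exact ⟨0, le_rfl, fun χ χ₁ χ₂ χ₃ _ _ _ _ H => absurd H.nonneg (not_le.2 hX)⟩
  have hκ₁ := H₁.κ_pos
  have hκ₂ := H₂.κ_pos
  have hfd : ∀ x, HasDerivAt f (deriv f x) x := fun x => (hf.differentiable (by simp) x).hasDerivAt
  have hf'c : Continuous (deriv f) := hf.continuous_deriv (by simp)
  obtain ⟨M₀, hM₀⟩ := hfc.exists_bound_of_continuous hf.continuous
  obtain ⟨M₁, hM₁⟩ := hfc.deriv.exists_bound_of_continuous hf'c
  set M : ℝ := max M₀ M₁ with hM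
  have bM₀ : ∀ x, ‖f x‖ ≤ M := fun x => (hM₀ x).trans (le_max_left _ _)
  have bM₁ : ∀ x, ‖deriv f x‖ ≤ M := fun x => (hM₁ x).trans (le_max_right _ _)
  have hM0 : 0 ≤ M := (norm_nonneg _).trans (bM₀ 0)
  set g : ℝ := 2 * (κ₁ + κ₂) * L with hg
  have hg0 : 0 ≤ g := by positivity
  set β : ℝ := Real.exp g with hβ
  have hβ0 : 0 < β := Real.exp_pos g
  set α : ℝ := M + 2 * κ₂ * M + (2 * (X * X * M * β) + X * X * (M * (4 * κ₂)) * β + X * X * M * (g * β)) with hα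
  have hα0 : 0 ≤ α := by positivity
  obtain ⟨C, hC, hmain⟩ := H.exists_norm_contact_integral_sub_le hr hr1 hrR hrw p hk hα0
  refine ⟨C, hC, ?_⟩
  intro χ χ₁ χ₂ χ₃ a h l E hχ ha har hh hha hak he him hE hl hlw
  set e : ℝ := E.re with hedef
  have hR2 : (2 * r) ^ 2 ≤ R / 2 := by nlinarith
  have hIoo : ∀ x ∈ Set.Icc (-r) r, x ∈ Set.Ioo (-(2 * r)) (2 * r) := fun x hx =>
    ⟨by linarith [hx.1], by linarith [hx.2]⟩
  have habs2 : ∀ x ∈ Set.Icc (-r) r, |x| ≤ 2 * r := fun x hx => (abs_le.2 hx).trans (by linarith)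
  have hmE : ∀ x ∈ Set.Icc (-r) r, E - (x : ℂ) ^ 2 ∈ Metric.ball (0 : ℂ) R := fun x hx =>
    sub_sq_mem_ball hR2 hE (habs2 x hx)
  have hme : ∀ x ∈ Set.Icc (-r) r, (e : ℂ) - (x : ℂ) ^ 2 ∈ Metric.ball (0 : ℂ) R' := fun x hx =>
    IsUnitFactor.mem_ball hr hrR ha.le har he (habs2 x hx)
  have hme' : ∀ x ∈ Set.Icc (-r) r, (e : ℂ) - (x : ℂ) ^ 2 ∈ Metric.ball (0 : ℂ) R := fun x hx =>
    Metric.ball_subset_ball hR' (hme x hx)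
  -- The effect of Im E on the phase difference. Its derivative is O(h), so exp(iG/h) has bounded
  -- derivative and is treated as part of the amplitude; the remaining phase is real.
  set G : ℝ → ℂ := fun x => action U₂ E x - action U₁ E x - contactPhase (p + 1) Ω e x with hG
  set G' : ℝ → ℂ := fun x => U₂ (E - (x : ℂ) ^ 2) - U₁ (E - (x : ℂ) ^ 2) -
    ((e : ℂ) - (x : ℂ) ^ 2) ^ (p + 1) * Ω ((e : ℂ) - (x : ℂ) ^ 2) with hG'
  have dG : ∀ x ∈ Set.Icc (-r) r, HasDerivAt G (G' x) x := fun x hx =>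
    ((hasDerivAt_action H₂.diffU.continuousOn hR2 hE (hIoo x hx)).sub
      (hasDerivAt_action H₁.diffU.continuousOn hR2 hE (hIoo x hx))).sub
      (IsUnitFactor.hasDerivAt_contactPhase H.diff.continuousOn (p + 1) hr hrR ha.le har he (abs_le.2 hx))
  have hlipU : ∀ {V : ℝ → ℝ} {ρ κ : ℝ} {Vc U : ℂ → ℂ}, IsChart V R ρ κ Vc U → ∀ x ∈ Set.Icc (-r) r,
      ‖U (E - (x : ℂ) ^ 2) - U ((e : ℂ) - (x : ℂ) ^ 2)‖ ≤ 2 * κ * |E.im| := by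
    intro V ρ κ Vc U HU x hx
    have := (convex_ball (0 : ℂ) R).norm_image_sub_le_of_norm_hasDerivWithin_le
      (fun z hz => (HU.hasDerivAt_inverse hz).hasDerivWithinAt) (fun z hz => HU.norm_deriv_le hz)
      (hme' x hx) (hmE x hx)
    rwa [show E - (x : ℂ) ^ 2 - ((e : ℂ) - (x : ℂ) ^ 2) = E - E.re by rw [hedef]; ring,
      norm_sub_ofReal_re] at this
  have bG' : ∀ x ∈ Set.Icc (-r) r, ‖G' x‖ ≤ g * h := fun x hx => by
    have e1 : G' x = (U₂ (E - (x : ℂ) ^ 2) - U₂ ((e : ℂ) - (x : ℂ) ^ 2)) -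
        (U₁ (E - (x : ℂ) ^ 2) - U₁ ((e : ℂ) - (x : ℂ) ^ 2)) := by
      simp only [hG']; rw [← hW _ (hme x hx)]; ring
    rw [e1]
    refine (norm_sub_le _ _).trans ((add_le_add (hlipU H₂ x hx) (hlipU H₁ x hx)).trans ?_)
    calc _ = 2 * (κ₁ + κ₂) * |E.im| := by ring
      _ ≤ 2 * (κ₁ + κ₂) * (L * h) := by gcongr
      _ = _ := by rw [hg]; ring
  have cG' : ContinuousOn G' (Set.Icc (-r) r) := by
    refine ContinuousOn.sub (ContinuousOn.sub ?_ ?_) (ContinuousOn.mul (by fun_prop) ?_)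
    · exact H₂.diffU.continuousOn.comp (by fun_prop) hmE
    · exact H₁.diffU.continuousOn.comp (by fun_prop) hmE
    · exact H.diff.continuousOn.comp (by fun_prop) hme
  have cG : ContinuousOn G (Set.Icc (-r) r) := fun x hx => (dG x hx).continuousAt.continuousWithinAt
  have hG0 : G 0 = 0 := by simp [hG, action, contactPhase]
  have bG : ∀ x ∈ Set.Icc (-r) r, |(G x).im| ≤ g * h := fun x hx => by
    have h1 := norm_sub_le_of_norm_deriv_le hr.le dG bG' hx
    rw [hG0, sub_zero] at h1
    have h2 : |x| ≤ 1 := (abs_le.2 hx).trans hr1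
    calc _ ≤ ‖G x‖ := abs_im_le_norm _
      _ ≤ g * h * |x| := h1
      _ ≤ g * h * 1 := by gcongr
      _ = _ := mul_one _
  set b : ℝ → ℂ := fun x => osc h (G x) with hb
  have bb : ∀ x ∈ Set.Icc (-r) r, ‖b x‖ ≤ β := fun x hx => norm_osc_le hh (bG x hx)
  set u : ℝ → ℝ := fun x => (U₂ ((e : ℂ) - (x : ℂ) ^ 2)).re with hu
  set u' : ℝ → ℝ := fun x => (deriv U₂ ((e : ℂ) - (x : ℂ) ^ 2) * (-(2 * (x : ℂ)))).re with hu'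
  have du : ∀ x ∈ Set.Icc (-r) r, HasDerivAt u (u' x) x := fun x hx => by
    have h1 : HasDerivAt (fun z : ℂ => (e : ℂ) - z ^ 2) (-(2 * (x : ℂ))) (x : ℂ) := by
      simpa using (hasDerivAt_pow 2 (x : ℂ)).const_sub (e : ℂ)
    have h2 := (HasDerivAt.comp (x : ℂ) (H₂.hasDerivAt_inverse (hme' x hx)) h1).comp_ofReal
    exact reCLM.hasFDerivAt.comp_hasDerivAt x h2
  have cu' : ContinuousOn u' (Set.Icc (-r) r) :=
    continuous_re.comp_continuousOn
      (((H₂.holBdd_deriv.diff.continuousOn.comp (by fun_prop) hme')).mul (by fun_prop))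
  have cu : ContinuousOn u (Set.Icc (-r) r) := fun x hx => (du x hx).continuousAt.continuousWithinAt
  have bu' : ∀ x ∈ Set.Icc (-r) r, ‖(u' x : ℂ)‖ ≤ 4 * κ₂ := fun x hx => by
    rw [norm_real, Real.norm_eq_abs]
    refine (abs_re_le_norm _).trans ?_
    rw [norm_mul, norm_neg, norm_mul, norm_ofNat, norm_real, Real.norm_eq_abs]
    have h2 : |x| ≤ 1 := (abs_le.2 hx).trans hr1
    calc _ ≤ 2 * κ₂ * (2 * 1) := by gcongr; exact H₂.norm_deriv_le (hme' x hx)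
      _ = _ := by ring
  set A : ℝ → ℂ := fun x => χ x * χ (-x) * f (u x) * b x with hA
  set A' : ℝ → ℂ := fun x => ((χ₁ x * χ (-x) + χ x * -χ₁ (-x)) * f (u x) + χ x * χ (-x) * (u' x * deriv f (u x))) * b x +
    χ x * χ (-x) * f (u x) * (I / h * G' x * b x) with hA'
  have dχm : ∀ x, HasDerivAt (fun x => χ (-x)) (-χ₁ (-x)) x := fun x => by
    simpa [Function.comp_def] using (hχ.deriv₁ (-x)).scomp x (hasDerivAt_neg x)
  have dA : ∀ x ∈ Set.Icc (-r) r, HasDerivAt A (A' x) x := fun x hx => by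
    have h1 : HasDerivAt (fun x => f (u x)) (u' x * deriv f (u x)) x := by
      simpa [Function.comp_def] using (hfd (u x)).scomp x (du x hx)
    exact (((hχ.deriv₁ x).mul (dχm x)).mul h1).mul (hasDerivAt_osc (dG x hx))
  have c0 := hχ.cont₀
  have c1 := hχ.cont₁
  have cb : ContinuousOn b (Set.Icc (-r) r) := (continuous_osc h).comp_continuousOn cG
  have cf : ContinuousOn (fun x => f (u x)) (Set.Icc (-r) r) := hf.continuous.comp_continuousOn cu
  have cf' : ContinuousOn (fun x => deriv f (u x)) (Set.Icc (-r) r) := hf'c.comp_continuousOn cu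
  have cu'' : ContinuousOn (fun x => (u' x : ℂ)) (Set.Icc (-r) r) := continuous_ofReal.comp_continuousOn cu'
  have cA' : ContinuousOn A' (Set.Icc (-r) r) := by
    refine ContinuousOn.add (ContinuousOn.mul (ContinuousOn.add (ContinuousOn.mul (by fun_prop) cf)
      (ContinuousOn.mul (by fun_prop) (cu''.mul cf'))) cb) (ContinuousOn.mul (ContinuousOn.mul (by fun_prop) cf)
      (ContinuousOn.mul (continuousOn_const.mul cG') cb))
  have bA'1 : ∀ x ∈ Set.Icc (-r) r, ‖A' x‖ ≤
      2 * (X * X * M * β) + X * X * (M * (4 * κ₂)) * β + X * X * M * (g * β) := fun x hx => by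
    have q0 : ‖I / h * G' x * b x‖ ≤ g * β := by
      rw [norm_mul, norm_mul, norm_div, norm_I, norm_real, Real.norm_eq_abs, abs_of_pos hh]
      calc _ ≤ 1 / h * (g * h) * β := by gcongr; exacts [bG' x hx, bb x hx]
        _ = _ := by field_simp
    have q1 : ‖χ₁ x * χ (-x) + χ x * -χ₁ (-x)‖ ≤ X * X + X * X := by
      refine (norm_add_le _ _).trans ?_
      rw [norm_mul, norm_mul, norm_neg]
      gcongr
      exacts [hχ.bdd₁ _, hχ.bdd₀ _, hχ.bdd₀ _, hχ.bdd₁ _]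
    have q2 : ‖χ x * χ (-x)‖ ≤ X * X := by
      rw [norm_mul]; gcongr; exacts [hχ.bdd₀ _, hχ.bdd₀ _]
    have q3 : ‖(u' x : ℂ) * deriv f (u x)‖ ≤ 4 * κ₂ * M := by
      rw [norm_mul]; gcongr; exacts [bu' x hx, bM₁ _]
    refine (norm_add_le _ _).trans ?_
    rw [norm_mul, norm_mul _ (I / h * G' x * b x), norm_mul _ (f (u x))]
    have q4 : ‖(χ₁ x * χ (-x) + χ x * -χ₁ (-x)) * f (u x) + χ x * χ (-x) * (u' x * deriv f (u x))‖ ≤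
        (X * X + X * X) * M + X * X * (4 * κ₂ * M) := by
      refine (norm_add_le _ _).trans ?_
      rw [norm_mul _ (f (u x)), norm_mul _ ((u' x : ℂ) * deriv f (u x))]
      gcongr
      exact bM₀ _
    calc _ ≤ ((X * X + X * X) * M + X * X * (4 * κ₂ * M)) * β + X * X * M * (g * β) := by
          gcongr
          exacts [bb x hx, bM₀ _]
      _ = _ := by ring
  have bA' : ∀ x ∈ Set.Icc (-r) r, ‖A' x‖ ≤ α := fun x hx =>
    (bA'1 x hx).trans (by rw [hα]; have : 0 ≤ M + 2 * κ₂ * M := by positivity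
                          linarith)
  have h0m : (0 : ℝ) ∈ Set.Icc (-r) r := ⟨by linarith, hr.le⟩
  -- The weight is evaluated at U₂(Re E), which is O(|Re E|) = O(a²), and a² ≤ a.
  have hA0 : ‖A 0 - f 0‖ ≤ 2 * κ₂ * M * a := by
    have e2 : A 0 = f (u 0) := by
      simp only [hA, hb, hG0, neg_zero]
      rw [hχ.one 0 (by rw [abs_zero]; linarith)]
      simp [osc]
    have h1 := convex_univ.norm_image_sub_le_of_norm_hasDerivWithin_le (f := f) (f' := deriv f) (C := M)
      (x := 0) (y := u 0) (fun x _ => (hfd x).hasDerivWithinAt) (fun x _ => bM₁ x) (Set.mem_univ _) (Set.mem_univ _)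
    have h2 : ‖u 0 - 0‖ ≤ 2 * κ₂ * a := by
      have h3 := (convex_ball (0 : ℂ) R).norm_image_sub_le_of_norm_hasDerivWithin_le
        (fun z hz => (H₂.hasDerivAt_inverse hz).hasDerivWithinAt) (fun z hz => H₂.norm_deriv_le hz)
        (Metric.mem_ball_self H₂.R_pos) (hme' 0 h0m)
      rw [hU₂, sub_zero, sub_zero, ofReal_zero, zero_pow two_ne_zero, sub_zero, norm_real, Real.norm_eq_abs] at h3
      rw [sub_zero, Real.norm_eq_abs]
      simp only [hu, ofReal_zero, zero_pow two_ne_zero, sub_zero]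
      refine (abs_re_le_norm _).trans (h3.trans ?_)
      gcongr
      have ha2 : a ^ 2 ≤ a := pow_le_of_le_one ha.le (har.trans hr1) two_ne_zero
      linarith [abs_nonneg e]
    rw [e2]
    calc _ ≤ M * ‖u 0 - 0‖ := h1
      _ ≤ M * (2 * κ₂ * a) := by gcongr
      _ = _ := by ring
  have bA : ∀ x ∈ Set.Icc (-r) r, ‖A x - f 0‖ ≤ α * (a + |x|) := fun x hx => by
    have h1 := norm_sub_le_of_norm_deriv_le hr.le dA bA' hx
    have h2 : 2 * κ₂ * M * a ≤ α * a := by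
      gcongr
      rw [hα]
      have : 0 ≤ M + (2 * (X * X * M * β) + X * X * (M * (4 * κ₂)) * β + X * X * M * (g * β)) := by positivity
      linarith
    calc _ = ‖(A x - A 0) + (A 0 - f 0)‖ := by ring_nf
      _ ≤ α * |x| + 2 * κ₂ * M * a := (norm_add_le _ _).trans (add_le_add h1 hA0)
      _ ≤ _ := by linarith
  have hfin := hmain A A' a h e l (f 0) ha har hh hha hak he hl hlw dA cA' bA bA' ((bM₀ 0).trans (by
    rw [hα]
    have : 0 ≤ 2 * κ₂ * M + (2 * (X * X * M * β) + X * X * (M * (4 * κ₂)) * β + X * X * M * (g * β)) := by positivity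
    linarith))
  refine le_trans (le_of_eq (congrArg norm ?_)) hfin
  congr 1
  refine intervalIntegral.integral_congr fun η hη => ?_
  simp only [hA, hb, hu, hG]
  -- Oddness of the action turns the second phase at -η into +S₂(η), so the sum of the two phases is
  -- S₂ - S₁, split as G plus the contact phase.
  rw [action_neg, neg_neg, mul_assoc _ (osc h (action U₂ E η - action U₁ E η - contactPhase (p + 1) Ω e η)), ← osc_add,
    sub_add_cancel, sub_eq_add_neg (action U₂ E η), osc_add, ofReal_neg, neg_sq]
  ring

theorem norm_halfPow_le {z : ℂ} {κ : ℝ} (hz : z ≠ 0) (h : ‖z‖ ≤ 2 * κ) : ‖halfPow z‖ ≤ 2 * κ + 1 := by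
  have h1 : ‖halfPow z‖ ^ 2 = ‖z‖ := by rw [← norm_pow, halfPow_sq hz]
  nlinarith [norm_nonneg (halfPow z), sq_nonneg (‖halfPow z‖ - 1)]

theorem rpow_one_third_pow_three {h : ℝ} (hh : 0 < h) : (h ^ (1 / 3 : ℝ)) ^ 3 = h := by
  rw [← Real.rpow_natCast, ← Real.rpow_mul hh.le]
  norm_num

namespace IsChart

variable {V : ℝ → ℝ} {R ρ κ : ℝ} {Vc U : ℂ → ℂ}

theorem ofReal_mem_ball (H : IsChart V R ρ κ Vc U) {x : ℝ} (hx : |x| < ρ) :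
    (V x : ℂ) ∈ Metric.ball (0 : ℂ) R := by
  rw [← H.eq_real x hx]
  refine H.maps _ ?_
  rw [mem_ball_zero_iff, norm_real]; exact hx

theorem deriv_mem_slitPlane (H : IsChart V R ρ κ Vc U) {z : ℂ} (hz : z ∈ Metric.ball (0 : ℂ) R) :
    deriv U z ∈ slitPlane :=
  mem_slitPlane_of_norm_sub_le H.κ_pos (H.close z hz)

end IsChart

theorem norm_mul_sub_mul_le {G₁ G₂ P₁ P₂ : ℂ} {δ B : ℝ} (hδ : 0 ≤ δ) (h₁ : ‖G₁ - P₁‖ ≤ δ) (h₂ : ‖G₂ - P₂‖ ≤ δ)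
    (hP₁ : ‖P₁‖ ≤ B) (hP₂ : ‖P₂‖ ≤ B) : ‖G₁ * G₂ - P₁ * P₂‖ ≤ δ * (2 * B + δ) := by
  have e : G₁ * G₂ - P₁ * P₂ = (G₁ - P₁) * (G₂ - P₂) + (G₁ - P₁) * P₂ + P₁ * (G₂ - P₂) := by ring
  rw [e]
  have hB : 0 ≤ B := (norm_nonneg _).trans hP₁
  refine (norm_add_le _ _).trans ((add_le_add (norm_add_le _ _) le_rfl).trans ?_)
  rw [norm_mul, norm_mul, norm_mul]
  calc _ ≤ δ * δ + δ * B + B * δ := by gcongr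
    _ = _ := by ring

theorem IsCutoff.continuous_wave {r X h : ℝ} {χ χ₁ χ₂ χ₃ φ : ℝ → ℂ} (H : IsCutoff r X χ χ₁ χ₂ χ₃) (hr : 0 < r)
    (hφ : ContinuousOn φ (Set.Icc (-r) r)) :
    Continuous fun x : ℝ => ∫ η in (-r)..r, χ η * osc h (x * η + φ η) := by
  have h1 := H.continuous_mul_osc hr (h := h) hφ
  have h2 := continuous_osc h
  have e : (fun x : ℝ => ∫ η in (-r)..r, χ η * osc h (x * η + φ η)) =
      fun x : ℝ => ∫ η in (-r)..r, χ η * osc h (φ η) * osc h (x * η) := by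
    funext x
    refine intervalIntegral.integral_congr fun η _ => ?_
    simp only [osc_add]
    ring
  rw [e]
  refine intervalIntegral.continuous_parametric_intervalIntegral_of_continuous' ?_ _ _
  exact (h1.comp continuous_snd).mul (h2.comp (by fun_prop))

/-- The overlap integral of two Airy-type functions as an overlap of oscillatory integrals. -/
theorem exists_norm_keyIntegral_add_le {V₁ V₂ : ℝ → ℝ} {R ρ₁ ρ₂ κ₁ κ₂ r : ℝ} {Vc₁ Vc₂ U₁ U₂ : ℂ → ℂ}
    (H₁ : IsChart V₁ R ρ₁ κ₁ Vc₁ U₁) (H₂ : IsChart V₂ R ρ₂ κ₂ Vc₂ U₂) (hV₁ : ContinuousAt V₁ 0) (hV₂ : ContinuousAt V₂ 0)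
    (hV₁0 : V₁ 0 = 0) (hV₂0 : V₂ 0 = 0) (hr : 0 < r) (hr1 : r ≤ 1) (hrR : (9 * r) ^ 2 ≤ R / 4) :
    ∃ δ > 0, δ ≤ ρ₁ ∧ δ ≤ ρ₂ ∧ ∃ e₀ > 0, e₀ < R / 8 ∧ ∀ (X L : ℝ) (r₀ : ℝ → ℝ), 0 ≤ L → Continuous r₀ →
      tsupport r₀ ⊆ Set.Ioo (-δ) δ → ∃ C, 0 ≤ C ∧ ∃ h₀, 0 < h₀ ∧ h₀ ≤ 1 ∧ L * h₀ ≤ R / 8 ∧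
      ∀ (χ χ₁ χ₂ χ₃ : ℝ → ℂ) (f : ℝ → ℂ) (h : ℝ) (E : ℂ), IsCutoff r X χ χ₁ χ₂ χ₃ → Continuous f →
        (∀ x, f x = r₀ x * (halfPow (deriv U₁ (V₁ x : ℂ)) * halfPow (deriv U₂ (V₂ x : ℂ)))) → 0 < h → h ≤ h₀ →
        |E.re| ≤ e₀ → |E.im| ≤ L * h →
        ‖keyIntegral r₀ (langer Vc₁ U₁) (langer Vc₂ U₂) E h +
          1 / (2 * Real.pi * h) * ∫ x, f x * (∫ η in (-r)..r, χ η * osc h (x * η + -action U₁ E η)) *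
            ∫ η in (-r)..r, χ η * osc h (x * η + -action U₂ E η)‖ ≤ C * (h ^ (1 / 3 : ℝ)) ^ 2 := by
  obtain ⟨δ₁, hδ₁, hδρ₁, e₁, he₁, heR₁, hap₁⟩ := H₁.exists_airy_approx hV₁ hV₁0 hr hr1 hrR
  obtain ⟨δ₂, hδ₂, hδρ₂, e₂, he₂, heR₂, hap₂⟩ := H₂.exists_airy_approx hV₂ hV₂0 hr hr1 hrR
  set δ := min δ₁ δ₂ with hδ
  have hδ0 : 0 < δ := lt_min hδ₁ hδ₂
  have hδ1 : δ ≤ δ₁ := min_le_left _ _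
  have hδ2 : δ ≤ δ₂ := min_le_right _ _
  refine ⟨δ, hδ0, hδ1.trans hδρ₁, hδ2.trans hδρ₂, min e₁ e₂, lt_min he₁ he₂,
    (min_le_left _ _).trans_lt heR₁, ?_⟩
  intro X L r₀ hL hr₀ hsupp
  have hcomp : HasCompactSupport r₀ := (isCompact_Icc (a := -δ) (b := δ)).of_isClosed_subset (isClosed_tsupport _)
    (hsupp.trans Set.Ioo_subset_Icc_self)
  obtain ⟨M, hM⟩ := hcomp.exists_bound_of_continuous hr₀
  have hM0 : 0 ≤ M := (norm_nonneg _).trans (hM 0)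
  obtain ⟨C₁, hC₁, h₁, hh₁, hh₁1, hLh₁, b₁⟩ := hap₁ X L hL
  obtain ⟨C₂, hC₂, h₂, hh₂, hh₂1, hLh₂, b₂⟩ := hap₂ X L hL
  have hκ₁ := H₁.κ_pos
  have hκ₂ := H₂.κ_pos
  set C := max C₁ C₂ with hC
  have hC0 : 0 ≤ C := hC₁.trans (le_max_left _ _)
  set P : ℝ := (2 * κ₁ + 1) + (2 * κ₂ + 1) with hP
  have hP0 : 0 ≤ P := by positivity
  refine ⟨1 / (2 * Real.pi) * (M * (C * (2 * (P * C) + C)) * (2 * δ)), by positivity, min h₁ h₂, lt_min hh₁ hh₂,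
    (min_le_left _ _).trans hh₁1, (mul_le_mul_of_nonneg_left (min_le_left _ _) hL).trans hLh₁, ?_⟩
  intro χ χ₁ χ₂ χ₃ f h E hχ hfc hf hh hh0 hEr hEi
  have hh1 : h ≤ 1 := hh0.trans ((min_le_left _ _).trans hh₁1)
  set t : ℝ := h ^ (1 / 3 : ℝ) with ht
  have ht0 : 0 < t := Real.rpow_pos_of_pos hh _
  have ht3 : t ^ 3 = h := rpow_one_third_pow_three hh
  set A₁ : ℝ → ℂ := fun x => airyAi (((h ^ (-(2 / 3) : ℝ) : ℝ) : ℂ) * langer Vc₁ U₁ (x, E)) with hA₁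
  set A₂ : ℝ → ℂ := fun x => airyAi (((h ^ (-(2 / 3) : ℝ) : ℝ) : ℂ) * langer Vc₂ U₂ (x, E)) with hA₂
  set g₁ : ℝ → ℂ := fun x => ∫ η in (-r)..r, χ η * osc h (x * η + -action U₁ E η) with hg₁
  set g₂ : ℝ → ℂ := fun x => ∫ η in (-r)..r, χ η * osc h (x * η + -action U₂ E η) with hg₂
  set K : ℝ → ℂ := fun x => (r₀ x : ℂ) / (xiDeriv (langer Vc₁ U₁) E x * xiDeriv (langer Vc₂ U₂) E x) ^ (1 / 2 : ℂ) *
    A₁ x * A₂ x with hK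
  set F : ℝ → ℂ := fun x => f x * g₁ x * g₂ x with hF
  -- With t = h^{1/3}, this normalises both Airy factors at once, and c / (2πh) = 2π / t is the
  -- prefactor of the overlap integral.
  set c : ℂ := (2 * Real.pi * t) ^ 2 with hc
  have habs : ∀ x ∈ Set.Ioo (-δ) δ, |x| < δ := fun x hx => abs_lt.2 hx
  have hzero : ∀ x, x ∉ Set.Ioo (-δ) δ → r₀ x = 0 := fun x hx =>
    image_eq_zero_of_notMem_tsupport fun h => hx (hsupp h)
  have hb₁ := fun x (hx : x ∈ Set.Ioo (-δ) δ) => b₁ χ χ₁ χ₂ χ₃ h E x hχ hh (hh0.trans (min_le_left _ _))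
    (hEr.trans (min_le_left _ _)) hEi ((habs x hx).trans_le hδ1)
  have hb₂ := fun x (hx : x ∈ Set.Ioo (-δ) δ) => b₂ χ χ₁ χ₂ χ₃ h E x hχ hh (hh0.trans (min_le_right _ _))
    (hEr.trans (min_le_right _ _)) hEi ((habs x hx).trans_le hδ2)
  have hpt : ∀ x ∈ Set.Ioo (-δ) δ, ‖c * K x - F x‖ ≤ M * (C * (2 * (P * C) + C)) * (h * t ^ 2) := by
    intro x hx
    obtain ⟨N₁, hN₁, a₁, w₁⟩ := hb₁ x hx
    obtain ⟨N₂, hN₂, a₂, w₂⟩ := hb₂ x hx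
    simp only [sub_eq_add_neg (_ * _ : ℂ)] at a₁ a₂ w₁ w₂
    have e1 : c * K x - F x = r₀ x * ((sixthRoot N₁ * (2 * Real.pi * t * A₁ x)) * (sixthRoot N₂ * (2 * Real.pi * t * A₂ x)) -
        (halfPow (deriv U₁ (V₁ x : ℂ)) * g₁ x) * (halfPow (deriv U₂ (V₂ x : ℂ)) * g₂ x)) := by
      simp only [hK, hF, hc]
      rw [hN₁, hN₂, inv_cubeRoot_mul_cpow_half, hf x, div_inv_eq_mul]
      ring
    have m₁ := H₁.ofReal_mem_ball ((habs x hx).trans_le (hδ1.trans hδρ₁))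
    have m₂ := H₂.ofReal_mem_ball ((habs x hx).trans_le (hδ2.trans hδρ₂))
    have p₁ : ‖halfPow (deriv U₁ (V₁ x : ℂ))‖ ≤ P :=
      (norm_halfPow_le (slitPlane_ne_zero (H₁.deriv_mem_slitPlane m₁)) (H₁.norm_deriv_le m₁)).trans
        (by rw [hP]; linarith)
    have p₂ : ‖halfPow (deriv U₂ (V₂ x : ℂ))‖ ≤ P :=
      (norm_halfPow_le (slitPlane_ne_zero (H₂.deriv_mem_slitPlane m₂)) (H₂.norm_deriv_le m₂)).trans
        (by rw [hP]; linarith)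
    have q₁ : ‖halfPow (deriv U₁ (V₁ x : ℂ)) * g₁ x‖ ≤ P * C * t := by
      rw [norm_mul, mul_assoc]
      gcongr
      exact w₁.trans (by gcongr; exact le_max_left _ _)
    have q₂ : ‖halfPow (deriv U₂ (V₂ x : ℂ)) * g₂ x‖ ≤ P * C * t := by
      rw [norm_mul, mul_assoc]
      gcongr
      exact w₂.trans (by gcongr; exact le_max_right _ _)
    have hd0 : 0 ≤ C * (h * t) := by positivity
    have hprod := norm_mul_sub_mul_le hd0 (a₁.trans (mul_le_mul_of_nonneg_right (le_max_left _ _) (by positivity)))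
      (a₂.trans (mul_le_mul_of_nonneg_right (le_max_right _ _) (by positivity))) q₁ q₂
    rw [e1, norm_mul, norm_real]
    have hd1 : C * (h * t) ≤ C * t := by
      have : h * t ≤ 1 * t := by gcongr
      gcongr
      linarith
    calc _ ≤ M * (C * (h * t) * (2 * (P * C * t) + C * t)) :=
          mul_le_mul (hM x) (hprod.trans (by gcongr)) (norm_nonneg _) hM0
      _ = _ := by ring
  have hKset : ∫ x, K x = ∫ x in Set.Ioo (-δ) δ, K x :=
    (setIntegral_eq_integral_of_forall_compl_eq_zero fun x hx => by simp [hK, hzero x hx]).symm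
  have hFset : ∫ x, F x = ∫ x in Set.Ioo (-δ) δ, F x :=
    (setIntegral_eq_integral_of_forall_compl_eq_zero fun x hx => by simp [hF, hf x, hzero x hx]).symm
  have hR := H₁.R_pos
  have hrR2 : (2 * r) ^ 2 ≤ R / 2 := by nlinarith
  have hEn : ‖E‖ < R / 2 := by
    refine (norm_le_abs_re_add_abs_im E).trans_lt ?_
    have := hEr.trans (min_le_left _ _)
    have : L * h ≤ L * h₁ := by gcongr; exact hh0.trans (min_le_left _ _)
    linarith
  have hIoo : ∀ x ∈ Set.Icc (-r) r, x ∈ Set.Ioo (-(2 * r)) (2 * r) := fun x hx =>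
    ⟨by linarith [hx.1], by linarith [hx.2]⟩
  have cact : ∀ {V : ℝ → ℝ} {ρ κ : ℝ} {Vc U : ℂ → ℂ}, IsChart V R ρ κ Vc U →
      ContinuousOn (fun η => -action U E η) (Set.Icc (-r) r) := fun HU x hx =>
    (hasDerivAt_action HU.diffU.continuousOn hrR2 hEn (hIoo x hx)).neg.continuousAt.continuousWithinAt
  have cF : Continuous F := (hfc.mul (hχ.continuous_wave hr (cact H₁))).mul (hχ.continuous_wave hr (cact H₂))
  have iF : IntegrableOn F (Set.Ioo (-δ) δ) :=
    (cF.integrableOn_Icc (a := -δ) (b := δ)).mono_set Set.Ioo_subset_Icc_self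
  have meas : ∀ {V : ℝ → ℝ} {ρ κ : ℝ} {Vc U : ℂ → ℂ},
      (∀ x ∈ Set.Ioo (-δ) δ, ∃ N : ℂ, xiDeriv (langer Vc U) E x = (cubeRoot N)⁻¹) →
      AEStronglyMeasurable (fun x : ℝ => airyAi (((h ^ (-(2 / 3) : ℝ) : ℝ) : ℂ) * langer Vc U (x, E)))
        (volume.restrict (Set.Ioo (-δ) δ)) := by
    intro V ρ κ Vc U hN
    refine ContinuousOn.aestronglyMeasurable (fun x hx => ContinuousAt.continuousWithinAt ?_) measurableSet_Ioo
    obtain ⟨N, hN⟩ := hN x hx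
    -- `deriv` is 0 by default where a function is not differentiable, so a nonzero value already
    -- gives differentiability and hence continuity.
    have h0 : deriv (fun z : ℂ => langer Vc U (z, E)) (x : ℂ) ≠ 0 := by
      rw [show deriv (fun z : ℂ => langer Vc U (z, E)) (x : ℂ) = _ from hN]
      exact inv_ne_zero (cubeRoot_ne_zero N)
    have h1 := (differentiableAt_of_deriv_ne_zero h0).continuousAt
    have h2 : ContinuousAt (fun x : ℝ => langer Vc U (x, E)) x :=
      ContinuousAt.comp (g := fun z : ℂ => langer Vc U (z, E)) h1 continuous_ofReal.continuousAt
    exact differentiable_airyAi.continuous.continuousAt.comp (continuousAt_const.mul h2)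
  have mxi : ∀ ξ : ℂ × ℂ → ℂ, Measurable fun x : ℝ => xiDeriv ξ E x := fun ξ =>
    (measurable_deriv fun z : ℂ => ξ (z, E)).comp continuous_ofReal.measurable
  have mK : AEStronglyMeasurable K (volume.restrict (Set.Ioo (-δ) δ)) := by
    refine (AEStronglyMeasurable.mul ?_ (meas (V := V₁) (ρ := ρ₁) (κ := κ₁) fun x hx => ?_)).mul
      (meas (V := V₂) (ρ := ρ₂) (κ := κ₂) fun x hx => ?_)
    · refine Measurable.aestronglyMeasurable ?_
      exact (continuous_ofReal.comp hr₀).measurable.div (((mxi _).mul (mxi _)).pow_const _)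
    · obtain ⟨N, hN, -⟩ := hb₁ x hx; exact ⟨N, hN⟩
    · obtain ⟨N, hN, -⟩ := hb₂ x hx; exact ⟨N, hN⟩
  have hfinite : volume (Set.Ioo (-δ) δ) < ⊤ := by rw [Real.volume_Ioo]; exact ENNReal.ofReal_lt_top
  have : IsFiniteMeasure (volume.restrict (Set.Ioo (-δ) δ)) := ⟨by rwa [Measure.restrict_apply_univ]⟩
  -- The integrand K contains a principal power and is only known to be measurable. Integrability
  -- comes from the uniform bound on its distance to the continuous function F.
  have iD : IntegrableOn (fun x => c * K x - F x) (Set.Ioo (-δ) δ) :=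
    Integrable.of_bound ((mK.const_mul c).sub cF.aestronglyMeasurable) _
      (ae_restrict_of_forall_mem measurableSet_Ioo hpt)
  have icK : IntegrableOn (fun x => c * K x) (Set.Ioo (-δ) δ) :=
    (Integrable.add iD iF).congr (Eventually.of_forall fun x => by simp)
  have hbound : ‖∫ x in Set.Ioo (-δ) δ, (c * K x - F x)‖ ≤ M * (C * (2 * (P * C) + C)) * (h * t ^ 2) * (2 * δ) := by
    refine (norm_setIntegral_le_of_norm_le_const hfinite hpt).trans (le_of_eq ?_)
    rw [Real.volume_real_Ioo_of_le (by linarith)]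
    ring
  rw [integral_sub icK iF, integral_const_mul] at hbound
  have hpi := Real.pi_pos
  have hpi' : (Real.pi : ℂ) ≠ 0 := by exact_mod_cast hpi.ne'
  have ht' : (t : ℂ) ≠ 0 := by exact_mod_cast ht0.ne'
  have e2 : keyIntegral r₀ (langer Vc₁ U₁) (langer Vc₂ U₂) E h + 1 / (2 * Real.pi * h) * ∫ x, F x =
      -(1 / (2 * Real.pi * h)) * (c * (∫ x in Set.Ioo (-δ) δ, K x) - ∫ x in Set.Ioo (-δ) δ, F x) := by
    have e0 : keyIntegral r₀ (langer Vc₁ U₁) (langer Vc₂ U₂) E h = -((2 * Real.pi / t : ℝ) : ℂ) * ∫ x, K x := rfl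
    rw [e0, hFset, ← hKset]
    have : (h : ℂ) = (t : ℂ) ^ 3 := by rw [← ht3]; push_cast; rfl
    rw [this, hc]
    push_cast
    field_simp
    ring
  rw [e2, norm_mul]
  have e3 : ‖-(1 / (2 * (Real.pi : ℂ) * h))‖ = 1 / (2 * Real.pi * h) := by
    rw [norm_neg, norm_div, norm_one, norm_mul, norm_mul, norm_ofNat, norm_real, norm_real, Real.norm_eq_abs,
      Real.norm_eq_abs, abs_of_pos hpi, abs_of_pos hh]
  rw [e3]
  calc _ ≤ 1 / (2 * Real.pi * h) * (M * (C * (2 * (P * C) + C)) * (h * t ^ 2) * (2 * δ)) := by gcongr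
    _ = _ := by field_simp

theorem analyticAt_halfPow {z : ℂ} (hz : z ∈ slitPlane) : AnalyticAt ℂ halfPow z := by
  unfold halfPow
  have h1 : AnalyticAt ℂ (fun z : ℂ => log z) z := analyticAt_id.clog hz
  exact (h1.div analyticAt_const two_ne_zero).cexp

theorem halfPow_ofReal {x : ℝ} (hx : 0 < x) : halfPow x = (√x : ℝ) := by
  rw [halfPow, ← ofReal_log hx.le, Real.sqrt_eq_rpow, Real.rpow_def_of_pos hx]
  push_cast
  congr 1
  ring

namespace IsChart

variable {V : ℝ → ℝ} {R ρ κ : ℝ} {Vc U : ℂ → ℂ}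

theorem contDiffAt_halfPow_deriv (H : IsChart V R ρ κ Vc U) {x : ℝ} (hx : |x| < ρ) (hV : AnalyticAt ℝ V x) :
    ContDiffAt ℝ (⊤ : ℕ∞) (fun x : ℝ => halfPow (deriv U (V x : ℂ))) x := by
  have hm := H.ofReal_mem_ball hx
  have h1 : AnalyticAt ℂ (deriv U) (V x : ℂ) :=
    (H.holBdd_deriv.diff.analyticOnNhd Metric.isOpen_ball) _ hm
  have h2 : AnalyticAt ℂ (fun z => halfPow (deriv U z)) (V x : ℂ) :=
    (analyticAt_halfPow (H.deriv_mem_slitPlane hm)).comp h1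
  have h3 : ContDiffAt ℝ (⊤ : ℕ∞) (fun z => halfPow (deriv U z)) (V x : ℂ) := h2.contDiffAt.restrict_scalars ℝ
  have h4 : ContDiffAt ℝ (⊤ : ℕ∞) (fun x : ℝ => (V x : ℂ)) x :=
    ofRealCLM.contDiff.contDiffAt.comp x hV.contDiffAt
  exact ContDiffAt.comp (g := fun z => halfPow (deriv U z)) x h3 h4

theorem norm_inverse_sub_le (H : IsChart V R ρ κ Vc U) {z w : ℂ} (hz : z ∈ Metric.ball (0 : ℂ) R)
    (hw : w ∈ Metric.ball (0 : ℂ) R) : ‖U z - U w‖ ≤ 2 * κ * ‖z - w‖ :=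
  (convex_ball (0 : ℂ) R).norm_image_sub_le_of_norm_hasDerivWithin_le
    (fun _ hz => (H.hasDerivAt_inverse hz).hasDerivWithinAt) (fun _ hz => H.norm_deriv_le hz) hw hz

end IsChart

theorem contDiff_weight {V₁ V₂ : ℝ → ℝ} {R ρ₁ ρ₂ κ₁ κ₂ δ : ℝ} {Vc₁ Vc₂ U₁ U₂ : ℂ → ℂ}
    (H₁ : IsChart V₁ R ρ₁ κ₁ Vc₁ U₁) (H₂ : IsChart V₂ R ρ₂ κ₂ Vc₂ U₂) (hδ₁ : δ ≤ ρ₁) (hδ₂ : δ ≤ ρ₂)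
    (hV₁ : ∀ x, |x| < δ → AnalyticAt ℝ V₁ x) (hV₂ : ∀ x, |x| < δ → AnalyticAt ℝ V₂ x) {r₀ : ℝ → ℝ}
    (hr₀ : ContDiff ℝ (⊤ : ℕ∞) r₀) (hs : tsupport r₀ ⊆ Set.Ioo (-δ) δ) :
    ContDiff ℝ (⊤ : ℕ∞) (fun x => (r₀ x : ℂ) * (halfPow (deriv U₁ (V₁ x : ℂ)) * halfPow (deriv U₂ (V₂ x : ℂ)))) ∧
    HasCompactSupport
      (fun x => (r₀ x : ℂ) * (halfPow (deriv U₁ (V₁ x : ℂ)) * halfPow (deriv U₂ (V₂ x : ℂ)))) := by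
  have hsub : tsupport (fun x => (r₀ x : ℂ) * (halfPow (deriv U₁ (V₁ x : ℂ)) * halfPow (deriv U₂ (V₂ x : ℂ)))) ⊆
      tsupport r₀ := by
    refine closure_mono fun x hx => ?_
    rw [Function.mem_support] at hx ⊢
    intro h0
    exact hx (by rw [h0]; simp)
  refine ⟨contDiff_iff_contDiffAt.2 fun x => ?_, ?_⟩
  · by_cases hx : x ∈ tsupport fun x =>
      (r₀ x : ℂ) * (halfPow (deriv U₁ (V₁ x : ℂ)) * halfPow (deriv U₂ (V₂ x : ℂ)))
    swap
    · exact contDiffAt_const.congr_of_eventuallyEq (notMem_tsupport_iff_eventuallyEq.1 hx)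
    have hx' := abs_lt.2 (hs (hsub hx))
    exact (ofRealCLM.contDiff.contDiffAt.comp x hr₀.contDiffAt).mul
      ((H₁.contDiffAt_halfPow_deriv (hx'.trans_le hδ₁) (hV₁ x hx')).mul
        (H₂.contDiffAt_halfPow_deriv (hx'.trans_le hδ₂) (hV₂ x hx')))
  · exact (isCompact_Icc (a := -δ) (b := δ)).of_isClosed_subset (isClosed_tsupport _)
      ((hsub.trans hs).trans Set.Ioo_subset_Icc_self)

/-- The overlap of the two oscillatory integrals, reduced to a single oscillatory integral. -/
theorem exists_norm_overlap_sub_le {V₁ V₂ : ℝ → ℝ} {R ρ₁ ρ₂ κ₁ κ₂ r X L : ℝ} {Vc₁ Vc₂ U₁ U₂ : ℂ → ℂ}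
    (H₁ : IsChart V₁ R ρ₁ κ₁ Vc₁ U₁) (H₂ : IsChart V₂ R ρ₂ κ₂ Vc₂ U₂) (hr : 0 < r) (hr1 : r ≤ 1)
    (hrR : (2 * r) ^ 2 ≤ R / 2) (hL : 0 ≤ L) {f : ℝ → ℂ} (hf : ContDiff ℝ (⊤ : ℕ∞) f) (hfc : HasCompactSupport f) :
    ∃ C, 0 ≤ C ∧ ∀ (χ χ₁ χ₂ χ₃ : ℝ → ℂ) (h : ℝ) (E : ℂ), IsCutoff r X χ χ₁ χ₂ χ₃ → 0 < h → ‖E‖ < R / 2 →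
      |E.im| ≤ L * h →
      ‖(∫ x, f x * (∫ η in (-r)..r, χ η * osc h (x * η + -action U₁ E η)) *
            ∫ η in (-r)..r, χ η * osc h (x * η + -action U₂ E η)) -
        2 * Real.pi * h * ∫ η in (-r)..r, χ η * osc h (-action U₁ E η) *
          (χ (-η) * osc h (-action U₂ E (-η)) * f ((U₂ (E.re - ((-η : ℝ) : ℂ) ^ 2)).re))‖ ≤ C * h ^ 2 := by
  have hκ₁ := H₁.κ_pos
  have hκ₂ := H₂.κ_pos
  -- The constant c collects the Lipschitz constant 4κ₂ of η ↦ U₂(E - η²) on |η| ≤ 1 and the bound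
  -- 2κ₂ L h for moving E to Re E.
  obtain ⟨C, hC, hb⟩ := exists_norm_product_integral_sub_le (r := r) (X := X) (L := 2 * (κ₁ + κ₂) * L)
    (c := 4 * κ₂ + 2 * κ₂ * L) hf hfc hr (by positivity)
  refine ⟨C, hC, fun χ χ₁ χ₂ χ₃ h E hχ hh hE him => ?_⟩
  have hE' : ‖((E.re : ℝ) : ℂ)‖ < R / 2 := by
    rw [norm_real]; exact (abs_re_le_norm E).trans_lt hE
  have hIoo : ∀ x ∈ Set.Icc (-r) r, x ∈ Set.Ioo (-(2 * r)) (2 * r) := fun x hx =>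
    ⟨by linarith [hx.1], by linarith [hx.2]⟩
  have habs2 : ∀ x ∈ Set.Icc (-r) r, |x| ≤ 2 * r := fun x hx => (abs_le.2 hx).trans (by linarith)
  have habs1 : ∀ x ∈ Set.Icc (-r) r, |x| ≤ 1 := fun x hx => (abs_le.2 hx).trans hr1
  have hrR' : r ^ 2 ≤ R / 2 := by nlinarith
  have hm : ∀ x ∈ Set.Icc (-r) r, E - (x : ℂ) ^ 2 ∈ Metric.ball (0 : ℂ) R := fun x hx =>
    sub_sq_mem_ball hrR hE (habs2 x hx)
  have hm' : ∀ x ∈ Set.Icc (-r) r, (E.re : ℂ) - (x : ℂ) ^ 2 ∈ Metric.ball (0 : ℂ) R := fun x hx =>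
    sub_sq_mem_ball hrR hE' (habs2 x hx)
  have d : ∀ {V : ℝ → ℝ} {ρ κ : ℝ} {Vc U : ℂ → ℂ}, IsChart V R ρ κ Vc U → ∀ x ∈ Set.Icc (-r) r,
      HasDerivAt (fun η => -action U E η) (-U (E - (x : ℂ) ^ 2)) x := fun HU x hx =>
    (hasDerivAt_action HU.diffU.continuousOn hrR hE (hIoo x hx)).neg
  refine hb χ χ₁ χ₂ χ₃ h (fun η => -action U₁ E η) (fun η => -action U₂ E η) (fun η => -U₂ (E - (η : ℂ) ^ 2))
    (fun η => (U₂ (E.re - (η : ℂ) ^ 2)).re) hχ hh (fun x hx => (d H₁ x hx).continuousAt.continuousWithinAt)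
    (continuous_re.comp_continuousOn (H₂.diffU.continuousOn.comp (by fun_prop) hm')) (d H₂)
    (fun x hx y hy => ?_) (fun x hx => ?_) (fun x hx => ?_) (fun x hx => ?_)
  · rw [neg_sub_neg, norm_sub_rev]
    refine (H₂.norm_inverse_sub_le (hm x hx) (hm y hy)).trans ?_
    have e1 : E - (x : ℂ) ^ 2 - (E - (y : ℂ) ^ 2) = -(((x + y) * (x - y) : ℝ) : ℂ) := by push_cast; ring
    rw [e1, norm_neg, norm_real, Real.norm_eq_abs, abs_mul]
    have h2 : |x + y| ≤ 2 := (abs_add_le x y).trans (by linarith [habs1 x hx, habs1 y hy])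
    have h3 : 0 ≤ 2 * κ₂ * L * |x - y| := by positivity
    calc 2 * κ₂ * (|x + y| * |x - y|) ≤ 2 * κ₂ * (2 * |x - y|) := by gcongr
      _ ≤ _ := by linarith
  · have e2 : (((U₂ (E.re - (x : ℂ) ^ 2)).re : ℝ) : ℂ) = U₂ (E.re - (x : ℂ) ^ 2) := by
      have h1 := hm' x hx
      rw [show (E.re : ℂ) - (x : ℂ) ^ 2 = ((E.re - x ^ 2 : ℝ) : ℂ) by push_cast; rfl] at h1 ⊢
      rw [mem_ball_zero_iff, norm_real, Real.norm_eq_abs] at h1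
      exact Complex.ext (by simp) (by rw [ofReal_im, H₂.real _ h1])
    simp only [e2]
    rw [neg_add_eq_sub, norm_sub_rev]
    refine (H₂.norm_inverse_sub_le (hm x hx) (hm' x hx)).trans ?_
    rw [sub_sub_sub_cancel_right, norm_sub_ofReal_re]
    have : 0 ≤ 4 * κ₂ * h := by positivity
    calc 2 * κ₂ * |E.im| ≤ 2 * κ₂ * (L * h) := by gcongr
      _ ≤ _ := by linarith
  · rw [neg_im, abs_neg]
    refine (H₁.abs_im_action_le hr1 hrR' hE (abs_le.2 hx)).trans ?_
    have : 0 ≤ 2 * κ₂ * (L * h) := by positivity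
    calc 2 * κ₁ * |E.im| ≤ 2 * κ₁ * (L * h) := by gcongr
      _ ≤ _ := by linarith
  · rw [neg_im, abs_neg]
    refine (H₂.abs_im_action_le hr1 hrR' hE (abs_le.2 hx)).trans ?_
    have : 0 ≤ 2 * κ₁ * (L * h) := by positivity
    calc 2 * κ₂ * |E.im| ≤ 2 * κ₂ * (L * h) := by gcongr
      _ ≤ _ := by linarith

/-- `A_n` is Lipschitz on discs. -/
theorem exists_norm_genAiry_sub_le {n : ℕ} (hn : 1 ≤ n) (Y : ℝ) : ∃ C, 0 ≤ C ∧
    ∀ y z : ℂ, ‖y‖ ≤ Y → ‖z‖ ≤ Y → ‖genAiry n y - genAiry n z‖ ≤ C * ‖y - z‖ := by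
  have hd := differentiable_genAiry n hn
  have hc : Continuous (deriv (genAiry n)) := (hd.contDiff (n := 1)).continuous_deriv le_rfl
  obtain ⟨C, hC⟩ := (isCompact_closedBall (0 : ℂ) Y).exists_bound_of_continuousOn hc.continuousOn
  refine ⟨max C 0, le_max_right _ _, fun y z hy hz => ?_⟩
  exact (convex_closedBall (0 : ℂ) Y).norm_image_sub_le_of_norm_hasDerivWithin_le
    (fun w _ => (hd w).hasDerivAt.hasDerivWithinAt) (fun w hw => (hC w hw).trans (le_max_left _ _))
    (mem_closedBall_zero_iff.2 hz) (mem_closedBall_zero_iff.2 hy)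

theorem exists_small_radius {R R' B w : ℝ} (hR : 0 < R) (hR' : 0 < R') (hB : 0 ≤ B) (hw : w ≠ 0) :
    ∃ r, 0 < r ∧ r ≤ 1 ∧ (9 * r) ^ 2 ≤ R / 4 ∧ 8 * r ^ 2 ≤ R' ∧ 6 * B * r ^ 2 ≤ |w| := by
  have hw' := abs_pos.2 hw
  set r := min 1 (min (R / 324) (min (R' / 8) (|w| / (6 * B + 1)))) with hr
  have hr0 : 0 < r := by positivity
  have hr1 : r ≤ 1 := min_le_left _ _
  have hr2 : r ^ 2 ≤ r := pow_le_of_le_one hr0.le hr1 two_ne_zero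
  have h1 : r ≤ R / 324 := (min_le_right _ _).trans (min_le_left _ _)
  have h2 : r ≤ R' / 8 := (min_le_right _ _).trans ((min_le_right _ _).trans (min_le_left _ _))
  have h3 : r ≤ |w| / (6 * B + 1) := (min_le_right _ _).trans ((min_le_right _ _).trans (min_le_right _ _))
  rw [le_div_iff₀ (by positivity)] at h3
  refine ⟨r, hr0, hr1, by nlinarith, by linarith, ?_⟩
  have : 6 * B * r ^ 2 ≤ 6 * B * r := by gcongr
  linarith

/-- Because 2n + 1 ≥ 3, the Airy remainder h^{2/3} never exceeds the final scale ε² with ε =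
h^{1/(2n+1)}. -/
theorem rpow_one_third_le {p : ℕ} {ε : ℝ} (hε : 0 < ε) (hε1 : ε ≤ 1) : (ε ^ (2 * p + 3)) ^ (1 / 3 : ℝ) ≤ ε := by
  have h1 : ε ^ (2 * p + 3) ≤ ε ^ 3 := pow_le_pow_of_le_one hε.le hε1 (by omega)
  calc _ ≤ (ε ^ 3) ^ (1 / 3 : ℝ) := Real.rpow_le_rpow (by positivity) h1 (by norm_num)
    _ = ε := by rw [← Real.rpow_natCast, ← Real.rpow_mul hε.le]; norm_num

set_option maxHeartbeats 1000000 in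
/-- The asymptotics of the overlap integral, at the scale `ε` with `ε^(2n+1) = h`. -/
theorem exists_norm_keyIntegral_add_genAiry_le {V₁ V₂ : ℝ → ℝ} {R ρ₁ ρ₂ κ₁ κ₂ R' B w s : ℝ}
    {Vc₁ Vc₂ U₁ U₂ Ω : ℂ → ℂ} {p : ℕ} (H₁ : IsChart V₁ R ρ₁ κ₁ Vc₁ U₁) (H₂ : IsChart V₂ R ρ₂ κ₂ Vc₂ U₂)
    (H : IsUnitFactor R' B w Ω) (hR'0 : 0 < R') (hR' : R' ≤ R) (hU₂ : U₂ 0 = 0)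
    (hW : ∀ z ∈ Metric.ball (0 : ℂ) R', U₂ z - U₁ z = z ^ (p + 1) * Ω z)
    (hV₁ : AnalyticAt ℝ V₁ 0) (hV₂ : AnalyticAt ℝ V₂ 0) (hV₁0 : V₁ 0 = 0) (hV₂0 : V₂ 0 = 0)
    (hs : 0 < s) (hsw : s ^ (2 * p + 3) * |w| = 1) :
    ∃ δ > 0, ∀ r₀ : ℝ → ℝ, ContDiff ℝ (⊤ : ℕ∞) r₀ → tsupport r₀ ⊆ Set.Ioo (-δ) δ → ∀ L > 0, ∃ C, 0 ≤ C ∧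
      ∃ ε₀ > 0, ε₀ ≤ 1 ∧ ∀ (ε : ℝ) (E : ℂ), 0 < ε → ε < ε₀ → |E.re| ≤ L * ε ^ 2 → |E.im| ≤ L * ε ^ (2 * p + 3) →
        ‖keyIntegral r₀ (langer Vc₁ U₁) (langer Vc₂ U₂) E (ε ^ (2 * p + 3)) +
          r₀ 0 * (halfPow (deriv U₁ 0) * halfPow (deriv U₂ 0)) *
            (2 * Real.pi * (s * ε : ℝ) * genAiry (p + 1) (-E / ((s * ε : ℝ) : ℂ) ^ 2))‖ ≤ C * ε ^ 2 := by
  obtain ⟨r, hr, hr1, hrR, hrR', hrw⟩ := exists_small_radius H₁.R_pos hR'0 H.nonneg H.ne_zero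
  have hR := H₁.R_pos
  obtain ⟨δ, hδ, hδ₁, hδ₂, e₀, he₀, heR, hkey⟩ :=
    exists_norm_keyIntegral_add_le H₁ H₂ hV₁.continuousAt hV₂.continuousAt hV₁0 hV₂0 hr hr1 hrR
  obtain ⟨δ', hδ', han⟩ := Metric.eventually_nhds_iff.1 (hV₁.eventually_analyticAt.and hV₂.eventually_analyticAt)
  simp only [dist_zero_right, Real.norm_eq_abs] at han
  refine ⟨min δ δ', lt_min hδ hδ', fun r₀ hr₀ hsupp L hL => ?_⟩
  have hsupp' : tsupport r₀ ⊆ Set.Ioo (-δ) δ :=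
    hsupp.trans (Set.Ioo_subset_Ioo (neg_le_neg (min_le_left _ _)) (min_le_left _ _))
  obtain ⟨X, χ, χ₁, χ₂, χ₃, hχ⟩ := exists_isCutoff hr
  set f : ℝ → ℂ := fun x => (r₀ x : ℂ) * (halfPow (deriv U₁ (V₁ x : ℂ)) * halfPow (deriv U₂ (V₂ x : ℂ))) with hf
  obtain ⟨hfs, hfc⟩ := contDiff_weight H₁ H₂ ((min_le_left _ _).trans hδ₁) ((min_le_left _ _).trans hδ₂)
    (fun x hx => (han (hx.trans_le (min_le_right _ _))).1) (fun x hx => (han (hx.trans_le (min_le_right _ _))).2)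
    hr₀ hsupp
  have hf0 : f 0 = r₀ 0 * (halfPow (deriv U₁ 0) * halfPow (deriv U₂ 0)) := by
    simp only [hf]; rw [hV₁0, hV₂0, ofReal_zero]
  -- The cut between core and outer region is a = K ε. K ≥ 1 gives h ≤ a^{2p+3}, and K² ≥ 2L gives
  -- 2|Re E| ≤ a².
  set K : ℝ := 1 + 2 * L with hK
  have hK1 : 1 ≤ K := by rw [hK]; linarith
  have hrR2 : (2 * r) ^ 2 ≤ R / 2 := by nlinarith
  obtain ⟨C₁, hC₁, h₁, hh₁, hh₁1, hLh₁, b₁⟩ := hkey X L r₀ hL.le hr₀.continuous hsupp'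
  obtain ⟨C₂, hC₂, b₂⟩ := exists_norm_overlap_sub_le (X := X) H₁ H₂ hr hr1 hrR2 hL.le hfs hfc
  obtain ⟨C₃, hC₃, b₃⟩ := exists_norm_reduced_integral_sub_le (X := X) (p := p) (k := K ^ (2 * p + 3)) H₁ H₂ H hR' hU₂ hW hr
    hr1 hrR' hrw (by positivity) hL.le hfs hfc
  obtain ⟨C₄, hC₄, b₄⟩ := exists_norm_genAiry_sub_le (n := p + 1) (by omega) (2 * L / s ^ 2)
  have hpi := Real.pi_pos
  refine ⟨C₁ + 1 / (2 * Real.pi) * C₂ + C₃ * K ^ 2 + ‖f 0‖ * (2 * Real.pi * s * (C₄ * (L / s ^ 2))), by positivity,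
    min 1 (min h₁ (min (r / K) (e₀ / L))), by positivity, min_le_left _ _, ?_⟩
  intro ε E hε hεlt hEr hEi
  have hε1 : ε ≤ 1 := hεlt.le.trans (min_le_left _ _)
  have hεh : ε ≤ h₁ := hεlt.le.trans ((min_le_right _ _).trans (min_le_left _ _))
  have hεr : ε ≤ r / K := hεlt.le.trans ((min_le_right _ _).trans ((min_le_right _ _).trans (min_le_left _ _)))
  have hεe : ε ≤ e₀ / L := hεlt.le.trans ((min_le_right _ _).trans ((min_le_right _ _).trans (min_le_right _ _)))
  rw [le_div_iff₀ (by positivity)] at hεr hεe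
  have hε2 : ε ^ 2 ≤ ε := pow_le_of_le_one hε.le hε1 two_ne_zero
  set h : ℝ := ε ^ (2 * p + 3) with hh
  have hh0 : 0 < h := by positivity
  have hhε : h ≤ ε := pow_le_of_le_one hε.le hε1 (by omega)
  have hhε3 : h ≤ ε ^ 3 := pow_le_pow_of_le_one hε.le hε1 (by omega)
  have hhε2 : h ≤ ε ^ 2 := pow_le_pow_of_le_one hε.le hε1 (by omega)
  have hre : |E.re| ≤ e₀ := hEr.trans (by nlinarith)
  have hEn : ‖E‖ < R / 2 := by
    refine (norm_le_abs_re_add_abs_im E).trans_lt ?_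
    have : L * h ≤ L * h₁ := by gcongr; exact hhε.trans hεh
    linarith
  have q₁ := b₁ χ χ₁ χ₂ χ₃ f h E hχ hfs.continuous (fun x => rfl) hh0 (hhε.trans hεh) hre hEi
  have q₂ := b₂ χ χ₁ χ₂ χ₃ h E hχ hh0 hEn hEi
  have q₃ := b₃ χ χ₁ χ₂ χ₃ (K * ε) h (s * ε) E hχ (by positivity) (by linarith) hh0
    (by rw [mul_pow]; exact le_mul_of_one_le_left (by positivity) (one_le_pow₀ hK1))
    (by rw [mul_pow]) (by
      rw [mul_pow]
      have : 2 * L ≤ K ^ 2 := by rw [hK]; nlinarith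
      nlinarith [sq_nonneg ε]) hEi hEn (by positivity)
    (by rw [mul_pow, mul_right_comm, hsw, one_mul])
  set Φ := ∫ x, f x * (∫ η in (-r)..r, χ η * osc h (x * η + -action U₁ E η)) *
            ∫ η in (-r)..r, χ η * osc h (x * η + -action U₂ E η) with hΦ
  set J := ∫ η in (-r)..r, χ η * osc h (-action U₁ E η) *
          (χ (-η) * osc h (-action U₂ E (-η)) * f ((U₂ (E.re - ((-η : ℝ) : ℂ) ^ 2)).re)) with hJ
  set y₀ : ℂ := ((-E.re / (s * ε) ^ 2 : ℝ) : ℂ) with hy₀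
  set y : ℂ := -E / ((s * ε : ℝ) : ℂ) ^ 2 with hy
  have hsε : 0 < (s * ε) ^ 2 := by positivity
  have ny : ‖y‖ ≤ 2 * L / s ^ 2 := by
    rw [hy, norm_div, norm_neg, norm_pow, norm_real, Real.norm_eq_abs, sq_abs, div_le_iff₀ hsε]
    refine (norm_le_abs_re_add_abs_im E).trans ?_
    have : |E.im| ≤ L * ε ^ 2 := hEi.trans (by gcongr)
    calc _ ≤ 2 * L * ε ^ 2 := by linarith
      _ = _ := by field_simp
  have ny₀ : ‖y₀‖ ≤ 2 * L / s ^ 2 := by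
    rw [hy₀, norm_real, Real.norm_eq_abs, abs_div, abs_neg, abs_of_pos hsε, div_le_iff₀ hsε]
    have : 0 ≤ L * ε ^ 2 := by positivity
    calc _ ≤ 2 * L * ε ^ 2 := by linarith
      _ = _ := by field_simp
  -- Dividing Im E = O(ε^{2p+3}) by ε² leaves at least one power of ε, and the prefactor of A_n
  -- supplies another.
  have nyy : ‖y₀ - y‖ ≤ L / s ^ 2 * ε := by
    have e1 : y₀ - y = (E - E.re) / ((s * ε : ℝ) : ℂ) ^ 2 := by rw [hy₀, hy]; push_cast; ring
    rw [e1, norm_div, norm_sub_ofReal_re, norm_pow, norm_real, Real.norm_eq_abs, sq_abs, div_le_iff₀ hsε]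
    calc _ ≤ L * ε ^ 3 := hEi.trans (by gcongr)
      _ = _ := by field_simp
  have q₄ := (b₄ y₀ y ny₀ ny).trans (mul_le_mul_of_nonneg_left nyy hC₄)
  have hh' : (h : ℂ) ≠ 0 := by exact_mod_cast hh0.ne'
  have hpi' : (Real.pi : ℂ) ≠ 0 := by exact_mod_cast hpi.ne'
  rw [← hf0]
  -- The four errors: Airy factors, x-integration, degenerate stationary phase, and Re E in place of
  -- E inside A_n.
  have e2 : keyIntegral r₀ (langer Vc₁ U₁) (langer Vc₂ U₂) E h + f 0 * (2 * Real.pi * (s * ε : ℝ) * genAiry (p + 1) y) =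
      (keyIntegral r₀ (langer Vc₁ U₁) (langer Vc₂ U₂) E h + 1 / (2 * Real.pi * h) * Φ) -
      1 / (2 * Real.pi * h) * (Φ - 2 * Real.pi * h * J) -
      (J - f 0 * (2 * Real.pi * (s * ε : ℝ) * genAiry (p + 1) y₀)) -
      f 0 * (2 * Real.pi * (s * ε : ℝ) * (genAiry (p + 1) y₀ - genAiry (p + 1) y)) := by
    field_simp
    ring
  rw [e2]
  have n1 : ‖keyIntegral r₀ (langer Vc₁ U₁) (langer Vc₂ U₂) E h + 1 / (2 * Real.pi * h) * Φ‖ ≤ C₁ * ε ^ 2 :=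
    q₁.trans (by gcongr; exact rpow_one_third_le hε hε1)
  have n2 : ‖1 / (2 * (Real.pi : ℂ) * h) * (Φ - 2 * Real.pi * h * J)‖ ≤ 1 / (2 * Real.pi) * C₂ * ε ^ 2 := by
    rw [norm_mul, norm_div, norm_one, norm_mul, norm_mul, norm_ofNat, norm_real, norm_real, Real.norm_eq_abs,
      Real.norm_eq_abs, abs_of_pos hpi, abs_of_pos hh0]
    calc _ ≤ 1 / (2 * Real.pi * h) * (C₂ * h ^ 2) := by gcongr
      _ = 1 / (2 * Real.pi) * C₂ * h := by field_simp
      _ ≤ _ := by gcongr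
  have n3 : ‖J - f 0 * (2 * Real.pi * (s * ε : ℝ) * genAiry (p + 1) y₀)‖ ≤ C₃ * K ^ 2 * ε ^ 2 :=
    q₃.trans (le_of_eq (by ring))
  have n4 : ‖f 0 * (2 * Real.pi * (s * ε : ℝ) * (genAiry (p + 1) y₀ - genAiry (p + 1) y))‖ ≤
      ‖f 0‖ * (2 * Real.pi * s * (C₄ * (L / s ^ 2))) * ε ^ 2 := by
    have e3 : ‖2 * (Real.pi : ℂ) * (s * ε : ℝ)‖ = 2 * Real.pi * (s * ε) := by
      rw [norm_mul, norm_mul, norm_ofNat, norm_real, norm_real, Real.norm_eq_abs,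
        Real.norm_eq_abs, abs_of_pos hpi, abs_of_pos (mul_pos hs hε)]
    rw [norm_mul (f 0), norm_mul (2 * (Real.pi : ℂ) * (s * ε : ℝ)), e3]
    calc _ ≤ ‖f 0‖ * (2 * Real.pi * (s * ε) * (C₄ * (L / s ^ 2 * ε))) := by gcongr
      _ = _ := by ring
  refine (norm_sub_le _ _).trans ?_
  rw [add_mul _ (‖f 0‖ * _)]
  refine add_le_add ((norm_sub_le _ _).trans ?_) n4
  rw [add_mul _ (C₃ * K ^ 2)]
  refine add_le_add ((norm_sub_le _ _).trans ?_) n3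
  rw [add_mul]
  exact add_le_add n1 n2

/-! ### The crossing constants and the main theorem -/

/-- Off the origin Ω is a quotient of functions real on the real axis, and at the origin its value
is the real number w. The origin itself is adjoined to the factorisation by U₁(0) = U₂(0). -/
theorem exists_isUnitFactor {R w : ℝ} {U₁ U₂ Ω : ℂ → ℂ} {p : ℕ} (hR : 0 < R) (hΩ : AnalyticAt ℂ Ω 0) (hw : w ≠ 0)
    (hΩ0 : Ω 0 = w) (h₁ : ∀ y : ℝ, |y| < R → (U₁ y).im = 0) (h₂ : ∀ y : ℝ, |y| < R → (U₂ y).im = 0)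
    (hU₁ : U₁ 0 = 0) (hU₂ : U₂ 0 = 0) (hW : ∀ᶠ z in 𝓝[≠] 0, U₂ z - U₁ z = z ^ (p + 1) * Ω z) :
    ∃ R' B, 0 < R' ∧ R' ≤ R ∧ IsUnitFactor R' B w Ω ∧
      ∀ z ∈ Metric.ball (0 : ℂ) R', U₂ z - U₁ z = z ^ (p + 1) * Ω z := by
  obtain ⟨B, hB⟩ := hΩ.differentiableAt.isBigO_sub.bound
  obtain ⟨R₁, hR₁, hb⟩ := Metric.eventually_nhds_iff.1
    ((hΩ.eventually_analyticAt.and hB).and (eventually_nhdsWithin_iff.1 hW))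
  have hmem : ∀ z ∈ Metric.ball (0 : ℂ) (min R₁ R), dist z 0 < R₁ := fun z hz =>
    (Metric.mem_ball.1 hz).trans_le (min_le_left _ _)
  have hid : ∀ z ∈ Metric.ball (0 : ℂ) (min R₁ R), U₂ z - U₁ z = z ^ (p + 1) * Ω z := fun z hz => by
    rcases eq_or_ne z 0 with rfl | h0
    · rw [hU₁, hU₂]; simp
    · exact (hb (hmem z hz)).2 h0
  refine ⟨min R₁ R, max B 0, lt_min hR₁ hR, min_le_right _ _, ⟨?_, ?_, ?_, hw, le_max_right _ _⟩, hid⟩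
  · exact fun z hz => (hb (hmem z hz)).1.1.differentiableAt.differentiableWithinAt
  · intro y hy
    rcases eq_or_ne y 0 with rfl | h0
    · rw [ofReal_zero, hΩ0, ofReal_im]
    · have hy' : (y : ℂ) ∈ Metric.ball (0 : ℂ) (min R₁ R) := by
        rw [mem_ball_zero_iff, norm_real]; exact hy
      have h3 := congrArg Complex.im (hid _ hy')
      have hyR := hy.trans_le (min_le_right _ _)
      rw [sub_im, h₁ y hyR, h₂ y hyR, sub_zero, ← ofReal_pow, im_ofReal_mul] at h3
      exact (mul_eq_zero.1 h3.symm).resolve_left (pow_ne_zero _ h0)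
  · intro z hz
    have h3 := (hb (hmem z hz)).1.2
    rw [hΩ0, sub_zero] at h3
    exact h3.trans (mul_le_mul_of_nonneg_right (le_max_left _ _) (norm_nonneg _))

theorem errorLoss_nonneg (n : ℕ) : 0 ≤ errorLoss n := by
  unfold errorLoss
  split_ifs <;> positivity

/-- For n = 1 the slopes may differ but the exponent matches the definition of v₀. For n ≥ 2 contact
forces equal slopes, so the asymmetric product is a power of v₀. -/
theorem sqrt_crossingSlope_pow {V₁ V₂ : ℝ → ℝ} {n : ℕ} (hn : 1 ≤ n) (hV₁' : 0 < deriv V₁ 0) (hV₂' : 0 < deriv V₂ 0)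
    (hcontact : ∀ k < n, iteratedDeriv k V₁ 0 = iteratedDeriv k V₂ 0) :
    √(crossingSlope V₁ V₂) ^ (2 * n + 2) = deriv V₁ 0 * deriv V₂ 0 ^ n := by
  have h1 : √(crossingSlope V₁ V₂) ^ 2 = crossingSlope V₁ V₂ := Real.sq_sqrt (Real.sqrt_nonneg _)
  have h2 : crossingSlope V₁ V₂ ^ 2 = deriv V₁ 0 * deriv V₂ 0 := Real.sq_sqrt (by positivity)
  rw [show 2 * n + 2 = 2 * (n + 1) by ring, pow_mul, h1]
  rcases hn.eq_or_lt with rfl | hn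
  · rw [h2, pow_one]
  · have h3 := hcontact 1 hn
    rw [iteratedDeriv_one, iteratedDeriv_one] at h3
    have h4 : crossingSlope V₁ V₂ = deriv V₂ 0 := by
      rw [crossingSlope, h3, Real.sqrt_mul_self hV₂'.le]
    rw [h4, h3]
    ring

theorem crossingCoeff_mul_sqrt {V₁ V₂ : ℝ → ℝ} (n : ℕ) (hV₁' : 0 < deriv V₁ 0) (hV₂' : 0 < deriv V₂ 0) :
    crossingCoeff V₁ V₂ n * √(crossingSlope V₁ V₂) =
      (iteratedDeriv n V₁ 0 - iteratedDeriv n V₂ 0) / n.factorial := by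
  have h0 : 0 < deriv V₁ 0 * deriv V₂ 0 := mul_pos hV₁' hV₂'
  have h1 : (deriv V₁ 0 * deriv V₂ 0) ^ (1 / 4 : ℝ) = √(crossingSlope V₁ V₂) := by
    rw [crossingSlope, Real.sqrt_eq_rpow, Real.sqrt_eq_rpow, ← Real.rpow_mul h0.le]
    norm_num
  have h2 : 0 < √(crossingSlope V₁ V₂) := Real.sqrt_pos.2 (Real.sqrt_pos.2 h0)
  rw [crossingCoeff, h1]
  have : (n.factorial : ℝ) ≠ 0 := by positivity
  field_simp

theorem mainTheorem3 (V₁ V₂ : ℝ → ℝ) (n : ℕ) (hn : 1 ≤ n)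
    (hV₁ : AnalyticAt ℝ V₁ 0) (hV₂ : AnalyticAt ℝ V₂ 0)
    (hV₁0 : V₁ 0 = 0) (hV₂0 : V₂ 0 = 0)
    (hV₁' : 0 < deriv V₁ 0) (hV₂' : 0 < deriv V₂ 0)
    (hcontact : ∀ k < n, iteratedDeriv k V₁ 0 = iteratedDeriv k V₂ 0)
    (hcontact_n : iteratedDeriv n V₁ 0 ≠ iteratedDeriv n V₂ 0) :
    ∃ ξ₁ ξ₂ : ℂ × ℂ → ℂ, IsXi V₁ ξ₁ ∧ IsXi V₂ ξ₂ ∧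
      ∃ δ > 0, ∀ r₀ : ℝ → ℝ, ContDiff ℝ (⊤ : ℕ∞) r₀ → tsupport r₀ ⊆ Set.Ioo (-δ) δ →
        ∀ L > 0, ∃ C > 0, ∃ h₀ > 0, ∀ h : ℝ, 0 < h → h < h₀ → ∀ E : ℂ,
          |E.re| ≤ L * h ^ (2 / (2 * n + 1) : ℝ) → |E.im| ≤ L * h →
          ‖keyIntegral r₀ ξ₁ ξ₂ E h -
              (-((2 * Real.pi * r₀ 0 / √(crossingSlope V₁ V₂) *
                  (h / |crossingCoeff V₁ V₂ n|) ^ (1 / (2 * n + 1) : ℝ) : ℝ) : ℂ) *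
                genAiry n (-((((|crossingCoeff V₁ V₂ n| / h) ^ (2 / (2 * n + 1) : ℝ) : ℝ) : ℂ) * E /
                  (crossingSlope V₁ V₂ : ℂ))))‖
            ≤ C * h ^ ((2 - errorLoss n) / (2 * n + 1) : ℝ) := by
  obtain ⟨p, rfl⟩ : ∃ p, n = p + 1 := ⟨n - 1, by omega⟩
  obtain ⟨Vc₁, U₁, hp₁, hU₁, hd₁, hU₁0, hVc₁0, hre₁, hl₁, -, him₁⟩ := exists_inverse hV₁ hV₁0 hV₁'
  obtain ⟨Vc₂, U₂, hp₂, hU₂, hd₂, hU₂0, hVc₂0, hre₂, hl₂, hr₂, him₂⟩ := exists_inverse hV₂ hV₂0 hV₂'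
  obtain ⟨R₁, hR₁, hch₁⟩ := exists_isChart (inv_pos.2 hV₁') hp₁.analyticAt hU₁ hd₁ hVc₁0 hre₁ hl₁ him₁
  obtain ⟨R₂, hR₂, hch₂⟩ := exists_isChart (inv_pos.2 hV₂') hp₂.analyticAt hU₂ hd₂ hVc₂0 hre₂ hl₂ him₂
  have hR : 0 < min R₁ R₂ := lt_min hR₁ hR₂
  obtain ⟨ρ₁, H₁⟩ := hch₁ (min R₁ R₂) hR (min_le_left _ _)
  obtain ⟨ρ₂, H₂⟩ := hch₂ (min R₁ R₂) hR (min_le_right _ _)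
  obtain ⟨Ω, hΩ, hΩ0, hW⟩ := exists_contact_factor hcontact hp₁ hp₂ hU₁ hU₂ hd₁ hd₂ hU₂0 hVc₁0 hl₁ hr₂
  set v := crossingSlope V₁ V₂ with hv
  set q := crossingCoeff V₁ V₂ (p + 1) with hq
  set σ := √v with hσ
  have hd12 : 0 < deriv V₁ 0 * deriv V₂ 0 := mul_pos hV₁' hV₂'
  have hv0 : 0 < v := Real.sqrt_pos.2 hd12
  have hσ0 : 0 < σ := Real.sqrt_pos.2 hv0
  have hσ2 : σ ^ 2 = v := Real.sq_sqrt hv0.le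
  have hσp := sqrt_crossingSlope_pow hn hV₁' hV₂' hcontact
  have hqσ := crossingCoeff_mul_sqrt (p + 1) hV₁' hV₂'
  rw [← hv, ← hσ] at hσp hqσ
  rw [← hq] at hqσ
  have hq0 : q ≠ 0 := fun h0 => by
    rw [h0, zero_mul, eq_comm, div_eq_zero_iff] at hqσ
    rcases hqσ with h1 | h1
    · exact hcontact_n (sub_eq_zero.1 h1)
    · exact (Nat.cast_ne_zero.2 (Nat.factorial_ne_zero _)) h1
  have hq' : 0 < |q| := abs_pos.2 hq0
  -- The value of Ω at the origin is q σ / (V₁'(0) V₂'(0)ⁿ) = q σ / σ^{2n+2}, with n = p + 1 and σ²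
  -- = v₀.
  set w : ℝ := q / σ ^ (2 * p + 3) with hw
  have hw0 : w ≠ 0 := div_ne_zero hq0 (pow_pos hσ0 _).ne'
  have hΩw : Ω 0 = w := by
    rw [hΩ0, ← hqσ, ← ofReal_pow, ← ofReal_mul, ← ofReal_mul]
    congr 1
    rw [inv_pow, ← mul_inv, ← hσp, hw]
    field_simp
    ring
  obtain ⟨R', B, hR'0, hR', H, hW'⟩ := exists_isUnitFactor hR hΩ hw0 hΩw H₁.real H₂.real hU₁0 hU₂0 hW
  set N : ℝ := 2 * ((p + 1 : ℕ) : ℝ) + 1 with hN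
  have hN0 : 0 < N := by positivity
  have hNp : ((2 * p + 3 : ℕ) : ℝ) = N := by rw [hN]; push_cast; ring
  have hroot : ∀ x : ℝ, 0 < x → (x ^ (1 / N)) ^ (2 * p + 3) = x := fun x hx => by
    rw [← Real.rpow_natCast, ← Real.rpow_mul hx.le, hNp, one_div, inv_mul_cancel₀ hN0.ne', Real.rpow_one]
  have hroot2 : ∀ x : ℝ, 0 < x → x ^ (2 / N) = (x ^ (1 / N)) ^ 2 := fun x hx => by
    rw [← Real.rpow_natCast, ← Real.rpow_mul hx.le]
    congr 1
    push_cast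
    ring
  -- The length l = s ε with s = σ |q|^{-1/N} solves l^N |w| = h. Its square produces the argument
  -- of A_n, and with the weight r₀(0)/σ² it produces the prefactor.
  have hs0 : 0 < σ / |q| ^ (1 / N) := div_pos hσ0 (Real.rpow_pos_of_pos hq' _)
  have hsw : (σ / |q| ^ (1 / N)) ^ (2 * p + 3) * |w| = 1 := by
    rw [div_pow, hroot _ hq', hw, abs_div, abs_of_pos (pow_pos hσ0 _)]
    field_simp
  obtain ⟨δ, hδ, hmain⟩ := exists_norm_keyIntegral_add_genAiry_le H₁ H₂ H hR'0 hR' hU₂0 hW' hV₁ hV₂ hV₁0 hV₂0 hs0 hsw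
  refine ⟨langer Vc₁ U₁, langer Vc₂ U₂, isXi_langer H₁ hV₁ hV₁0 hV₁' hp₁.analyticAt hU₁,
    isXi_langer H₂ hV₂ hV₂0 hV₂' hp₂.analyticAt hU₂, δ, hδ, fun r₀ hr₀ hsupp L hL => ?_⟩
  obtain ⟨C, hC, ε₀, hε₀, hε₀1, hb⟩ := hmain r₀ hr₀ hsupp L hL
  refine ⟨C + 1, by positivity, ε₀ ^ (2 * p + 3), by positivity, fun h hh hhlt E hEr hEi => ?_⟩
  set ε := h ^ (1 / N) with hε
  have hεp : 0 < ε := Real.rpow_pos_of_pos hh _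
  have hεh : ε ^ (2 * p + 3) = h := hroot h hh
  have hεlt : ε < ε₀ := by
    refine lt_of_pow_lt_pow_left₀ (2 * p + 3) hε₀.le ?_
    rwa [hεh]
  have hh1 : h ≤ 1 := hhlt.le.trans (pow_le_one₀ hε₀.le hε₀1)
  rw [hroot2 h hh] at hEr
  have hfin := hb ε E hεp hεlt hEr (by rwa [hεh])
  rw [hεh] at hfin
  have hm : (h / |q|) ^ (1 / N) = ε / |q| ^ (1 / N) := Real.div_rpow hh.le hq'.le _
  have hm2 : (|q| / h) ^ (2 / N) = (|q| ^ (1 / N) / ε) ^ 2 := by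
    rw [hroot2 _ (div_pos hq' hh), Real.div_rpow hq'.le hh.le]
  set g := |q| ^ (1 / N) with hg
  have hg0 : 0 < g := Real.rpow_pos_of_pos hq' _
  have hhalf : halfPow (deriv U₁ 0) * halfPow (deriv U₂ 0) = ((σ ^ 2)⁻¹ : ℝ) := by
    rw [hd₁.hasDerivAt.deriv, hd₂.hasDerivAt.deriv, halfPow_ofReal (inv_pos.2 hV₁'), halfPow_ofReal (inv_pos.2 hV₂'),
      ← ofReal_mul, ← Real.sqrt_mul (inv_pos.2 hV₁').le, ← mul_inv, Real.sqrt_inv, hσ2]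
    rfl
  have hσ' : (σ : ℂ) ≠ 0 := by exact_mod_cast hσ0.ne'
  have hg' : (g : ℂ) ≠ 0 := by exact_mod_cast hg0.ne'
  have hε' : (ε : ℂ) ≠ 0 := by exact_mod_cast hεp.ne'
  have harg : -((((|q| / h) ^ (2 / N) : ℝ) : ℂ) * E / (v : ℂ)) = -E / ((σ / g * ε : ℝ) : ℂ) ^ 2 := by
    rw [hm2, ← hσ2]
    push_cast
    field_simp
  rw [harg, hm]
  -- The proof gives ε² = h^{2/N} without loss; as h ≤ 1, lowering the exponent only weakens the
  -- bound.
  have hle : ε ^ 2 ≤ h ^ ((2 - errorLoss (p + 1)) / N) := by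
    rw [← hroot2 h hh]
    refine Real.rpow_le_rpow_of_exponent_ge hh hh1 ?_
    have := errorLoss_nonneg (p + 1)
    gcongr
    linarith
  rw [hhalf] at hfin
  calc _ ≤ C * ε ^ 2 := by
        refine le_trans (le_of_eq (congrArg norm ?_)) hfin
        push_cast
        field_simp
        ring
    _ ≤ (C + 1) * h ^ ((2 - errorLoss (p + 1)) / N) := by
        gcongr
        linarith

end
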